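/- Let $G$ be a connected complex Lie group and $H\subset G$ a connected complex Lie subgroup, with Lie algebras $\mathfrak h\subset\mathfrak g$. Let $X$ be a compact connected Kähler manifold of complex dimension $d\ge 1$ with Kähler form $\omega$. For a holomorphic vector bundle $V$ on $X$ put $\mathrm{degree}(V)=\int_X c_1(V)\wedge\omega^{d-1}\in\mathbb R$, where $c_1(V)$ is the real first Chern class, and for a divisor $D$ put $\mathrm{degree}(D)=\mathrm{degree}(\mathcal O_X(D))$. Fix an effective divisor $D$ on $X$ and a holomorphic principal $H$-bundle $E_H$ on $X$. Let $E_G=E_H\times^H G$ be the associated principal $G$-bundle, let $\mathrm{ad}(E_H)$, $\mathrm{ad}(E_G)$ be the adjoint bundles with inclusion $\iota_1:\mathrm{ad}(E_H)\to\mathrm{ad}(E_G)$, and let $\mathrm{At}(E_H)=(TE_H)/H$ be the Atiyah bundle, with inclusion $\iota_2:\mathrm{ad}(E_H)\to\mathrm{At}(E_H)$ and $\mathrm{At}(E_H)/\iota_2(\mathrm{ad}(E_H))=TX$. A branched holomorphic Cartan geometry of type $G/H$ on $X$ with principal bundle $E_H$ is a holomorphic homomorphism of vector bundles $\theta:\mathrm{At}(E_H)\to\mathrm{ad}(E_G)$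 which is an isomorphism over some nonempty open subset of $X$ and satisfies $\theta\circ\iota_2=\iota_1$. It induces a homomorphism $\phi:TX\to\mathrm{ad}(E_G)/\mathrm{ad}(E_H)$, and its branching divisor is the divisor of the holomorphic section $\bigwedge^d\phi$ of the line bundle $\bigl(\bigwedge^d(\mathrm{ad}(E_G)/\mathrm{ad}(E_H))\bigr)\otimes\Omega^d_X$. (1) If $\mathrm{degree}(\Omega^1_X)-\mathrm{degree}(D)\ne\mathrm{degree}(\mathrm{ad}(E_H))$, then there is no branched holomorphic Cartan geometry of type $G/H$ on $X$ with principal bundle $E_H$ and branching divisor $D$. (2) In particular, if $D\ne 0$ and $\mathrm{degree}(\Omega^1_X)\le\mathrm{degree}(\mathrm{ad}(E_H))$, then there is no branched holomorphic Cartan geometry of type $G/H$ on $X$ with principal bundle $E_H$ and branching divisor $D$. -/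

import Mathlib

open scoped Manifold ContDiff Bundle Topology

noncomputable section

namespace BranchedCartan

/-! ### Integration, Kähler forms and the degree of a holomorphic vector bundle -/

section Degree

variable {E : Type*} [NormedAddCommGroup E] [NormedSpace ℂ E]

variable (E) in
/-- Multiplication by `i`, as a real linear endomorphism. -/
def mulI : E →L[ℝ] E := (Complex.I • ContinuousLinearMap.id ℂ E).restrictScalars ℝ

/-- The real `(1,1)`-form `i ∂∂̄ u = - (1/2) d (du ∘ J)` of a real function `u` on a complex vector
space, where `J` is multiplication by `i`. -/
def iddbar (u : E → ℝ) (y : E) : E [⋀^Fin 2]→L[ℝ] ℝ :=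
  (-(1 / 2 : ℝ)) • extDeriv
    (fun z => ContinuousAlternatingMap.ofSubsingleton ℝ E ℝ (0 : Fin 1)
      ((fderiv ℝ u z).comp (mulI E))) y

variable {X : Type*} [TopologicalSpace X] [ChartedSpace E X]

/-- The real derivative of the inverse of a holomorphic chart. -/
def chartSymmDeriv (e : OpenPartialHomeomorph X E) (y : E) :
    E →L[ℝ] TangentSpace 𝓘(ℂ, E) (e.symm y) :=
  (mfderiv 𝓘(ℂ, E) 𝓘(ℂ, E) e.symm y).restrictScalars ℝ

/-- A real `2`-form on `X` written in a chart, i.e. its pullback under the inverse of the chart. -/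
def twoFormInChart (η : ∀ x : X, (TangentSpace 𝓘(ℂ, E) x) [⋀^Fin 2]→L[ℝ] ℝ)
    (e : OpenPartialHomeomorph X E) (y : E) : E [⋀^Fin 2]→L[ℝ] ℝ :=
  (η (e.symm y)).compContinuousLinearMap (chartSymmDeriv e y)

variable (E X) in
/-- A Kähler form on the complex manifold `X`: a smooth closed real `2`-form of type `(1,1)`
which is positive. -/
structure KaehlerForm where
  form : ∀ x : X, (TangentSpace 𝓘(ℂ, E) x) [⋀^Fin 2]→L[ℝ] ℝ
  smooth : ∀ e ∈ atlas E X, ContDiffOn ℝ ∞ (twoFormInChart form e) e.target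
  closed : ∀ e ∈ atlas E X, ∀ y ∈ e.target, extDeriv (twoFormInChart form e) y = 0
  type_one_one : ∀ (x : X) (v w : TangentSpace 𝓘(ℂ, E) x),
    form x ![Complex.I • v, Complex.I • w] = form x ![v, w]
  positive : ∀ (x : X) (v : TangentSpace 𝓘(ℂ, E) x), v ≠ 0 → 0 < form x ![v, Complex.I • v]

theorem twoForm_prod_update {T : Type*} [AddCommGroup T] [Module ℝ T] [TopologicalSpace T] {d : ℕ}
    (α : Fin d → T [⋀^Fin 2]→L[ℝ] ℝ) (v : Fin d × Fin 2 → T) (i : Fin d × Fin 2) (z : T) :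
    ∏ k, α k (fun j => Function.update v i z (k, j)) =
      α i.1 (Function.update (fun j => v (i.1, j)) i.2 z) *
        ∏ k ∈ Finset.univ.erase i.1, α k (fun j => v (k, j)) := by
  rw [← Finset.mul_prod_erase _ _ (Finset.mem_univ i.1)]
  congr 1
  · congr 1
    ext j
    by_cases hj : j = i.2
    · subst hj; simp
    · have : (i.1, j) ≠ i := fun h => hj (by rw [← h])
      simp [hj, this]
  · refine Finset.prod_congr rfl fun k hk => ?_
    have hk' : k ≠ i.1 := Finset.ne_of_mem_erase hk
    have : ∀ j, (k, j) ≠ i := fun j h => hk' (by rw [← h])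
    simp [this]

/-- The wedge product `α₁ ∧ ⋯ ∧ α_d` of `d` real `2`-forms. Its `2d` arguments are indexed by
`Fin d × Fin 2`, in lexicographic order `(0,0), (0,1), (1,0), (1,1), …`; so
`(α₁ ∧ ⋯ ∧ α_d) (v) = 2⁻ᵈ ∑_σ sign σ ∏ₖ αₖ (v_{σ (k,0)}, v_{σ (k,1)})`. -/
def wedgeTwoForms {T : Type*} [AddCommGroup T] [Module ℝ T] [TopologicalSpace T] {d : ℕ}
    (α : Fin d → T [⋀^Fin 2]→L[ℝ] ℝ) : T [⋀^(Fin d × Fin 2)]→ₗ[ℝ] ℝ :=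
  ((1 / 2 : ℝ) ^ d) • MultilinearMap.alternatization
    (MultilinearMap.mk' (fun v : Fin d × Fin 2 → T => ∏ k, α k (fun j => v (k, j)))
      (fun v i x y => by simp only [twoForm_prod_update, ContinuousAlternatingMap.map_update_add,
        add_mul])
      (fun v i c x => by simp only [twoForm_prod_update, ContinuousAlternatingMap.map_update_smul,
        smul_eq_mul, mul_assoc]))

section Real

variable (E X)

/-- A complex manifold is a real analytic manifold. -/
theorem isManifold_real [IsManifold 𝓘(ℂ, E) ω X] : IsManifold 𝓘(ℝ, E) ω X := by
  refine isManifold_of_contDiffOn 𝓘(ℝ, E) ω X fun e e' he he' => ?_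
  have h := (contDiffGroupoid ω 𝓘(ℂ, E)).compatible he he'
  rw [contDiffGroupoid, mem_groupoid_of_pregroupoid] at h
  have h1 : ContDiffOn ℂ ω (𝓘(ℂ, E) ∘ (e.symm ≫ₕ e') ∘ 𝓘(ℂ, E).symm)
    (𝓘(ℂ, E).symm ⁻¹' (e.symm ≫ₕ e').source ∩ Set.range 𝓘(ℂ, E)) := h.1
  exact h1.restrict_scalars ℝ

variable {E X} in
/-- Holomorphic functions are real smooth. -/
theorem contMDiffAt_real {F : Type*} [NormedAddCommGroup F] [NormedSpace ℂ F] {f : X → F} {x : X}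
    (h : ContMDiffAt 𝓘(ℂ, E) 𝓘(ℂ, F) ω f x) : ContMDiffAt 𝓘(ℝ, E) 𝓘(ℝ, F) ∞ f x := by
  rw [contMDiffAt_iff] at h ⊢
  exact ⟨h.1, (h.2.restrict_scalars ℝ).of_le le_top⟩

theorem exists_chart_partition [IsManifold 𝓘(ℂ, E) ω X] [FiniteDimensional ℂ E] [CompactSpace X]
    [T2Space X] :
    ∃ ρ : SmoothPartitionOfUnity X 𝓘(ℝ, E) X Set.univ,
      ρ.IsSubordinate fun x => (chartAt E x).source := by
  have : IsManifold 𝓘(ℝ, E) ω X := isManifold_real E X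
  have : IsManifold 𝓘(ℝ, E) ∞ X := inferInstance
  exact SmoothPartitionOfUnity.exists_isSubordinate_chartAt_source 𝓘(ℝ, E) X

end Real

variable [FiniteDimensional ℂ E]

variable (E) in
/-- Real linear coordinates `(x₁, y₁, …, x_d, y_d)` on `E`: the point `∑ₖ (xₖ + i yₖ) bₖ`, where
`b` is a complex basis of `E`. -/
def realCoord (t : Fin (Module.finrank ℂ E) × Fin 2 → ℝ) : E :=
  ∑ k, ((t (k, 0) : ℂ) + (t (k, 1) : ℂ) * Complex.I) • Module.finBasis ℂ E k

variable (E) in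
/-- The coordinate vectors `∂/∂x₁, ∂/∂y₁, …, ∂/∂x_d, ∂/∂y_d` in these coordinates. -/
def realFrame (i : Fin (Module.finrank ℂ E) × Fin 2) : E :=
  if i.2 = 0 then Module.finBasis ℂ E i.1 else Complex.I • Module.finBasis ℂ E i.1

/-- The integral `∫_X η` of a form of top degree over the compact complex manifold `X`, with its
complex orientation, computed with a smooth partition of unity subordinate to coordinate charts. -/
def integral [IsManifold 𝓘(ℂ, E) ω X] [CompactSpace X] [T2Space X]
    (η : ∀ x : X, (TangentSpace 𝓘(ℂ, E) x) [⋀^(Fin (Module.finrank ℂ E) × Fin 2)]→ₗ[ℝ] ℝ) : ℝ :=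
  let ρ := (exists_chart_partition E X).choose
  ∑ᶠ c : X, ∫ t in realCoord E ⁻¹' (chartAt E c).target,
    ρ c ((chartAt E c).symm (realCoord E t)) *
      η ((chartAt E c).symm (realCoord E t))
        (fun i => chartSymmDeriv (chartAt E c) (realCoord E t) (realFrame E i))

section Bundle

variable {F : Type*} [NormedAddCommGroup F] [NormedSpace ℂ F]
  {V : X → Type*} [TopologicalSpace (Bundle.TotalSpace F V)] [∀ x, AddCommGroup (V x)]
  [∀ x, Module ℂ (V x)] [∀ x, TopologicalSpace (V x)] [FiberBundle F V] [VectorBundle ℂ F V]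

variable (E F V) in
/-- A smooth Hermitian metric on a holomorphic vector bundle `V` on `X`
(conjugate linear in the first variable). -/
structure HermitianMetric where
  inner : ∀ x : X, V x →ₗ⋆[ℂ] V x →ₗ[ℂ] ℂ
  symm : ∀ (x : X) (v w : V x), inner x w v = starRingEnd ℂ (inner x v w)
  pos : ∀ (x : X) (v : V x), v ≠ 0 → 0 < (inner x v v).re
  smooth : ∀ (e : Bundle.Trivialization F (Bundle.TotalSpace.proj : Bundle.TotalSpace F V → X))
    [MemTrivializationAtlas e] (v w : F),
    ContMDiffOn 𝓘(ℝ, E) 𝓘(ℝ, ℂ) ∞ (fun x => inner x (e.symm x v) (e.symm x w)) e.baseSet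

variable [FiniteDimensional ℂ F]

/-- The function `log det (h (eᵢ, eⱼ))`, where `(eᵢ)` is the local holomorphic frame of `V` around
`x₀` given by the preferred trivialization at `x₀` and a basis of the model fibre. -/
def HermitianMetric.logDet (h : HermitianMetric E F V) (x₀ x : X) : ℝ :=
  let e := trivializationAt F V x₀
  Real.log (Matrix.det (Matrix.of fun i j =>
    h.inner x (e.symm x (Module.finBasis ℂ F i)) (e.symm x (Module.finBasis ℂ F j)))).re

/-- The first Chern form `c₁(V, h) = (i/2π) tr Θ_h = -(1/2π) i ∂∂̄ log det h` of the Chern connection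
of a Hermitian metric `h` on `V`, which represents `c₁(V)` in real cohomology. It is computed at
`x` in the preferred chart at `x`, through which the tangent space at `x` is identified with `E`. -/
def HermitianMetric.chernForm (h : HermitianMetric E F V) (x : X) :
    (TangentSpace 𝓘(ℂ, E) x) [⋀^Fin 2]→L[ℝ] ℝ :=
  (-(1 / (2 * Real.pi))) • iddbar (h.logDet x ∘ (chartAt E x).symm) (chartAt E x x)


theorem exists_standard_hermitian_form (F : Type*) [NormedAddCommGroup F] [NormedSpace ℂ F]
    [FiniteDimensional ℂ F] : ∃ B : F →ₗ⋆[ℂ] F →ₗ[ℂ] ℂ,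
      (∀ v w, B w v = starRingEnd ℂ (B v w)) ∧ (∀ v, v ≠ 0 → 0 < (B v v).re) ∧
      ContDiff ℝ ∞ (fun p : F × F => B p.1 p.2) := by
  let b := Module.finBasis ℂ F
  let B : F →ₗ⋆[ℂ] F →ₗ[ℂ] ℂ := LinearMap.mk₂'ₛₗ (starRingEnd ℂ) (RingHom.id ℂ)
    (fun v w => ∑ i, starRingEnd ℂ (b.repr v i) * b.repr w i)
    (by intros; simp [add_mul, Finset.sum_add_distrib])
    (by intros; simp [mul_assoc, Finset.mul_sum])
    (by intros; simp [mul_add, Finset.sum_add_distrib])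
    (by intros; simp only [map_smul, Finsupp.smul_apply, smul_eq_mul, Finset.mul_sum,
          RingHom.id_apply]; exact Finset.sum_congr rfl fun i _ => by ring)
  refine ⟨B, ?_, ?_, ?_⟩
  · intro v w
    simp [B, LinearMap.mk₂'ₛₗ_apply, mul_comm]
  · intro v hv
    have : (B v v).re = ∑ i, Complex.normSq (b.repr v i) := by
      simp only [B, LinearMap.mk₂'ₛₗ_apply, Complex.re_sum]
      refine Finset.sum_congr rfl fun i _ => ?_
      rw [← Complex.normSq_eq_conj_mul_self, Complex.ofReal_re]
    rw [this]
    have hne : ∃ i, b.repr v i ≠ 0 := by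
      by_contra! h
      exact hv (b.repr.map_eq_zero_iff.1 (Finsupp.ext h))
    obtain ⟨i, hi⟩ := hne
    exact Finset.sum_pos' (fun i _ => Complex.normSq_nonneg _)
      ⟨i, Finset.mem_univ _, Complex.normSq_pos.2 hi⟩
  · have hr : ∀ i, ContDiff ℝ ∞ (fun v : F => b.repr v i) := fun i =>
      ((LinearMap.toContinuousLinearMap (b.coord i)).restrictScalars ℝ).contDiff
    have : (fun p : F × F => B p.1 p.2) =
        fun p => ∑ i, Complex.conjCLE (b.repr p.1 i) * b.repr p.2 i := rfl
    rw [this]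
    refine ContDiff.sum fun i _ => ContDiff.mul ?_ ((hr i).comp contDiff_snd)
    exact Complex.conjCLE.contDiff.comp ((hr i).comp contDiff_fst)

variable (E F V) in
theorem HermitianMetric.nonempty [IsManifold 𝓘(ℂ, E) ω X] [CompactSpace X] [T2Space X]
    [ContMDiffVectorBundle ω F V 𝓘(ℂ, E)] : Nonempty (HermitianMetric E F V) := by
  have : IsManifold 𝓘(ℝ, E) ω X := isManifold_real E X
  have : IsManifold 𝓘(ℝ, E) ∞ X := inferInstance
  obtain ⟨ρ, hρ⟩ := SmoothPartitionOfUnity.exists_isSubordinate 𝓘(ℝ, E) (isClosed_univ (X := X))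
    (fun c : X => (trivializationAt F V c).baseSet) (fun c => (trivializationAt F V c).open_baseSet)
    (fun x _ => Set.mem_iUnion.2 ⟨x, FiberBundle.mem_baseSet_trivializationAt F V x⟩)
  obtain ⟨B, hBs, hBp, hBd⟩ := exists_standard_hermitian_form F
  let T : ∀ c x : X, V x →ₗ[ℂ] F := fun c x => (trivializationAt F V c).linearMapAt ℂ x
  refine ⟨⟨fun x => LinearMap.mk₂'ₛₗ (starRingEnd ℂ) (RingHom.id ℂ)
    (fun v w => ∑ c ∈ ρ.finsupport x, ρ c x • B (T c x v) (T c x w)) ?_ ?_ ?_ ?_, ?_, ?_, ?_⟩⟩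
  · intros; simp [Finset.sum_add_distrib]
  · intro c v w
    simp only [LinearMap.map_smulₛₗ, LinearMap.smul_apply, Finset.smul_sum]
    exact Finset.sum_congr rfl fun i _ => smul_comm _ _ _
  · intros; simp [Finset.sum_add_distrib]
  · intro c v w
    simp only [map_smul, Finset.smul_sum]
    exact Finset.sum_congr rfl fun i _ => smul_comm _ _ _
  · intro x v w
    simp only [LinearMap.mk₂'ₛₗ_apply, map_sum]
    refine Finset.sum_congr rfl fun i _ => ?_
    rw [hBs (T i x v) (T i x w), Complex.real_smul, Complex.real_smul, map_mul, Complex.conj_ofReal]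
  · intro x v hv
    simp only [LinearMap.mk₂'ₛₗ_apply, Complex.re_sum]
    have hsum := ρ.sum_finsupport x (Set.mem_univ x)
    have hne : ∃ c ∈ ρ.finsupport x, ρ c x ≠ 0 := by
      by_contra! h
      rw [Finset.sum_eq_zero h] at hsum
      exact zero_ne_one hsum
    have hT : ∀ c ∈ ρ.finsupport x, T c x v ≠ 0 := by
      intro c hc h0
      have hc' : x ∈ (trivializationAt F V c).baseSet :=
        hρ c (subset_tsupport _ ((ρ.mem_finsupport x).1 hc))
      apply hv
      have := (trivializationAt F V c).symmₗ_linearMapAt (R := ℂ) hc' v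
      rw [show (trivializationAt F V c).linearMapAt ℂ x v = 0 from h0] at this
      rw [← this]
      exact ((trivializationAt F V c).symmₗ ℂ x).map_zero
    obtain ⟨c, hc, hc0⟩ := hne
    refine Finset.sum_pos' (fun i hi => ?_) ⟨c, hc, ?_⟩
    · rw [Complex.real_smul, Complex.re_ofReal_mul]
      exact mul_nonneg (ρ.nonneg i x) (hBp _ (hT i hi)).le
    · rw [Complex.real_smul, Complex.re_ofReal_mul]
      exact mul_pos (lt_of_le_of_ne (ρ.nonneg c x) hc0.symm) (hBp _ (hT c hc))
  · intro e he v w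
    have key : ∀ x₀ ∈ e.baseSet, ContMDiffAt 𝓘(ℝ, E) 𝓘(ℝ, ℂ) ∞
        (fun x => ∑ᶠ c, ρ c x • B (T c x (e.symm x v)) (T c x (e.symm x w))) x₀ := by
      intro x₀ hx₀
      refine ρ.contMDiffAt_finsum fun c hc => ?_
      have hc' : x₀ ∈ (trivializationAt F V c).baseSet := hρ c hc
      have hcc : ∀ u : F, ContMDiffAt 𝓘(ℝ, E) 𝓘(ℝ, F) ∞
          (fun x => (e.coordChangeL ℂ (trivializationAt F V c) x : F →L[ℂ] F) u) x₀ := by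
        intro u
        have h1 : ContMDiffAt 𝓘(ℂ, E) 𝓘(ℂ, F →L[ℂ] F) ω
            (fun x => (e.coordChangeL ℂ (trivializationAt F V c) x : F →L[ℂ] F)) x₀ :=
          (ContMDiffVectorBundle.contMDiffOn_coordChangeL (IB := 𝓘(ℂ, E)) (n := ω) e
            (trivializationAt F V c)).contMDiffAt
            ((e.open_baseSet.inter (trivializationAt F V c).open_baseSet).mem_nhds ⟨hx₀, hc'⟩)
        exact contMDiffAt_real (h1.clm_apply contMDiffAt_const)
      have hB : ∀ f g : X → F, ContMDiffAt 𝓘(ℝ, E) 𝓘(ℝ, F) ∞ f x₀ →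
          ContMDiffAt 𝓘(ℝ, E) 𝓘(ℝ, F) ∞ g x₀ →
          ContMDiffAt 𝓘(ℝ, E) 𝓘(ℝ, ℂ) ∞ (fun x => B (f x) (g x)) x₀ := by
        intro f g hf hg
        exact hBd.contMDiff.contMDiffAt.comp x₀ (hf.prodMk_space hg)
      refine (hB _ _ (hcc v) (hcc w)).congr_of_eventuallyEq ?_
      filter_upwards [(e.open_baseSet.inter (trivializationAt F V c).open_baseSet).mem_nhds
        ⟨hx₀, hc'⟩] with x hx
      have : ∀ u, T c x (e.symm x u) = (e.coordChangeL ℂ (trivializationAt F V c) x : F →L[ℂ] F) u := by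
        intro u
        rw [ContinuousLinearEquiv.coe_coe, e.coordChangeL_apply _ hx]
        simp only [T, (trivializationAt F V c).coe_linearMapAt_of_mem hx.2]
      rw [this, this]
    intro x₀ hx₀
    refine ((key x₀ hx₀).congr_of_eventuallyEq (Filter.Eventually.of_forall fun x => ?_)).contMDiffWithinAt
    simp only [LinearMap.mk₂'ₛₗ_apply]
    exact ρ.sum_finsupport_smul_eq_finsum (x₀ := x)
      (fun c x => B (T c x (e.symm x v)) (T c x (e.symm x w)))

/-- The degree `∫_X c₁(V) ∧ κ^{d-1}`, `d = dim X ≥ 1`, of a holomorphic vector bundle `V` on a compact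
complex manifold `X` with Kähler form `κ`, where `c₁(V)` is represented by the first Chern form of a
Hermitian metric on `V`. -/
def degree (κ : KaehlerForm E X) (F : Type*) [NormedAddCommGroup F] [NormedSpace ℂ F]
    [FiniteDimensional ℂ F]
    (V : X → Type*) [TopologicalSpace (Bundle.TotalSpace F V)] [∀ x, AddCommGroup (V x)]
    [∀ x, Module ℂ (V x)] [∀ x, TopologicalSpace (V x)] [FiberBundle F V] [VectorBundle ℂ F V]
    [IsManifold 𝓘(ℂ, E) ω X] [CompactSpace X] [T2Space X]
    [ContMDiffVectorBundle ω F V 𝓘(ℂ, E)] : ℝ :=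
  let h := Classical.choice (HermitianMetric.nonempty E F V)
  integral fun x => wedgeTwoForms fun k : Fin (Module.finrank ℂ E) =>
    if (k : ℕ) = 0 then h.chernForm x else κ.form x

end Bundle
end Degree

/-! ### Effective divisors and their line bundles -/

section Divisor

variable (E : Type*) [NormedAddCommGroup E] [NormedSpace ℂ E]
  {X : Type*} [TopologicalSpace X] [ChartedSpace E X]

/-- `f` is a holomorphic function on the open set `U`. -/
def HolOn (U : Set X) (f : X → ℂ) : Prop := ContMDiffOn 𝓘(ℂ, E) 𝓘(ℂ, ℂ) ω f U

/-- `u` is a nowhere vanishing holomorphic function on the open set `U`. -/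
def UnitOn (U : Set X) (u : X → ℂ) : Prop := HolOn E U u ∧ ∀ x ∈ U, u x ≠ 0

variable (X) in
/-- An effective divisor on the complex manifold `X`, given by its local equations: `D.localEq U f`
says that `f` is a local equation of `D` on the open set `U`. Local equations are holomorphic, vanish
identically on no nonempty open set, exist around each point, agree up to nowhere vanishing
holomorphic factors on overlaps, and the collection of all of them is maximal; equal divisors thus
have the same local equations. -/
@[ext]
structure EffectiveDivisor where
  localEq : Set X → (X → ℂ) → Prop
  isOpen : ∀ U f, localEq U f → IsOpen U
  hol : ∀ U f, localEq U f → HolOn E U f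
  nonzero : ∀ U f, localEq U f → ∀ W ⊆ U, IsOpen W → W.Nonempty → ∃ x ∈ W, f x ≠ 0
  cover : ∀ x : X, ∃ U f, x ∈ U ∧ localEq U f
  compatible : ∀ U f V g, localEq U f → localEq V g →
    ∃ u, UnitOn E (U ∩ V) u ∧ ∀ x ∈ U ∩ V, g x = u x * f x
  maximal : ∀ V g, IsOpen V → HolOn E V g →
    (∀ U f, localEq U f → ∃ u, UnitOn E (U ∩ V) u ∧ ∀ x ∈ U ∩ V, g x = u x * f x) → localEq V g

variable {E}

theorem UnitOn.mono {U V : Set X} {u : X → ℂ} (h : UnitOn E U u) (hV : V ⊆ U) : UnitOn E V u :=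
  ⟨ContMDiffOn.mono h.1 hV, fun x hx => h.2 x (hV hx)⟩

theorem UnitOn.div {U : Set X} {u v : X → ℂ} (h : UnitOn E U u) (h' : UnitOn E U v) :
    UnitOn E U (fun x => u x / v x) :=
  ⟨by
    have : ContMDiffOn 𝓘(ℂ, E) 𝓘(ℂ, ℂ) ω (fun x => u x * (v x)⁻¹) U :=
      ContMDiffOn.mul h.1 (ContMDiffOn.inv₀ h'.1 h'.2)
    simpa only [HolOn, div_eq_mul_inv] using this,
   fun x hx => div_ne_zero (h.2 x hx) (h'.2 x hx)⟩

/-- The zero divisor: its local equations are the nowhere vanishing holomorphic functions. -/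
instance : Zero (EffectiveDivisor E X) where
  zero :=
    { localEq := fun U f => IsOpen U ∧ UnitOn E U f
      isOpen := fun _ _ h => h.1
      hol := fun _ _ h => h.2.1
      nonzero := fun U f h W hW _ ⟨x, hx⟩ => ⟨x, hx, h.2.2 x (hW hx)⟩
      cover := fun x => ⟨Set.univ, fun _ => 1, Set.mem_univ x, isOpen_univ, contMDiffOn_const,
        fun _ _ => one_ne_zero⟩
      compatible := fun U f V g hf hg => ⟨fun x => g x / f x,
        (hg.2.mono Set.inter_subset_right).div (hf.2.mono Set.inter_subset_left),
        fun x hx => (div_mul_cancel₀ _ (hf.2.2 x hx.1)).symm⟩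
      maximal := fun V g hV hg h => by
        obtain ⟨u, hu, h'⟩ := h Set.univ (fun _ => 1)
          ⟨isOpen_univ, contMDiffOn_const, fun _ _ => one_ne_zero⟩
        refine ⟨hV, hg, fun x hx => ?_⟩
        rw [h' x ⟨Set.mem_univ x, hx⟩, mul_one]
        exact hu.2 x ⟨Set.mem_univ x, hx⟩ }

namespace EffectiveDivisor

variable (D : EffectiveDivisor E X)

/-- The local equations of `D`, with their domains. -/
def LocalEquation : Type _ := {p : Set X × (X → ℂ) // D.localEq p.1 p.2}

/-- The unit `f_j / f_i` on the intersection of the domains of two local equations. -/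
def ratio (i j : D.LocalEquation) : X → ℂ :=
  (D.compatible i.1.1 i.1.2 j.1.1 j.1.2 i.2 j.2).choose

theorem ratio_unit (i j : D.LocalEquation) : UnitOn E (i.1.1 ∩ j.1.1) (D.ratio i j) :=
  (D.compatible i.1.1 i.1.2 j.1.1 j.1.2 i.2 j.2).choose_spec.1

theorem ratio_mul (i j : D.LocalEquation) {x : X} (hx : x ∈ i.1.1 ∩ j.1.1) :
    j.1.2 x = D.ratio i j x * i.1.2 x :=
  (D.compatible i.1.1 i.1.2 j.1.1 j.1.2 i.2 j.2).choose_spec.2 x hx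

/-- Continuous functions agreeing after multiplication by a local equation agree. -/
theorem eq_of_mul_eq (i : D.LocalEquation) {W : Set X} (hW : IsOpen W) (hWi : W ⊆ i.1.1)
    {u v : X → ℂ} (hu : ContinuousOn u W) (hv : ContinuousOn v W)
    (h : ∀ x ∈ W, u x * i.1.2 x = v x * i.1.2 x) {x : X} (hx : x ∈ W) : u x = v x := by
  by_contra hne
  have hO : IsOpen (W ∩ (fun y => u y - v y) ⁻¹' {0}ᶜ) :=
    (hu.sub hv).isOpen_inter_preimage hW isOpen_compl_singleton
  obtain ⟨y, hy, hy0⟩ := D.nonzero _ _ i.2 _ (Set.inter_subset_left.trans hWi) hO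
    ⟨x, hx, fun h0 => hne (sub_eq_zero.1 h0)⟩
  exact hy.2 (sub_eq_zero.2 (mul_right_cancel₀ hy0 (h y hy.1)))

/-- The holomorphic line bundle `O_X(D)`, through its transition functions. A local section of
`O_X(D)`, i.e. a meromorphic function `s` with `div s + D ≥ 0`, has coordinate `s f_i` with respect to
the local equation `f_i`, so that the coordinate change from `f_i` to `f_j` is multiplication by
`f_j / f_i`. -/
def lineBundleCore : VectorBundleCore ℂ X ℂ D.LocalEquation where
  baseSet i := i.1.1
  isOpen_baseSet i := D.isOpen _ _ i.2
  indexAt x := ⟨((D.cover x).choose, (D.cover x).choose_spec.choose),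
    (D.cover x).choose_spec.choose_spec.2⟩
  mem_baseSet_at x := (D.cover x).choose_spec.choose_spec.1
  coordChange i j x := D.ratio i j x • ContinuousLinearMap.id ℂ ℂ
  coordChange_self i x hx v := by
    have : D.ratio i i x = 1 := by
      refine D.eq_of_mul_eq i (D.isOpen _ _ i.2) subset_rfl (u := D.ratio i i) (v := fun _ => 1)
        ?_ continuousOn_const (fun y hy => ?_) hx
      · exact (ContMDiffOn.continuousOn (D.ratio_unit i i).1).mono fun y hy => ⟨hy, hy⟩
      · rw [← D.ratio_mul i i ⟨hy, hy⟩, one_mul]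
    simp [this]
  continuousOn_coordChange i j :=
    (ContMDiffOn.continuousOn (D.ratio_unit i j).1).smul continuousOn_const
  coordChange_comp i j k x hx v := by
    have : D.ratio j k x * D.ratio i j x = D.ratio i k x := by
      have c1 : ContinuousOn (D.ratio j k) (i.1.1 ∩ j.1.1 ∩ k.1.1) :=
        (ContMDiffOn.continuousOn (D.ratio_unit j k).1).mono fun y hy => ⟨hy.1.2, hy.2⟩
      have c2 : ContinuousOn (D.ratio i j) (i.1.1 ∩ j.1.1 ∩ k.1.1) :=
        (ContMDiffOn.continuousOn (D.ratio_unit i j).1).mono fun y hy => hy.1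
      have c3 : ContinuousOn (D.ratio i k) (i.1.1 ∩ j.1.1 ∩ k.1.1) :=
        (ContMDiffOn.continuousOn (D.ratio_unit i k).1).mono fun y hy => ⟨hy.1.1, hy.2⟩
      refine D.eq_of_mul_eq i (((D.isOpen _ _ i.2).inter (D.isOpen _ _ j.2)).inter
        (D.isOpen _ _ k.2)) (fun y hy => hy.1.1) (u := fun y => D.ratio j k y * D.ratio i j y)
        (c1.mul c2) c3 (fun y hy => ?_) hx
      rw [mul_assoc, ← D.ratio_mul i j hy.1, ← D.ratio_mul j k ⟨hy.1.2, hy.2⟩,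
        ← D.ratio_mul i k ⟨hy.1.1, hy.2⟩]
    simp [← this, mul_assoc]

instance : D.lineBundleCore.IsContMDiff 𝓘(ℂ, E) ω where
  contMDiffOn_coordChange i j := by
    have h : ContMDiffOn 𝓘(ℂ, E) 𝓘(ℂ, ℂ) ω (D.ratio i j) (i.1.1 ∩ j.1.1) := (D.ratio_unit i j).1
    exact h.smul contMDiffOn_const

variable [FiniteDimensional ℂ E] [IsManifold 𝓘(ℂ, E) ω X] [CompactSpace X] [T2Space X]

/-- The degree of a divisor `D`: the degree of the line bundle `O_X(D)`. -/
def degree (κ : KaehlerForm E X) : ℝ := BranchedCartan.degree κ ℂ D.lineBundleCore.Fiber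

end EffectiveDivisor

variable (E X) in
/-- The fibres `Hom(T_x X, ℂ)` of the holomorphic cotangent bundle `Ω¹_X`. -/
abbrev Cotangent (x : X) : Type _ := TangentSpace 𝓘(ℂ, E) x →L[ℂ] Bundle.Trivial X ℂ x

end Divisor

/-! ### Complex Lie groups and adjoint actions -/

section LieGroups

variable (𝔤 : Type*) [NormedAddCommGroup 𝔤] [NormedSpace ℂ 𝔤]
  {G : Type*} [TopologicalSpace G] [ChartedSpace 𝔤 G] [Group G]

/-- The adjoint action of a complex Lie group `G` on its Lie algebra, the derivative at `1` of
`y ↦ g y g⁻¹`. The Lie algebra of `G` is the tangent space at `1`, which in Mathlib is by definition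
the model vector space `𝔤` of `G`. -/
def Ad (g : G) : 𝔤 →L[ℂ] 𝔤 :=
  (mfderiv 𝓘(ℂ, 𝔤) 𝓘(ℂ, 𝔤) (fun y : G => g * y * g⁻¹) 1 :)

theorem mfderiv_base_eq {E E' M M' : Type*} [NormedAddCommGroup E] [NormedSpace ℂ E]
    [NormedAddCommGroup E'] [NormedSpace ℂ E'] [TopologicalSpace M] [ChartedSpace E M]
    [TopologicalSpace M'] [ChartedSpace E' M'] (f : M → M') {x y : M} (h : x = y) :
    (mfderiv 𝓘(ℂ, E) 𝓘(ℂ, E') f x : E →L[ℂ] E') = (mfderiv 𝓘(ℂ, E) 𝓘(ℂ, E') f y : E →L[ℂ] E') := by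
  subst h; rfl

theorem Ad_one : Ad 𝔤 (1 : G) = ContinuousLinearMap.id ℂ 𝔤 := by
  have : (fun y : G => 1 * y * 1⁻¹) = id := by ext; simp
  rw [Ad, this]
  exact mfderiv_id

variable [LieGroup 𝓘(ℂ, 𝔤) ω G]

theorem contMDiff_conj (g : G) :
    ContMDiff 𝓘(ℂ, 𝔤) 𝓘(ℂ, 𝔤) ω (fun y : G => g * y * g⁻¹) :=
  (contMDiff_const.mul contMDiff_id).mul contMDiff_const

theorem Ad_mul (g h : G) : Ad 𝔤 (g * h) = (Ad 𝔤 g).comp (Ad 𝔤 h) := by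
  have h0 : (fun y : G => (g * h) * y * (g * h)⁻¹) =
      (fun y => g * y * g⁻¹) ∘ (fun y => h * y * h⁻¹) := by
    ext y; simp [mul_assoc]
  have h1 := mfderiv_comp (I := 𝓘(ℂ, 𝔤)) (I' := 𝓘(ℂ, 𝔤)) (I'' := 𝓘(ℂ, 𝔤)) (1 : G)
    ((contMDiff_conj 𝔤 g).contMDiffAt.mdifferentiableAt (by simp))
    ((contMDiff_conj 𝔤 h).contMDiffAt.mdifferentiableAt (by simp))
  rw [← h0] at h1
  have h2 := mfderiv_base_eq (E := 𝔤) (E' := 𝔤) (fun y : G => g * y * g⁻¹)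
    (show h * 1 * h⁻¹ = 1 by simp)
  refine (show Ad 𝔤 (g * h) = ContinuousLinearMap.comp
    ((mfderiv 𝓘(ℂ, 𝔤) 𝓘(ℂ, 𝔤) (fun y : G => g * y * g⁻¹) (h * 1 * h⁻¹) :) : 𝔤 →L[ℂ] 𝔤)
    (Ad 𝔤 h) from h1).trans ?_
  rw [h2]; rfl

theorem Ad_mul_apply (g h : G) (v : 𝔤) : Ad 𝔤 (g * h) v = Ad 𝔤 g (Ad 𝔤 h v) := by
  rw [Ad_mul]; rfl

theorem Ad_inv_Ad (g : G) (v : 𝔤) : Ad 𝔤 g⁻¹ (Ad 𝔤 g v) = v := by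
  rw [← Ad_mul_apply, inv_mul_cancel, Ad_one]; rfl

theorem Ad_Ad_inv (g : G) (v : 𝔤) : Ad 𝔤 g (Ad 𝔤 g⁻¹ v) = v := by
  rw [← Ad_mul_apply, mul_inv_cancel, Ad_one]; rfl

theorem contMDiff_Ad : ContMDiff 𝓘(ℂ, 𝔤) 𝓘(ℂ, 𝔤 →L[ℂ] 𝔤) ω (fun g : G => Ad 𝔤 g) := by
  intro g₀
  have hf : ContMDiffAt (𝓘(ℂ, 𝔤).prod 𝓘(ℂ, 𝔤)) 𝓘(ℂ, 𝔤) ω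
      (Function.uncurry fun (g y : G) => g * y * g⁻¹) (g₀, (1 : G)) :=
    ((contMDiff_fst.mul contMDiff_snd).mul contMDiff_fst.inv).contMDiffAt
  have : IsManifold 𝓘(ℂ, 𝔤) 1 G := inferInstance
  have h := ContMDiffAt.mfderiv (m := ω) (fun (g y : G) => g * y * g⁻¹) (fun _ : G => (1 : G)) hf
    contMDiffAt_const (by simp)
  have key : ∀ z w : G, z = 1 → w = 1 → ∀ v : 𝔤,
      (tangentBundleCore 𝓘(ℂ, 𝔤) G).coordChange (achart 𝔤 z) (achart 𝔤 w) z v = v := by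
    rintro z w rfl rfl v
    exact (tangentBundleCore 𝓘(ℂ, 𝔤) G).coordChange_self _ _ (mem_chart_source 𝔤 (1 : G)) v
  refine h.congr_of_eventuallyEq (Filter.Eventually.of_forall fun g => ?_)
  have e : ∀ x : G, x * 1 * x⁻¹ = 1 := fun x => by simp
  have h' := inTangentCoordinates_eq (I := 𝓘(ℂ, 𝔤)) (I' := 𝓘(ℂ, 𝔤)) (fun _ : G => (1 : G))
    (fun x : G => x * 1 * x⁻¹) (fun g : G => Ad 𝔤 g) (x₀ := g₀) (x := g)
    (mem_chart_source 𝔤 (1 : G)) (by simp only [e]; exact mem_chart_source 𝔤 (1 : G))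
  refine Eq.trans ?_ h'.symm
  ext v
  refine Eq.symm ((key _ _ (e g) (e g₀) _).trans ?_)
  exact congrArg (Ad 𝔤 g) (key _ _ rfl rfl v)

variable (𝔥 : Type*) [NormedAddCommGroup 𝔥] [NormedSpace ℂ 𝔥]
  (H : Type*) [TopologicalSpace H] [ChartedSpace 𝔥 H] [Group H] (G)

/-- A complex Lie subgroup `H` of a complex Lie group `G`: a complex Lie group with an injective
holomorphic homomorphism to `G` which is an immersion. -/
structure LieSubgroup where
  incl : H →* G
  holomorphic : ContMDiff 𝓘(ℂ, 𝔥) 𝓘(ℂ, 𝔤) ω incl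
  injective : Function.Injective incl
  immersion : Function.Injective (mfderiv 𝓘(ℂ, 𝔥) 𝓘(ℂ, 𝔤) incl 1)

variable {𝔤 G 𝔥 H}

/-- The inclusion of the Lie algebra of `H` in the Lie algebra of `G`. -/
def LieSubgroup.lie (ι : LieSubgroup 𝔤 G 𝔥 H) : 𝔥 →L[ℂ] 𝔤 :=
  (mfderiv 𝓘(ℂ, 𝔥) 𝓘(ℂ, 𝔤) ι.incl 1 :)

theorem LieSubgroup.lie_Ad [LieGroup 𝓘(ℂ, 𝔥) ω H] (ι : LieSubgroup 𝔤 G 𝔥 H) (h : H) (v : 𝔥) :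
    ι.lie (Ad 𝔥 h v) = Ad 𝔤 (ι.incl h) (ι.lie v) := by
  have h0 : ι.incl ∘ (fun y => h * y * h⁻¹) =
      (fun y : G => ι.incl h * y * (ι.incl h)⁻¹) ∘ ι.incl := by
    ext y; simp
  have h1 := mfderiv_comp (I := 𝓘(ℂ, 𝔥)) (I' := 𝓘(ℂ, 𝔥)) (I'' := 𝓘(ℂ, 𝔤)) (1 : H)
    (ι.holomorphic.contMDiffAt.mdifferentiableAt (by simp))
    ((contMDiff_conj 𝔥 h).contMDiffAt.mdifferentiableAt (by simp))
  have h2 := mfderiv_comp (I := 𝓘(ℂ, 𝔥)) (I' := 𝓘(ℂ, 𝔤)) (I'' := 𝓘(ℂ, 𝔤)) (1 : H)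
    ((contMDiff_conj 𝔤 (ι.incl h)).contMDiffAt.mdifferentiableAt (by simp))
    (ι.holomorphic.contMDiffAt.mdifferentiableAt (by simp))
  have e1 := mfderiv_base_eq (E := 𝔥) (E' := 𝔤) ι.incl (show h * 1 * h⁻¹ = 1 by simp)
  have e2 := mfderiv_base_eq (E := 𝔤) (E' := 𝔤)
    (fun y : G => ι.incl h * y * (ι.incl h)⁻¹) (map_one ι.incl)
  rw [h0, h2] at h1
  have h3 := DFunLike.congr_fun h1 v
  refine (show ι.lie (Ad 𝔥 h v) = ((mfderiv 𝓘(ℂ, 𝔥) 𝓘(ℂ, 𝔤) ι.incl (h * 1 * h⁻¹) :) :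
    𝔥 →L[ℂ] 𝔤) (Ad 𝔥 h v) by rw [e1]; rfl).trans ?_
  refine h3.symm.trans (show ((mfderiv 𝓘(ℂ, 𝔤) 𝓘(ℂ, 𝔤)
    (fun y : G => ι.incl h * y * (ι.incl h)⁻¹) (ι.incl 1) :) : 𝔤 →L[ℂ] 𝔤) (ι.lie v) = _ from ?_)
  rw [e2]; rfl

end LieGroups

/-! ### Principal bundles, adjoint bundles and Atiyah bundles -/

section Principal

variable (E X 𝔥 H 𝔭 P : Type*) [NormedAddCommGroup E] [NormedSpace ℂ E] [TopologicalSpace X]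
  [ChartedSpace E X] [NormedAddCommGroup 𝔥] [NormedSpace ℂ 𝔥] [TopologicalSpace H]
  [ChartedSpace 𝔥 H] [Group H] [NormedAddCommGroup 𝔭] [NormedSpace ℂ 𝔭] [TopologicalSpace P]
  [ChartedSpace 𝔭 P]

variable {X H P} in
/-- A local trivialization of `proj : P → X` with fibre `H` which is biholomorphic and equivariant
for the right actions of `H`. -/
structure IsHolTrivialization {proj : P → X} (act : P → H → P)
    (e : Bundle.Trivialization H proj) : Prop where
  hol : ContMDiffOn 𝓘(ℂ, 𝔭) (𝓘(ℂ, E).prod 𝓘(ℂ, 𝔥)) ω e e.source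
  hol_symm : ContMDiffOn (𝓘(ℂ, E).prod 𝓘(ℂ, 𝔥)) 𝓘(ℂ, 𝔭) ω e.toOpenPartialHomeomorph.symm e.target
  equivariant : ∀ p ∈ e.source, ∀ h, e (act p h) = ((e p).1, (e p).2 * h)

/-- A holomorphic principal `H`-bundle on the complex manifold `X`, with total space the complex
manifold `P`. -/
structure PrincipalBundle where
  proj : P → X
  act : P → H → P
  act_one : ∀ p, act p 1 = p
  act_mul : ∀ p h k, act p (h * k) = act (act p h) k
  proj_act : ∀ p h, proj (act p h) = proj p
  act_hol : ContMDiff (𝓘(ℂ, 𝔭).prod 𝓘(ℂ, 𝔥)) 𝓘(ℂ, 𝔭) ω fun z : P × H => act z.1 z.2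
  locally_trivial : ∀ x, ∃ e : Bundle.Trivialization H proj,
    x ∈ e.baseSet ∧ IsHolTrivialization E 𝔥 𝔭 act e

/-- The fibre at `x` of the adjoint vector bundle `Q ×^G 𝔤` of a principal `G`-bundle
`proj : Q → X`: since `(q, v)` and `(q g, Ad(g⁻¹) v)` are identified in it, an element of the fibre
is a function `a` on the fibre of `Q` with `a (q g) = Ad(g⁻¹) (a q)`
(the element is the class of `(q, a q)`, for any `q`). -/
def adFiber {X : Type*} (𝔤 : Type*) [NormedAddCommGroup 𝔤] [NormedSpace ℂ 𝔤] {G : Type*}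
    [TopologicalSpace G] [ChartedSpace 𝔤 G] [Group G] {Q : Type*} (proj : Q → X) (act : Q → G → Q)
    (x : X) : Submodule ℂ ({q : Q // proj q = x} → 𝔤) where
  carrier := {a | ∀ (q q' : {q : Q // proj q = x}) (g : G), q'.1 = act q.1 g →
    a q' = Ad 𝔤 g⁻¹ (a q)}
  add_mem' ha hb q q' g h := by simp [ha q q' g h, hb q q' g h]
  zero_mem' q q' g _ := by simp
  smul_mem' c a ha q q' g h := by simp [ha q q' g h]

variable {E X 𝔥 H 𝔭 P}

namespace PrincipalBundle

variable (B : PrincipalBundle E X 𝔥 H 𝔭 P)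

/-- The fibre at `x` of the adjoint vector bundle `ad(E_H)` of a principal `H`-bundle `E_H`. -/
def AdH (x : X) : Type _ := adFiber 𝔥 B.proj B.act x

instance (x : X) : AddCommGroup (B.AdH x) := inferInstanceAs (AddCommGroup (adFiber 𝔥 B.proj B.act x))
instance (x : X) : Module ℂ (B.AdH x) := inferInstanceAs (Module ℂ (adFiber 𝔥 B.proj B.act x))
instance (x : X) : TopologicalSpace (B.AdH x) :=
  inferInstanceAs (TopologicalSpace (adFiber 𝔥 B.proj B.act x))

section Trivializations

variable {B} {e : Bundle.Trivialization H B.proj}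

/-- The point with coordinate `1` in the fibre over `x` of a trivialization. -/
def sec (e : Bundle.Trivialization H B.proj) (x : X) : P := e.toOpenPartialHomeomorph.symm (x, 1)

theorem proj_sec {x : X} (hx : x ∈ e.baseSet) : B.proj (sec e x) = x := e.proj_symm_apply' hx

theorem apply_sec {x : X} (hx : x ∈ e.baseSet) : e (sec e x) = (x, 1) := e.apply_symm_apply' hx

theorem mem_source_of {x : X} (hx : x ∈ e.baseSet) (q : {q : P // B.proj q = x}) :
    q.1 ∈ e.source := by
  rw [e.mem_source, q.2]; exact hx

theorem act_sec (he : IsHolTrivialization E 𝔥 𝔭 B.act e) {x : X} (hx : x ∈ e.baseSet) (q : {q : P // B.proj q = x}) :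
    q.1 = B.act (sec e x) (e q.1).2 := by
  have hs : sec e x ∈ e.source := mem_source_of hx ⟨_, proj_sec hx⟩
  have hs' : B.act (sec e x) (e q.1).2 ∈ e.source :=
    mem_source_of hx ⟨_, (B.proj_act _ _).trans (proj_sec hx)⟩
  refine e.injOn (mem_source_of hx q) hs' ?_
  refine Eq.trans ?_ (he.equivariant _ hs _).symm
  rw [apply_sec hx, one_mul]
  refine Prod.ext ?_ rfl
  exact (e.coe_fst (mem_source_of hx q)).trans q.2

variable [LieGroup 𝓘(ℂ, 𝔥) ω H]

/-- The element of the fibre of `ad(E_H)` with coordinate `v` in a local trivialization. -/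
def adOf (he : IsHolTrivialization E 𝔥 𝔭 B.act e) {x : X} (hx : x ∈ e.baseSet) (v : 𝔥) : B.AdH x :=
  ⟨fun q => Ad 𝔥 (e q.1).2⁻¹ v, fun q q' g h => by
    change Ad 𝔥 (e q'.1).2⁻¹ v = Ad 𝔥 g⁻¹ (Ad 𝔥 (e q.1).2⁻¹ v)
    rw [h, he.equivariant _ (mem_source_of hx q), mul_inv_rev, Ad_mul_apply]⟩

theorem adOf_sec (he : IsHolTrivialization E 𝔥 𝔭 B.act e) {x : X} (hx : x ∈ e.baseSet) (v : 𝔥) :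
    (adOf he hx v).1 ⟨sec e x, proj_sec hx⟩ = v := by
  change Ad 𝔥 (e (sec e x)).2⁻¹ v = v
  rw [apply_sec hx]
  simp [Ad_one]

theorem adOf_apply_sec (he : IsHolTrivialization E 𝔥 𝔭 B.act e) {x : X} (hx : x ∈ e.baseSet)
    (a : B.AdH x) : adOf he hx (a.1 ⟨sec e x, proj_sec hx⟩) = a := by
  refine Subtype.ext (funext fun q => ?_)
  exact (a.2 ⟨sec e x, proj_sec hx⟩ q (e q.1).2 (act_sec he hx q)).symm

open Classical in
/-- The local trivialization of the adjoint bundle `ad(E_H)` given by one of `E_H`. -/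
def adPretriv (he : IsHolTrivialization E 𝔥 𝔭 B.act e) :
    Bundle.Pretrivialization 𝔥 (Bundle.TotalSpace.proj : Bundle.TotalSpace 𝔥 B.AdH → X) where
  toFun z := (z.1, if h : z.1 ∈ e.baseSet then z.2.1 ⟨sec e z.1, proj_sec h⟩ else 0)
  invFun y := ⟨y.1, if h : y.1 ∈ e.baseSet then adOf he h y.2 else 0⟩
  source := Bundle.TotalSpace.proj ⁻¹' e.baseSet
  target := e.baseSet ×ˢ Set.univ
  map_source' z hz := ⟨hz, trivial⟩
  map_target' y hy := hy.1
  left_inv' z hz := by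
    have hz' : z.1 ∈ e.baseSet := hz
    rcases z with ⟨x, a⟩
    simp only [dif_pos hz']
    rw [adOf_apply_sec]
  right_inv' y hy := by
    have hy' : y.1 ∈ e.baseSet := hy.1
    rcases y with ⟨x, v⟩
    simp only [dif_pos hy']
    rw [adOf_sec]
  open_target := e.open_baseSet.prod isOpen_univ
  baseSet := e.baseSet
  open_baseSet := e.open_baseSet
  source_eq := rfl
  target_eq := rfl
  proj_toFun _ _ := rfl

theorem adPretriv_apply (he : IsHolTrivialization E 𝔥 𝔭 B.act e) {x : X} (hx : x ∈ e.baseSet)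
    (a : B.AdH x) : (adPretriv he ⟨x, a⟩).2 = a.1 ⟨sec e x, proj_sec hx⟩ := dif_pos hx

open Classical in
theorem adPretriv_symm (he : IsHolTrivialization E 𝔥 𝔭 B.act e) {x : X} (hx : x ∈ e.baseSet)
    (v : 𝔥) : (adPretriv he).symm x v = adOf he hx v := by
  have h := (adPretriv he).mk_symm (b := x) hx v
  have h2 : (adPretriv he).toPartialEquiv.symm (x, v) = ⟨x, adOf he hx v⟩ := by
    change (⟨x, if h : x ∈ e.baseSet then adOf he h v else 0⟩ : Bundle.TotalSpace 𝔥 B.AdH) = _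
    rw [dif_pos hx]
  rw [h2] at h
  simpa using h

theorem contMDiffOn_adCoord {e' : Bundle.Trivialization H B.proj}
    (he : IsHolTrivialization E 𝔥 𝔭 B.act e) (he' : IsHolTrivialization E 𝔥 𝔭 B.act e') :
    ContMDiffOn 𝓘(ℂ, E) 𝓘(ℂ, 𝔥 →L[ℂ] 𝔥) ω (fun x => Ad 𝔥 (e (sec e' x)).2⁻¹)
      (e.baseSet ∩ e'.baseSet) := by
  have h1 : ContMDiffOn 𝓘(ℂ, E) 𝓘(ℂ, 𝔭) ω (sec e') (e.baseSet ∩ e'.baseSet) := by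
    refine he'.hol_symm.comp (f := fun x : X => (x, (1 : H)))
      ((contMDiff_id.prodMk contMDiff_const).contMDiffOn) ?_
    intro x hx
    rw [e'.target_eq]
    exact ⟨hx.2, trivial⟩
  have h2 : ContMDiffOn 𝓘(ℂ, E) (𝓘(ℂ, E).prod 𝓘(ℂ, 𝔥)) ω (fun x => e (sec e' x))
      (e.baseSet ∩ e'.baseSet) := by
    refine he.hol.comp h1 ?_
    intro x hx
    change sec e' x ∈ e.source
    rw [e.mem_source, proj_sec hx.2]
    exact hx.1
  have h3 : ContMDiffOn 𝓘(ℂ, E) 𝓘(ℂ, 𝔥) ω (fun x => (e (sec e' x)).2⁻¹)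
      (e.baseSet ∩ e'.baseSet) := (contMDiff_snd.comp_contMDiffOn h2).inv
  exact (contMDiff_Ad 𝔥).comp_contMDiffOn h3

theorem adPretriv_coord {e' : Bundle.Trivialization H B.proj}
    (he : IsHolTrivialization E 𝔥 𝔭 B.act e) (he' : IsHolTrivialization E 𝔥 𝔭 B.act e')
    {x : X} (hx : x ∈ e.baseSet ∩ e'.baseSet) (v : 𝔥) :
    Ad 𝔥 (e (sec e' x)).2⁻¹ v = (adPretriv he' ⟨x, (adPretriv he).symm x v⟩).2 := by
  rw [adPretriv_apply he' hx.2, adPretriv_symm he hx.1]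
  rfl

end Trivializations

variable [LieGroup 𝓘(ℂ, 𝔥) ω H]

/-- The local trivializations of `ad(E_H)` induced by those of `E_H`. -/
def adPrebundle : VectorPrebundle ℂ 𝔥 B.AdH where
  pretrivializationAtlas := {t | ∃ (e : Bundle.Trivialization H B.proj)
    (he : IsHolTrivialization E 𝔥 𝔭 B.act e), t = adPretriv he}
  pretrivialization_linear' := by
    rintro _ ⟨e, he, rfl⟩
    refine ⟨fun x hx => ⟨fun a b => ?_, fun c a => ?_⟩⟩
    · simp only [adPretriv_apply he hx]; rfl
    · simp only [adPretriv_apply he hx]; rfl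
  pretrivializationAt x := adPretriv (B.locally_trivial x).choose_spec.2
  mem_base_pretrivializationAt x := (B.locally_trivial x).choose_spec.1
  pretrivialization_mem_atlas x := ⟨_, (B.locally_trivial x).choose_spec.2, rfl⟩
  exists_coordChange := by
    rintro _ ⟨e, he, rfl⟩ _ ⟨e', he', rfl⟩
    exact ⟨_, (contMDiffOn_adCoord he he').continuousOn, fun x hx v => adPretriv_coord he he' hx v⟩
  totalSpaceMk_isInducing x := by
    set e := (B.locally_trivial x).choose
    have hx : x ∈ e.baseSet := (B.locally_trivial x).choose_spec.1
    have he : IsHolTrivialization E 𝔥 𝔭 B.act e := (B.locally_trivial x).choose_spec.2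
    refine (Function.LeftInverse.isEmbedding (f := fun y : X × 𝔥 => adOf he hx y.2)
      (fun a => ?_) ?_ ?_).isInducing
    · change adOf he hx (adPretriv he ⟨x, a⟩).2 = a
      rw [adPretriv_apply he hx, adOf_apply_sec]
    · refine Continuous.subtype_mk (continuous_pi fun q => ?_) _
      exact (Ad 𝔥 (e q.1).2⁻¹).continuous.comp continuous_snd
    · have : (adPretriv he ∘ Bundle.TotalSpace.mk x : B.AdH x → X × 𝔥) =
          fun a => (x, a.1 ⟨sec e x, proj_sec hx⟩) := by
        funext a
        exact Prod.ext rfl (adPretriv_apply he hx a)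
      rw [this]
      exact continuous_const.prodMk ((continuous_apply _).comp continuous_subtype_val)

instance : B.adPrebundle.IsContMDiff 𝓘(ℂ, E) ω where
  exists_contMDiffCoordChange := by
    rintro _ ⟨e, he, rfl⟩ _ ⟨e', he', rfl⟩
    exact ⟨_, contMDiffOn_adCoord he he', fun x hx v => adPretriv_coord he he' hx v⟩

instance : TopologicalSpace (Bundle.TotalSpace 𝔥 B.AdH) := B.adPrebundle.totalSpaceTopology
instance : FiberBundle 𝔥 B.AdH := B.adPrebundle.toFiberBundle
instance : VectorBundle ℂ 𝔥 B.AdH := B.adPrebundle.toVectorBundle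
/-- The adjoint bundle `ad(E_H)` is a holomorphic vector bundle. -/
instance : ContMDiffVectorBundle ω 𝔥 B.AdH 𝓘(ℂ, E) := B.adPrebundle.contMDiffVectorBundle 𝓘(ℂ, E)

/-! The Atiyah bundle `At(E_H) = (T E_H)/H`. -/

/-- The derivative of the right translation by `h` on the total space. -/
def dAct (h : H) (p : P) : TangentSpace 𝓘(ℂ, 𝔭) p →L[ℂ] TangentSpace 𝓘(ℂ, 𝔭) (B.act p h) :=
  mfderiv 𝓘(ℂ, 𝔭) 𝓘(ℂ, 𝔭) (fun q => B.act q h) p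

/-- The fibre at `x` of the Atiyah bundle `At(E_H) = (T E_H)/H`: the `H`-invariant vector fields
along the fibre of `E_H` over `x`. -/
def At (x : X) : Submodule ℂ (∀ p : {p : P // B.proj p = x}, TangentSpace 𝓘(ℂ, 𝔭) p.1) where
  carrier := {v | ∀ (p : {p : P // B.proj p = x}) (h : H),
    v ⟨B.act p.1 h, (B.proj_act p.1 h).trans p.2⟩ = B.dAct h p.1 (v p)}
  add_mem' ha hb p h := by simp [ha p h, hb p h]
  zero_mem' p h := by simp
  smul_mem' c a ha p h := by simp [ha p h]

/-- The value at `p` of the fundamental vector field on `E_H` of an element of the Lie algebra of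
`H`, i.e. the derivative at `1` of `h ↦ p h`. -/
def fundamental (p : P) : 𝔥 →L[ℂ] TangentSpace 𝓘(ℂ, 𝔭) p :=
  (mfderiv 𝓘(ℂ, 𝔥) 𝓘(ℂ, 𝔭) (fun h : H => B.act p h) 1 :)

theorem fundamental_act (p : P) (h : H) (v : 𝔥) :
    B.fundamental (B.act p h) (Ad 𝔥 h⁻¹ v) = B.dAct h p (B.fundamental p v) := by
  have hact : ∀ q : P, ContMDiff 𝓘(ℂ, 𝔥) 𝓘(ℂ, 𝔭) ω (fun y : H => B.act q y) := fun q =>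
    B.act_hol.comp (contMDiff_const.prodMk contMDiff_id)
  have hact' : ContMDiff 𝓘(ℂ, 𝔭) 𝓘(ℂ, 𝔭) ω (fun q : P => B.act q h) :=
    B.act_hol.comp (contMDiff_id.prodMk contMDiff_const)
  have h0 : (fun y => B.act (B.act p h) y) ∘ (fun y => h⁻¹ * y * (h⁻¹)⁻¹) =
      (fun q => B.act q h) ∘ (fun y => B.act p y) := by
    ext y
    simp only [Function.comp_apply, ← B.act_mul]
    congr 1
    group
  have h1 := mfderiv_comp (I := 𝓘(ℂ, 𝔥)) (I' := 𝓘(ℂ, 𝔥)) (I'' := 𝓘(ℂ, 𝔭)) (1 : H)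
    ((hact (B.act p h)).contMDiffAt.mdifferentiableAt (by simp))
    ((contMDiff_conj 𝔥 h⁻¹).contMDiffAt.mdifferentiableAt (by simp))
  have h2 := mfderiv_comp (I := 𝓘(ℂ, 𝔥)) (I' := 𝓘(ℂ, 𝔭)) (I'' := 𝓘(ℂ, 𝔭)) (1 : H)
    (hact'.contMDiffAt.mdifferentiableAt (by simp))
    ((hact p).contMDiffAt.mdifferentiableAt (by simp))
  have e1 := mfderiv_base_eq (E := 𝔥) (E' := 𝔭) (fun y => B.act (B.act p h) y)
    (show h⁻¹ * 1 * (h⁻¹)⁻¹ = 1 by simp)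
  have e2 := mfderiv_base_eq (E := 𝔭) (E' := 𝔭) (fun q : P => B.act q h) (B.act_one p)
  rw [h0, h2] at h1
  have h3 := DFunLike.congr_fun h1 v
  refine (show B.fundamental (B.act p h) (Ad 𝔥 h⁻¹ v) =
    ((mfderiv 𝓘(ℂ, 𝔥) 𝓘(ℂ, 𝔭) (fun y => B.act (B.act p h) y) (h⁻¹ * 1 * (h⁻¹)⁻¹) :) :
    𝔥 →L[ℂ] 𝔭) (Ad 𝔥 h⁻¹ v) by rw [e1]; rfl).trans ?_
  refine h3.symm.trans (show ((mfderiv 𝓘(ℂ, 𝔭) 𝓘(ℂ, 𝔭) (fun q : P => B.act q h) (B.act p 1) :) :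
    𝔭 →L[ℂ] 𝔭) (B.fundamental p v) = _ from ?_)
  rw [e2]; rfl

/-- The inclusion `ι₂ : ad(E_H) → At(E_H)`. -/
def iota₂ (x : X) : B.AdH x →ₗ[ℂ] B.At x where
  toFun a := ⟨fun p => B.fundamental p.1 (a.1 p), fun p h => by
    have h1 := a.2 p ⟨B.act p.1 h, (B.proj_act p.1 h).trans p.2⟩ h rfl
    exact (congrArg (B.fundamental (B.act p.1 h)) h1).trans (B.fundamental_act p.1 h _)⟩
  map_add' a b := Subtype.ext (funext fun p => (B.fundamental p.1).map_add (a.1 p) (b.1 p))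
  map_smul' c a := Subtype.ext (funext fun p => (B.fundamental p.1).map_smul c (a.1 p))

/-- A holomorphic section of `At(E_H)` over `U`: an `H`-invariant vector field on the part of `E_H`
over `U` which is holomorphic. -/
def IsHolAt [IsManifold 𝓘(ℂ, 𝔭) ω P] (U : Set X) (σ : ∀ x, B.At x) : Prop :=
  ContMDiffOn 𝓘(ℂ, 𝔭) 𝓘(ℂ, 𝔭).tangent ω
    (fun p : P => (⟨p, (σ (B.proj p)).1 ⟨p, rfl⟩⟩ : TangentBundle 𝓘(ℂ, 𝔭) P)) (B.proj ⁻¹' U)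

/-! The principal `G`-bundle `E_G = E_H ×^H G` and its adjoint bundle. -/

variable {𝔤 G : Type*} [NormedAddCommGroup 𝔤] [NormedSpace ℂ 𝔤] [TopologicalSpace G]
  [ChartedSpace 𝔤 G] [Group G] (ι : LieSubgroup 𝔤 G 𝔥 H)

/-- The equivalence relation on `E_H × G` that identifies `(c, g)` and `(c h, h⁻¹ g)`, `h ∈ H`. -/
def extSetoid : Setoid (P × G) where
  r a b := ∃ h : H, b.1 = B.act a.1 h ∧ b.2 = (ι.incl h)⁻¹ * a.2
  iseqv :=
    { refl := fun a => ⟨1, (B.act_one _).symm, by simp⟩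
      symm := by
        rintro a b ⟨h, h1, h2⟩
        refine ⟨h⁻¹, ?_, ?_⟩
        · rw [h1, ← B.act_mul, mul_inv_cancel, B.act_one]
        · rw [h2, map_inv]; simp
      trans := by
        rintro a b c ⟨h, h1, h2⟩ ⟨k, h3, h4⟩
        refine ⟨h * k, ?_, ?_⟩
        · rw [h3, h1, B.act_mul]
        · rw [h4, h2, map_mul, mul_inv_rev, mul_assoc] }

/-- The (total space of the) principal `G`-bundle `E_G = E_H ×^H G`. -/
def Ext : Type _ := Quotient (B.extSetoid ι)

/-- The class in `E_G` of an element of `E_H × G`. -/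
def toExt (p : P) (g : G) : B.Ext ι := Quotient.mk (B.extSetoid ι) (p, g)

/-- The projection of `E_G` to `X`. -/
def extProj : B.Ext ι → X := Quotient.lift (fun a : P × G => B.proj a.1) (by
  rintro a b ⟨h, h1, -⟩
  rw [h1, B.proj_act])

/-- The right action of `G` on `E_G`. -/
def extAct (z : B.Ext ι) (g : G) : B.Ext ι :=
  Quotient.map' (s₁ := B.extSetoid ι) (s₂ := B.extSetoid ι) (fun a => (a.1, a.2 * g)) (by
    rintro a b ⟨h, h1, h2⟩
    exact ⟨h, h1, by rw [h2, mul_assoc]⟩) z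

/-- The fibre at `x` of the adjoint vector bundle `ad(E_G)`. -/
def AdG (x : X) : Submodule ℂ ({z : B.Ext ι // B.extProj ι z = x} → 𝔤) :=
  adFiber 𝔤 (B.extProj ι) (B.extAct ι) x

/-- A holomorphic section of `ad(E_G)` over `U`: an equivariant map to `𝔤` on the part of `E_G` over
`U` which is holomorphic, i.e. whose composition with the quotient map `E_H × G → E_G` is. -/
def IsHolAdG (U : Set X) (σ : ∀ x, B.AdG ι x) : Prop :=
  ContMDiffOn (𝓘(ℂ, 𝔭).prod 𝓘(ℂ, 𝔤)) 𝓘(ℂ, 𝔤) ω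
    (fun z : P × G => (σ (B.proj z.1)).1 ⟨B.toExt ι z.1 z.2, rfl⟩) {z | B.proj z.1 ∈ U}

variable [LieGroup 𝓘(ℂ, 𝔤) ω G]

/-- The value at a point of `E_G` of the element of `ad(E_G)` given by an element of `ad(E_H)`. -/
def iota₁Fun {x : X} (a : B.AdH x) (z : {z : B.Ext ι // B.extProj ι z = x}) : 𝔤 :=
  Ad 𝔤 (Quotient.out z.1).2⁻¹ (ι.lie (a.1 ⟨(Quotient.out z.1).1, by
    have h := z.2
    rw [← Quotient.out_eq z.1] at h
    exact h⟩))

theorem iota₁Fun_toExt {x : X} (a : B.AdH x) (p : P) (hp : B.proj p = x) (g : G) :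
    B.iota₁Fun ι a ⟨B.toExt ι p g, hp⟩ = Ad 𝔤 g⁻¹ (ι.lie (a.1 ⟨p, hp⟩)) := by
  obtain ⟨h, h1, h2⟩ : (B.extSetoid ι).r (Quotient.out (B.toExt ι p g)) (p, g) :=
    Quotient.exact (Quotient.out_eq (B.toExt ι p g))
  have hp' : B.proj (Quotient.out (B.toExt ι p g)).1 = x := by
    exact ((congrArg B.proj h1).trans (B.proj_act _ _)).symm.trans hp
  have h3 := a.2 ⟨_, hp'⟩ ⟨p, hp⟩ h h1
  have h4 : (Quotient.out (B.toExt ι p g)).2⁻¹ = g⁻¹ * (ι.incl h)⁻¹ :=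
    (congrArg Inv.inv (eq_inv_mul_iff_mul_eq.1 h2)).symm.trans (mul_inv_rev _ _)
  rw [h3, ι.lie_Ad, map_inv, ← Ad_mul_apply]
  exact congrArg (fun t => Ad 𝔤 t (ι.lie (a.1 ⟨_, hp'⟩))) h4

/-- The inclusion `ι₁ : ad(E_H) → ad(E_G)`. It is characterized by
`(ι₁ a) [p, g] = Ad(g⁻¹) (a p)`, i.e. it is induced by the inclusions of `E_H` in `E_G` and of
`𝔥` in `𝔤`. -/
def iota₁ (x : X) : B.AdH x →ₗ[ℂ] B.AdG ι x where
  toFun a := ⟨B.iota₁Fun ι a, by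
    rintro ⟨z, hz⟩ ⟨z', hz'⟩ g h
    obtain ⟨⟨p, k⟩, rfl⟩ := Quotient.exists_rep z
    subst h
    refine (B.iota₁Fun_toExt ι a p hz (k * g)).trans ?_
    rw [mul_inv_rev, Ad_mul_apply]
    exact congrArg _ (B.iota₁Fun_toExt ι a p hz k).symm⟩
  map_add' a b := Subtype.ext (funext fun z =>
    ((Ad 𝔤 (Quotient.out z.1).2⁻¹).comp ι.lie).map_add _ _)
  map_smul' c a := Subtype.ext (funext fun z =>
    ((Ad 𝔤 (Quotient.out z.1).2⁻¹).comp ι.lie).map_smul c _)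

/-- The fibre at `x` of the vector bundle `ad(E_G)/ad(E_H)`. -/
abbrev AdQuot (x : X) : Type _ := B.AdG ι x ⧸ LinearMap.range (B.iota₁ ι x)

end PrincipalBundle

/-! ### Branched holomorphic Cartan geometries -/

variable {𝔤 G : Type*} [NormedAddCommGroup 𝔤] [NormedSpace ℂ 𝔤] [TopologicalSpace G]
  [ChartedSpace 𝔤 G] [Group G] [LieGroup 𝓘(ℂ, 𝔤) ω G] [LieGroup 𝓘(ℂ, 𝔥) ω H]
  [IsManifold 𝓘(ℂ, E) ω X] [IsManifold 𝓘(ℂ, 𝔭) ω P]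

/-- A branched holomorphic Cartan geometry of type `G/H` on `X` with underlying principal bundle
`E_H`: a holomorphic homomorphism of vector bundles `θ : At(E_H) → ad(E_G)` which is an isomorphism
over some nonempty open subset of `X` and satisfies `θ ∘ ι₂ = ι₁`. -/
structure BranchedCartanGeometry (ι : LieSubgroup 𝔤 G 𝔥 H) (B : PrincipalBundle E X 𝔥 H 𝔭 P) where
  θ : ∀ x, B.At x →ₗ[ℂ] B.AdG ι x
  holomorphic : ∀ (U : Set X) (σ : ∀ x, B.At x), IsOpen U → B.IsHolAt U σ →
    B.IsHolAdG ι U fun x => θ x (σ x)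
  iso : ∃ U : Set X, IsOpen U ∧ U.Nonempty ∧ ∀ x ∈ U, Function.Bijective (θ x)
  comp_iota : ∀ x, θ x ∘ₗ B.iota₂ x = B.iota₁ ι x

namespace BranchedCartanGeometry

variable {ι : LieSubgroup 𝔤 G 𝔥 H} {B : PrincipalBundle E X 𝔥 H 𝔭 P}
  (Θ : BranchedCartanGeometry ι B)

/-- `φ : TX → ad(E_G)/ad(E_H)` is the homomorphism induced by `θ`: one has
`φ (q_H v) = θ v mod ad(E_H)` for all `v` in `At(E_H)`, where `q_H : At(E_H) → TX` is the projection
induced by the derivative of `E_H → X`. -/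
def IsInduced (φ : ∀ x : X, TangentSpace 𝓘(ℂ, E) x →ₗ[ℂ] B.AdQuot ι x) : Prop :=
  ∀ (p : P) (v : B.At (B.proj p)),
    φ (B.proj p) (mfderiv 𝓘(ℂ, 𝔭) 𝓘(ℂ, E) B.proj p (v.1 ⟨p, rfl⟩)) =
      (LinearMap.range (B.iota₁ ι (B.proj p))).mkQ (Θ.θ (B.proj p) v)

end BranchedCartanGeometry

/-- A holomorphic frame of `TX` over `U`. -/
def IsTangentFrame {d : ℕ} (U : Set X) (e : Fin d → ∀ x : X, TangentSpace 𝓘(ℂ, E) x) : Prop :=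
  (∀ k, ContMDiffOn 𝓘(ℂ, E) 𝓘(ℂ, E).tangent ω
    (fun x : X => (⟨x, e k x⟩ : TangentBundle 𝓘(ℂ, E) X)) U) ∧
  ∀ x ∈ U, LinearIndependent ℂ (fun k => e k x) ∧
    Submodule.span ℂ (Set.range fun k => e k x) = ⊤

/-- A holomorphic frame over `U` of `ad(E_G)/ad(E_H)`, given by holomorphic sections of
`ad(E_G)`. -/
def IsQuotFrame (ι : LieSubgroup 𝔤 G 𝔥 H) (B : PrincipalBundle E X 𝔥 H 𝔭 P) {d : ℕ} (U : Set X)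
    (q : Fin d → ∀ x : X, B.AdG ι x) : Prop :=
  (∀ k, B.IsHolAdG ι U (q k)) ∧
  ∀ x ∈ U, LinearIndependent ℂ (fun k => (LinearMap.range (B.iota₁ ι x)).mkQ (q k x)) ∧
    Submodule.span ℂ (Set.range fun k => (LinearMap.range (B.iota₁ ι x)).mkQ (q k x)) = ⊤

/-- `D` is the branching divisor of the branched Cartan geometry: the divisor of the section
`⋀ᵈφ` of `(⋀ᵈ(ad(E_G)/ad(E_H))) ⊗ Ω^d_X`, where `d = dim X` and `φ : TX → ad(E_G)/ad(E_H)` is induced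
by `θ`. That is, with respect to any local holomorphic frames `e` of `TX` and `q` of
`ad(E_G)/ad(E_H)`, the function `f` with `⋀ᵈφ (e₁ ∧ ⋯ ∧ e_d) = f q₁ ∧ ⋯ ∧ q_d` is a local equation
of `D`. -/
def BranchedCartanGeometry.IsBranchingDivisor {ι : LieSubgroup 𝔤 G 𝔥 H}
    {B : PrincipalBundle E X 𝔥 H 𝔭 P} (Θ : BranchedCartanGeometry ι B)
    (D : EffectiveDivisor E X) : Prop :=
  ∃ φ : ∀ x : X, TangentSpace 𝓘(ℂ, E) x →ₗ[ℂ] B.AdQuot ι x, Θ.IsInduced φ ∧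
    ∀ (U : Set X) (e : Fin (Module.finrank ℂ E) → ∀ x : X, TangentSpace 𝓘(ℂ, E) x)
      (q : Fin (Module.finrank ℂ E) → ∀ x : X, B.AdG ι x) (f : X → ℂ),
      IsOpen U → IsTangentFrame U e → IsQuotFrame ι B U q →
      (∀ x ∈ U, exteriorPower.map (Module.finrank ℂ E) (φ x)
          (exteriorPower.ιMulti ℂ (Module.finrank ℂ E) fun k => e k x) =
        f x • exteriorPower.ιMulti ℂ (Module.finrank ℂ E)
          fun k => (LinearMap.range (B.iota₁ ι x)).mkQ (q k x)) →
      D.localEq U f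

end Principal
end BranchedCartan

end

/-! Both parts rest on two facts. A branched Cartan geometry with branching divisor D forces
degree(Ω¹) - degree(D) = degree(ad(E_H)), and a nonzero effective divisor on a compact Kähler
manifold has positive degree.

The degree relation. Since θ ∘ ι₂ = ι₁, the map θ amounts to a holomorphic connection on E_G, hence
to one on det ad(E_G). The section ⋀ᵈφ has divisor D, so Ω^d ⊗ O(-D) ⊗ det ad(E_H)⁻¹ is the dual of
det ad(E_G). The bundle det ad(E_G) enters only through its transition functions, which are given by
the character χ = det Ad of G. In a trivialization of E_H the geometry becomes a holomorphic
𝔤-valued 1-form `connForm` with the gauge law A' = Ad(k⁻¹) A + k⁻¹ dk (`connForm_change`). Modulo 𝔥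
its determinant is a local equation of D (`localEq_branchFun`). Its image under the derivative of χ
is a holomorphic 1-form `traceForm` that changes by χ⁻¹ dχ. With Hermitian metrics on Ω¹, O(D) and
ad(E_H), the difference Φ of the functions log det changes by -log |χ|². Hence dΦ + 2
Re(`traceForm`) is a global 1-form. Composed with the complex structure J it gives β such that dβ
equals -2 i∂∂̄Φ up to a form of type (2,0) + (0,2). The wedge product of dβ with κ^{d-1} integrates
to zero by Stokes' theorem, and the other term has zero wedge product with κ^{d-1} for reasons of
type. This is `integralPow_eq_zero_of_potentials`, and it yields `degree_eq_of_isBranchingDivisor`.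

Positivity. Let N be the square norm of the canonical section of O(D), L = -log ε, and G = log(N +
ε) + (log(N + ε))² / (2L). Off the divisor, i∂∂̄G + 2π χ' c₁ is a nonnegative combination of forms
i∂u ∧ ∂̄u, where now χ' is the derivative of G with respect to log N; it is at least 1/L times the
energy form of log(N + ε) (`chartDensity_regularized_ge`). Near a zero this energy is at least a
constant times L (`exists_energy_lower_bound`), because log(N + ε) climbs by about L on each disc of
a family of discs through the zeros. The integral of i∂∂̄G vanishes and χ' tends boundedly to 1, so
letting ε tend to 0 bounds 2π degree(D) below by a positive constant (`degree_pos`). -/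

set_option linter.unusedSectionVars false

noncomputable section

namespace BranchedCartan

/-! ### Exterior derivatives of one-forms and i∂∂̄ on a complex vector space. -/

section FormCalculus

variable {E : Type*} [NormedAddCommGroup E] [NormedSpace ℂ E]

theorem mulI_apply (v : E) : mulI E v = Complex.I • v := rfl

/-- The `1`-form given by a continuous linear functional, as a continuous linear map. -/
def oneFormCLM (E : Type*) [NormedAddCommGroup E] [NormedSpace ℂ E] :
    (E →L[ℝ] ℝ) →L[ℝ] (E [⋀^Fin 1]→L[ℝ] ℝ) :=
  ((ContinuousAlternatingMap.ofSubsingletonLIE (0 : Fin 1)).toContinuousLinearEquiv :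
    (E →L[ℝ] ℝ) ≃L[ℝ] (E [⋀^Fin 1]→L[ℝ] ℝ))

theorem oneFormCLM_apply_apply (f : E →L[ℝ] ℝ) (v : Fin 1 → E) : oneFormCLM E f v = f (v 0) := rfl

/-- The alternating form `(v, w) ↦ f v w - f w v`. -/
def skew (f : E →L[ℝ] E →L[ℝ] ℝ) : E [⋀^Fin 2]→L[ℝ] ℝ :=
  ContinuousAlternatingMap.alternatizeUncurryFin ((oneFormCLM E).comp f)

theorem skew_apply (f : E →L[ℝ] E →L[ℝ] ℝ) (v : Fin 2 → E) :
    skew f v = f (v 0) (v 1) - f (v 1) (v 0) := by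
  simp [skew, ContinuousAlternatingMap.alternatizeUncurryFin_apply, Fin.sum_univ_two,
    oneFormCLM_apply_apply, Fin.removeNth, Fin.succAbove]
  ring

/-- The exterior derivative of a real `1`-form. -/
def dOne (γ : E → E →L[ℝ] ℝ) (y : E) : E [⋀^Fin 2]→L[ℝ] ℝ :=
  extDeriv (fun z => ContinuousAlternatingMap.ofSubsingleton ℝ E ℝ (0 : Fin 1) (γ z)) y

/-- The exterior derivative of a 1-form is the antisymmetrized derivative. Identities between forms
thereby become identities between second derivatives evaluated on two vectors. -/
theorem dOne_eq_skew {γ : E → E →L[ℝ] ℝ} {y : E} (h : DifferentiableAt ℝ γ y) :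
    dOne γ y = skew (fderiv ℝ γ y) := by
  have : fderiv ℝ (fun z => oneFormCLM E (γ z)) y = (oneFormCLM E).comp (fderiv ℝ γ y) :=
    ((oneFormCLM E).hasFDerivAt.comp y h.hasFDerivAt).fderiv
  rw [skew, ← this]
  rfl

theorem dOne_apply {γ : E → E →L[ℝ] ℝ} {y : E} (h : DifferentiableAt ℝ γ y) (v : Fin 2 → E) :
    dOne γ y v = fderiv ℝ γ y (v 0) (v 1) - fderiv ℝ γ y (v 1) (v 0) := by
  rw [dOne_eq_skew h, skew_apply]

theorem dOne_congr {γ γ' : E → E →L[ℝ] ℝ} {y : E} (h : γ =ᶠ[𝓝 y] γ') : dOne γ y = dOne γ' y := by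
  refine Filter.EventuallyEq.extDeriv_eq ?_
  filter_upwards [h] with z hz
  rw [hz]

theorem skew_add (f g : E →L[ℝ] E →L[ℝ] ℝ) : skew (f + g) = skew f + skew g := by
  ext v; simp [skew_apply]; ring

theorem skew_smul (c : ℝ) (f : E →L[ℝ] E →L[ℝ] ℝ) : skew (c • f) = c • skew f := by
  ext v; simp [skew_apply]; ring

theorem dOne_add {γ γ' : E → E →L[ℝ] ℝ} {y : E} (h : DifferentiableAt ℝ γ y)
    (h' : DifferentiableAt ℝ γ' y) : dOne (fun z => γ z + γ' z) y = dOne γ y + dOne γ' y := by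
  rw [dOne_eq_skew h, dOne_eq_skew h', dOne_eq_skew (γ := fun z => γ z + γ' z) (h.add h'), ← skew_add, ← fderiv_add h h']
  rfl

theorem dOne_const_smul {γ : E → E →L[ℝ] ℝ} {y : E} (c : ℝ) (h : DifferentiableAt ℝ γ y) :
    dOne (fun z => c • γ z) y = c • dOne γ y := by
  rw [dOne_eq_skew h, dOne_eq_skew (γ := fun z => c • γ z) (h.const_smul c), ← skew_smul, ← fderiv_const_smul h c]
  rfl

theorem dOne_sum {ι : Type*} (s : Finset ι) {γ : ι → E → E →L[ℝ] ℝ} {y : E}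
    (h : ∀ i ∈ s, DifferentiableAt ℝ (γ i) y) :
    dOne (fun z => ∑ i ∈ s, γ i z) y = ∑ i ∈ s, dOne (γ i) y := by
  classical
  induction s using Finset.induction_on with
  | empty =>
    rw [dOne_eq_skew (by simp)]
    ext v
    simp [skew_apply]
  | insert i s hi ih =>
    simp only [Finset.sum_insert hi]
    rw [dOne_add (h i (Finset.mem_insert_self i s)), ih fun j hj => h j (Finset.mem_insert_of_mem hj)]
    exact DifferentiableAt.fun_sum fun j hj => h j (Finset.mem_insert_of_mem hj)

theorem dOne_pullback {E' : Type*} [NormedAddCommGroup E'] [NormedSpace ℂ E']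
    {γ : E' → E' →L[ℝ] ℝ} {τ : E → E'} {y : E}
    (h : DifferentiableAt ℝ γ (τ y)) (hτ : ContDiffAt ℝ 2 τ y) :
    dOne (fun z => (γ (τ z)).comp (fderiv ℝ τ z)) y =
      (dOne γ (τ y)).compContinuousLinearMap (fderiv ℝ τ y) := by
  have h' : DifferentiableAt ℝ
      (fun z => ContinuousAlternatingMap.ofSubsingleton ℝ E' ℝ (0 : Fin 1) (γ z)) (τ y) :=
    (oneFormCLM E').differentiableAt.comp (τ y) h
  exact extDeriv_pullback (r := 2) h' hτ (by simp)

theorem iddbar_eq (u : E → ℝ) (y : E) :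
    iddbar u y = (-(1 / 2 : ℝ)) • dOne (fun z => (fderiv ℝ u z).comp (mulI E)) y := rfl

theorem iddbar_congr {u u' : E → ℝ} {y : E} (h : u =ᶠ[𝓝 y] u') : iddbar u y = iddbar u' y := by
  rw [iddbar_eq, iddbar_eq]
  congr 1
  refine dOne_congr ?_
  filter_upwards [h.eventuallyEq_nhds] with z hz
  rw [hz.fderiv_eq]

theorem differentiableAt_fderiv {F : Type*} [NormedAddCommGroup F] [NormedSpace ℝ F] {u : E → F}
    {y : E} (h : ContDiffAt ℝ 2 u y) : DifferentiableAt ℝ (fderiv ℝ u) y :=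
  (h.fderiv_right (m := 1) (by norm_num)).differentiableAt (by simp)

theorem differentiableAt_fderiv_comp_mulI {u : E → ℝ} {y : E} (h : ContDiffAt ℝ 2 u y) :
    DifferentiableAt ℝ (fun z => (fderiv ℝ u z).comp (mulI E)) y :=
  (differentiableAt_fderiv h).clm_comp (differentiableAt_const _)

theorem iddbar_apply {u : E → ℝ} {y : E} (h : ContDiffAt ℝ 2 u y) (v : Fin 2 → E) :
    iddbar u y v = -(1 / 2) * (fderiv ℝ (fderiv ℝ u) y (v 0) (mulI E (v 1)) -
      fderiv ℝ (fderiv ℝ u) y (v 1) (mulI E (v 0))) := by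
  have h1 : fderiv ℝ (fun z => (fderiv ℝ u z).comp (mulI E)) y =
      ((ContinuousLinearMap.compL ℝ E E ℝ).flip (mulI E)).comp (fderiv ℝ (fderiv ℝ u) y) :=
    (((ContinuousLinearMap.compL ℝ E E ℝ).flip (mulI E)).hasFDerivAt.comp y
      (differentiableAt_fderiv h).hasFDerivAt).fderiv
  rw [iddbar_eq, ContinuousAlternatingMap.smul_apply,
    dOne_apply (differentiableAt_fderiv_comp_mulI h), h1]
  simp

theorem iddbar_add {u u' : E → ℝ} {y : E} (h : ContDiffAt ℝ 2 u y) (h' : ContDiffAt ℝ 2 u' y) :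
    iddbar (fun z => u z + u' z) y = iddbar u y + iddbar u' y := by
  rw [iddbar_eq, iddbar_eq, iddbar_eq, ← smul_add, ← dOne_add
    (differentiableAt_fderiv_comp_mulI h) (differentiableAt_fderiv_comp_mulI h')]
  congr 1
  refine dOne_congr ?_
  filter_upwards [h.eventually (by simp), h'.eventually (by simp)] with z hz hz'
  rw [← ContinuousLinearMap.add_comp]
  congr 1
  exact fderiv_add (hz.differentiableAt (by simp)) (hz'.differentiableAt (by simp))

theorem iddbar_const_smul {u : E → ℝ} {y : E} (c : ℝ) (h : ContDiffAt ℝ 2 u y) :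
    iddbar (fun z => c * u z) y = c • iddbar u y := by
  rw [iddbar_eq, iddbar_eq, smul_comm, ← dOne_const_smul c (differentiableAt_fderiv_comp_mulI h)]
  congr 1
  refine dOne_congr ?_
  filter_upwards [h.eventually (by simp)] with z hz
  rw [← ContinuousLinearMap.smul_comp]
  congr 1
  exact fderiv_const_smul (hz.differentiableAt (by simp)) c

theorem iddbar_sub {u u' : E → ℝ} {y : E} (h : ContDiffAt ℝ 2 u y) (h' : ContDiffAt ℝ 2 u' y) :
    iddbar (fun z => u z - u' z) y = iddbar u y - iddbar u' y := by
  have h1 := iddbar_add (u := u) (u' := fun z => (-1) * u' z) h (contDiffAt_const.mul h')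
  rw [iddbar_const_smul _ h'] at h1
  have h2 : (-1 : ℝ) • iddbar u' y = -iddbar u' y := by ext v; simp
  rw [h2] at h1
  simpa only [sub_eq_add_neg, neg_mul, one_mul] using h1

theorem fderiv_real_eq {F : Type*} [NormedAddCommGroup F] [NormedSpace ℂ F] {f : E → F} {y : E}
    (h : DifferentiableAt ℂ f y) : fderiv ℝ f y = (fderiv ℂ f y).restrictScalars ℝ :=
  h.fderiv_restrictScalars ℝ

theorem contDiffAt_real {F : Type*} [NormedAddCommGroup F] [NormedSpace ℂ F] {f : E → F} {y : E}
    {n : ℕ∞ω} (h : ContDiffAt ℂ n f y) : ContDiffAt ℝ n f y := h.restrict_scalars ℝ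

theorem fderiv_real_mulI {F : Type*} [NormedAddCommGroup F] [NormedSpace ℂ F] {f : E → F} {y : E}
    (h : DifferentiableAt ℂ f y) :
    (fderiv ℝ f y).comp (mulI E) = (mulI F).comp (fderiv ℝ f y) := by
  ext v
  simp [fderiv_real_eq h, mulI_apply]

/-- The differential of a holomorphic map commutes with J, so du ∘ J pulls back to d(u ∘ τ) ∘ J, and
the exterior derivative is natural. -/
theorem iddbar_comp_hol {E' : Type*} [NormedAddCommGroup E'] [NormedSpace ℂ E'] {u : E' → ℝ}
    {τ : E → E'} {y : E} (h : ContDiffAt ℝ 2 u (τ y)) (hτ : ContDiffAt ℂ 2 τ y) :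
    iddbar (u ∘ τ) y = (iddbar u (τ y)).compContinuousLinearMap (fderiv ℝ τ y) := by
  have h1 := dOne_pullback (differentiableAt_fderiv_comp_mulI h) (contDiffAt_real hτ)
  rw [iddbar_eq, iddbar_eq]
  refine Eq.trans ?_ (congrArg (fun a => (-(1 / 2 : ℝ)) • a) h1)
  congr 1
  refine dOne_congr ?_
  have hc : ∀ᶠ z in 𝓝 y, ContDiffAt ℝ 2 u (τ z) :=
    hτ.continuousAt.eventually (h.eventually (by simp))
  filter_upwards [hτ.eventually (by simp), hc] with z hz hz'
  have hd := hz.differentiableAt (by simp)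
  rw [fderiv_comp z (hz'.differentiableAt (by simp)) (hd.restrictScalars ℝ),
    ContinuousLinearMap.comp_assoc, fderiv_real_mulI hd, ContinuousLinearMap.comp_assoc]

/-- A real `2`-form of type `(2,0) + (0,2)`. -/
def IsAntiType (τ : E [⋀^Fin 2]→L[ℝ] ℝ) : Prop :=
  ∀ v w : E, τ ![Complex.I • v, Complex.I • w] = -τ ![v, w]

/-- The real `1`-form `v ↦ Re (γ (i v))`. -/
def reI (γ : E →L[ℂ] ℂ) : E →L[ℝ] ℝ := (Complex.reCLM.comp (γ.restrictScalars ℝ)).comp (mulI E)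

theorem reI_apply (γ : E →L[ℂ] ℂ) (v : E) : reI γ v = -(γ v).im := by
  simp [reI, mulI_apply]

variable (E) in
-- Bundled as a continuous linear map, `reI` can be moved through derivatives.
def reICLM : (E →L[ℂ] ℂ) →L[ℝ] (E →L[ℝ] ℝ) :=
  ((ContinuousLinearMap.compL ℝ E E ℝ).flip (mulI E)).comp
    ((ContinuousLinearMap.compL ℝ E ℂ ℝ Complex.reCLM).comp
      (ContinuousLinearMap.restrictScalarsL ℂ E ℂ ℝ ℝ))

theorem reICLM_apply (γ : E →L[ℂ] ℂ) : reICLM E γ = reI γ := rfl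

/-- `reI γ` is minus the imaginary part of γ, and the derivative of a holomorphic γ is complex
bilinear, so multiplying both arguments by i multiplies it by -1. This is why a holomorphic
connection form contributes nothing to a degree. -/
theorem isAntiType_dOne_reI {γ : E → E →L[ℂ] ℂ} {y : E} (h : DifferentiableAt ℂ γ y) :
    IsAntiType (dOne (fun z => reI (γ z)) y) := by
  have hd : DifferentiableAt ℝ (fun z => reI (γ z)) y :=
    (reICLM E).differentiableAt.comp y (h.restrictScalars ℝ)
  have h1 : fderiv ℝ (fun z => reI (γ z)) y = (reICLM E).comp (fderiv ℝ γ y) :=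
    ((reICLM E).hasFDerivAt.comp y (h.restrictScalars ℝ).hasFDerivAt).fderiv
  intro v w
  rw [dOne_apply hd, dOne_apply hd, h1, fderiv_real_eq h]
  simp [reICLM_apply, reI_apply]
  ring

/-- For u = Re f the form du ∘ J is `reI` of df, and its exterior derivative antisymmetrizes the
second complex derivative of f, which is symmetric. -/
theorem iddbar_re_hol {f : E → ℂ} {y : E} (h : ContDiffAt ℂ 2 f y) :
    iddbar (fun z => (f z).re) y = 0 := by
  have h0 : ContDiffAt ℝ 2 (fun z => (f z).re) y :=
    Complex.reCLM.contDiff.contDiffAt.comp y (contDiffAt_real h)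
  have hd : DifferentiableAt ℂ (fderiv ℂ f) y :=
    (h.fderiv_right (m := 1) (by norm_num)).differentiableAt (by simp)
  rw [iddbar_eq]
  have h1 : dOne (fun z => (fderiv ℝ (fun z => (f z).re) z).comp (mulI E)) y =
      dOne (fun z => reI (fderiv ℂ f z)) y := by
    refine dOne_congr ?_
    filter_upwards [h.eventually (by simp)] with z hz
    have hz' := hz.differentiableAt (by simp)
    rw [reI, ← fderiv_real_eq hz']
    congr 1
    exact (Complex.reCLM.hasFDerivAt.comp z (hz'.restrictScalars ℝ).hasFDerivAt).fderiv
  have h2 : fderiv ℝ (fun z => reI (fderiv ℂ f z)) y =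
      (reICLM E).comp (fderiv ℝ (fderiv ℂ f) y) :=
    ((reICLM E).hasFDerivAt.comp y (hd.restrictScalars ℝ).hasFDerivAt).fderiv
  have hs : IsSymmSndFDerivAt ℂ f y := h.isSymmSndFDerivAt (by simp)
  rw [h1]
  ext v
  rw [ContinuousAlternatingMap.smul_apply,
    dOne_apply (γ := fun z => reI (fderiv ℂ f z)) ((reICLM E).differentiableAt.comp y (hd.restrictScalars ℝ)), h2, fderiv_real_eq hd]
  simp [reICLM_apply, reI_apply, hs (v 0) (v 1)]

/-- This is d log |f|² = 2 Re(df / f), the source of the factor 2 in front of the real parts of the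
connection forms. -/
theorem fderiv_log_normSq {f : E → ℂ} {y : E} (h : DifferentiableAt ℂ f y) (h0 : f y ≠ 0) :
    fderiv ℝ (fun z => Real.log (Complex.normSq (f z))) y =
      Complex.reCLM.comp ((((2 : ℂ) * (f y)⁻¹) • fderiv ℂ f y).restrictScalars ℝ) := by
  have hr : HasFDerivAt (fun z => (f z).re) (Complex.reCLM.comp (fderiv ℝ f y)) y :=
    Complex.reCLM.hasFDerivAt.comp y (h.restrictScalars ℝ).hasFDerivAt
  have hi : HasFDerivAt (fun z => (f z).im) (Complex.imCLM.comp (fderiv ℝ f y)) y :=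
    Complex.imCLM.hasFDerivAt.comp y (h.restrictScalars ℝ).hasFDerivAt
  have hn : HasFDerivAt (fun z => Complex.normSq (f z)) _ y := (hr.mul hr).add (hi.mul hi)
  have h1 := (hn.log (by simpa using h0)).fderiv
  rw [h1, fderiv_real_eq h]
  ext v
  have hns : Complex.normSq (f y) ≠ 0 := by simpa using h0
  simp only [smul_apply, add_apply,
    ContinuousLinearMap.comp_apply, ContinuousLinearMap.coe_restrictScalars', Complex.reCLM_apply,
    Complex.imCLM_apply, smul_eq_mul, Complex.mul_re, Complex.mul_im, Complex.inv_re,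
    Complex.inv_im, Complex.re_ofNat, Complex.im_ofNat]
  field_simp
  ring

theorem contDiffAt_log_normSq {f : E → ℂ} {y : E} {n : ℕ∞ω} (h : ContDiffAt ℝ n f y) (h0 : f y ≠ 0) :
    ContDiffAt ℝ n (fun z => Real.log (Complex.normSq (f z))) y := by
  have hr : ContDiffAt ℝ n (fun z => (f z).re) y := Complex.reCLM.contDiff.contDiffAt.comp y h
  have hi : ContDiffAt ℝ n (fun z => (f z).im) y := Complex.imCLM.contDiff.contDiffAt.comp y h
  exact ((hr.mul hr).add (hi.mul hi)).log (by
    rw [← Complex.normSq_apply]; simpa using h0)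

/-- Locally log |f|² is twice the real part of a branch of log f, up to a constant. This makes Chern
forms independent of the trivialization. -/
theorem iddbar_log_normSq {f : E → ℂ} {y : E} (h : ContDiffAt ℂ 2 f y) (h0 : f y ≠ 0) :
    iddbar (fun z => Real.log (Complex.normSq (f z))) y = 0 := by
  -- Division by `f y` moves the value at y to 1, where the principal branch of the logarithm is
  -- holomorphic.
  have h1 : ContDiffAt ℂ 2 (fun z => Complex.log (f z / f y)) y := by
    refine (Complex.contDiffAt_log ?_).comp y (h.div_const (f y))
    simp [div_self h0]
  have hne : ∀ᶠ z in 𝓝 y, f z ≠ 0 := h.continuousAt.eventually_ne h0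
  have h2 : (fun z => Real.log (Complex.normSq (f z))) =ᶠ[𝓝 y]
      fun z => 2 * (Complex.log (f z / f y)).re + Real.log (Complex.normSq (f y)) := by
    filter_upwards [hne] with z hz
    rw [Complex.log_re, norm_div, Real.log_div (by simpa using hz) (by simpa using h0),
      Complex.normSq_eq_norm_sq, Complex.normSq_eq_norm_sq, Real.log_pow, Real.log_pow]
    push_cast; ring
  have h3 : ContDiffAt ℝ 2 (fun z => (Complex.log (f z / f y)).re) y :=
    Complex.reCLM.contDiff.contDiffAt.comp y (contDiffAt_real h1)
  rw [iddbar_congr h2, iddbar_add (contDiffAt_const.mul h3) contDiffAt_const,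
    iddbar_const_smul 2 h3, iddbar_re_hol h1]
  ext v
  rw [smul_zero, zero_add, iddbar_apply contDiffAt_const]
  simp

/-- The nonnegative real `(1,1)`-form `i ∂u ∧ ∂̄u` (up to a positive factor) of a differential `p`. -/
def rankOne (p : E →L[ℝ] ℝ) : E [⋀^Fin 2]→L[ℝ] ℝ :=
  (-(1 / 2 : ℝ)) • skew (p.smulRight (p.comp (mulI E)))

theorem rankOne_apply (p : E →L[ℝ] ℝ) (v : Fin 2 → E) :
    rankOne p v = -(1 / 2) * (p (v 0) * p (mulI E (v 1)) - p (v 1) * p (mulI E (v 0))) := by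
  simp [rankOne, skew_apply]

theorem rankOne_smul (c : ℝ) (p : E →L[ℝ] ℝ) : rankOne (c • p) = c ^ 2 • rankOne p := by
  ext v; simp [rankOne_apply]; ring

/-- The product rule for χ'(w) dw ∘ J: differentiating the factor χ'(w) gives χ'' dw ⊗ (dw ∘ J),
whose antisymmetrization is the rank one form. -/
theorem iddbar_comp_real {χ χ' : ℝ → ℝ} {w : E → ℝ} {y : E} {χ'' : ℝ} (hw : ContDiffAt ℝ 2 w y)
    (h1 : ∀ᶠ t in 𝓝 (w y), HasDerivAt χ (χ' t) t) (h2 : HasDerivAt χ' χ'' (w y)) :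
    iddbar (fun z => χ (w z)) y = χ' (w y) • iddbar w y + χ'' • rankOne (fderiv ℝ w y) := by
  have e1 : ∀ᶠ z in 𝓝 y, (fderiv ℝ (fun z => χ (w z)) z).comp (mulI E) =
      χ' (w z) • (fderiv ℝ w z).comp (mulI E) := by
    filter_upwards [hw.continuousAt.eventually h1, hw.eventually (by simp)] with z hz hz'
    have := hz.comp_hasFDerivAt z (hz'.differentiableAt (by simp)).hasFDerivAt
    rw [← ContinuousLinearMap.smul_comp]
    congr 1
    exact this.fderiv
  have hd := (differentiableAt_fderiv_comp_mulI hw)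
  have e2 := (h2.comp_hasFDerivAt y (hw.differentiableAt (by simp)).hasFDerivAt)
  have e3 := e2.smul hd.hasFDerivAt
  rw [iddbar_eq, dOne_congr e1, iddbar_eq, dOne_eq_skew hd,
    dOne_eq_skew (γ := fun z => χ' (w z) • (fderiv ℝ w z).comp (mulI E)) e3.differentiableAt]
  rw [show fderiv ℝ (fun z => χ' (w z) • (fderiv ℝ w z).comp (mulI E)) y = _ from e3.fderiv]
  ext v
  simp only [Function.comp_apply, ContinuousAlternatingMap.smul_apply,
    ContinuousAlternatingMap.add_apply, skew_apply, rankOne_apply, add_apply,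
    smul_apply, ContinuousLinearMap.smulRight_apply,
    ContinuousLinearMap.comp_apply, smul_eq_mul]
  ring

end FormCalculus

/-! ### Wedge products of two-forms on a vector space. -/

section WedgeAlgebra

variable {T : Type*} [AddCommGroup T] [Module ℝ T] [TopologicalSpace T]

theorem wedgeTwoForms_apply {d : ℕ} (α : Fin d → T [⋀^Fin 2]→L[ℝ] ℝ) (v : Fin d × Fin 2 → T) :
    wedgeTwoForms α v = (1 / 2 : ℝ) ^ d * ∑ σ : Equiv.Perm (Fin d × Fin 2),
      ((Equiv.Perm.sign σ : ℤ) : ℝ) * ∏ k, α k ![v (σ (k, 0)), v (σ (k, 1))] := by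
  have h : ∀ f : Fin 2 → T, f = ![f 0, f 1] := fun f => by
    ext i; fin_cases i <;> rfl
  simp only [wedgeTwoForms, AlternatingMap.smul_apply, MultilinearMap.alternatization_apply,
    smul_eq_mul]
  congr 1
  refine Finset.sum_congr rfl fun σ _ => ?_
  rw [Units.smul_def, zsmul_eq_mul]
  congr 1
  change ∏ k, α k (fun j => v (σ (k, j))) = _
  exact Finset.prod_congr rfl fun k _ => congrArg (α k) (h fun j => v (σ (k, j)))

/-- The wedge product `τ ∧ κ ∧ ⋯ ∧ κ` with `d - 1` factors `κ`. -/
def wedgePow (d : ℕ) (τ k : T [⋀^Fin 2]→L[ℝ] ℝ) : T [⋀^(Fin d × Fin 2)]→ₗ[ℝ] ℝ :=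
  wedgeTwoForms fun i : Fin d => if (i : ℕ) = 0 then τ else k

theorem prod_first {d : ℕ} (hd : 0 < d) (f g : Fin d → ℝ) :
    ∏ i : Fin d, (if (i : ℕ) = 0 then f i else g i) =
      f ⟨0, hd⟩ * ∏ i ∈ Finset.univ.erase (⟨0, hd⟩ : Fin d), g i := by
  rw [← Finset.mul_prod_erase _ _ (Finset.mem_univ (⟨0, hd⟩ : Fin d)), if_pos rfl]
  congr 1
  refine Finset.prod_congr rfl fun i hi => if_neg fun h => ?_
  exact Finset.ne_of_mem_erase hi (Fin.ext h)

theorem wedgePow_apply {d : ℕ} (hd : 0 < d) (τ k : T [⋀^Fin 2]→L[ℝ] ℝ) (v : Fin d × Fin 2 → T) :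
    wedgePow d τ k v = (1 / 2 : ℝ) ^ d * ∑ σ : Equiv.Perm (Fin d × Fin 2),
      ((Equiv.Perm.sign σ : ℤ) : ℝ) * (τ ![v (σ (⟨0, hd⟩, 0)), v (σ (⟨0, hd⟩, 1))] *
        ∏ i ∈ Finset.univ.erase (⟨0, hd⟩ : Fin d), k ![v (σ (i, 0)), v (σ (i, 1))]) := by
  rw [wedgePow, wedgeTwoForms_apply]
  congr 1
  refine Finset.sum_congr rfl fun σ _ => ?_
  congr 1
  rw [← prod_first hd (fun i => τ ![v (σ (i, 0)), v (σ (i, 1))])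
    (fun i => k ![v (σ (i, 0)), v (σ (i, 1))])]
  refine Finset.prod_congr rfl fun i _ => ?_
  split_ifs <;> rfl

theorem wedgePow_add {d : ℕ} (hd : 0 < d) (τ τ' k : T [⋀^Fin 2]→L[ℝ] ℝ) :
    wedgePow d (τ + τ') k = wedgePow d τ k + wedgePow d τ' k := by
  ext v
  rw [AlternatingMap.add_apply, wedgePow_apply hd, wedgePow_apply hd, wedgePow_apply hd, ← mul_add,
    ← Finset.sum_add_distrib]
  congr 1
  refine Finset.sum_congr rfl fun σ _ => ?_
  rw [ContinuousAlternatingMap.add_apply]; ring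

theorem wedgePow_smul {d : ℕ} (hd : 0 < d) (c : ℝ) (τ k : T [⋀^Fin 2]→L[ℝ] ℝ) :
    wedgePow d (c • τ) k = c • wedgePow d τ k := by
  ext v
  rw [AlternatingMap.smul_apply, wedgePow_apply hd, wedgePow_apply hd, smul_eq_mul,
    Finset.mul_sum, Finset.mul_sum, Finset.mul_sum]
  refine Finset.sum_congr rfl fun σ _ => ?_
  rw [ContinuousAlternatingMap.smul_apply, smul_eq_mul]; ring

theorem wedgePow_zero {d : ℕ} (hd : 0 < d) (k : T [⋀^Fin 2]→L[ℝ] ℝ) : wedgePow d 0 k = 0 := by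
  ext v
  rw [wedgePow_apply hd]
  simp

theorem wedgePow_comp {T' : Type*} [AddCommGroup T'] [Module ℝ T'] [TopologicalSpace T'] {d : ℕ}
    (τ k : T [⋀^Fin 2]→L[ℝ] ℝ) (f : T' →L[ℝ] T) (v : Fin d × Fin 2 → T') :
    wedgePow d (τ.compContinuousLinearMap f) (k.compContinuousLinearMap f) v =
      wedgePow d τ k fun i => f (v i) := by
  rw [wedgePow, wedgePow, wedgeTwoForms_apply, wedgeTwoForms_apply]
  congr 1
  refine Finset.sum_congr rfl fun σ _ => ?_
  congr 1
  refine Finset.prod_congr rfl fun i _ => ?_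
  have h : ∀ (β : T [⋀^Fin 2]→L[ℝ] ℝ) (a b : T'),
      β.compContinuousLinearMap f ![a, b] = β ![f a, f b] := fun β a b => by
    rw [ContinuousAlternatingMap.compContinuousLinearMap_apply]
    congr 1
    ext j; fin_cases j <;> rfl
  split_ifs <;> exact h _ _ _

/-- Such a permutation permutes the pairs and acts inside each of them. The permutation of the pairs
moves both members of a pair alike, so its sign occurs squared and drops out. -/
theorem pair_preserving_perm {d : ℕ} (σ : Equiv.Perm (Fin d × Fin 2))
    (h : ∀ k, (σ (k, 0)).1 = (σ (k, 1)).1) :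
    ∃ (ϖ : Equiv.Perm (Fin d)) (τ : Fin d → Equiv.Perm (Fin 2)),
      (∀ k j, σ (k, j) = (ϖ k, τ k j)) ∧ Equiv.Perm.sign σ = ∏ k, Equiv.Perm.sign (τ k) := by
  have h1 : ∀ k j, (σ (k, j)).1 = (σ (k, 0)).1 := fun k j => by
    fin_cases j
    · rfl
    · exact (h k).symm
  have hinj : ∀ k, Function.Injective fun j => (σ (k, j)).2 := fun k j j' hj => by
    have := σ.injective (a₁ := (k, j)) (a₂ := (k, j')) (Prod.ext ((h1 k j).trans (h1 k j').symm) hj)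
    exact congrArg Prod.snd this
  let τ : Fin d → Equiv.Perm (Fin 2) := fun k =>
    Equiv.ofBijective _ (Finite.injective_iff_bijective.1 (hinj k))
  have hϖ : Function.Injective fun k => (σ (k, 0)).1 := fun k k' hk => by
    obtain ⟨j, hj⟩ := (τ k).surjective (σ (k', 0)).2
    have := σ.injective (a₁ := (k, j)) (a₂ := (k', 0)) (Prod.ext ((h1 k j).trans hk) hj)
    exact congrArg Prod.fst this
  let ϖ : Equiv.Perm (Fin d) := Equiv.ofBijective _ (Finite.injective_iff_bijective.1 hϖ)
  have hσ : ∀ k j, σ (k, j) = (ϖ k, τ k j) := fun k j => Prod.ext (h1 k j) rfl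
  refine ⟨ϖ, τ, hσ, ?_⟩
  have e : σ = (Equiv.prodCongrLeft fun _ : Fin 2 => ϖ) * Equiv.prodCongrRight τ := by
    ext1 ⟨k, j⟩
    rw [hσ]; rfl
  rw [e, Equiv.Perm.sign_mul, Equiv.Perm.sign_prodCongrLeft, Equiv.Perm.sign_prodCongrRight]
  simp

/-- When the forms vanish on vectors from different pairs, only permutations preserving pairs
contribute. Each contributes a nonnegative product, since its sign cancels the signs coming from
antisymmetry of the factors. The bound keeps the identity alone. -/
theorem wedgeTwoForms_diagonal {d : ℕ} (α : Fin d → T [⋀^Fin 2]→L[ℝ] ℝ) (v : Fin d × Fin 2 → T)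
    (hoff : ∀ k a b, a.1 ≠ b.1 → α k ![v a, v b] = 0)
    (hdiag : ∀ k i, 0 ≤ α k ![v (i, 0), v (i, 1)]) :
    (1 / 2 : ℝ) ^ d * ∏ k, α k ![v (k, 0), v (k, 1)] ≤ wedgeTwoForms α v := by
  rw [wedgeTwoForms_apply]
  refine mul_le_mul_of_nonneg_left ?_ (by positivity)
  have hterm : ∀ σ : Equiv.Perm (Fin d × Fin 2),
      0 ≤ ((Equiv.Perm.sign σ : ℤ) : ℝ) * ∏ k, α k ![v (σ (k, 0)), v (σ (k, 1))] := by
    intro σ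
    by_cases h : ∀ k, (σ (k, 0)).1 = (σ (k, 1)).1
    · obtain ⟨ϖ, τ, hσ, hs⟩ := pair_preserving_perm σ h
      rw [hs]
      push_cast
      rw [← Finset.prod_mul_distrib]
      refine Finset.prod_nonneg fun k _ => ?_
      rw [hσ, hσ]
      have h2 := (α k).toAlternatingMap.map_perm ![v (ϖ k, 0), v (ϖ k, 1)] (τ k)
      have h3 : (![v (ϖ k, 0), v (ϖ k, 1)] ∘ τ k) = ![v (ϖ k, τ k 0), v (ϖ k, τ k 1)] := by
        have : ![v (ϖ k, 0), v (ϖ k, 1)] = fun j => v (ϖ k, j) := by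
          ext j; fin_cases j <;> rfl
        rw [this]
        ext j; fin_cases j <;> rfl
      rw [h3] at h2
      have h4 : α k ![v (ϖ k, τ k 0), v (ϖ k, τ k 1)] =
          ((Equiv.Perm.sign (τ k) : ℤ) : ℝ) * α k ![v (ϖ k, 0), v (ϖ k, 1)] := by
        refine Eq.trans h2 ?_
        rw [Units.smul_def, zsmul_eq_mul]; rfl
      rw [h4, ← mul_assoc]
      refine mul_nonneg ?_ (hdiag k _)
      exact mul_self_nonneg _
    · push Not at h
      obtain ⟨k, hk⟩ := h
      rw [Finset.prod_eq_zero (Finset.mem_univ k) (hoff k _ _ hk), mul_zero]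
  refine le_trans (le_of_eq ?_) (Finset.single_le_sum (fun σ _ => hterm σ)
    (Finset.mem_univ (1 : Equiv.Perm (Fin d × Fin 2))))
  simp

/-- Every alternating form of top degree is a multiple of the determinant of a basis. -/
theorem map_frame_eq_det {ι : Type*} [Fintype ι] [DecidableEq ι] (g : T [⋀^ι]→ₗ[ℝ] ℝ)
    (b : Module.Basis ι ℝ T) (f : T →ₗ[ℝ] T) : g (fun i => f (b i)) = LinearMap.det f * g b := by
  have h := DFunLike.congr_fun (g.eq_smul_basis_det b) fun i => f (b i)
  rw [h, AlternatingMap.smul_apply, smul_eq_mul, show (fun i => f (b i)) = f ∘ b from rfl,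
    b.det_comp, b.det_self]
  ring

end WedgeAlgebra

/-! ### Complex bases and the real frames they define. -/

section ComplexFrames

variable {V : Type*} [AddCommGroup V] [Module ℂ V]

/-- The real frame `b₁, i b₁, …, b_d, i b_d` of a complex basis `b`. -/
def frameOf {d : ℕ} (b : Fin d → V) (i : Fin d × Fin 2) : V :=
  if i.2 = 0 then b i.1 else Complex.I • b i.1

/-- The real basis `b₁, i b₁, …, b_d, i b_d` of a complex basis `b`. -/
def realBasis {d : ℕ} (b : Module.Basis (Fin d) ℂ V) : Module.Basis (Fin d × Fin 2) ℝ V :=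
  (Complex.basisOneI.smulTower b).reindex (Equiv.prodComm _ _)

theorem realBasis_apply {d : ℕ} (b : Module.Basis (Fin d) ℂ V) (i : Fin d × Fin 2) :
    realBasis b i = frameOf b i := by
  rcases i with ⟨k, j⟩
  fin_cases j <;> simp [realBasis, frameOf, Module.Basis.smulTower_apply]

/-- The real determinant is the norm, from ℂ to ℝ, of the complex one. Its nonnegativity is what
makes complex manifolds canonically oriented. -/
theorem det_restrictScalars_eq_normSq (f : V →ₗ[ℂ] V) [FiniteDimensional ℂ V] :
    LinearMap.det (f.restrictScalars ℝ) = Complex.normSq (LinearMap.det f) := by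
  rw [LinearMap.det_restrictScalars, Algebra.norm_complex_apply]

theorem map_frameOf_eq_normSq_det [FiniteDimensional ℂ V] {d : ℕ}
    (g : V [⋀^(Fin d × Fin 2)]→ₗ[ℝ] ℝ)
    (b : Module.Basis (Fin d) ℂ V) (f : V →ₗ[ℂ] V) :
    g (fun i => f (frameOf b i)) = Complex.normSq (LinearMap.det f) * g (frameOf b) := by
  let _ : TopologicalSpace V := ⊥
  have h := map_frame_eq_det g (realBasis b) (f.restrictScalars ℝ)
  rw [det_restrictScalars_eq_normSq] at h
  simpa only [realBasis_apply, LinearMap.coe_restrictScalars,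
    show (⇑(realBasis b) : _ → V) = frameOf b from funext (realBasis_apply b)] using h

theorem frameOf_map {d : ℕ} (f : V →ₗ[ℂ] V) (b : Fin d → V) (i : Fin d × Fin 2) :
    f (frameOf b i) = frameOf (fun k => f (b k)) i := by
  unfold frameOf
  split_ifs <;> simp

/-- For ℓ ≠ 0 the first vector is the normalized Riesz vector of ℓ, whose orthogonal complement is
the kernel of ℓ. The index 0 is singled out to match the position of the special factor in
`wedgePow`. -/
theorem exists_orthogonal_basis_of_core [FiniteDimensional ℂ V] (c : InnerProductSpace.Core ℂ V)
    {d : ℕ} (hd : Module.finrank ℂ V = d) (ℓ : V →ₗ[ℂ] ℂ) :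
    ∃ b : Module.Basis (Fin d) ℂ V, (∀ i j, i ≠ j → c.inner (b i) (b j) = 0) ∧
      ∀ j : Fin d, (j : ℕ) ≠ 0 → ℓ (b j) = 0 := by
  let _ : NormedAddCommGroup V := @InnerProductSpace.Core.toNormedAddCommGroup ℂ V _ _ _ c
  let _ : InnerProductSpace ℂ V := InnerProductSpace.ofCore c.toCore
  by_cases hℓ : ℓ = 0
  · subst hd
    refine ⟨(stdOrthonormalBasis ℂ V).toBasis, fun i j hij => ?_, by simp [hℓ]⟩
    have := (stdOrthonormalBasis ℂ V).orthonormal.2 hij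
    simpa using this
  · obtain ⟨a, ha⟩ := (InnerProductSpace.toDual ℂ V).surjective (LinearMap.toContinuousLinearMap ℓ)
    have ha' : ∀ v, inner ℂ a v = ℓ v := fun v => by
      rw [← InnerProductSpace.toDual_apply_apply, ha]; rfl
    have ha0 : a ≠ 0 := by
      rintro rfl
      exact hℓ (LinearMap.ext fun v => by rw [← ha' v]; simp)
    have hu : ‖((‖a‖ : ℂ)⁻¹ • a)‖ = 1 := by
      rw [norm_smul, norm_inv, Complex.norm_real, norm_norm, inv_mul_cancel₀ (norm_ne_zero_iff.2 ha0)]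
    have hd0 : 0 < d := by
      rw [← hd]
      exact Module.finrank_pos_iff_exists_ne_zero.2 ⟨a, ha0⟩
    obtain ⟨b, hb⟩ := Orthonormal.exists_orthonormalBasis_extension_of_card_eq (𝕜 := ℂ)
      (ι := Fin d) (v := fun _ => (‖a‖ : ℂ)⁻¹ • a) (s := {⟨0, hd0⟩}) (by simpa using hd)
      (by
        constructor
        · rintro ⟨i, hi⟩; exact hu
        · rintro ⟨i, hi⟩ ⟨j, hj⟩ hij
          exact absurd (Subtype.ext (hi.trans hj.symm)) hij)
    have hb0 : b ⟨0, hd0⟩ = (‖a‖ : ℂ)⁻¹ • a := hb _ rfl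
    refine ⟨b.toBasis, fun i j hij => ?_, fun j hj => ?_⟩
    · have := b.orthonormal.2 hij
      simpa using this
    · have h1 := b.orthonormal.2 (show (⟨0, hd0⟩ : Fin d) ≠ j from fun h => hj (by rw [← h]))
      beta_reduce at h1
      rw [hb0, inner_smul_left, ha'] at h1
      simpa [ha0] using h1

end ComplexFrames

/-! ### Positivity and type of wedge products with powers of a Kähler form. -/

section Positivity

variable {E : Type*} [NormedAddCommGroup E] [NormedSpace ℂ E] [FiniteDimensional ℂ E]

theorem realFrame_eq : realFrame E = frameOf (Module.finBasis ℂ E) := rfl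

theorem two_form_skew (k : E [⋀^Fin 2]→L[ℝ] ℝ) (v w : E) : k ![v, w] = -k ![w, v] := by
  have := k.toAlternatingMap.map_swap ![w, v] (show (0 : Fin 2) ≠ 1 by simp)
  refine Eq.trans ?_ this
  change _ = k _
  congr 1
  ext j; fin_cases j <;> simp

theorem two_form_add_left (k : E [⋀^Fin 2]→L[ℝ] ℝ) (u v w : E) :
    k ![u + v, w] = k ![u, w] + k ![v, w] := by
  have h : ∀ z : E, Function.update ![u, w] 0 z = ![z, w] := fun z => by
    ext j; fin_cases j <;> simp
  have := k.toAlternatingMap.map_update_add ![u, w] 0 u v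
  rwa [h, h, h] at this

theorem two_form_smul_left (k : E [⋀^Fin 2]→L[ℝ] ℝ) (c : ℝ) (v w : E) :
    k ![c • v, w] = c * k ![v, w] := by
  have h : ∀ z : E, Function.update ![v, w] 0 z = ![z, w] := fun z => by
    ext j; fin_cases j <;> simp
  have := k.toAlternatingMap.map_update_smul ![v, w] 0 c v
  rwa [h, h] at this

theorem two_form_smul_right (k : E [⋀^Fin 2]→L[ℝ] ℝ) (c : ℝ) (v w : E) :
    k ![w, c • v] = c * k ![w, v] := by
  rw [two_form_skew, two_form_smul_left, two_form_skew k v]; ring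

theorem two_form_neg_right (k : E [⋀^Fin 2]→L[ℝ] ℝ) (v w : E) : k ![w, -v] = -k ![w, v] := by
  have := two_form_smul_right k (-1) v w
  simpa using this

/-- The Hermitian inner product of a positive real `(1,1)`-form. -/
@[reducible]
def coreOfForm (k : E [⋀^Fin 2]→L[ℝ] ℝ)
    (h11 : ∀ v w : E, k ![Complex.I • v, Complex.I • w] = k ![v, w])
    (hpos : ∀ v : E, v ≠ 0 → 0 < k ![v, Complex.I • v]) : InnerProductSpace.Core ℂ E where
  inner v w := ⟨k ![v, Complex.I • w], k ![v, w]⟩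
  conj_inner_symm v w := by
    apply Complex.ext
    · change k ![w, Complex.I • v] = k ![v, Complex.I • w]
      rw [← h11, smul_smul, Complex.I_mul_I, neg_one_smul, two_form_neg_right, two_form_skew, neg_neg]
    · change -k ![w, v] = k ![v, w]
      rw [two_form_skew, neg_neg]
  re_inner_nonneg v := by
    by_cases hv : v = 0
    · subst hv
      change 0 ≤ k ![0, Complex.I • 0]
      have := two_form_smul_left k 0 0 (Complex.I • (0 : E))
      rw [zero_smul, zero_mul] at this
      rw [this]
    · exact (hpos v hv).le
  add_left u v w := by
    apply Complex.ext
    · exact two_form_add_left k u v _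
    · exact two_form_add_left k u v _
  smul_left v w c := by
    have hc : c • v = c.re • v + c.im • (Complex.I • v) := by
      conv_lhs => rw [← Complex.re_add_im c]
      rw [add_smul, mul_smul]; rfl
    have e1 : ∀ w, k ![Complex.I • v, w] = -k ![v, Complex.I • w] := fun w => by
      rw [← h11 v, smul_smul, Complex.I_mul_I, neg_one_smul, two_form_neg_right, neg_neg]
    apply Complex.ext
    · change k ![c • v, Complex.I • w] = _
      rw [hc, two_form_add_left, two_form_smul_left, two_form_smul_left, h11]
      simp
    · change k ![c • v, w] = _
      rw [hc, two_form_add_left, two_form_smul_left, two_form_smul_left, e1]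
      simp
  definite v hv := by
    by_contra h0
    have h1 := hpos v h0
    have h2 : k ![v, Complex.I • v] = 0 := congrArg Complex.re hv
    exact h1.ne' h2

theorem exists_linearMap_frameOf {d : ℕ} (b b' : Module.Basis (Fin d) ℂ E) :
    ∃ f : E ≃ₗ[ℂ] E, ∀ i, frameOf b' i = f (frameOf b i) := by
  refine ⟨b.equiv b' (Equiv.refl _), fun i => ?_⟩
  have := frameOf_map (b.equiv b' (Equiv.refl _)).toLinearMap b i
  refine Eq.trans ?_ this.symm
  congr 1
  ext k
  simp

/-- Two complex bases differ by a complex automorphism, whose real determinant |det|² is positive,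
so the sign of a top form may be tested on any complex basis. -/
theorem top_form_pos_iff {d : ℕ} (g : E [⋀^(Fin d × Fin 2)]→ₗ[ℝ] ℝ)
    (b b' : Module.Basis (Fin d) ℂ E) : ∃ c : ℝ, 0 < c ∧ g (frameOf b') = c * g (frameOf b) := by
  obtain ⟨f, hf⟩ := exists_linearMap_frameOf b b'
  refine ⟨_, Complex.normSq_pos.2 f.isUnit_det'.ne_zero, ?_⟩
  rw [← map_frameOf_eq_normSq_det g b f.toLinearMap]
  congr 1
  ext i
  exact hf i

/-- The positivity of `i ∂u ∧ ∂̄u ∧ κ^{d-1}`. -/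
theorem wedgePow_rankOne {d : ℕ} (hd : Module.finrank ℂ E = d) (k : E [⋀^Fin 2]→L[ℝ] ℝ)
    (h11 : ∀ v w : E, k ![Complex.I • v, Complex.I • w] = k ![v, w])
    (hpos : ∀ v : E, v ≠ 0 → 0 < k ![v, Complex.I • v]) (p : E →L[ℝ] ℝ)
    (b : Module.Basis (Fin d) ℂ E) :
    0 ≤ wedgePow d (rankOne p) k (frameOf b) ∧
      (p ≠ 0 → 0 < wedgePow d (rankOne p) k (frameOf b)) := by
  -- The complex linear form with real part p. Its kernel consists of the vectors killed by both p
  -- and p ∘ J.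
  let ℓ : E →ₗ[ℂ] ℂ :=
    { toFun := fun v => (p v : ℂ) - Complex.I * (p (Complex.I • v) : ℂ)
      map_add' := fun v w => by simp; ring
      map_smul' := fun c v => by
        have hc : c • v = c.re • v + c.im • (Complex.I • v) := by
          conv_lhs => rw [← Complex.re_add_im c]
          rw [add_smul, mul_smul]; rfl
        have hc' : Complex.I • c • v = c.re • (Complex.I • v) - c.im • v := by
          rw [hc, smul_add, smul_comm, smul_comm Complex.I c.im, smul_smul Complex.I Complex.I,
            Complex.I_mul_I, neg_one_smul, smul_neg, sub_eq_add_neg]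
        rw [hc', hc]
        simp only [map_add, map_sub, map_smul, smul_eq_mul, RingHom.id_apply]
        conv_rhs => rw [← Complex.re_add_im c]
        push_cast
        linear_combination ((c.im : ℂ) * (p (Complex.I • v) : ℂ)) * Complex.I_sq }
  obtain ⟨e, he, hℓ⟩ := exists_orthogonal_basis_of_core (coreOfForm k h11 hpos) hd ℓ
  have hre : ∀ i j, i ≠ j → k ![e i, Complex.I • e j] = 0 := fun i j hij =>
    congrArg Complex.re (he i j hij)
  have him : ∀ i j, i ≠ j → k ![e i, e j] = 0 := fun i j hij => congrArg Complex.im (he i j hij)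
  -- All frame vectors outside the first pair are killed by p and p ∘ J, so `rankOne p` sees the
  -- first pair only.
  have hp : ∀ j : Fin d, (j : ℕ) ≠ 0 → ∀ s : Fin 2,
      p (frameOf e (j, s)) = 0 ∧ p (mulI E (frameOf e (j, s))) = 0 := by
    intro j hj s
    have h1 : p (e j) = 0 := by simpa [ℓ] using congrArg Complex.re (hℓ j hj)
    have h2 : p (Complex.I • e j) = 0 := by simpa [ℓ] using congrArg Complex.im (hℓ j hj)
    fin_cases s
    · simpa [frameOf, mulI_apply] using ⟨h1, h2⟩
    · simpa [frameOf, mulI_apply, smul_smul] using ⟨h2, h1⟩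
  have hr0 : ∀ i, 0 ≤ rankOne p ![frameOf e (i, 0), frameOf e (i, 1)] := fun i => by
    simp only [rankOne_apply, frameOf, mulI_apply]
    simp [smul_smul]
    nlinarith [sq_nonneg (p (e i)), sq_nonneg (p (Complex.I • e i))]
  have hne : ∀ i, e i ≠ 0 := fun i => e.ne_zero i
  -- In the orthogonal frame each factor vanishes on vectors of different pairs and is nonnegative
  -- on every pair.
  have hmain := wedgeTwoForms_diagonal (T := E)
    (fun i : Fin d => if (i : ℕ) = 0 then rankOne p else k) (frameOf e) (by
      rintro i ⟨a, s⟩ ⟨a', s'⟩ hab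
      have hab' : a ≠ a' := hab
      split_ifs with hi
      · by_cases ha : (a : ℕ) = 0
        · have ha' : (a' : ℕ) ≠ 0 := fun h => hab' (Fin.ext (ha.trans h.symm))
          simp [rankOne_apply, hp a' ha']
        · simp [rankOne_apply, hp a ha]
      · fin_cases s <;> fin_cases s' <;> simp [frameOf]
        · exact him _ _ hab'
        · exact hre _ _ hab'
        · rw [two_form_skew, hre _ _ hab'.symm, neg_zero]
        · rw [h11]; exact him _ _ hab') (by
      intro i a
      split_ifs with hi
      · exact hr0 a
      · simpa [frameOf] using (hpos _ (hne a)).le)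
  obtain ⟨c, hc, hcb⟩ := top_form_pos_iff (wedgePow d (rankOne p) k) e b
  have hnn : 0 ≤ wedgePow d (rankOne p) k (frameOf e) := by
    refine le_trans (mul_nonneg (by positivity) (Finset.prod_nonneg fun i _ => ?_)) hmain
    split_ifs
    · exact hr0 i
    · simpa [frameOf] using (hpos _ (hne i)).le
  refine ⟨by rw [hcb]; positivity, fun hp0 => ?_⟩
  rw [hcb]
  refine mul_pos hc (lt_of_lt_of_le ?_ hmain)
  refine mul_pos (by positivity) (Finset.prod_pos fun i _ => ?_)
  split_ifs with hi
  -- On the pair (v, iv) the rank one form is (p(v)² + p(iv)²) / 2. Were it zero on the first pair,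
  -- p would vanish on a whole real basis.
  · by_contra hle
    apply hp0
    have hz : p (e i) = 0 ∧ p (Complex.I • e i) = 0 := by
      simp only [rankOne_apply, frameOf, mulI_apply] at hle
      simp [smul_smul] at hle
      constructor <;> nlinarith [sq_nonneg (p (e i)), sq_nonneg (p (Complex.I • e i))]
    have hz' : ∀ j s, p (frameOf e (j, s)) = 0 := fun j s => by
      by_cases hj : (j : ℕ) = 0
      · obtain rfl : j = i := Fin.ext (hj.trans hi.symm)
        fin_cases s
        · simpa [frameOf] using hz.1
        · simpa [frameOf] using hz.2
      · exact (hp j hj s).1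
    have := (realBasis e).ext (f₁ := p.toLinearMap) (f₂ := 0) fun ⟨j, s⟩ => by
      rw [realBasis_apply]; exact hz' j s
    ext v
    exact DFunLike.congr_fun this v
  · simpa [frameOf] using hpos _ (hne i)

/-- Pull back along J: κ is unchanged, τ changes sign, and the value on the frame is multiplied by
the real determinant of J, which is 1. So the value is its own negative. -/
theorem wedgePow_eq_zero_of_isAntiType (hd : 0 < Module.finrank ℂ E) (τ k : E [⋀^Fin 2]→L[ℝ] ℝ)
    (h11 : ∀ v w : E, k ![Complex.I • v, Complex.I • w] = k ![v, w]) (hτ : IsAntiType τ)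
    (b : Module.Basis (Fin (Module.finrank ℂ E)) ℂ E) :
    wedgePow (Module.finrank ℂ E) τ k (frameOf b) = 0 := by
  have h2 : ∀ f : Fin 2 → E, f = ![f 0, f 1] := fun f => by ext i; fin_cases i <;> rfl
  have hk : k.compContinuousLinearMap (mulI E) = k := by
    ext v
    rw [h2 v, ContinuousAlternatingMap.compContinuousLinearMap_apply, ← h11]
    congr 1
    ext j; fin_cases j <;> rfl
  have ht : τ.compContinuousLinearMap (mulI E) = (-1 : ℝ) • τ := by
    ext v
    rw [h2 v, ContinuousAlternatingMap.compContinuousLinearMap_apply,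
      ContinuousAlternatingMap.smul_apply, smul_eq_mul, neg_one_mul, ← hτ]
    congr 1
    ext j; fin_cases j <;> rfl
  have h := wedgePow_comp τ k (mulI E) (frameOf b)
  have h3 := map_frameOf_eq_normSq_det (wedgePow (Module.finrank ℂ E) τ k) b
    (Complex.I • LinearMap.id)
  have h4 : (Complex.normSq (LinearMap.det (Complex.I • (LinearMap.id : E →ₗ[ℂ] E)))) = 1 := by
    simp
  rw [h4, one_mul] at h3
  rw [hk, ht, wedgePow_smul hd, AlternatingMap.smul_apply] at h
  have h5 := h.trans h3
  rw [smul_eq_mul] at h5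
  linarith

end Positivity

/-! ### Stokes' theorem for forms γ ∧ κ^{d-1} in a complex vector space. -/

section LocalStokes

open MeasureTheory

theorem sum_perm_eq_zero_of_cycle {I : Type*} [Fintype I] [DecidableEq I] (c : Equiv.Perm I)
    (f : Equiv.Perm I → ℝ) (h : ∀ σ, f σ + f (σ * c) + f (σ * (c * c)) = 0) : ∑ σ, f σ = 0 := by
  have h1 : ∑ σ, f (σ * c) = ∑ σ, f σ := Equiv.sum_comp (Equiv.mulRight c) f
  have h2 : ∑ σ, f (σ * (c * c)) = ∑ σ, f σ := Equiv.sum_comp (Equiv.mulRight (c * c)) f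
  have h3 : ∑ σ, (f σ + f (σ * c) + f (σ * (c * c))) = 0 := Finset.sum_eq_zero fun σ _ => h σ
  rw [Finset.sum_add_distrib, Finset.sum_add_distrib, h1, h2] at h3
  linarith

/-- These are the terms of d(γ ∧ κ^{d-1}) in which the derivative falls on a factor κ. The 3-cycle c
through (z,0), (i,0), (i,1) is even and leaves the other arguments in place, so the terms of σ, σc
and σc² add up to a multiple of the cyclic sum in `hD`, which expresses closedness. -/
theorem sum_perm_closed_eq_zero {d : ℕ} (z : Fin d) (g : Fin d × Fin 2 → ℝ)
    (k : Fin d × Fin 2 → Fin d × Fin 2 → ℝ)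
    (Dk : Fin d × Fin 2 → Fin d × Fin 2 → Fin d × Fin 2 → ℝ)
    (hD : ∀ a b c, Dk a b c + Dk b c a + Dk c a b = 0) :
    ∑ σ : Equiv.Perm (Fin d × Fin 2), ((Equiv.Perm.sign σ : ℤ) : ℝ) * (g (σ (z, 1)) *
      ∑ i ∈ Finset.univ.erase z, (∏ j ∈ (Finset.univ.erase z).erase i, k (σ (j, 0)) (σ (j, 1))) *
        Dk (σ (z, 0)) (σ (i, 0)) (σ (i, 1))) = 0 := by
  simp only [Finset.mul_sum]
  rw [Finset.sum_comm]
  refine Finset.sum_eq_zero fun i hi => ?_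
  have hiz : i ≠ z := Finset.ne_of_mem_erase hi
  set c : Equiv.Perm (Fin d × Fin 2) := Equiv.swap (z, 0) (i, 0) * Equiv.swap (i, 0) (i, 1) with hc
  have c1 : c (z, 0) = (i, 0) := by
    simp [hc, Equiv.Perm.mul_apply, Equiv.swap_apply_def, hiz.symm]
  have c2 : c (i, 0) = (i, 1) := by
    simp [hc, Equiv.Perm.mul_apply, Equiv.swap_apply_def, hiz]
  have c3 : c (i, 1) = (z, 0) := by
    simp [hc, Equiv.Perm.mul_apply, Equiv.swap_apply_def]
  have c4 : c (z, 1) = (z, 1) := by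
    simp [hc, Equiv.Perm.mul_apply, Equiv.swap_apply_def, hiz.symm]
  have c5 : ∀ j s, j ≠ z → j ≠ i → c (j, s) = (j, s) := fun j s hz hji => by
    simp [hc, Equiv.Perm.mul_apply, Equiv.swap_apply_def, hz, hji]
  have hs : Equiv.Perm.sign c = 1 := by
    rw [hc, Equiv.Perm.sign_mul, Equiv.Perm.sign_swap (by simp [hiz.symm]),
      Equiv.Perm.sign_swap (by simp)]
    rfl
  refine sum_perm_eq_zero_of_cycle c _ fun σ => ?_
  have hp : ∀ τ : Equiv.Perm (Fin d × Fin 2),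
      (∀ j s, j ≠ z → j ≠ i → τ (j, s) = σ (j, s)) →
      ∏ j ∈ (Finset.univ.erase z).erase i, k (τ (j, 0)) (τ (j, 1)) =
        ∏ j ∈ (Finset.univ.erase z).erase i, k (σ (j, 0)) (σ (j, 1)) := fun τ hτ =>
    Finset.prod_congr rfl fun j hj => by
      have h1 := Finset.ne_of_mem_erase hj
      have h2 := Finset.ne_of_mem_erase (Finset.mem_of_mem_erase hj)
      rw [hτ j 0 h2 h1, hτ j 1 h2 h1]
  rw [hp (σ * c) fun j s h1 h2 => by rw [Equiv.Perm.mul_apply, c5 j s h1 h2],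
    hp (σ * (c * c)) fun j s h1 h2 => by
      rw [Equiv.Perm.mul_apply, Equiv.Perm.mul_apply, c5 j s h1 h2, c5 j s h1 h2]]
  simp only [Equiv.Perm.sign_mul, hs, mul_one, Equiv.Perm.mul_apply, c1, c2, c3, c4]
  have h := hD (σ (z, 0)) (σ (i, 0)) (σ (i, 1))
  linear_combination (((Equiv.Perm.sign σ : ℤ) : ℝ) * g (σ (z, 1)) *
    ∏ j ∈ (Finset.univ.erase z).erase i, k (σ (j, 0)) (σ (j, 1))) * h

variable {E : Type*} [NormedAddCommGroup E] [NormedSpace ℂ E] [FiniteDimensional ℂ E]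

variable (E) in
/-- The coordinates `realCoord` as a continuous linear equivalence. -/
def realCoordCLE : (Fin (Module.finrank ℂ E) × Fin 2 → ℝ) ≃L[ℝ] E :=
  have : FiniteDimensional ℝ E := FiniteDimensional.complexToReal E
  (realBasis (Module.finBasis ℂ E)).equivFun.symm.toContinuousLinearEquiv

theorem realCoordCLE_apply (t : Fin (Module.finrank ℂ E) × Fin 2 → ℝ) :
    realCoordCLE E t = realCoord E t := by
  change (realBasis (Module.finBasis ℂ E)).equivFun.symm t = _
  rw [Module.Basis.equivFun_symm_apply, Fintype.sum_prod_type, realCoord]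
  refine Finset.sum_congr rfl fun k _ => ?_
  rw [Fin.sum_univ_two, realBasis_apply, realBasis_apply, add_smul, mul_smul]
  rfl

theorem realCoord_eq : realCoord E = realCoordCLE E := funext fun t => (realCoordCLE_apply t).symm

/-- Integration by parts against the constant function 1. -/
theorem integral_fderiv_eq_zero {W : Type*} [NormedAddCommGroup W] [NormedSpace ℝ W]
    [MeasurableSpace W] [BorelSpace W] [FiniteDimensional ℝ W] (μ : Measure W) [μ.IsAddHaarMeasure]
    {F : W → ℝ} (hF : ContDiff ℝ 1 F) (hc : HasCompactSupport F) (v : W) :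
    ∫ t, fderiv ℝ F t v ∂μ = 0 := by
  have h1 : Continuous fun t => fderiv ℝ F t v :=
    (hF.continuous_fderiv (by simp)).clm_apply continuous_const
  have h2 : HasCompactSupport fun t => fderiv ℝ F t v :=
    (hc.fderiv ℝ).comp_left (g := fun L : W →L[ℝ] ℝ => L v) (by simp)
  have h := integral_mul_fderiv_eq_neg_fderiv_mul_of_integrable (μ := μ) (f := fun _ => (1 : ℝ))
    (g := F) (v := v) (by simp) (by simpa using h1.integrable_of_hasCompactSupport h2)
    (by simpa using hF.continuous.integrable_of_hasCompactSupport hc)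
    (fun _ _ => differentiableAt_const _) (fun x _ => (hF.differentiable (by simp)).differentiableAt)
  simpa using h

theorem integral_realCoord_fderiv_eq_zero {F : E → ℝ} (hF : ContDiff ℝ 1 F)
    (hc : HasCompactSupport F) (v : E) : ∫ t, fderiv ℝ F (realCoord E t) v = 0 := by
  have h := integral_fderiv_eq_zero volume (F := F ∘ realCoordCLE E)
    (hF.comp (realCoordCLE E).contDiff)
    (hc.comp_homeomorph (realCoordCLE E).toHomeomorph) ((realCoordCLE E).symm v)
  rw [← h]
  congr 1
  ext t
  rw [fderiv_comp t (hF.differentiable (by simp)).differentiableAt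
    (realCoordCLE E).differentiableAt, (realCoordCLE E).fderiv, realCoord_eq]
  simp

theorem contDiff_of_support {W F : Type*} [NormedAddCommGroup W] [NormedSpace ℝ W]
    [NormedAddCommGroup F] [NormedSpace ℝ F] {f : W → F} {O : Set W} {n : ℕ∞ω} (hO : IsOpen O)
    (hf : ContDiffOn ℝ n f O) (hs : tsupport f ⊆ O) : ContDiff ℝ n f := by
  rw [contDiff_iff_contDiffAt]
  intro y
  by_cases hy : y ∈ O
  · exact hf.contDiffAt (hO.mem_nhds hy)
  · have : f =ᶠ[𝓝 y] 0 := by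
      rw [← notMem_tsupport_iff_eventuallyEq]
      exact fun h => hy (hs h)
    exact contDiffAt_const.congr_of_eventuallyEq this

theorem extDeriv_two_form_apply {k : E → E [⋀^Fin 2]→L[ℝ] ℝ} {y : E} (h : DifferentiableAt ℝ k y)
    (a b c : E) : extDeriv k y ![a, b, c] =
      fderiv ℝ k y a ![b, c] + fderiv ℝ k y b ![c, a] + fderiv ℝ k y c ![a, b] := by
  rw [extDeriv_apply h]
  simp only [fderiv_continuousAlternatingMap_apply_const h, Fin.sum_univ_three]
  have e0 : Fin.removeNth 0 ![a, b, c] = ![b, c] := by ext j; fin_cases j <;> rfl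
  have e1 : Fin.removeNth 1 ![a, b, c] = ![a, c] := by ext j; fin_cases j <;> rfl
  have e2 : Fin.removeNth 2 ![a, b, c] = ![a, b] := by ext j; fin_cases j <;> rfl
  refine (Fin.sum_univ_three _).trans ?_
  rw [e0, e1, e2]
  simp
  rw [two_form_skew _ a c]
  ring

theorem fderiv_apply_prod {γ : E → E →L[ℝ] ℝ} {k : E → E [⋀^Fin 2]→L[ℝ] ℝ} {y : E}
    (hγ : DifferentiableAt ℝ γ y) (hk : DifferentiableAt ℝ k y) {ι : Type*} [DecidableEq ι]
    (s : Finset ι) (b : E) (p q : ι → E) (v : E) :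
    fderiv ℝ (fun y => γ y b * ∏ i ∈ s, k y ![p i, q i]) y v =
      fderiv ℝ γ y v b * (∏ i ∈ s, k y ![p i, q i]) +
      γ y b * ∑ i ∈ s, (∏ j ∈ s.erase i, k y ![p j, q j]) * fderiv ℝ k y v ![p i, q i] := by
  have h1 : HasFDerivAt (fun y => γ y b) _ y := hγ.hasFDerivAt.clm_apply (hasFDerivAt_const b y)
  have h2 : ∀ i ∈ s, HasFDerivAt (fun y => k y ![p i, q i]) _ y := fun i _ =>
    hk.hasFDerivAt.continuousAlternatingMap_apply_const _
  have h3 := h1.mul (HasFDerivAt.finsetProd h2)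
  rw [show (fun y => γ y b * ∏ i ∈ s, k y ![p i, q i]) =
    (fun y => γ y b) * fun y => ∏ i ∈ s, k y ![p i, q i] from rfl, h3.fderiv]
  simp [ContinuousLinearMap.flip_apply]
  ring

theorem dOne_zero (y : E) : dOne (0 : E → E →L[ℝ] ℝ) y = 0 := by
  rw [dOne_eq_skew (γ := 0) (differentiableAt_const (0 : E →L[ℝ] ℝ))]
  ext v
  simp [skew_apply]

/-- The exterior derivative of `γ ∧ κ^{d-1}` in coordinates, for a closed `2`-form `κ`. -/
theorem wedgePow_dOne_eq_sum {γ : E → E →L[ℝ] ℝ} {k : E → E [⋀^Fin 2]→L[ℝ] ℝ} {y : E}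
    (hγ : DifferentiableAt ℝ γ y) (hk : DifferentiableAt ℝ k y) (hk0 : extDeriv k y = 0) {d : ℕ}
    (hd : 0 < d) (e : Fin d × Fin 2 → E) :
    wedgePow d (dOne γ y) (k y) e = (1 / 2 : ℝ) ^ d * ∑ σ : Equiv.Perm (Fin d × Fin 2),
      (2 * ((Equiv.Perm.sign σ : ℤ) : ℝ)) * fderiv ℝ (fun y => γ y (e (σ (⟨0, hd⟩, 1))) *
        ∏ i ∈ Finset.univ.erase (⟨0, hd⟩ : Fin d), k y ![e (σ (i, 0)), e (σ (i, 1))]) y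
          (e (σ (⟨0, hd⟩, 0))) := by
  set z : Fin d := ⟨0, hd⟩ with hz
  -- Closedness of κ removes the terms in which a factor κ is differentiated.
  have hcl := sum_perm_closed_eq_zero z (fun b => γ y (e b)) (fun a b => k y ![e a, e b])
    (fun a b c => fderiv ℝ k y (e a) ![e b, e c]) (fun a b c => by
      rw [← extDeriv_two_form_apply hk, hk0]; rfl)
  rw [wedgePow_apply hd]
  congr 1
  have h1 : ∀ σ : Equiv.Perm (Fin d × Fin 2), dOne γ y ![e (σ (z, 0)), e (σ (z, 1))] =
      fderiv ℝ γ y (e (σ (z, 0))) (e (σ (z, 1))) - fderiv ℝ γ y (e (σ (z, 1))) (e (σ (z, 0))) :=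
    fun σ => dOne_apply hγ _
  -- Exchanging the two arguments of dγ turns its second term into minus the first; this accounts
  -- for the factor 2 in the statement.
  have h2 : ∑ σ : Equiv.Perm (Fin d × Fin 2), ((Equiv.Perm.sign σ : ℤ) : ℝ) *
      (fderiv ℝ γ y (e (σ (z, 1))) (e (σ (z, 0))) *
        ∏ i ∈ Finset.univ.erase z, k y ![e (σ (i, 0)), e (σ (i, 1))]) =
      -∑ σ : Equiv.Perm (Fin d × Fin 2), ((Equiv.Perm.sign σ : ℤ) : ℝ) *
      (fderiv ℝ γ y (e (σ (z, 0))) (e (σ (z, 1))) *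
        ∏ i ∈ Finset.univ.erase z, k y ![e (σ (i, 0)), e (σ (i, 1))]) := by
    rw [← Equiv.sum_comp (Equiv.mulRight (Equiv.swap (z, (0 : Fin 2)) (z, 1))), ← Finset.sum_neg_distrib]
    refine Finset.sum_congr rfl fun σ _ => ?_
    rw [Equiv.coe_mulRight, Equiv.Perm.sign_mul, Equiv.Perm.sign_swap (by simp),
      Equiv.Perm.mul_apply, Equiv.Perm.mul_apply, Equiv.swap_apply_left, Equiv.swap_apply_right]
    have : ∏ i ∈ Finset.univ.erase z, k y ![e ((σ * Equiv.swap (z, 0) (z, 1) : Equiv.Perm (Fin d × Fin 2)) (i, 0)),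
        e ((σ * Equiv.swap (z, 0) (z, 1) : Equiv.Perm (Fin d × Fin 2)) (i, 1))] =
        ∏ i ∈ Finset.univ.erase z, k y ![e (σ (i, 0)), e (σ (i, 1))] :=
      Finset.prod_congr rfl fun i hi => by
        have hi' := Finset.ne_of_mem_erase hi
        rw [Equiv.Perm.mul_apply, Equiv.Perm.mul_apply,
          Equiv.swap_apply_of_ne_of_ne (by simp [hi']) (by simp [hi']),
          Equiv.swap_apply_of_ne_of_ne (by simp [hi']) (by simp [hi'])]
    rw [this]
    push_cast
    ring
  simp only [fderiv_apply_prod hγ hk]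
  rw [← hz]
  simp only [h1, sub_mul, mul_sub, mul_add, Finset.sum_sub_distrib, Finset.sum_add_distrib, h2]
  simp only [mul_assoc, ← Finset.mul_sum]
  rw [hcl]
  ring

/-- Stokes' theorem for `d (γ ∧ κ^{d-1})`, with `γ` compactly supported in an open set on which `κ`
is smooth and closed. -/
theorem integral_wedgePow_dOne_eq_zero (hd : 0 < Module.finrank ℂ E) {O : Set E} (hO : IsOpen O)
    {γ : E → E →L[ℝ] ℝ} {k : E → E [⋀^Fin 2]→L[ℝ] ℝ} (hγ : ContDiff ℝ 1 γ)
    (hc : HasCompactSupport γ) (hs : tsupport γ ⊆ O) (hk : ContDiffOn ℝ 1 k O)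
    (hk0 : ∀ y ∈ O, extDeriv k y = 0) :
    ∫ t in realCoord E ⁻¹' O, wedgePow (Module.finrank ℂ E) (dOne γ (realCoord E t))
      (k (realCoord E t)) (realFrame E) = 0 := by
  set z : Fin (Module.finrank ℂ E) := ⟨0, hd⟩ with hz
  -- The coefficients of γ ∧ κ^{d-1} in the real frame. They inherit from γ compact support inside
  -- O, and the density is a combination of their directional derivatives.
  let F : Equiv.Perm (Fin (Module.finrank ℂ E) × Fin 2) → E → ℝ := fun σ y =>
    γ y (realFrame E (σ (z, 1))) *
      ∏ i ∈ Finset.univ.erase z, k y ![realFrame E (σ (i, 0)), realFrame E (σ (i, 1))]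
  have hFs : ∀ σ, tsupport (F σ) ⊆ tsupport γ := fun σ => by
    refine closure_mono fun y hy => ?_
    intro h0
    apply hy
    simp only [F]
    rw [h0]; simp
  have hF : ∀ σ, ContDiff ℝ 1 (F σ) := fun σ => by
    refine contDiff_of_support hO ?_ ((hFs σ).trans hs)
    refine (hγ.contDiffOn.clm_apply contDiffOn_const).mul (contDiffOn_prod fun i _ => ?_)
    exact (ContinuousAlternatingMap.apply ℝ E ℝ _).contDiff.comp_contDiffOn hk
  have hFc : ∀ σ, HasCompactSupport (F σ) := fun σ =>
    hc.of_isClosed_subset (isClosed_tsupport _) (hFs σ)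
  rw [setIntegral_eq_integral_of_forall_compl_eq_zero]
  · have heq : ∀ t, wedgePow (Module.finrank ℂ E) (dOne γ (realCoord E t))
        (k (realCoord E t)) (realFrame E) = (1 / 2 : ℝ) ^ (Module.finrank ℂ E) *
        ∑ σ : Equiv.Perm (Fin (Module.finrank ℂ E) × Fin 2),
        (2 * ((Equiv.Perm.sign σ : ℤ) : ℝ)) * fderiv ℝ (F σ) (realCoord E t)
          (realFrame E (σ (z, 0))) := by
      intro t
      by_cases ht : realCoord E t ∈ O
      · exact wedgePow_dOne_eq_sum (hγ.differentiable (by simp)).differentiableAt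
          ((hk.contDiffAt (hO.mem_nhds ht)).differentiableAt (by simp)) (hk0 _ ht) hd (realFrame E)
      -- Off O nothing is known about k, but γ vanishes near the point and both sides are zero.
      · have h0 : γ =ᶠ[𝓝 (realCoord E t)] 0 := by
          rw [← notMem_tsupport_iff_eventuallyEq]
          exact fun h => ht (hs h)
        have h1 : dOne γ (realCoord E t) = 0 := by
          rw [dOne_congr h0, dOne_zero]
        have h2 : ∀ σ, fderiv ℝ (F σ) (realCoord E t) = 0 := fun σ => by
          have : F σ =ᶠ[𝓝 (realCoord E t)] fun _ => 0 := by
            filter_upwards [h0] with y hy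
            simp only [F]
            rw [hy]; simp
          rw [this.fderiv_eq]; simp
        rw [h1, wedgePow_zero hd]
        simp [h2]
    simp only [heq]
    rw [integral_const_mul, integral_finsetSum]
    · simp only [integral_const_mul]
      rw [Finset.sum_eq_zero fun σ _ => by
        rw [integral_realCoord_fderiv_eq_zero (hF σ) (hFc σ), mul_zero], mul_zero]
    · intro σ _
      refine Integrable.const_mul ?_ _
      have h1 : Continuous fun t => fderiv ℝ (F σ) (realCoord E t) (realFrame E (σ (z, 0))) := by
        rw [realCoord_eq]
        exact (((hF σ).continuous_fderiv (by simp)).comp (realCoordCLE E).continuous).clm_apply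
          continuous_const
      refine h1.integrable_of_hasCompactSupport ?_
      have h2 : HasCompactSupport fun y => fderiv ℝ (F σ) y (realFrame E (σ (z, 0))) :=
        ((hFc σ).fderiv ℝ).comp_left (g := fun L : E →L[ℝ] ℝ => L _) (by simp)
      have h3 := h2.comp_homeomorph (realCoordCLE E).toHomeomorph
      rw [realCoord_eq]
      exact h3
  · intro t ht
    have h0 : γ =ᶠ[𝓝 (realCoord E t)] 0 := by
      rw [← notMem_tsupport_iff_eventuallyEq]
      exact fun h => ht (hs h)
    have h1 : dOne γ (realCoord E t) = 0 := by
      rw [dOne_congr h0, dOne_zero]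
    rw [h1, wedgePow_zero hd]; rfl

end LocalStokes

/-! ### Forms on X read in charts. -/

section ChartCalculus

variable {E : Type*} [NormedAddCommGroup E] [NormedSpace ℂ E]
  {X : Type*} [TopologicalSpace X] [ChartedSpace E X]

theorem contDiffOn_transition [IsManifold 𝓘(ℂ, E) ω X] {e e' : OpenPartialHomeomorph X E}
    (he : e ∈ atlas E X) (he' : e' ∈ atlas E X) :
    ContDiffOn ℂ ω (e' ∘ e.symm) (e.symm ≫ₕ e').source := by
  have h := (contDiffGroupoid ω 𝓘(ℂ, E)).compatible he he'
  rw [contDiffGroupoid, mem_groupoid_of_pregroupoid] at h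
  have h1 : ContDiffOn ℂ ω (𝓘(ℂ, E) ∘ (e.symm ≫ₕ e') ∘ 𝓘(ℂ, E).symm)
    (𝓘(ℂ, E).symm ⁻¹' (e.symm ≫ₕ e').source ∩ Set.range 𝓘(ℂ, E)) := h.1
  simpa using h1

theorem contDiffAt_transition [IsManifold 𝓘(ℂ, E) ω X] {e e' : OpenPartialHomeomorph X E}
    (he : e ∈ atlas E X) (he' : e' ∈ atlas E X) {y : E} (hy : y ∈ e.target)
    (hy' : e.symm y ∈ e'.source) : ContDiffAt ℂ ω (e' ∘ e.symm) y :=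
  (contDiffOn_transition he he').contDiffAt
    ((e.symm ≫ₕ e').open_source.mem_nhds (by simpa using ⟨hy, hy'⟩))

variable [IsManifold 𝓘(ℂ, E) ω X]

/-- The tangent space at x is identified with E through `chartAt E x`, so the derivative of `e.symm`
is that of the transition map into the preferred chart at the image point. -/
theorem chartSymmDeriv_eq {e : OpenPartialHomeomorph X E} (he : e ∈ atlas E X) {y : E}
    (hy : y ∈ e.target) :
    (chartSymmDeriv e y : E →L[ℝ] E) = fderiv ℝ (chartAt E (e.symm y) ∘ e.symm) y := by
  have h1 := contDiffAt_transition he (chart_mem_atlas E (e.symm y)) hy (mem_chart_source E _)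
  have hmd : MDifferentiableAt 𝓘(ℂ, E) 𝓘(ℂ, E) e.symm y := by
    rw [mdifferentiableAt_iff]
    refine ⟨e.symm.continuousAt hy, ?_⟩
    change DifferentiableWithinAt ℂ (chartAt E (e.symm y) ∘ e.symm) (Set.range id) y
    exact (h1.differentiableAt (by simp)).differentiableWithinAt
  rw [fderiv_real_eq (h1.differentiableAt (by simp))]
  have h2 : (mfderiv 𝓘(ℂ, E) 𝓘(ℂ, E) e.symm y : E →L[ℂ] E) =
      fderiv ℂ (chartAt E (e.symm y) ∘ e.symm) y := by
    refine hmd.mfderiv.trans ?_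
    change fderivWithin ℂ (chartAt E (e.symm y) ∘ e.symm) (Set.range id) y = _
    rw [Set.range_id, fderivWithin_univ]
  exact congrArg (fun f : E →L[ℂ] E => f.restrictScalars ℝ) h2

theorem eventuallyEq_transition {e e' e'' : OpenPartialHomeomorph X E} {y : E}
    (hy : y ∈ e.target) (hy' : e.symm y ∈ e'.source) :
    (e'' ∘ e.symm) =ᶠ[𝓝 y] (e'' ∘ e'.symm) ∘ (e' ∘ e.symm) := by
  have h : ∀ᶠ z in 𝓝 y, z ∈ (e.symm ≫ₕ e').source :=
    (e.symm ≫ₕ e').open_source.mem_nhds (by simpa using ⟨hy, hy'⟩)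
  filter_upwards [h] with z hz
  have hz' : e.symm z ∈ e'.source := by simpa using (show z ∈ e.target ∧ _ by simpa using hz).2
  simp [e'.left_inv hz']

theorem chartSymmDeriv_transition {e e' : OpenPartialHomeomorph X E} (he : e ∈ atlas E X)
    (he' : e' ∈ atlas E X) {y : E} (hy : y ∈ e.target) (hy' : e.symm y ∈ e'.source) :
    (chartSymmDeriv e y : E →L[ℝ] E) =
      (chartSymmDeriv e' (e' (e.symm y)) : E →L[ℝ] E).comp (fderiv ℝ (e' ∘ e.symm) y) := by
  have ht : e' (e.symm y) ∈ e'.target := e'.map_source hy'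
  rw [chartSymmDeriv_eq he hy, chartSymmDeriv_eq he' ht, e'.left_inv hy',
    (eventuallyEq_transition hy hy').fderiv_eq]
  refine fderiv_comp y ?_ ?_
  · have := contDiffAt_transition he' (chart_mem_atlas E (e.symm y)) ht
      (by rw [e'.left_inv hy']; exact mem_chart_source E _)
    exact (this.differentiableAt (by simp)).restrictScalars ℝ
  · exact ((contDiffAt_transition he he' hy hy').differentiableAt (by simp)).restrictScalars ℝ

theorem chartSymmDeriv_chartAt (x : X) :
    (chartSymmDeriv (chartAt E x) (chartAt E x x) : E →L[ℝ] E) = ContinuousLinearMap.id ℝ E := by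
  rw [chartSymmDeriv_eq (chart_mem_atlas E x) (mem_chart_target E x),
    (chartAt E x).left_inv (mem_chart_source E x)]
  have : (chartAt E x ∘ (chartAt E x).symm) =ᶠ[𝓝 (chartAt E x x)] id := by
    filter_upwards [(chartAt E x).open_target.mem_nhds (mem_chart_target E x)] with z hz
    exact (chartAt E x).right_inv hz
  rw [this.fderiv_eq, fderiv_id]

/-- A real `1`-form on `X` written in a chart. -/
def oneFormInChart (β : ∀ x : X, TangentSpace 𝓘(ℂ, E) x →L[ℝ] ℝ)
    (e : OpenPartialHomeomorph X E) (y : E) : E →L[ℝ] ℝ :=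
  (β (e.symm y)).comp (chartSymmDeriv e y)

theorem oneFormInChart_transition (β : ∀ x : X, TangentSpace 𝓘(ℂ, E) x →L[ℝ] ℝ)
    {e e' : OpenPartialHomeomorph X E} (he : e ∈ atlas E X)
    (he' : e' ∈ atlas E X) {y : E} (hy : y ∈ e.target) (hy' : e.symm y ∈ e'.source) :
    oneFormInChart β e y =
      (oneFormInChart β e' (e' (e.symm y))).comp (fderiv ℝ (e' ∘ e.symm) y) := by
  -- The points `e'.symm (e' (e.symm y))` and `e.symm y` are only propositionally equal, and β
  -- depends on the point. Generalizing both points lets the equality be substituted.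
  have h : ∀ z x, z = x → ∀ L L' L'' : E →L[ℝ] E, L = L'.comp L'' →
      (β x : E →L[ℝ] ℝ).comp L = ((β z : E →L[ℝ] ℝ).comp L').comp L'' := by
    rintro z x rfl L L' L'' rfl; rfl
  exact h _ _ (e'.left_inv hy') _ _ _ (chartSymmDeriv_transition he he' hy hy')

theorem twoFormInChart_transition (η : ∀ x : X, (TangentSpace 𝓘(ℂ, E) x) [⋀^Fin 2]→L[ℝ] ℝ)
    {e e' : OpenPartialHomeomorph X E} (he : e ∈ atlas E X)
    (he' : e' ∈ atlas E X) {y : E} (hy : y ∈ e.target) (hy' : e.symm y ∈ e'.source) :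
    twoFormInChart η e y = (twoFormInChart η e' (e' (e.symm y))).compContinuousLinearMap
      (fderiv ℝ (e' ∘ e.symm) y) := by
  have h : ∀ z x, z = x → ∀ L L' L'' : E →L[ℝ] E, L = L'.comp L'' →
      (η x : E [⋀^Fin 2]→L[ℝ] ℝ).compContinuousLinearMap L =
        ((η z : E [⋀^Fin 2]→L[ℝ] ℝ).compContinuousLinearMap L').compContinuousLinearMap L'' := by
    rintro z x rfl L L' L'' rfl; rfl
  exact h _ _ (e'.left_inv hy') _ _ _ (chartSymmDeriv_transition he he' hy hy')

/-- The exterior derivative of a real `1`-form on `X`. -/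
def dForm (β : ∀ x : X, TangentSpace 𝓘(ℂ, E) x →L[ℝ] ℝ) (x : X) :
    (TangentSpace 𝓘(ℂ, E) x) [⋀^Fin 2]→L[ℝ] ℝ :=
  (dOne (oneFormInChart β (chartAt E x)) (chartAt E x x) : E [⋀^Fin 2]→L[ℝ] ℝ)

/-- `dForm` uses a different chart at each point. Naturality of the exterior derivative under
transition maps shows that any fixed chart computes the same form. -/
theorem twoFormInChart_dForm (β : ∀ x : X, TangentSpace 𝓘(ℂ, E) x →L[ℝ] ℝ)
    (hβ : ∀ c : X, ContDiffOn ℝ 1 (oneFormInChart β (chartAt E c)) (chartAt E c).target)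
    {e : OpenPartialHomeomorph X E} (he : e ∈ atlas E X) {y : E} (hy : y ∈ e.target) :
    twoFormInChart (dForm β) e y = dOne (oneFormInChart β e) y := by
  set x := e.symm y with hx
  have hs : e.symm y ∈ (chartAt E x).source := mem_chart_source E x
  have h1 := dOne_pullback (γ := oneFormInChart β (chartAt E x)) (τ := chartAt E x ∘ e.symm) (y := y)
    (((hβ x).contDiffAt ((chartAt E x).open_target.mem_nhds
      (mem_chart_target E x))).differentiableAt (by simp))
    ((contDiffAt_real (contDiffAt_transition he (chart_mem_atlas E x) hy hs)).of_le le_top)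
  have h2 : (fun z => (oneFormInChart β (chartAt E x) ((chartAt E x ∘ e.symm) z)).comp
      (fderiv ℝ (chartAt E x ∘ e.symm) z)) =ᶠ[𝓝 y] oneFormInChart β e := by
    have h : ∀ᶠ z in 𝓝 y, z ∈ (e.symm ≫ₕ (chartAt E x)).source :=
      (e.symm ≫ₕ (chartAt E x)).open_source.mem_nhds (by simpa using ⟨hy, hs⟩)
    filter_upwards [h] with z hz
    have hz' : z ∈ e.target ∧ e.symm z ∈ (chartAt E x).source := by simpa using hz
    exact (oneFormInChart_transition β he (chart_mem_atlas E x) hz'.1 hz'.2).symm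
  rw [← dOne_congr h2, h1]
  exact congrArg (fun L : E →L[ℝ] E => (dOne (oneFormInChart β (chartAt E x))
    (chartAt E x x)).compContinuousLinearMap L) (chartSymmDeriv_eq he hy)

end ChartCalculus

/-! ### Integration over X: change of charts, linearity, forms supported in one chart. -/

section GlobalIntegral

open MeasureTheory

variable {E : Type*} [NormedAddCommGroup E] [NormedSpace ℂ E] [FiniteDimensional ℂ E]
  {X : Type*} [TopologicalSpace X] [ChartedSpace E X]

/-- The density in a chart of the form `τ ∧ κ^{d-1}` of top degree. -/
def chartDensity (τ k : ∀ x : X, (TangentSpace 𝓘(ℂ, E) x) [⋀^Fin 2]→L[ℝ] ℝ)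
    (e : OpenPartialHomeomorph X E) (y : E) : ℝ :=
  wedgePow (Module.finrank ℂ E) (twoFormInChart τ e y) (twoFormInChart k e y) (realFrame E)

theorem wedgePow_chart_eq (τ k : ∀ x : X, (TangentSpace 𝓘(ℂ, E) x) [⋀^Fin 2]→L[ℝ] ℝ)
    (e : OpenPartialHomeomorph X E) (y : E) :
    wedgePow (Module.finrank ℂ E) (τ (e.symm y)) (k (e.symm y))
      (fun i => chartSymmDeriv e y (realFrame E i)) = chartDensity τ k e y :=
  (wedgePow_comp (T := E) (T' := E) (τ (e.symm y)) (k (e.symm y)) (chartSymmDeriv e y)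
    (realFrame E)).symm

variable (E) in
theorem isOpen_realCoord_preimage {O : Set E} (hO : IsOpen O) : IsOpen (realCoord E ⁻¹' O) := by
  rw [realCoord_eq]; exact hO.preimage (realCoordCLE E).continuous

theorem continuousOn_comp_realCoord {F : E → ℝ} {O : Set E} (hF : ContinuousOn F O) :
    ContinuousOn (fun t => F (realCoord E t)) (realCoord E ⁻¹' O) := by
  rw [realCoord_eq]
  exact hF.comp (realCoordCLE E).continuous.continuousOn fun t ht => ht

/-- A continuous function on the open chart target need not be integrable, but this one vanishes
outside the compact image of K. -/
theorem integrableOn_chart [CompactSpace X] {e : OpenPartialHomeomorph X E} {K : Set X}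
    (hK : IsClosed K) (hKe : K ⊆ e.source) {F : E → ℝ} (hF : ContinuousOn F e.target)
    (h0 : ∀ y ∈ e.target, e.symm y ∉ K → F y = 0) :
    IntegrableOn (fun t => F (realCoord E t)) (realCoord E ⁻¹' e.target) := by
  have hc : IsCompact (e '' K) := hK.isCompact.image_of_continuousOn (e.continuousOn.mono hKe)
  have hc' : IsCompact (realCoord E ⁻¹' (e '' K)) := by
    rw [realCoord_eq]
    exact (realCoordCLE E).toHomeomorph.isCompact_preimage.2 hc
  have hsub : e '' K ⊆ e.target := by
    rintro _ ⟨x, hx, rfl⟩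
    exact e.map_source (hKe hx)
  have h1 : IntegrableOn (fun t => F (realCoord E t)) (realCoord E ⁻¹' (e '' K)) :=
    ((continuousOn_comp_realCoord hF).mono (Set.preimage_mono hsub)).integrableOn_compact hc'
  refine h1.of_forall_sdiff_eq_zero (isOpen_realCoord_preimage E e.open_target).measurableSet ?_
  rintro t ⟨ht, ht'⟩
  exact h0 _ ht fun h => ht' ⟨_, h, e.right_inv ht⟩

variable [IsManifold 𝓘(ℂ, E) ω X]

/-- The real Jacobian of a holomorphic transition is |det|² ≥ 0, so the density already transforms
with the absolute value that the change of variables formula requires. -/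
theorem chartDensity_transition (τ k : ∀ x : X, (TangentSpace 𝓘(ℂ, E) x) [⋀^Fin 2]→L[ℝ] ℝ)
    {e e' : OpenPartialHomeomorph X E} (he : e ∈ atlas E X)
    (he' : e' ∈ atlas E X) {y : E} (hy : y ∈ e.target) (hy' : e.symm y ∈ e'.source) :
    chartDensity τ k e y = |LinearMap.det (fderiv ℝ (e' ∘ e.symm) y : E →ₗ[ℝ] E)| *
      chartDensity τ k e' (e' (e.symm y)) := by
  have hd := (contDiffAt_transition he he' hy hy').differentiableAt (by simp)
  rw [chartDensity, twoFormInChart_transition τ he he' hy hy',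
    twoFormInChart_transition k he he' hy hy', wedgePow_comp, fderiv_real_eq hd]
  have h := map_frameOf_eq_normSq_det (wedgePow (Module.finrank ℂ E)
    (twoFormInChart τ e' (e' (e.symm y))) (twoFormInChart k e' (e' (e.symm y))))
    (Module.finBasis ℂ E) (fderiv ℂ (e' ∘ e.symm) y : E →ₗ[ℂ] E)
  have h2 : LinearMap.det (((fderiv ℂ (e' ∘ e.symm) y).restrictScalars ℝ : E →L[ℝ] E) : E →ₗ[ℝ] E)
      = Complex.normSq (LinearMap.det (fderiv ℂ (e' ∘ e.symm) y : E →ₗ[ℂ] E)) :=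
    det_restrictScalars_eq_normSq (fderiv ℂ (e' ∘ e.symm) y : E →ₗ[ℂ] E)
  rw [h2, abs_of_nonneg (Complex.normSq_nonneg _)]
  exact h

variable [CompactSpace X] [T2Space X]

/-- The weight r vanishes off either chart domain, so both integrals live on the overlap, where the
change of variables formula applies. -/
theorem integral_chart_change (τ k : ∀ x : X, (TangentSpace 𝓘(ℂ, E) x) [⋀^Fin 2]→L[ℝ] ℝ)
    {e e' : OpenPartialHomeomorph X E} (he : e ∈ atlas E X) (he' : e' ∈ atlas E X) (r : X → ℝ)
    (hr : ∀ x, x ∉ e.source → r x = 0) (hr' : ∀ x, x ∉ e'.source → r x = 0) :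
    ∫ t in realCoord E ⁻¹' e.target, r (e.symm (realCoord E t)) * chartDensity τ k e (realCoord E t) =
    ∫ t in realCoord E ⁻¹' e'.target,
      r (e'.symm (realCoord E t)) * chartDensity τ k e' (realCoord E t) := by
  have hz : ∀ (e e' : OpenPartialHomeomorph X E), (∀ x, x ∉ e'.source → r x = 0) →
      ∫ t in realCoord E ⁻¹' e.target,
        r (e.symm (realCoord E t)) * chartDensity τ k e (realCoord E t) =
      ∫ t in realCoord E ⁻¹' (e.symm ≫ₕ e').source,
        r (e.symm (realCoord E t)) * chartDensity τ k e (realCoord E t) := fun e e' hr' => by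
    refine setIntegral_eq_of_subset_of_forall_sdiff_eq_zero
      (isOpen_realCoord_preimage E e.open_target).measurableSet (fun t ht => ?_) ?_
    · have : realCoord E t ∈ e.target ∧ e.symm (realCoord E t) ∈ e'.source := by simpa using ht
      exact this.1
    · rintro t ⟨ht, ht'⟩
      rw [hr' _ fun h => ht' (by simpa using ⟨ht, h⟩), zero_mul]
  rw [hz e e' hr', hz e' e hr]
  set A := (e.symm ≫ₕ e').source with hA
  have hAopen : IsOpen A := (e.symm ≫ₕ e').open_source
  have hAm : ∀ y, y ∈ A ↔ y ∈ e.target ∧ e.symm y ∈ e'.source := fun y => by simp [hA]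
  have hBm : ∀ y, y ∈ (e'.symm ≫ₕ e).source ↔ y ∈ e'.target ∧ e'.symm y ∈ e.source := fun y => by
    simp
  let ψ : (Fin (Module.finrank ℂ E) × Fin 2 → ℝ) → (Fin (Module.finrank ℂ E) × Fin 2 → ℝ) :=
    fun t => (realCoordCLE E).symm (e' (e.symm (realCoordCLE E t)))
  let ψ' : (Fin (Module.finrank ℂ E) × Fin 2 → ℝ) →
      ((Fin (Module.finrank ℂ E) × Fin 2 → ℝ) →L[ℝ] (Fin (Module.finrank ℂ E) × Fin 2 → ℝ)) :=
    fun t => ((realCoordCLE E).symm : E →L[ℝ] _).comp ((fderiv ℝ (e' ∘ e.symm) (realCoordCLE E t)).comp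
      (realCoordCLE E : _ →L[ℝ] E))
  have hψd : ∀ t ∈ realCoord E ⁻¹' A, HasFDerivWithinAt ψ (ψ' t) (realCoord E ⁻¹' A) t := by
    intro t ht
    rw [realCoord_eq] at ht
    obtain ⟨h1, h2⟩ := (hAm _).1 ht
    have hd := (((contDiffAt_transition he he' h1 h2).differentiableAt (by simp)).restrictScalars
      ℝ).hasFDerivAt
    exact ((realCoordCLE E).symm.hasFDerivAt.comp t
      (hd.comp t (realCoordCLE E).hasFDerivAt)).hasFDerivWithinAt
  have hinj : Set.InjOn ψ (realCoord E ⁻¹' A) := by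
    intro t ht s hs hts
    rw [realCoord_eq] at ht hs
    obtain ⟨h1, h2⟩ := (hAm _).1 ht
    obtain ⟨h3, h4⟩ := (hAm _).1 hs
    exact (realCoordCLE E).injective (e.symm.injOn h1 h3
      (e'.injOn h2 h4 ((realCoordCLE E).symm.injective hts)))
  have himg : ψ '' (realCoord E ⁻¹' A) = realCoord E ⁻¹' (e'.symm ≫ₕ e).source := by
    rw [realCoord_eq]
    ext s
    constructor
    · rintro ⟨t, ht, rfl⟩
      obtain ⟨h1, h2⟩ := (hAm _).1 ht
      refine (hBm _).2 ?_
      rw [ContinuousLinearEquiv.apply_symm_apply, e'.left_inv h2]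
      exact ⟨e'.map_source h2, e.map_target h1⟩
    · intro hs
      obtain ⟨h1, h2⟩ := (hBm _).1 hs
      refine ⟨(realCoordCLE E).symm (e (e'.symm (realCoordCLE E s))), (hAm _).2 ?_, ?_⟩
      · rw [ContinuousLinearEquiv.apply_symm_apply, e.left_inv h2]
        exact ⟨e.map_source h2, e'.map_target h1⟩
      · simp only [ψ]
        rw [ContinuousLinearEquiv.apply_symm_apply, e.left_inv h2, e'.right_inv h1,
          ContinuousLinearEquiv.symm_apply_apply]
  rw [← himg, integral_image_eq_integral_abs_det_fderiv_smul volume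
    (isOpen_realCoord_preimage E hAopen).measurableSet hψd hinj]
  refine setIntegral_congr_fun (isOpen_realCoord_preimage E hAopen).measurableSet fun t ht => ?_
  obtain ⟨h1, h2⟩ := (hAm _).1 ht
  have hdet : (ψ' t).det =
      LinearMap.det (fderiv ℝ (e' ∘ e.symm) (realCoord E t) : E →ₗ[ℝ] E) := by
    rw [← realCoordCLE_apply]
    exact LinearMap.det_conj (fderiv ℝ (e' ∘ e.symm) (realCoordCLE E t) : E →ₗ[ℝ] E)
      (realCoordCLE E).symm.toLinearEquiv
  have hψ : realCoord E (ψ t) = e' (e.symm (realCoord E t)) := by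
    rw [← realCoordCLE_apply, ← realCoordCLE_apply]
    simp [ψ]
  rw [chartDensity_transition τ k he he' h1 h2, hdet, hψ, e'.left_inv h2, smul_eq_mul]
  ring

variable (E X) in
/-- The partition of unity used to define the integral. -/
def chartPartition : SmoothPartitionOfUnity X 𝓘(ℝ, E) X Set.univ := (exists_chart_partition E X).choose

variable (E X) in
theorem chartPartition_subordinate (c : X) :
    tsupport (chartPartition E X c) ⊆ (chartAt E c).source := (exists_chart_partition E X).choose_spec c

variable (E X) in
theorem finite_chartPartition : {c | (chartPartition E X c : X → ℝ) ≠ 0}.Finite := by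
  refine ((chartPartition E X).locallyFinite.finite_nonempty_of_compact).subset fun c hc => ?_
  obtain ⟨x, hx⟩ := Function.ne_iff.1 hc
  exact ⟨x, hx⟩

variable (E X) in
/-- The finite set of indices of the partition of unity. -/
def chartIndices : Finset X := (finite_chartPartition E X).toFinset

theorem sum_chartPartition (x : X) : ∑ c ∈ chartIndices E X, chartPartition E X c x = 1 := by
  rw [← (chartPartition E X).sum_eq_one (Set.mem_univ x)]
  symm
  refine finsum_eq_sum_of_support_subset _ fun c hc => ?_
  simp only [chartIndices, Set.Finite.coe_toFinset, Set.mem_ofPred_eq]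
  intro h
  exact hc (congrFun h x)

/-- The integral of `τ ∧ κ^{d-1}` over `X`. -/
def integralPow (τ k : ∀ x : X, (TangentSpace 𝓘(ℂ, E) x) [⋀^Fin 2]→L[ℝ] ℝ) : ℝ :=
  integral fun x => wedgePow (Module.finrank ℂ E) (τ x) (k x)

theorem integralPow_eq_sum (τ k : ∀ x : X, (TangentSpace 𝓘(ℂ, E) x) [⋀^Fin 2]→L[ℝ] ℝ) :
    integralPow τ k = ∑ c ∈ chartIndices E X, ∫ t in realCoord E ⁻¹' (chartAt E c).target,
      chartPartition E X c ((chartAt E c).symm (realCoord E t)) *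
        chartDensity τ k (chartAt E c) (realCoord E t) := by
  have h : integralPow τ k = ∑ᶠ c : X, ∫ t in realCoord E ⁻¹' (chartAt E c).target,
      chartPartition E X c ((chartAt E c).symm (realCoord E t)) *
        chartDensity τ k (chartAt E c) (realCoord E t) := by
    refine finsum_congr fun c => ?_
    congr 1
    ext t
    rw [← wedgePow_chart_eq]
    rfl
  rw [h]
  refine finsum_eq_sum_of_support_subset _ fun c hc => ?_
  simp only [chartIndices, Set.Finite.coe_toFinset, Set.mem_ofPred_eq]
  intro h
  exact hc (by simp [h])

theorem contDiffOn_chartPartition (c : X) {e : OpenPartialHomeomorph X E} (he : e ∈ atlas E X) :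
    ContDiffOn ℝ ∞ (fun y => chartPartition E X c (e.symm y)) e.target := by
  have : IsManifold 𝓘(ℝ, E) ω X := isManifold_real E X
  have : IsManifold 𝓘(ℝ, E) ∞ X := inferInstance
  have h1 : ContMDiffOn 𝓘(ℝ, E) 𝓘(ℝ, E) ∞ e.symm e.target :=
    contMDiffOn_symm_of_mem_maximalAtlas (IsManifold.subset_maximalAtlas he)
  have h2 := ((chartPartition E X c).contMDiff).comp_contMDiffOn h1
  exact h2.contDiffOn

/-- A `2`-form which is continuous in all charts. -/
def IsContForm (τ : ∀ x : X, (TangentSpace 𝓘(ℂ, E) x) [⋀^Fin 2]→L[ℝ] ℝ) : Prop :=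
  ∀ c : X, ContinuousOn (twoFormInChart τ (chartAt E c)) (chartAt E c).target

theorem continuousOn_chartDensity {τ k : ∀ x : X, (TangentSpace 𝓘(ℂ, E) x) [⋀^Fin 2]→L[ℝ] ℝ}
    (hτ : IsContForm τ) (hk : IsContForm k) (c : X) :
    ContinuousOn (chartDensity τ k (chartAt E c)) (chartAt E c).target := by
  have happ : ∀ {η : ∀ x : X, (TangentSpace 𝓘(ℂ, E) x) [⋀^Fin 2]→L[ℝ] ℝ}, IsContForm η →
      ∀ v : Fin 2 → E, ContinuousOn (fun y => twoFormInChart η (chartAt E c) y v)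
        (chartAt E c).target := fun h v =>
    (ContinuousAlternatingMap.apply ℝ E ℝ v).continuous.comp_continuousOn (h c)
  unfold chartDensity wedgePow
  simp only [wedgeTwoForms_apply]
  refine continuousOn_const.mul (continuousOn_finsetSum _ fun σ _ => continuousOn_const.mul
    (continuousOn_finsetProd _ fun i _ => ?_))
  split_ifs
  · exact happ hτ _
  · exact happ hk _

theorem integrableOn_partition_mul (c : X) {F : E → ℝ}
    (hF : ContinuousOn F (chartAt E c).target) :
    IntegrableOn (fun t => chartPartition E X c ((chartAt E c).symm (realCoord E t)) *
      F (realCoord E t)) (realCoord E ⁻¹' (chartAt E c).target) := by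
  refine integrableOn_chart (isClosed_tsupport (chartPartition E X c))
    (chartPartition_subordinate E X c)
    (F := fun y => chartPartition E X c ((chartAt E c).symm y) * F y) ?_ ?_
  · exact (contDiffOn_chartPartition c (chart_mem_atlas E c)).continuousOn.mul hF
  · intro y _ hy
    rw [image_eq_zero_of_notMem_tsupport hy, zero_mul]

theorem integralPow_add (hd : 0 < Module.finrank ℂ E)
    {τ τ' k : ∀ x : X, (TangentSpace 𝓘(ℂ, E) x) [⋀^Fin 2]→L[ℝ] ℝ}
    (hτ : IsContForm τ) (hτ' : IsContForm τ') (hk : IsContForm k) :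
    integralPow (fun x => τ x + τ' x) k = integralPow τ k + integralPow τ' k := by
  rw [integralPow_eq_sum, integralPow_eq_sum, integralPow_eq_sum, ← Finset.sum_add_distrib]
  refine Finset.sum_congr rfl fun c _ => ?_
  rw [← integral_add (integrableOn_partition_mul c (continuousOn_chartDensity hτ hk c))
    (integrableOn_partition_mul c (continuousOn_chartDensity hτ' hk c))]
  congr 1
  ext t
  rw [← mul_add]
  congr 1
  exact DFunLike.congr_fun (wedgePow_add hd (twoFormInChart τ (chartAt E c) (realCoord E t))
    (twoFormInChart τ' (chartAt E c) (realCoord E t)) _) (realFrame E)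

theorem integralPow_smul (hd : 0 < Module.finrank ℂ E) (a : ℝ)
    (τ k : ∀ x : X, (TangentSpace 𝓘(ℂ, E) x) [⋀^Fin 2]→L[ℝ] ℝ) :
    integralPow (fun x => a • τ x) k = a * integralPow τ k := by
  rw [integralPow_eq_sum, integralPow_eq_sum, Finset.mul_sum]
  refine Finset.sum_congr rfl fun c _ => ?_
  rw [← integral_const_mul]
  congr 1
  ext t
  have : chartDensity (fun x => a • τ x) k (chartAt E c) (realCoord E t) =
      a * chartDensity τ k (chartAt E c) (realCoord E t) :=
    DFunLike.congr_fun (wedgePow_smul hd a (twoFormInChart τ (chartAt E c) (realCoord E t)) _)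
      (realFrame E)
  rw [this]; ring

/-- The integral of a form supported in a chart. -/
theorem integralPow_eq_chart (hd : 0 < Module.finrank ℂ E)
    {τ k : ∀ x : X, (TangentSpace 𝓘(ℂ, E) x) [⋀^Fin 2]→L[ℝ] ℝ} (hk : IsContForm k)
    (c : X) {K : Set X} (hK : IsClosed K) (hKc : K ⊆ (chartAt E c).source) (h0 : ∀ x ∉ K, τ x = 0)
    (hτ : ContinuousOn (twoFormInChart τ (chartAt E c)) (chartAt E c).target) :
    integralPow τ k = ∫ t in realCoord E ⁻¹' (chartAt E c).target,
      chartDensity τ k (chartAt E c) (realCoord E t) := by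
  classical
  have hz : ∀ (e : OpenPartialHomeomorph X E) (y : E), e.symm y ∉ K → chartDensity τ k e y = 0 := by
    intro e y hy
    have h1 : twoFormInChart τ e y = 0 := by
      have h2 : ∀ x, x = e.symm y → τ x = 0 := fun x hx => h0 x (hx ▸ hy)
      unfold twoFormInChart
      rw [h2 _ rfl]
      rfl
    rw [chartDensity, h1, wedgePow_zero hd]; rfl
  have hτc : ContinuousOn (chartDensity τ k (chartAt E c)) (chartAt E c).target := by
    have happ : ∀ {f : E → E [⋀^Fin 2]→L[ℝ] ℝ}, ContinuousOn f (chartAt E c).target →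
        ∀ v : Fin 2 → E, ContinuousOn (fun y => f y v) (chartAt E c).target := fun h v =>
      (ContinuousAlternatingMap.apply ℝ E ℝ v).continuous.comp_continuousOn h
    unfold chartDensity wedgePow
    simp only [wedgeTwoForms_apply]
    refine continuousOn_const.mul (continuousOn_finsetSum _ fun σ _ => continuousOn_const.mul
      (continuousOn_finsetProd _ fun i _ => ?_))
    split_ifs
    · exact happ hτ _
    · exact happ (hk c) _
  have h1 : ∀ b : X, ∫ t in realCoord E ⁻¹' (chartAt E b).target,
      chartPartition E X b ((chartAt E b).symm (realCoord E t)) *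
        chartDensity τ k (chartAt E b) (realCoord E t) =
      ∫ t in realCoord E ⁻¹' (chartAt E c).target,
      chartPartition E X b ((chartAt E c).symm (realCoord E t)) *
        chartDensity τ k (chartAt E c) (realCoord E t) := by
    intro b
    -- The partition function is cut off to K so that the weight also vanishes outside the chart at
    -- c. As the form is zero off K, nothing is lost.
    have h2 := integral_chart_change τ k (chart_mem_atlas E b) (chart_mem_atlas E c)
      (fun x => if x ∈ K then chartPartition E X b x else 0)
      (fun x hx => by
        split_ifs
        · exact image_eq_zero_of_notMem_tsupport fun h => hx (chartPartition_subordinate E X b h)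
        · rfl)
      (fun x hx => if_neg fun h => hx (hKc h))
    have h3 : ∀ (e : OpenPartialHomeomorph X E) (y : E),
        (if e.symm y ∈ K then chartPartition E X b (e.symm y) else 0) * chartDensity τ k e y =
        chartPartition E X b (e.symm y) * chartDensity τ k e y := by
      intro e y
      split_ifs with h
      · rfl
      · rw [hz e y h]; simp
    simpa only [h3] using h2
  rw [integralPow_eq_sum, Finset.sum_congr rfl fun b _ => h1 b, ← integral_finsetSum]
  · congr 1
    ext t
    rw [← Finset.sum_mul, sum_chartPartition, one_mul]
  · intro b _
    refine integrableOn_chart hK hKc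
      (F := fun y => chartPartition E X b ((chartAt E c).symm y) * chartDensity τ k (chartAt E c) y)
      ((contDiffOn_chartPartition b (chart_mem_atlas E c)).continuousOn.mul hτc) ?_
    intro y _ hy
    rw [hz _ y hy, mul_zero]

end GlobalIntegral

/-! ### Stokes' theorem on X. -/

section GlobalStokes

open MeasureTheory

variable {E : Type*} [NormedAddCommGroup E] [NormedSpace ℂ E] [FiniteDimensional ℂ E]
  {X : Type*} [TopologicalSpace X] [ChartedSpace E X] [IsManifold 𝓘(ℂ, E) ω X]
  [CompactSpace X] [T2Space X]

theorem oneFormInChart_smul (r : X → ℝ) (β : ∀ x : X, TangentSpace 𝓘(ℂ, E) x →L[ℝ] ℝ)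
    (e : OpenPartialHomeomorph X E) (y : E) :
    oneFormInChart (fun x => r x • β x) e y = r (e.symm y) • oneFormInChart β e y := rfl

theorem integralPow_congr {τ τ' k : ∀ x : X, (TangentSpace 𝓘(ℂ, E) x) [⋀^Fin 2]→L[ℝ] ℝ}
    (h : ∀ (c : X), ∀ y ∈ (chartAt E c).target,
      chartDensity τ k (chartAt E c) y = chartDensity τ' k (chartAt E c) y) :
    integralPow τ k = integralPow τ' k := by
  rw [integralPow_eq_sum, integralPow_eq_sum]
  refine Finset.sum_congr rfl fun c _ => ?_
  refine setIntegral_congr_fun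
    (isOpen_realCoord_preimage E (chartAt E c).open_target).measurableSet fun t ht => ?_
  rw [h c _ ht]

theorem KaehlerForm.isContForm (κ : KaehlerForm E X) : IsContForm κ.form := fun c =>
  (κ.smooth _ (chart_mem_atlas E c)).continuousOn

theorem continuousOn_dOne {γ : E → E →L[ℝ] ℝ} {O : Set E} (hO : IsOpen O)
    (hγ : ContDiffOn ℝ 1 γ O) : ContinuousOn (dOne γ) O := by
  have h1 : ContinuousOn (fderiv ℝ γ) O := hγ.continuousOn_fderiv_of_isOpen hO le_rfl
  have h2 : Continuous (fun f : E →L[ℝ] E →L[ℝ] ℝ => skew f) := by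
    unfold skew
    exact (ContinuousAlternatingMap.alternatizeUncurryFinCLM ℝ E ℝ).continuous.comp
      ((ContinuousLinearMap.compL ℝ E (E →L[ℝ] ℝ) (E [⋀^Fin 1]→L[ℝ] ℝ)
        (oneFormCLM E)).continuous)
  refine (h2.comp_continuousOn h1).congr fun y hy => ?_
  exact dOne_eq_skew ((hγ.contDiffAt (hO.mem_nhds hy)).differentiableAt (by simp))

theorem isContForm_dForm {β : ∀ x : X, TangentSpace 𝓘(ℂ, E) x →L[ℝ] ℝ}
    (hβ : ∀ c : X, ContDiffOn ℝ 1 (oneFormInChart β (chartAt E c)) (chartAt E c).target) :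
    IsContForm (dForm β) := fun c =>
  (continuousOn_dOne (chartAt E c).open_target (hβ c)).congr fun _ hy =>
    twoFormInChart_dForm β hβ (chart_mem_atlas E c) hy

/-- The chart carries β to a compactly supported 1-form on E, where the local theorem applies. -/
theorem integralPow_dForm_of_support (hd : 0 < Module.finrank ℂ E) (κ : KaehlerForm E X)
    {β : ∀ x : X, TangentSpace 𝓘(ℂ, E) x →L[ℝ] ℝ}
    (hβ : ∀ c : X, ContDiffOn ℝ 1 (oneFormInChart β (chartAt E c)) (chartAt E c).target)
    (c : X) {K : Set X} (hK : IsClosed K) (hKc : K ⊆ (chartAt E c).source)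
    (h0 : ∀ x ∉ K, β x = 0) : integralPow (dForm β) κ.form = 0 := by
  classical
  set e := chartAt E c with he
  have hinv : ∀ (x y : X), x = y → β y = 0 → (β x : E →L[ℝ] ℝ) = 0 := by rintro x y rfl h; exact h
  have hz1 : ∀ (e' : OpenPartialHomeomorph X E) (y : E), e'.symm y ∉ K → oneFormInChart β e' y = 0 := by
    intro e' y hy
    have h1 : β (e'.symm y) = 0 := h0 _ hy
    unfold oneFormInChart
    rw [h1]
    rfl
  have hz : ∀ x ∉ K, dForm β x = 0 := by
    intro x hx
    have h1 : oneFormInChart β (chartAt E x) =ᶠ[𝓝 (chartAt E x x)] 0 := by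
      have hc : ContinuousAt (chartAt E x).symm (chartAt E x x) :=
        (chartAt E x).continuousAt_symm (mem_chart_target E x)
      have : ∀ᶠ z in 𝓝 (chartAt E x x), (chartAt E x).symm z ∈ Kᶜ :=
        hc.eventually (hK.isOpen_compl.mem_nhds (by
          rw [(chartAt E x).left_inv (mem_chart_source E x)]; exact hx))
      filter_upwards [this] with z hz
      exact hz1 _ _ hz
    exact (dOne_congr h1).trans (dOne_zero _)
  rw [integralPow_eq_chart hd κ.isContForm c hK hKc hz (isContForm_dForm hβ c)]
  -- Extension by zero, since `e.symm` has no meaning outside the target of the chart.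
  let γ : E → E →L[ℝ] ℝ := fun y => if y ∈ e.target then oneFormInChart β e y else 0
  have hγe : ∀ y ∈ e.target, γ =ᶠ[𝓝 y] oneFormInChart β e := fun y hy => by
    filter_upwards [e.open_target.mem_nhds hy] with z hz
    exact if_pos hz
  have hKi : IsCompact (e '' K) := hK.isCompact.image_of_continuousOn (e.continuousOn.mono hKc)
  have hsub : e '' K ⊆ e.target := by
    rintro _ ⟨x, hx, rfl⟩
    exact e.map_source (hKc hx)
  have hts : tsupport γ ⊆ e '' K := by
    refine closure_minimal (fun y hy => ?_) hKi.isClosed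
    by_contra hyK
    apply hy
    simp only [γ]
    split_ifs with hyt
    · exact hz1 _ _ fun h => hyK ⟨_, h, e.right_inv hyt⟩
    · rfl
  have hγ1 : ContDiffOn ℝ 1 γ e.target := (hβ c).congr fun y hy => if_pos hy
  have hmain := integral_wedgePow_dOne_eq_zero hd e.open_target
    (contDiff_of_support e.open_target hγ1 (hts.trans hsub))
    (hKi.of_isClosed_subset (isClosed_tsupport _) hts) (hts.trans hsub)
    (k := twoFormInChart κ.form e)
    ((κ.smooth e (chart_mem_atlas E c)).of_le (by exact_mod_cast le_top))
    (κ.closed e (chart_mem_atlas E c))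
  rw [← hmain]
  refine setIntegral_congr_fun (isOpen_realCoord_preimage E e.open_target).measurableSet
    fun t ht => ?_
  rw [chartDensity, twoFormInChart_dForm β hβ (chart_mem_atlas E c) ht, dOne_congr (hγe _ ht)]

theorem integralPow_sum (hd : 0 < Module.finrank ℂ E) {ι : Type*} (s : Finset ι)
    {τ : ι → ∀ x : X, (TangentSpace 𝓘(ℂ, E) x) [⋀^Fin 2]→L[ℝ] ℝ}
    {k : ∀ x : X, (TangentSpace 𝓘(ℂ, E) x) [⋀^Fin 2]→L[ℝ] ℝ}
    (hτ : ∀ i ∈ s, IsContForm (τ i)) (hk : IsContForm k) :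
    integralPow (fun x => ∑ i ∈ s, τ i x) k = ∑ i ∈ s, integralPow (τ i) k := by
  have hz : IsContForm (fun x : X => (0 : (TangentSpace 𝓘(ℂ, E) x) [⋀^Fin 2]→L[ℝ] ℝ)) := fun c =>
    (continuousOn_const (c := (0 : E [⋀^Fin 2]→L[ℝ] ℝ))).congr fun y _ => rfl
  have hcont : ∀ s' ⊆ s, IsContForm (fun x => ∑ i ∈ s', τ i x) := fun s' hs' c => by
    have : ContinuousOn (fun y => ∑ i ∈ s', twoFormInChart (τ i) (chartAt E c) y)
        (chartAt E c).target := continuousOn_finsetSum _ fun i hi => hτ i (hs' hi) c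
    refine this.congr fun y _ => ?_
    ext v
    simp [twoFormInChart]
  classical
  induction s using Finset.induction_on with
  | empty =>
    simp only [Finset.sum_empty]
    have h := integralPow_smul hd 0
      (fun x : X => (0 : (TangentSpace 𝓘(ℂ, E) x) [⋀^Fin 2]→L[ℝ] ℝ)) k
    rw [zero_mul] at h
    rw [← h]
    congr 1
    ext x : 1
    rw [smul_zero]
  | insert i s hi ih =>
    simp only [Finset.sum_insert hi]
    rw [integralPow_add hd (hτ i (Finset.mem_insert_self i s))
      (hcont s (Finset.subset_insert i s)) hk, ih (fun j hj => hτ j (Finset.mem_insert_of_mem hj))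
      fun s' hs' => hcont s' (hs'.trans (Finset.subset_insert i s))]

/-- Stokes' theorem: `∫_X dβ ∧ κ^{d-1} = 0`. -/
theorem integralPow_dForm_eq_zero (hd : 0 < Module.finrank ℂ E) (κ : KaehlerForm E X)
    {β : ∀ x : X, TangentSpace 𝓘(ℂ, E) x →L[ℝ] ℝ}
    (hβ : ∀ c : X, ContDiffOn ℝ 1 (oneFormInChart β (chartAt E c)) (chartAt E c).target) :
    integralPow (dForm β) κ.form = 0 := by
  -- Each piece of the decomposition β = ∑ ρ_b β is supported in a single chart.
  let βc : X → ∀ x : X, TangentSpace 𝓘(ℂ, E) x →L[ℝ] ℝ := fun b x => chartPartition E X b x • β x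
  have hβc : ∀ b c : X, ContDiffOn ℝ 1 (oneFormInChart (βc b) (chartAt E c)) (chartAt E c).target :=
    fun b c => ((contDiffOn_chartPartition b (chart_mem_atlas E c)).of_le
      (by exact_mod_cast le_top)).smul (hβ c)
  have h1 : integralPow (dForm β) κ.form =
      integralPow (fun x => ∑ b ∈ chartIndices E X, dForm (βc b) x) κ.form := by
    refine congrArg (fun τ => integralPow τ κ.form) (funext fun x => ?_)
    have hdiff : ∀ b ∈ chartIndices E X,
        DifferentiableAt ℝ (oneFormInChart (βc b) (chartAt E x)) (chartAt E x x) := fun b _ =>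
      ((hβc b x).contDiffAt ((chartAt E x).open_target.mem_nhds
        (mem_chart_target E x))).differentiableAt (by simp)
    have key : dOne (oneFormInChart β (chartAt E x)) (chartAt E x x) =
        ∑ b ∈ chartIndices E X, dOne (oneFormInChart (βc b) (chartAt E x)) (chartAt E x x) := by
      rw [← dOne_sum (chartIndices E X) hdiff]
      refine dOne_congr (Filter.Eventually.of_forall fun y => ?_)
      simp only [βc, oneFormInChart_smul]
      rw [← Finset.sum_smul, sum_chartPartition, one_smul]
    exact key
  rw [h1, integralPow_sum hd _ (fun b _ => isContForm_dForm (hβc b)) κ.isContForm]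
  refine Finset.sum_eq_zero fun b _ => ?_
  refine integralPow_dForm_of_support hd κ (hβc b) b (isClosed_tsupport (chartPartition E X b))
    (chartPartition_subordinate E X b) fun x hx => ?_
  simp only [βc]
  rw [image_eq_zero_of_notMem_tsupport hx, zero_smul]

/-- A form which differs from an exact form by a form of type `(2,0) + (0,2)` integrates to zero. -/
theorem integralPow_eq_zero_of_isAntiType (hd : 0 < Module.finrank ℂ E) (κ : KaehlerForm E X)
    {τ : ∀ x : X, (TangentSpace 𝓘(ℂ, E) x) [⋀^Fin 2]→L[ℝ] ℝ}
    {β : ∀ x : X, TangentSpace 𝓘(ℂ, E) x →L[ℝ] ℝ}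
    (hβ : ∀ c : X, ContDiffOn ℝ 1 (oneFormInChart β (chartAt E c)) (chartAt E c).target)
    (a : ℝ) (h : ∀ c : X, ∀ y ∈ (chartAt E c).target, ∃ σ : E [⋀^Fin 2]→L[ℝ] ℝ, IsAntiType σ ∧
      twoFormInChart τ (chartAt E c) y = a • dOne (oneFormInChart β (chartAt E c)) y + σ) :
    integralPow τ κ.form = 0 := by
  have h1 := integralPow_dForm_eq_zero hd κ hβ
  rw [show (0 : ℝ) = a * 0 by simp, ← h1, ← integralPow_smul hd]
  refine integralPow_congr fun c y hy => ?_
  obtain ⟨σ, hσ, he⟩ := h c y hy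
  have h11 : ∀ v w : E, twoFormInChart κ.form (chartAt E c) y ![Complex.I • v, Complex.I • w] =
      twoFormInChart κ.form (chartAt E c) y ![v, w] := by
    intro v w
    have hI : ∀ u : E, (chartSymmDeriv (chartAt E c) y : E →L[ℝ] E) (Complex.I • u) =
        Complex.I • (chartSymmDeriv (chartAt E c) y : E →L[ℝ] E) u := fun u => by
      unfold chartSymmDeriv
      exact (mfderiv 𝓘(ℂ, E) 𝓘(ℂ, E) (chartAt E c).symm y).map_smul Complex.I u
    have hp : ∀ a b : E, twoFormInChart κ.form (chartAt E c) y ![a, b] =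
        κ.form ((chartAt E c).symm y) ![(chartSymmDeriv (chartAt E c) y : E →L[ℝ] E) a,
          (chartSymmDeriv (chartAt E c) y : E →L[ℝ] E) b] := fun a b => by
      refine congrArg (κ.form ((chartAt E c).symm y)) ?_
      ext j; fin_cases j <;> rfl
    rw [hp, hp, hI, hI]
    exact κ.type_one_one _ _ _
  have h2 : twoFormInChart (fun x => a • dForm β x) (chartAt E c) y =
      a • dOne (oneFormInChart β (chartAt E c)) y := by
    rw [← twoFormInChart_dForm β hβ (chart_mem_atlas E c) hy]; rfl
  rw [chartDensity, chartDensity, he, wedgePow_add hd, h2, AlternatingMap.add_apply]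
  -- The part of type (2,0) + (0,2) dies against powers of the (1,1)-form κ.
  have := wedgePow_eq_zero_of_isAntiType hd σ (twoFormInChart κ.form (chartAt E c) y) h11 hσ
    (Module.finBasis ℂ E)
  rw [realFrame_eq, this, add_zero]

end GlobalStokes

/-! ### Hermitian metrics, changes of trivialization and Chern forms. -/

section ChernForms

variable {E : Type*} [NormedAddCommGroup E] [NormedSpace ℂ E]
  {X : Type*} [TopologicalSpace X] [ChartedSpace E X]

theorem two_le_infty : (2 : ℕ∞ω) ≤ ∞ := WithTop.coe_le_coe.2 (le_top (a := (2 : ℕ∞)))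

section Functions

variable [IsManifold 𝓘(ℂ, E) ω X]

theorem contDiffAt_comp_symm_real {F : Type*} [NormedAddCommGroup F] [NormedSpace ℝ F] {f : X → F}
    {e : OpenPartialHomeomorph X E} (he : e ∈ atlas E X) {y : E} (hy : y ∈ e.target) {n : ℕ∞ω}
    (hf : ContMDiffAt 𝓘(ℝ, E) 𝓘(ℝ, F) n f (e.symm y)) : ContDiffAt ℝ n (f ∘ e.symm) y := by
  have : IsManifold 𝓘(ℝ, E) ω X := isManifold_real E X
  have : IsManifold 𝓘(ℝ, E) n X := IsManifold.of_le le_top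
  have h1 : ContMDiffAt 𝓘(ℝ, E) 𝓘(ℝ, E) n e.symm y :=
    (contMDiffOn_symm_of_mem_maximalAtlas (IsManifold.subset_maximalAtlas he)).contMDiffAt
      (e.open_target.mem_nhds hy)
  exact (hf.comp y h1).contDiffAt

theorem contDiffAt_comp_symm_complex {F : Type*} [NormedAddCommGroup F] [NormedSpace ℂ F]
    {f : X → F} {e : OpenPartialHomeomorph X E} (he : e ∈ atlas E X) {y : E} (hy : y ∈ e.target)
    (hf : ContMDiffAt 𝓘(ℂ, E) 𝓘(ℂ, F) ω f (e.symm y)) : ContDiffAt ℂ ω (f ∘ e.symm) y := by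
  have h1 : ContMDiffAt 𝓘(ℂ, E) 𝓘(ℂ, E) ω e.symm y :=
    (contMDiffOn_symm_of_mem_maximalAtlas (IsManifold.subset_maximalAtlas he)).contMDiffAt
      (e.open_target.mem_nhds hy)
  exact (hf.comp y h1).contDiffAt

theorem eventually_symm_mem {e : OpenPartialHomeomorph X E} {y : E} (hy : y ∈ e.target) {U : Set X}
    (hU : IsOpen U) (h : e.symm y ∈ U) : ∀ᶠ z in 𝓝 y, z ∈ e.target ∧ e.symm z ∈ U :=
  (Filter.eventually_of_mem (e.open_target.mem_nhds hy) fun _ h => h).and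
    ((e.continuousAt_symm hy).eventually (hU.mem_nhds h))

/-- `∂∂̄` of functions is natural for changes of charts. -/
theorem iddbar_transition {u : X → ℝ} {e e' : OpenPartialHomeomorph X E} (he : e ∈ atlas E X)
    (he' : e' ∈ atlas E X) {y : E} (hy : y ∈ e.target) (hy' : e.symm y ∈ e'.source)
    (hu : ContDiffAt ℝ 2 (u ∘ e'.symm) (e' (e.symm y))) :
    iddbar (u ∘ e.symm) y = (iddbar (u ∘ e'.symm) (e' (e.symm y))).compContinuousLinearMap
      (fderiv ℝ (e' ∘ e.symm) y) := by
  refine Eq.trans (iddbar_congr ?_) (iddbar_comp_hol (τ := e' ∘ e.symm) hu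
    ((contDiffAt_transition he he' hy hy').of_le le_top))
  filter_upwards [eventually_symm_mem hy e'.open_source hy'] with z hz
  simp [e'.left_inv hz.2]

end Functions

variable {F : Type*} [NormedAddCommGroup F] [NormedSpace ℂ F]
  {V : X → Type*} [TopologicalSpace (Bundle.TotalSpace F V)] [∀ x, AddCommGroup (V x)]
  [∀ x, Module ℂ (V x)] [∀ x, TopologicalSpace (V x)] [FiberBundle F V] [VectorBundle ℂ F V]
  [FiniteDimensional ℂ F]

/-- The Gram matrix of a Hermitian metric in a trivialization. -/
def HermitianMetric.gram (h : HermitianMetric E F V)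
    (e : Bundle.Trivialization F (Bundle.TotalSpace.proj : Bundle.TotalSpace F V → X)) (x : X) :
    Matrix (Fin (Module.finrank ℂ F)) (Fin (Module.finrank ℂ F)) ℂ :=
  Matrix.of fun i j => h.inner x (e.symm x (Module.finBasis ℂ F i)) (e.symm x (Module.finBasis ℂ F j))

/-- The function `log det (h (eᵢ, eⱼ))` of a Hermitian metric in a trivialization. -/
def HermitianMetric.logDetIn (h : HermitianMetric E F V)
    (e : Bundle.Trivialization F (Bundle.TotalSpace.proj : Bundle.TotalSpace F V → X)) (x : X) : ℝ :=
  Real.log (h.gram e x).det.re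

variable (h : HermitianMetric E F V)
  (e e' : Bundle.Trivialization F (Bundle.TotalSpace.proj : Bundle.TotalSpace F V → X))
  [MemTrivializationAtlas e] [MemTrivializationAtlas e']

theorem symm_sum_smul {x : X} (hx : x ∈ e.baseSet) {n : ℕ} (c : Fin n → ℂ) (b : Fin n → F) :
    e.symm x (∑ i, c i • b i) = ∑ i, c i • e.symm x (b i) := by
  rw [← e.coe_symmₗ (R := ℂ) hx, map_sum]
  simp

theorem HermitianMetric.star_dotProduct_gram {x : X} (hx : x ∈ e.baseSet) (c c' : Fin (Module.finrank ℂ F) → ℂ) :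
    star c ⬝ᵥ (h.gram e x).mulVec c' =
      h.inner x (e.symm x (∑ i, c i • Module.finBasis ℂ F i))
        (e.symm x (∑ i, c' i • Module.finBasis ℂ F i)) := by
  rw [symm_sum_smul e hx, symm_sum_smul e hx, map_sum (h.inner x), LinearMap.sum_apply]
  simp only [dotProduct, Matrix.mulVec, map_sum, LinearMap.map_smulₛₗ, LinearMap.smul_apply,
    map_smul, smul_eq_mul, Finset.mul_sum, HermitianMetric.gram, Matrix.of_apply, Pi.star_apply]
  refine Finset.sum_congr rfl fun i _ => Finset.sum_congr rfl fun j _ => ?_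
  rw [starRingEnd_apply]
  simp
  ring

open scoped ComplexOrder in
-- The matrix represents the metric in a basis of the fibre. Positivity of its determinant is what
-- makes `logDetIn` smooth.
theorem HermitianMetric.gram_posDef {x : X} (hx : x ∈ e.baseSet) : (h.gram e x).PosDef := by
  refine Matrix.PosDef.of_dotProduct_mulVec_pos ?_ fun c hc => ?_
  · ext i j
    rw [Matrix.conjTranspose_apply]
    exact (h.symm x _ _).symm
  · rw [h.star_dotProduct_gram e hx]
    set v := e.symm x (∑ i, c i • Module.finBasis ℂ F i) with hv
    have hv0 : v ≠ 0 := by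
      intro h0
      have h1 : e.linearEquivAt ℂ x hx v = ∑ i, c i • Module.finBasis ℂ F i := by
        rw [hv]
        exact (e.linearEquivAt ℂ x hx).apply_symm_apply _
      rw [h0, map_zero] at h1
      refine hc (funext fun i => ?_)
      exact Fintype.linearIndependent_iff.1 (Module.finBasis ℂ F).linearIndependent c h1.symm i
    have him : (h.inner x v v).im = 0 := by
      have := congrArg Complex.im (h.symm x v v)
      simp at this
      linarith
    rw [Complex.pos_iff]
    exact ⟨h.pos x v hv0, him.symm⟩

theorem HermitianMetric.gram_det_pos {x : X} (hx : x ∈ e.baseSet) :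
    0 < (h.gram e x).det.re ∧ ((h.gram e x).det.re : ℂ) = (h.gram e x).det := by
  open scoped ComplexOrder in
  have := (h.gram_posDef e hx).det_pos
  rw [Complex.pos_iff] at this
  exact ⟨this.1, Complex.ext (by simp) (by simpa using this.2)⟩

theorem HermitianMetric.contMDiffOn_logDetIn :
    ContMDiffOn 𝓘(ℝ, E) 𝓘(ℝ, ℝ) ∞ (h.logDetIn e) e.baseSet := by
  have h1 : ContMDiffOn 𝓘(ℝ, E) 𝓘(ℝ, ℂ) ∞ (fun x => (h.gram e x).det) e.baseSet := by
    simp only [Matrix.det_apply]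
    refine contMDiffOn_finsetSum fun σ _ => ?_
    have h2 : ContMDiffOn 𝓘(ℝ, E) 𝓘(ℝ, ℂ) ∞
        (fun x => ∏ i, h.gram e x (σ i) i) e.baseSet :=
      fun x hx => (contDiff_prod fun i _ => contDiff_apply ℝ ℂ i).contMDiff.contMDiffAt.comp_contMDiffWithinAt x
        (contMDiffWithinAt_pi_space.2 fun i => h.smooth e _ _ x hx)
    have h3 : ContMDiff 𝓘(ℝ, ℂ) 𝓘(ℝ, ℂ) ∞ (fun z : ℂ => Equiv.Perm.sign σ • z) := by
      have : (fun z : ℂ => Equiv.Perm.sign σ • z) = fun z => (((Equiv.Perm.sign σ : ℤ) : ℂ)) * z := by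
        ext z
        rw [Units.smul_def, zsmul_eq_mul]
      rw [this]
      exact (contDiff_const.mul contDiff_id).contMDiff
    exact h3.comp_contMDiffOn h2
  intro x hx
  have h2 : ContMDiffWithinAt 𝓘(ℝ, E) 𝓘(ℝ, ℝ) ∞ (fun x => (h.gram e x).det.re) e.baseSet x :=
    Complex.reCLM.contDiff.contMDiff.contMDiffAt.comp_contMDiffWithinAt x (h1 x hx)
  have h3 : ContMDiffAt 𝓘(ℝ, ℝ) 𝓘(ℝ, ℝ) ∞ Real.log (h.gram e x).det.re :=
    (Real.contDiffAt_log.2 (h.gram_det_pos e hx).1.ne').contMDiffAt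
  exact h3.comp_contMDiffWithinAt x h2

/-- The determinant of the coordinate change between two trivializations. -/
def coordDet (x : X) : ℂ := LinearMap.det ((e.coordChangeL ℂ e' x : F →L[ℂ] F) : F →ₗ[ℂ] F)

theorem coordDet_ne_zero (x : X) : coordDet e e' x ≠ 0 :=
  ((e.coordChangeL ℂ e' x).toLinearEquiv).isUnit_det'.ne_zero

/-- The coordinate change expresses the frame of e through that of e'. The conjugate transpose
stands on the left because the metric is conjugate linear in its first argument. -/
theorem HermitianMetric.gram_change {x : X} (hx : x ∈ e.baseSet) (hx' : x ∈ e'.baseSet) :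
    h.gram e x = (LinearMap.toMatrix (Module.finBasis ℂ F) (Module.finBasis ℂ F)
      ((e.coordChangeL ℂ e' x : F →L[ℂ] F) : F →ₗ[ℂ] F)).conjTranspose * h.gram e' x *
      LinearMap.toMatrix (Module.finBasis ℂ F) (Module.finBasis ℂ F)
      ((e.coordChangeL ℂ e' x : F →L[ℂ] F) : F →ₗ[ℂ] F) := by
  set b := Module.finBasis ℂ F
  set C := LinearMap.toMatrix b b ((e.coordChangeL ℂ e' x : F →L[ℂ] F) : F →ₗ[ℂ] F) with hC
  have hsymm : ∀ v : F, e.symm x v = e'.symm x (e.coordChangeL ℂ e' x v) := fun v => by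
    have h2 : e'.linearEquivAt ℂ x hx' (e.symm x v) = e.coordChangeL ℂ e' x v := by
      rw [e.coordChangeL_apply e' ⟨hx, hx'⟩]
      rfl
    rw [← h2]
    exact ((e'.linearEquivAt ℂ x hx').symm_apply_apply _).symm
  have hcol : ∀ j, e.coordChangeL ℂ e' x (b j) = ∑ i, C i j • b i := fun j => by
    have := b.sum_repr (e.coordChangeL ℂ e' x (b j))
    rw [← this]
    refine Finset.sum_congr rfl fun i _ => ?_
    rw [hC, LinearMap.toMatrix_apply]
    rfl
  ext i j
  have h1 : h.gram e x i j = h.inner x (e.symm x (b i)) (e.symm x (b j)) := rfl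
  rw [h1, hsymm (b i), hsymm (b j), hcol, hcol, ← h.star_dotProduct_gram e' hx']
  rw [Matrix.mul_assoc, Matrix.mul_apply]
  simp only [dotProduct, Matrix.conjTranspose_apply, Pi.star_apply, Matrix.mulVec, Matrix.mul_apply]

/-- Congruence of Gram matrices multiplies the determinant by |det C|², with C the matrix of the
coordinate change. -/
theorem HermitianMetric.logDetIn_change {x : X} (hx : x ∈ e.baseSet) (hx' : x ∈ e'.baseSet) :
    h.logDetIn e x = h.logDetIn e' x + Real.log (Complex.normSq (coordDet e e' x)) := by
  have h1 : (h.gram e x).det = (Complex.normSq (coordDet e e' x) : ℂ) * (h.gram e' x).det := by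
    rw [h.gram_change e e' hx hx', Matrix.det_mul, Matrix.det_mul, Matrix.det_conjTranspose,
      LinearMap.det_toMatrix, Complex.normSq_eq_conj_mul_self]
    rw [coordDet, starRingEnd_apply]
    ring
  rw [HermitianMetric.logDetIn, HermitianMetric.logDetIn, h1, Complex.re_ofReal_mul,
    Real.log_mul (Complex.normSq_pos.2 (coordDet_ne_zero e e' x)).ne'
      (h.gram_det_pos e' hx').1.ne', add_comm]

/-- By the Leibniz formula the determinant is polynomial in the matrix entries. -/
theorem contDiff_det : ContDiff ℂ ω (fun f : F →L[ℂ] F => LinearMap.det (f : F →ₗ[ℂ] F)) := by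
  set b := Module.finBasis ℂ F
  have h1 : (fun f : F →L[ℂ] F => LinearMap.det (f : F →ₗ[ℂ] F)) = fun f : F →L[ℂ] F =>
      ∑ σ : Equiv.Perm (Fin (Module.finrank ℂ F)), ((Equiv.Perm.sign σ : ℤ) : ℂ) *
        ∏ i, b.repr (f (b i)) (σ i) := by
    ext f
    rw [← LinearMap.det_toMatrix b, Matrix.det_apply']
    simp [LinearMap.toMatrix_apply]
  rw [h1]
  refine ContDiff.sum fun σ _ => contDiff_const.mul (contDiff_prod fun i _ => ?_)
  exact (LinearMap.toContinuousLinearMap (b.coord (σ i))).contDiff.comp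
    (ContinuousLinearMap.apply ℂ F (b i)).contDiff

variable [IsManifold 𝓘(ℂ, E) ω X] [ContMDiffVectorBundle ω F V 𝓘(ℂ, E)]

theorem contMDiffOn_coordDet : ContMDiffOn 𝓘(ℂ, E) 𝓘(ℂ, ℂ) ω (coordDet e e')
    (e.baseSet ∩ e'.baseSet) :=
  contDiff_det.contMDiff.comp_contMDiffOn
    (ContMDiffVectorBundle.contMDiffOn_coordChangeL (IB := 𝓘(ℂ, E)) (n := ω) e e')

theorem HermitianMetric.contDiffAt_logDetIn {c : OpenPartialHomeomorph X E} (hc : c ∈ atlas E X)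
    {y : E} (hy : y ∈ c.target) (hx : c.symm y ∈ e.baseSet) :
    ContDiffAt ℝ ∞ (h.logDetIn e ∘ c.symm) y :=
  contDiffAt_comp_symm_real hc hy
    ((h.contMDiffOn_logDetIn e).contMDiffAt (e.open_baseSet.mem_nhds hx))

/-- The Chern form in a chart, computed with an arbitrary trivialization. -/
theorem HermitianMetric.twoFormInChart_chernForm {c : OpenPartialHomeomorph X E} (hc : c ∈ atlas E X)
    {y : E} (hy : y ∈ c.target) (hx : c.symm y ∈ e.baseSet) :
    twoFormInChart h.chernForm c y =
      (-(1 / (2 * Real.pi))) • iddbar (h.logDetIn e ∘ c.symm) y := by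
  set x := c.symm y with hxd
  set e₀ := trivializationAt F V x with he₀
  have hx₀ : x ∈ e₀.baseSet := FiberBundle.mem_baseSet_trivializationAt F V x
  have hs : c.symm y ∈ (chartAt E x).source := mem_chart_source E x
  have h0 : ContDiffAt ℝ ∞ (h.logDetIn e₀ ∘ (chartAt E x).symm) (chartAt E x (c.symm y)) :=
    h.contDiffAt_logDetIn e₀ (chart_mem_atlas E x) ((chartAt E x).map_source hs)
      (by rw [(chartAt E x).left_inv hs]; exact hx₀)
  -- The two potentials differ by log |g|² with g holomorphic and nowhere zero, and i∂∂̄ annihilates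
  -- this function.
  have h2 : iddbar (h.logDetIn e ∘ c.symm) y = iddbar (h.logDetIn e₀ ∘ c.symm) y := by
    have hg : ContDiffAt ℂ ω (coordDet e e₀ ∘ c.symm) y :=
      contDiffAt_comp_symm_complex hc hy ((contMDiffOn_coordDet e e₀).contMDiffAt
        ((e.open_baseSet.inter e₀.open_baseSet).mem_nhds ⟨hx, hx₀⟩))
    have hlog := iddbar_log_normSq (hg.of_le le_top) (coordDet_ne_zero e e₀ _)
    rw [← add_zero (iddbar (h.logDetIn e₀ ∘ c.symm) y), ← hlog, ← iddbar_add
      ((h.contDiffAt_logDetIn e₀ hc hy hx₀).of_le two_le_infty)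
      (contDiffAt_log_normSq (contDiffAt_real (hg.of_le le_top)) (coordDet_ne_zero e e₀ _))]
    refine iddbar_congr ?_
    filter_upwards [eventually_symm_mem hy (e.open_baseSet.inter e₀.open_baseSet) ⟨hx, hx₀⟩]
      with z hz
    exact h.logDetIn_change e e₀ hz.2.1 hz.2.2
  rw [h2, iddbar_transition hc (chart_mem_atlas E x) hy hs
    (h0.of_le two_le_infty)]
  exact congrArg (fun L : E →L[ℝ] E => ((-(1 / (2 * Real.pi))) • iddbar
    (h.logDetIn e₀ ∘ (chartAt E x).symm) (chartAt E x x)).compContinuousLinearMap L)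
    (chartSymmDeriv_eq hc hy)

theorem continuousAt_iddbar [FiniteDimensional ℂ E] {u : E → ℝ} {y : E} (hu : ContDiffAt ℝ ∞ u y) :
    ContinuousAt (iddbar u) y := by
  have h0 : ContDiffAt ℝ 2 u y := hu.of_le two_le_infty
  obtain ⟨O, hO, hyO, huO⟩ : ∃ O, IsOpen O ∧ y ∈ O ∧ ∀ z ∈ O, ContDiffAt ℝ 2 u z := by
    obtain ⟨O, hO⟩ := eventually_nhds_iff.1 (h0.eventually (by simp))
    exact ⟨O, hO.2.1, hO.2.2, hO.1⟩
  have h1 : ContDiffOn ℝ 1 (fun z => (fderiv ℝ u z).comp (mulI E)) O := fun z hz =>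
    (((huO z hz).fderiv_right (m := 1) (by norm_num)).clm_comp contDiffAt_const).contDiffWithinAt
  have h2 := (continuousOn_dOne hO h1).continuousAt (hO.mem_nhds hyO)
  exact h2.const_smul (-(1 / 2 : ℝ))

theorem HermitianMetric.isContForm_chernForm [FiniteDimensional ℂ E] [CompactSpace X] [T2Space X] :
    IsContForm h.chernForm := by
  intro c y hy
  set e₀ := trivializationAt F V ((chartAt E c).symm y) with he₀
  have hx₀ : (chartAt E c).symm y ∈ e₀.baseSet := FiberBundle.mem_baseSet_trivializationAt F V _
  have h1 : ContinuousAt ((-(1 / (2 * Real.pi))) •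
      iddbar (h.logDetIn e₀ ∘ (chartAt E c).symm)) y :=
    ContinuousAt.const_smul (continuousAt_iddbar (h.contDiffAt_logDetIn e₀ (chart_mem_atlas E c) hy hx₀)) _
  refine (h1.congr ?_).continuousWithinAt
  filter_upwards [eventually_symm_mem hy e₀.open_baseSet hx₀] with z hz
  exact (h.twoFormInChart_chernForm e₀ (chart_mem_atlas E c) hz.1 hz.2).symm

end ChernForms

/-! ### Vanishing of integrals of forms with glued potentials. -/

section Potentials

variable {E : Type*} [NormedAddCommGroup E] [NormedSpace ℂ E] [FiniteDimensional ℂ E]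
  {X : Type*} [TopologicalSpace X] [ChartedSpace E X] [IsManifold 𝓘(ℂ, E) ω X]
  [CompactSpace X] [T2Space X]

/-- A `1`-form of type `(1,0)` on `X` written in a chart. -/
def holFormInChart (A : ∀ x : X, TangentSpace 𝓘(ℂ, E) x →L[ℂ] ℂ)
    (e : OpenPartialHomeomorph X E) (y : E) : E →L[ℂ] ℂ :=
  (A (e.symm y)).comp (mfderiv 𝓘(ℂ, E) 𝓘(ℂ, E) e.symm y)

/-- A form with local potentials `Φ` whose differentials glue up to the real parts of holomorphic
`1`-forms integrates to zero. -/
theorem integralPow_eq_zero_of_potentials (hd : 0 < Module.finrank ℂ E) (κ : KaehlerForm E X)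
    {τ : ∀ x : X, (TangentSpace 𝓘(ℂ, E) x) [⋀^Fin 2]→L[ℝ] ℝ} (Φ : X → X → ℝ) (U : X → Set X)
    (A : ∀ x₀ x : X, TangentSpace 𝓘(ℂ, E) x →L[ℂ] ℂ) (a : ℝ) (hU : ∀ x, IsOpen (U x))
    (hxU : ∀ x, x ∈ U x) (hΦ : ∀ x₀ c : X, ∀ y ∈ (chartAt E c).target, (chartAt E c).symm y ∈ U x₀ →
      ContDiffAt ℝ ∞ (Φ x₀ ∘ (chartAt E c).symm) y)
    (hτ : ∀ x₀ c : X, ∀ y ∈ (chartAt E c).target, (chartAt E c).symm y ∈ U x₀ →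
      twoFormInChart τ (chartAt E c) y = a • iddbar (Φ x₀ ∘ (chartAt E c).symm) y)
    (hA : ∀ x₀ c : X, ∀ y ∈ (chartAt E c).target, (chartAt E c).symm y ∈ U x₀ →
      ContDiffAt ℂ ω (holFormInChart (A x₀) (chartAt E c)) y)
    (hglue : ∀ x₀ x₁ c : X, ∀ y ∈ (chartAt E c).target, (chartAt E c).symm y ∈ U x₀ →
      (chartAt E c).symm y ∈ U x₁ → ∀ v : E,
      fderiv ℝ (Φ x₁ ∘ (chartAt E c).symm) y v + 2 * (holFormInChart (A x₁) (chartAt E c) y v).re =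
      fderiv ℝ (Φ x₀ ∘ (chartAt E c).symm) y v + 2 * (holFormInChart (A x₀) (chartAt E c) y v).re) :
    integralPow τ κ.form = 0 := by
  -- The 1-form dΦ + 2 Re A at x, computed with the local data attached to x itself. By `hglue`, the
  -- data attached to any x₀ with x in U x₀ give the same form.
  let g : X → E →L[ℝ] ℝ := fun x => fderiv ℝ (Φ x ∘ (chartAt E x).symm) (chartAt E x x) +
    (2 : ℝ) • Complex.reCLM.comp ((show E →L[ℂ] ℂ from A x x).restrictScalars ℝ)
  let β : ∀ x : X, TangentSpace 𝓘(ℂ, E) x →L[ℝ] ℝ := fun x => (g x).comp (mulI E)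
  -- For fixed x₀ the right-hand side is smooth in y, and this is where the regularity of β comes
  -- from.
  have hβ : ∀ x₀ c : X, ∀ y ∈ (chartAt E c).target, (chartAt E c).symm y ∈ U x₀ →
      oneFormInChart β (chartAt E c) y = (fderiv ℝ (Φ x₀ ∘ (chartAt E c).symm) y).comp (mulI E) +
        (2 : ℝ) • reI (holFormInChart (A x₀) (chartAt E c) y) := by
    intro x₀ c y hy hyU
    set x := (chartAt E c).symm y with hx
    have hs : (chartAt E c).symm y ∈ (chartAt E x).source := mem_chart_source E x
    have htr := contDiffAt_transition (chart_mem_atlas E c) (chart_mem_atlas E x) hy hs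
    have hdτ := htr.differentiableAt (by simp)
    have h1 : fderiv ℝ (Φ x ∘ (chartAt E c).symm) y =
        (fderiv ℝ (Φ x ∘ (chartAt E x).symm) (chartAt E x x)).comp
          (fderiv ℝ (chartAt E x ∘ (chartAt E c).symm) y) := by
      rw [(eventuallyEq_transition (e'' := (chartAt E x)) hy hs).fderiv_eq]
      have h2 : Φ x ∘ (chartAt E c).symm =ᶠ[𝓝 y]
          (Φ x ∘ (chartAt E x).symm) ∘ (chartAt E x ∘ (chartAt E c).symm) := by
        filter_upwards [eventually_symm_mem hy (chartAt E x).open_source hs] with z hz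
        simp [(chartAt E x).left_inv hz.2]
      rw [h2.fderiv_eq, ← (eventuallyEq_transition (e'' := (chartAt E x)) hy hs).fderiv_eq]
      refine fderiv_comp y ?_ (hdτ.restrictScalars ℝ)
      refine (hΦ x x _ (mem_chart_target E x) ?_).differentiableAt (by simp)
      rw [(chartAt E x).left_inv (mem_chart_source E x)]
      exact hxU x
    have hcs := chartSymmDeriv_eq (chart_mem_atlas E c) hy
    ext v
    have h3 := hglue x₀ x c y hy hyU (hxU x) (mulI E v)
    have h4 : (chartSymmDeriv (chartAt E c) y : E →L[ℝ] E) (mulI E v) =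
        mulI E ((chartSymmDeriv (chartAt E c) y : E →L[ℝ] E) v) := by
      rw [hcs]
      exact DFunLike.congr_fun (fderiv_real_mulI hdτ) v
    have h5 : oneFormInChart β (chartAt E c) y v =
        g x ((chartSymmDeriv (chartAt E c) y : E →L[ℝ] E) (mulI E v)) := by
      rw [h4]; rfl
    have h6 : g x ((chartSymmDeriv (chartAt E c) y : E →L[ℝ] E) (mulI E v)) =
        fderiv ℝ (Φ x ∘ (chartAt E c).symm) y (mulI E v) +
          2 * (holFormInChart (A x) (chartAt E c) y (mulI E v)).re := by
      rw [h1, ContinuousLinearMap.comp_apply, ← hcs]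
      rfl
    rw [h5, h6, h3]
    rfl
  have hβs : ∀ x₀ c : X, ∀ y ∈ (chartAt E c).target, (chartAt E c).symm y ∈ U x₀ →
      ContDiffAt ℝ 1 (fun y => (fderiv ℝ (Φ x₀ ∘ (chartAt E c).symm) y).comp (mulI E)) y ∧
      ContDiffAt ℝ 1 (fun y => (2 : ℝ) • reI (holFormInChart (A x₀) (chartAt E c) y)) y := by
    intro x₀ c y hy hyU
    refine ⟨?_, ?_⟩
    · exact ((hΦ x₀ c y hy hyU).fderiv_right (m := 1) (by norm_cast)).clm_comp contDiffAt_const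
    · exact ContDiffAt.const_smul (2 : ℝ) ((reICLM E).contDiff.contDiffAt.comp y
        (contDiffAt_real ((hA x₀ c y hy hyU).of_le le_top)))
  refine integralPow_eq_zero_of_isAntiType hd κ (β := β) (fun c y hy => ?_) (a * (-(1 / 2 : ℝ)))
    fun c y hy => ?_
  · set x := (chartAt E c).symm y with hx
    obtain ⟨s1, s2⟩ := hβs x c y hy (hxU x)
    refine ((s1.add s2).congr_of_eventuallyEq ?_).contDiffWithinAt
    filter_upwards [eventually_symm_mem hy (hU x) (hxU x)] with z hz
    exact hβ x c z hz.1 hz.2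
  · set x := (chartAt E c).symm y with hx
    obtain ⟨s1, s2⟩ := hβs x c y hy (hxU x)
    have hev : oneFormInChart β (chartAt E c) =ᶠ[𝓝 y] fun y =>
        (fderiv ℝ (Φ x ∘ (chartAt E c).symm) y).comp (mulI E) +
        (2 : ℝ) • reI (holFormInChart (A x) (chartAt E c) y) := by
      filter_upwards [eventually_symm_mem hy (hU x) (hxU x)] with z hz
      exact hβ x c z hz.1 hz.2
    have hAd := (hA x c y hy (hxU x)).differentiableAt (by simp)
    -- Since i∂∂̄Φ = -(1/2) d(dΦ ∘ J), the form τ equals -(a/2) dβ + a d(`reI` A), and the last term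
    -- is of type (2,0) + (0,2).
    refine ⟨a • dOne (fun y => reI (holFormInChart (A x) (chartAt E c) y)) y, ?_, ?_⟩
    · intro v w
      rw [ContinuousAlternatingMap.smul_apply, ContinuousAlternatingMap.smul_apply,
        isAntiType_dOne_reI hAd v w, smul_neg]
    · rw [hτ x c y hy (hxU x), iddbar_eq, dOne_congr hev,
        dOne_add (s1.differentiableAt (by simp)) (s2.differentiableAt (by simp)),
        dOne_const_smul (γ := fun y => reI (holFormInChart (A x) (chartAt E c) y)) 2
          ((reICLM E).differentiableAt.comp y (hAd.restrictScalars ℝ))]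
      ext v
      simp only [ContinuousAlternatingMap.smul_apply, ContinuousAlternatingMap.add_apply, smul_eq_mul]
      ring

end Potentials

/-! ### The 𝔤-valued one-form of a Cartan geometry on the total space of E_H. -/

section Connection

variable {E X 𝔥 H 𝔭 P : Type*} [NormedAddCommGroup E] [NormedSpace ℂ E] [TopologicalSpace X]
  [ChartedSpace E X] [NormedAddCommGroup 𝔥] [NormedSpace ℂ 𝔥] [TopologicalSpace H]
  [ChartedSpace 𝔥 H] [Group H] [NormedAddCommGroup 𝔭] [NormedSpace ℂ 𝔭] [TopologicalSpace P]
  [ChartedSpace 𝔭 P] [LieGroup 𝓘(ℂ, 𝔥) ω H]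

namespace PrincipalBundle

variable (B : PrincipalBundle E X 𝔥 H 𝔭 P)

theorem contMDiff_act_left (h : H) : ContMDiff 𝓘(ℂ, 𝔭) 𝓘(ℂ, 𝔭) ω (fun q : P => B.act q h) :=
  B.act_hol.comp (contMDiff_id.prodMk contMDiff_const)

theorem contMDiff_act_right (p : P) : ContMDiff 𝓘(ℂ, 𝔥) 𝓘(ℂ, 𝔭) ω (fun h : H => B.act p h) :=
  B.act_hol.comp (contMDiff_const.prodMk contMDiff_id)

theorem exists_act_eq {p q : P} (h : B.proj q = B.proj p) : ∃ k, q = B.act p k := by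
  obtain ⟨e, hx, he⟩ := B.locally_trivial (B.proj p)
  have hp := act_sec he hx ⟨p, rfl⟩
  have hq := act_sec he hx ⟨q, h⟩
  refine ⟨(e p).2⁻¹ * (e q).2, ?_⟩
  change p = _ at hp
  change q = _ at hq
  have h1 : B.act p (e p).2⁻¹ = sec e (B.proj p) := by
    refine (congrArg (fun r => B.act r (e p).2⁻¹) hp).trans ?_
    simp only [← B.act_mul, mul_inv_cancel, B.act_one]
  rw [B.act_mul, h1]
  exact hq

theorem act_injective (p : P) : Function.Injective (B.act p) := by
  intro h k hk
  obtain ⟨e, hx, he⟩ := B.locally_trivial (B.proj p)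
  have hp : p ∈ e.source := e.mem_source.2 hx
  have h1 := congrArg (fun q => (e q).2) hk
  simpa [he.equivariant p hp] using h1

theorem dAct_mul (p : P) (h k : H) (w : 𝔭) :
    (B.dAct (h * k) p w : 𝔭) = B.dAct k (B.act p h) (B.dAct h p w) := by
  have h0 : (fun q => B.act q (h * k)) = (fun q => B.act q k) ∘ fun q => B.act q h := by
    ext q
    exact B.act_mul q h k
  have h1 := mfderiv_comp (I := 𝓘(ℂ, 𝔭)) (I' := 𝓘(ℂ, 𝔭)) (I'' := 𝓘(ℂ, 𝔭)) p
    ((B.contMDiff_act_left k).contMDiffAt.mdifferentiableAt (by simp))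
    ((B.contMDiff_act_left h).contMDiffAt.mdifferentiableAt (by simp))
  rw [← h0] at h1
  exact DFunLike.congr_fun h1 w

theorem dAct_one (p : P) (w : 𝔭) : (B.dAct 1 p w : 𝔭) = w := by
  have h0 : (fun q => B.act q 1) = id := funext B.act_one
  have h1 : mfderiv 𝓘(ℂ, 𝔭) 𝓘(ℂ, 𝔭) (fun q => B.act q 1) p =
    mfderiv 𝓘(ℂ, 𝔭) 𝓘(ℂ, 𝔭) id p := by rw [h0]
  rw [mfderiv_id] at h1
  exact DFunLike.congr_fun h1 w

/-- The invariant vector field along the fibre of `p` with a given value at `p`. -/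
def invariantLift (p : P) : 𝔭 →ₗ[ℂ] B.At (B.proj p) where
  toFun w := ⟨fun q => (B.dAct (B.exists_act_eq q.2).choose p w : 𝔭), fun q h => by
    have h1 := (B.exists_act_eq q.2).choose_spec
    have h2 : (B.exists_act_eq (p := p) ((B.proj_act q.1 h).trans q.2)).choose =
        (B.exists_act_eq q.2).choose * h := by
      refine B.act_injective p ?_
      rw [← (B.exists_act_eq (p := p) ((B.proj_act q.1 h).trans q.2)).choose_spec, B.act_mul, ← h1]
    change (B.dAct (B.exists_act_eq (p := p) ((B.proj_act q.1 h).trans q.2)).choose p w : 𝔭) = _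
    rw [h2]
    refine (B.dAct_mul p _ h w).trans ?_
    have h3 := mfderiv_base_eq (E := 𝔭) (E' := 𝔭) (fun r => B.act r h) h1.symm
    exact DFunLike.congr_fun h3 _⟩
  map_add' v w := Subtype.ext (funext fun q => map_add (B.dAct _ p) v w)
  map_smul' c w := Subtype.ext (funext fun q => map_smul (B.dAct _ p) c w)

theorem invariantLift_apply_act (p : P) (w : 𝔭) (h : H) (hq : B.proj (B.act p h) = B.proj p) :
    ((B.invariantLift p w).1 ⟨B.act p h, hq⟩ : 𝔭) = B.dAct h p w := by
  have h1 : (B.exists_act_eq (p := p) hq).choose = h :=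
    B.act_injective p (B.exists_act_eq (p := p) hq).choose_spec.symm
  change (B.dAct (B.exists_act_eq (p := p) hq).choose p w : 𝔭) = _
  rw [h1]

theorem invariantLift_apply_self (p : P) (w : 𝔭) :
    ((B.invariantLift p w).1 ⟨p, rfl⟩ : 𝔭) = w := by
  have h1 : (B.exists_act_eq (p := p) rfl).choose = 1 :=
    B.act_injective p ((B.exists_act_eq (p := p) rfl).choose_spec.symm.trans (B.act_one p).symm)
  change (B.dAct (B.exists_act_eq (p := p) rfl).choose p w : 𝔭) = _
  rw [h1]
  exact B.dAct_one p w

/-- Fibres are orbits of H, so an invariant field along a fibre is determined by a single value. -/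
theorem invariantLift_apply (p : P) (v : B.At (B.proj p)) :
    B.invariantLift p (v.1 ⟨p, rfl⟩) = v := by
  refine Subtype.ext (funext fun q => ?_)
  obtain ⟨q, hq⟩ := q
  obtain ⟨h, rfl⟩ := B.exists_act_eq hq
  exact (B.invariantLift_apply_act p _ h hq).trans (v.2 ⟨p, rfl⟩ h).symm

/-- Evaluation of elements of the Atiyah bundle at a point of the fibre. -/
def evalAt (p : P) : B.At (B.proj p) ≃ₗ[ℂ] 𝔭 where
  toFun v := v.1 ⟨p, rfl⟩
  invFun := B.invariantLift p
  map_add' _ _ := rfl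
  map_smul' _ _ := rfl
  left_inv := B.invariantLift_apply p
  right_inv := B.invariantLift_apply_self p

/-- The element of `ad(E_H)` with value `v` at a given point of the fibre. -/
theorem exists_adH_apply (p : P) (v : 𝔥) : ∃ a : B.AdH (B.proj p), a.1 ⟨p, rfl⟩ = v := by
  obtain ⟨e, hx, he⟩ := B.locally_trivial (B.proj p)
  refine ⟨adOf he hx (Ad 𝔥 (e p).2 v), ?_⟩
  change Ad 𝔥 (e p).2⁻¹ (Ad 𝔥 (e p).2 v) = v
  exact Ad_inv_Ad 𝔥 _ v

section Extension

variable {𝔤 G : Type*} [NormedAddCommGroup 𝔤] [NormedSpace ℂ 𝔤] [TopologicalSpace G]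
  [ChartedSpace 𝔤 G] [Group G] (ι : LieSubgroup 𝔤 G 𝔥 H)

theorem toExt_act (p : P) (h : H) (g : G) :
    B.toExt ι (B.act p h) g = B.toExt ι p (ι.incl h * g) :=
  Quotient.sound (s := B.extSetoid ι) ⟨h⁻¹, by
    rw [← B.act_mul, mul_inv_cancel, B.act_one], by rw [map_inv, inv_inv]⟩

theorem extAct_toExt (p : P) (g k : G) : B.extAct ι (B.toExt ι p g) k = B.toExt ι p (g * k) := rfl

variable [LieGroup 𝓘(ℂ, 𝔤) ω G]

theorem adG_apply_act {x : X} (b : B.AdG ι x) (p : P) (hp : B.proj p = x) (h : H)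
    (hp' : B.proj (B.act p h) = x) :
    b.1 ⟨B.toExt ι (B.act p h) 1, hp'⟩ = Ad 𝔤 (ι.incl h)⁻¹ (b.1 ⟨B.toExt ι p 1, hp⟩) := by
  refine b.2 ⟨B.toExt ι p 1, hp⟩ ⟨B.toExt ι (B.act p h) 1, hp'⟩ (ι.incl h) ?_
  change B.toExt ι (B.act p h) 1 = B.extAct ι (B.toExt ι p 1) (ι.incl h)
  rw [B.toExt_act, B.extAct_toExt, mul_one, one_mul]

theorem adG_apply_toExt {x : X} (b : B.AdG ι x) (p : P) (hp : B.proj p = x) (g : G) :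
    b.1 ⟨B.toExt ι p g, hp⟩ = Ad 𝔤 g⁻¹ (b.1 ⟨B.toExt ι p 1, hp⟩) := by
  refine b.2 ⟨B.toExt ι p 1, hp⟩ ⟨B.toExt ι p g, hp⟩ g ?_
  change B.toExt ι p g = B.extAct ι (B.toExt ι p 1) g
  rw [B.extAct_toExt, one_mul]

/-- Every point of E_G over x is the class of (p k, g) for some k in H and g in G, so equivariance
determines b by its value at the class of (p, 1). -/
theorem adG_ext {x : X} {b b' : B.AdG ι x} (p : P) (hp : B.proj p = x)
    (h : b.1 ⟨B.toExt ι p 1, hp⟩ = b'.1 ⟨B.toExt ι p 1, hp⟩) : b = b' := by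
  subst hp
  refine Subtype.ext (funext fun z => ?_)
  obtain ⟨z, hz⟩ := z
  obtain ⟨⟨q, g⟩, rfl⟩ := Quotient.exists_rep z
  obtain ⟨k, rfl⟩ := B.exists_act_eq (p := p) hz
  have h1 : ∀ b : B.AdG ι (B.proj p), b.1 ⟨B.toExt ι (B.act p k) g, hz⟩ =
      Ad 𝔤 g⁻¹ (Ad 𝔤 (ι.incl k)⁻¹ (b.1 ⟨B.toExt ι p 1, rfl⟩)) := fun b =>
    (B.adG_apply_toExt ι b (B.act p k) hz g).trans
      (congrArg _ (B.adG_apply_act ι b p rfl k hz))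
  exact (h1 b).trans ((congrArg (fun w => Ad 𝔤 g⁻¹ (Ad 𝔤 (ι.incl k)⁻¹ w)) h).trans (h1 b').symm)

variable {B} in
/-- The coordinate in `G` of a point of `E_G` given by a local trivialization of `E_H`. -/
def extCoord (e : Bundle.Trivialization H B.proj) (z : B.Ext ι) : G :=
  ι.incl (e (Quotient.out z).1).2 * (Quotient.out z).2

variable {B ι} in
-- The representative chosen by `Quotient.out` differs from (p, g) by an element of H, which cancels
-- in the product.
theorem extCoord_toExt {e : Bundle.Trivialization H B.proj}
    (he : IsHolTrivialization E 𝔥 𝔭 B.act e) (p : P) (hp : B.proj p ∈ e.baseSet) (g : G) :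
    extCoord ι e (B.toExt ι p g) = ι.incl (e p).2 * g := by
  obtain ⟨h, h1, h2⟩ : (B.extSetoid ι).r (p, g) (Quotient.out (B.toExt ι p g)) :=
    Quotient.exact (Quotient.out_eq (B.toExt ι p g)).symm
  change (Quotient.out (B.toExt ι p g)).1 = B.act p h at h1
  change (Quotient.out (B.toExt ι p g)).2 = (ι.incl h)⁻¹ * g at h2
  rw [extCoord, h1, h2, he.equivariant p (e.mem_source.2 hp), map_mul]
  group

open Classical in
variable {B} in
/-- The local section of `ad(E_G)` with constant coordinate `w` in a local trivialization. -/
def adGConst {e : Bundle.Trivialization H B.proj} (he : IsHolTrivialization E 𝔥 𝔭 B.act e)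
    (w : 𝔤) (x : X) : B.AdG ι x :=
  ⟨fun z => if x ∈ e.baseSet then Ad 𝔤 (extCoord ι e z.1)⁻¹ w else 0, by
    rintro ⟨z, hz⟩ ⟨z', hz'⟩ g h
    change z' = _ at h
    subst h
    by_cases hx : x ∈ e.baseSet
    · simp only [if_pos hx]
      obtain ⟨⟨q, k⟩, rfl⟩ := Quotient.exists_rep z
      have hq : B.proj q ∈ e.baseSet := by
        have : B.proj q = x := hz
        rwa [this]
      have h1 : extCoord ι e (B.extAct ι (B.toExt ι q k) g) = extCoord ι e (B.toExt ι q k) * g := by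
        rw [B.extAct_toExt, extCoord_toExt he q hq, extCoord_toExt he q hq, mul_assoc]
      refine (congrArg (fun t : G => Ad 𝔤 t⁻¹ w) h1).trans ?_
      rw [mul_inv_rev, Ad_mul_apply]
      rfl
    · simp only [if_neg hx, map_zero]⟩

variable {B ι} in
theorem adGConst_apply {e : Bundle.Trivialization H B.proj}
    (he : IsHolTrivialization E 𝔥 𝔭 B.act e) (w : 𝔤) (p : P) (hp : B.proj p ∈ e.baseSet) (g : G) :
    (adGConst ι he w (B.proj p)).1 ⟨B.toExt ι p g, rfl⟩ = Ad 𝔤 (ι.incl (e p).2 * g)⁻¹ w := by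
  refine (if_pos hp).trans ?_
  rw [extCoord_toExt he p hp]

variable {B ι} in
theorem adGConst_apply_sec {e : Bundle.Trivialization H B.proj}
    (he : IsHolTrivialization E 𝔥 𝔭 B.act e) (w : 𝔤) {x : X} (hx : x ∈ e.baseSet) :
    (adGConst ι he w x).1 ⟨B.toExt ι (sec e x) 1, proj_sec hx⟩ = w := by
  refine (if_pos hx).trans ?_
  have hp : B.proj (sec e x) ∈ e.baseSet := by rwa [proj_sec hx]
  rw [extCoord_toExt he _ hp, apply_sec hx]
  simp [Ad_one]

variable {B ι} in
theorem isHolAdG_adGConst {e : Bundle.Trivialization H B.proj}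
    (he : IsHolTrivialization E 𝔥 𝔭 B.act e) (w : 𝔤) {U : Set X} (hU : U ⊆ e.baseSet) :
    B.IsHolAdG ι U (adGConst ι he w) := by
  have h1 : ContMDiffOn (𝓘(ℂ, 𝔭).prod 𝓘(ℂ, 𝔤)) (𝓘(ℂ, E).prod 𝓘(ℂ, 𝔥)) ω
      (fun z : P × G => e z.1) {z | B.proj z.1 ∈ U} :=
    he.hol.comp contMDiff_fst.contMDiffOn fun z hz => e.mem_source.2 (hU hz)
  have h2 : ContMDiffOn (𝓘(ℂ, 𝔭).prod 𝓘(ℂ, 𝔤)) 𝓘(ℂ, 𝔤) ω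
      (fun z : P × G => (ι.incl (e z.1).2 * z.2)⁻¹) {z | B.proj z.1 ∈ U} :=
    ((ι.holomorphic.comp_contMDiffOn (contMDiff_snd.comp_contMDiffOn h1)).mul
      contMDiff_snd.contMDiffOn).inv
  have h3 : ContMDiffOn (𝓘(ℂ, 𝔭).prod 𝓘(ℂ, 𝔤)) 𝓘(ℂ, 𝔤) ω
      (fun z : P × G => Ad 𝔤 (ι.incl (e z.1).2 * z.2)⁻¹ w) {z | B.proj z.1 ∈ U} :=
    ((contMDiff_Ad 𝔤).comp_contMDiffOn h2).clm_apply contMDiffOn_const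
  exact h3.congr fun z hz => adGConst_apply he w z.1 (hU hz) z.2

/-- Evaluation of elements of `ad(E_G)` at the point of `E_G` given by a point of `E_H`. -/
def evalAdG (p : P) : B.AdG ι (B.proj p) →ₗ[ℂ] 𝔤 where
  toFun b := b.1 ⟨B.toExt ι p 1, rfl⟩
  map_add' _ _ := rfl
  map_smul' _ _ := rfl

theorem evalAdG_bijective (p : P) : Function.Bijective (B.evalAdG ι p) := by
  refine ⟨fun b b' h => B.adG_ext ι p rfl h, fun w => ?_⟩
  obtain ⟨e, hx, he⟩ := B.locally_trivial (B.proj p)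
  refine ⟨adGConst ι he (Ad 𝔤 (ι.incl (e p).2) w) _, ?_⟩
  refine (adGConst_apply he _ p hx 1).trans ?_
  rw [mul_one, Ad_inv_Ad]

end Extension

end PrincipalBundle

namespace BranchedCartanGeometry

variable {𝔤 G : Type*} [NormedAddCommGroup 𝔤] [NormedSpace ℂ 𝔤] [TopologicalSpace G]
  [ChartedSpace 𝔤 G] [Group G] [LieGroup 𝓘(ℂ, 𝔤) ω G]
  [IsManifold 𝓘(ℂ, E) ω X] [IsManifold 𝓘(ℂ, 𝔭) ω P]
  {ι : LieSubgroup 𝔤 G 𝔥 H} {B : PrincipalBundle E X 𝔥 H 𝔭 P} (Θ : BranchedCartanGeometry ι B)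

/-- The `𝔤`-valued `1`-form on `E_H` defined by a branched Cartan geometry. -/
def conn (p : P) : 𝔭 →ₗ[ℂ] 𝔤 := B.evalAdG ι p ∘ₗ Θ.θ (B.proj p) ∘ₗ B.invariantLift p

theorem conn_apply {x : X} (v : B.At x) (p : P) (hp : B.proj p = x) :
    Θ.conn p (v.1 ⟨p, hp⟩) = (Θ.θ x v).1 ⟨B.toExt ι p 1, hp⟩ := by
  subst hp
  change (Θ.θ (B.proj p) (B.invariantLift p _)).1 _ = _
  rw [B.invariantLift_apply]

/-- θ is defined on invariant vector fields, so evaluating the same field at p and at p h compares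
two values of one equivariant element of ad(E_G). -/
theorem conn_dAct (p : P) (h : H) (w : 𝔭) :
    Θ.conn (B.act p h) (B.dAct h p w) = Ad 𝔤 (ι.incl h)⁻¹ (Θ.conn p w) := by
  have hp := B.proj_act p h
  have h1 := Θ.conn_apply (B.invariantLift p w) (B.act p h) hp
  rw [B.adG_apply_act ι _ p rfl h hp] at h1
  refine Eq.trans ?_ h1
  exact congrArg (Θ.conn (B.act p h)) (B.invariantLift_apply_act p w h hp).symm

/-- This is θ ∘ ι₂ = ι₁ read at a point: on vertical vectors the form reproduces the generator, as a
connection form does. -/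
theorem conn_fundamental (p : P) (v : 𝔥) : Θ.conn p (B.fundamental p v) = ι.lie v := by
  obtain ⟨a, rfl⟩ := B.exists_adH_apply p v
  have h1 := Θ.conn_apply (B.iota₂ _ a) p rfl
  have h2 : Θ.θ (B.proj p) (B.iota₂ (B.proj p) a) = B.iota₁ ι (B.proj p) a :=
    DFunLike.congr_fun (Θ.comp_iota (B.proj p)) a
  rw [h2] at h1
  refine h1.trans ((B.iota₁Fun_toExt ι a p rfl 1).trans ?_)
  rw [inv_one, Ad_one]
  rfl

/-- Over a point where θ is an isomorphism, all three factors of `conn` are bijective. This is the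
only use of the open set on which θ is an isomorphism, and it matters only for a dimension count. -/
theorem exists_conn_bijective : ∃ p : P, Function.Bijective (Θ.conn p) := by
  obtain ⟨U, -, ⟨x, hx⟩, hU⟩ := Θ.iso
  obtain ⟨e, hxe, he⟩ := B.locally_trivial x
  obtain ⟨p, rfl⟩ : ∃ p, B.proj p = x := ⟨PrincipalBundle.sec e x, PrincipalBundle.proj_sec hxe⟩
  exact ⟨p, (B.evalAdG_bijective ι p).comp ((hU _ hx).comp (B.evalAt p).symm.bijective)⟩

end BranchedCartanGeometry

end Connection

/-! ### Derivatives of families of maps. -/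

section ManifoldLemmas

variable {E X F M F' M' : Type*} [NormedAddCommGroup E] [NormedSpace ℂ E] [TopologicalSpace X]
  [ChartedSpace E X] [NormedAddCommGroup F] [NormedSpace ℂ F] [TopologicalSpace M]
  [ChartedSpace F M] [NormedAddCommGroup F'] [NormedSpace ℂ F'] [TopologicalSpace M']
  [ChartedSpace F' M']

theorem tangentBundle_mk_eq {q p : M} (h : q = p) {w w' : F} (hw : w = w') :
    (⟨q, w⟩ : TangentBundle 𝓘(ℂ, F) M) = ⟨p, w'⟩ := by
  subst h hw; rfl

/-- Leibniz rule for a function of two variables restricted to the diagonal. -/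
theorem mfderiv_diag {f : X × X → M} {x : X}
    (hf : MDifferentiableAt (𝓘(ℂ, E).prod 𝓘(ℂ, E)) 𝓘(ℂ, F) f (x, x)) :
    (mfderiv 𝓘(ℂ, E) 𝓘(ℂ, F) (fun y => f (y, y)) x : E →L[ℂ] F) =
      (mfderiv 𝓘(ℂ, E) 𝓘(ℂ, F) (fun y => f (y, x)) x : E →L[ℂ] F) +
      (mfderiv 𝓘(ℂ, E) 𝓘(ℂ, F) (fun y => f (x, y)) x : E →L[ℂ] F) := by
  have hd : MDifferentiableAt 𝓘(ℂ, E) (𝓘(ℂ, E).prod 𝓘(ℂ, E)) (fun y : X => (y, y)) x :=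
    mdifferentiableAt_id.prodMk mdifferentiableAt_id
  have h1 := mfderiv_comp (g := f) (f := fun y : X => (y, y)) x hf hd
  have hl : MDifferentiableAt 𝓘(ℂ, E) (𝓘(ℂ, E).prod 𝓘(ℂ, E)) (fun y : X => (y, x)) x :=
    mdifferentiableAt_id.prodMk mdifferentiableAt_const
  have hr : MDifferentiableAt 𝓘(ℂ, E) (𝓘(ℂ, E).prod 𝓘(ℂ, E)) (fun y : X => (x, y)) x :=
    mdifferentiableAt_const.prodMk mdifferentiableAt_id
  have h2 := mfderiv_comp (g := f) (f := fun y : X => (y, x)) x hf hl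
  have h3 := mfderiv_comp (g := f) (f := fun y : X => (x, y)) x hf hr
  have e1 : (mfderiv 𝓘(ℂ, E) (𝓘(ℂ, E).prod 𝓘(ℂ, E)) (fun y : X => (y, y)) x : E →L[ℂ] E × E) =
      (mfderiv 𝓘(ℂ, E) (𝓘(ℂ, E).prod 𝓘(ℂ, E)) (fun y : X => (y, x)) x : E →L[ℂ] E × E) +
      (mfderiv 𝓘(ℂ, E) (𝓘(ℂ, E).prod 𝓘(ℂ, E)) (fun y : X => (x, y)) x : E →L[ℂ] E × E) := by
    have d1 := mdifferentiableAt_id.mfderiv_prod (x := x) (I := 𝓘(ℂ, E)) (I' := 𝓘(ℂ, E))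
      (I'' := 𝓘(ℂ, E)) (mdifferentiableAt_id (I := 𝓘(ℂ, E)) (x := x))
    have d2 := mfderiv_prod_left (I := 𝓘(ℂ, E)) (I' := 𝓘(ℂ, E)) (x₀ := x) (y₀ := x)
    have d3 := mfderiv_prod_right (I := 𝓘(ℂ, E)) (I' := 𝓘(ℂ, E)) (x₀ := x) (y₀ := x)
    rw [mfderiv_id] at d1
    refine Eq.trans d1 ?_
    refine Eq.trans ?_ (congrArg₂ (fun a b : E →L[ℂ] E × E => a + b) d2.symm d3.symm)
    refine ContinuousLinearMap.ext fun v => ?_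
    exact Prod.ext (add_zero (v : E)).symm (zero_add (v : E)).symm
  let D : E × E →L[ℂ] F := mfderiv (𝓘(ℂ, E).prod 𝓘(ℂ, E)) 𝓘(ℂ, F) f (x, x)
  refine Eq.trans h1 (Eq.trans ?_ (congrArg₂ (fun a b : E →L[ℂ] F => a + b) h2.symm h3.symm))
  refine Eq.trans (congrArg (fun a : E →L[ℂ] E × E => D.comp a) e1) ?_
  exact ContinuousLinearMap.comp_add D _ _

variable [IsManifold 𝓘(ℂ, E) ω X] [IsManifold 𝓘(ℂ, F) ω M] [IsManifold 𝓘(ℂ, F') ω M']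

/-- Holomorphic families of maps push constant vector fields to holomorphic vector fields. -/
theorem contMDiffOn_partial_derivative {ψ : E × M → M'} {O : Set E} (hO : IsOpen O)
    (hψ : ContMDiffOn (𝓘(ℂ, E).prod 𝓘(ℂ, F)) 𝓘(ℂ, F') ω ψ (O ×ˢ Set.univ)) (v : E)
    {a : M' → E} {b : M' → M} {U : Set M'} (ha : ContMDiffOn 𝓘(ℂ, F') 𝓘(ℂ, E) ω a U)
    (hb : ContMDiffOn 𝓘(ℂ, F') 𝓘(ℂ, F) ω b U) (haO : ∀ p ∈ U, a p ∈ O)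
    (hab : ∀ p ∈ U, ψ (a p, b p) = p) :
    ContMDiffOn 𝓘(ℂ, F') 𝓘(ℂ, F').tangent ω (fun p : M' => (⟨p,
      (mfderiv 𝓘(ℂ, E) 𝓘(ℂ, F') (fun t => ψ (t, b p)) (a p) : E →L[ℂ] F') v⟩ :
        TangentBundle 𝓘(ℂ, F') M')) U := by
  have hS : IsOpen (O ×ˢ (Set.univ : Set M)) := hO.prod isOpen_univ
  have h1 := hψ.contMDiffOn_tangentMapWithin (m := ω) (n := ω) (by simp) hS.uniqueMDiffOn
  -- The field in question is the image, under the tangent map of ψ, of the constant field v paired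
  -- with the zero field on M.
  have s1 : ContMDiffOn 𝓘(ℂ, F') 𝓘(ℂ, E).tangent ω
      (fun p => (⟨a p, v⟩ : TangentBundle 𝓘(ℂ, E) E)) U := by
    intro p hp
    refine Bundle.contMDiffWithinAt_totalSpace.2 ?_
    refine ⟨ha p hp, ?_⟩
    simp only [TangentBundle.trivializationAt_apply, mfld_simps]
    simp only [fderivWithin_univ]
    refine (contMDiffWithinAt_const (I := 𝓘(ℂ, F')) (I' := 𝓘(ℂ, E)) (c := v)).congr (fun q _ => ?_) ?_
    all_goals
      simp only [chartAt_self_eq, OpenPartialHomeomorph.refl_symm]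
      exact DFunLike.congr_fun fderiv_id v
  have s2 : ContMDiffOn 𝓘(ℂ, F') 𝓘(ℂ, F).tangent ω
      (fun p => (⟨b p, 0⟩ : TangentBundle 𝓘(ℂ, F) M)) U :=
    (Bundle.contMDiff_zeroSection (n := ω) (IB := 𝓘(ℂ, F)) ℂ
      (TangentSpace 𝓘(ℂ, F) : M → Type _)).comp_contMDiffOn hb
  have s3 := (contMDiff_equivTangentBundleProd_symm (n := ω) (I := 𝓘(ℂ, E)) (M := E)
    (I' := 𝓘(ℂ, F)) (M' := M)).comp_contMDiffOn (s1.prodMk s2)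
  have h2 := h1.comp s3 (fun p hp => ⟨haO p hp, trivial⟩)
  refine h2.congr fun p hp => ?_
  refine tangentBundle_mk_eq (hab p hp).symm ?_
  have hz : (a p, b p) ∈ O ×ˢ (Set.univ : Set M) := ⟨haO p hp, trivial⟩
  have h3 : mfderivWithin (𝓘(ℂ, E).prod 𝓘(ℂ, F)) 𝓘(ℂ, F') ψ (O ×ˢ Set.univ) (a p, b p) =
    mfderiv (𝓘(ℂ, E).prod 𝓘(ℂ, F)) 𝓘(ℂ, F') ψ (a p, b p) := mfderivWithin_of_isOpen hS hz
  have h4 := mfderiv_comp (a p) (I := 𝓘(ℂ, E)) (I' := 𝓘(ℂ, E).prod 𝓘(ℂ, F)) (I'' := 𝓘(ℂ, F'))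
    (g := ψ) (f := fun t : E => (t, b p))
    ((hψ.contMDiffAt (hS.mem_nhds hz)).mdifferentiableAt (by simp))
    (mdifferentiableAt_id.prodMk mdifferentiableAt_const)
  rw [mfderiv_prod_left] at h4
  refine (DFunLike.congr_fun h4 v).trans ?_
  exact (DFunLike.congr_fun h3 ((v, 0) : E × F)).symm

end ManifoldLemmas

/-! ### Pullback to X by local sections, and the gauge law. -/

section Sections

variable {E X 𝔥 H 𝔭 P : Type*} [NormedAddCommGroup E] [NormedSpace ℂ E] [TopologicalSpace X]
  [ChartedSpace E X] [NormedAddCommGroup 𝔥] [NormedSpace ℂ 𝔥] [TopologicalSpace H]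
  [ChartedSpace 𝔥 H] [Group H] [NormedAddCommGroup 𝔭] [NormedSpace ℂ 𝔭] [TopologicalSpace P]
  [ChartedSpace 𝔭 P] [LieGroup 𝓘(ℂ, 𝔥) ω H]
  [IsManifold 𝓘(ℂ, E) ω X] [IsManifold 𝓘(ℂ, 𝔭) ω P]
  {B : PrincipalBundle E X 𝔥 H 𝔭 P}

namespace PrincipalBundle

variable {e e' : Bundle.Trivialization H B.proj} (he : IsHolTrivialization E 𝔥 𝔭 B.act e)
  (he' : IsHolTrivialization E 𝔥 𝔭 B.act e')

include he in
theorem contMDiffOn_sec : ContMDiffOn 𝓘(ℂ, E) 𝓘(ℂ, 𝔭) ω (sec e) e.baseSet := by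
  refine he.hol_symm.comp (f := fun x : X => (x, (1 : H)))
    ((contMDiff_id.prodMk contMDiff_const).contMDiffOn) ?_
  intro x hx
  rw [e.target_eq]
  exact ⟨hx, trivial⟩

include he in
theorem mdifferentiableAt_sec {x : X} (hx : x ∈ e.baseSet) :
    MDifferentiableAt 𝓘(ℂ, E) 𝓘(ℂ, 𝔭) (sec e) x :=
  ((contMDiffOn_sec he).contMDiffAt (e.open_baseSet.mem_nhds hx)).mdifferentiableAt (by simp)

/-- The derivative of the section of `E_H` given by a trivialization. -/
def dSec (e : Bundle.Trivialization H B.proj) (x : X) : E →L[ℂ] 𝔭 :=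
  (mfderiv 𝓘(ℂ, E) 𝓘(ℂ, 𝔭) (sec e) x :)

include he in
theorem contMDiffOn_proj : ContMDiffOn 𝓘(ℂ, 𝔭) 𝓘(ℂ, E) ω B.proj e.source :=
  (contMDiff_fst.comp_contMDiffOn he.hol).congr fun _ hp => (e.coe_fst hp).symm

include he in
-- The local section splits the projection, so every tangent vector of X is the image of a vector on
-- P; this allows φ, which is given on such images, to be evaluated.
theorem mfderiv_proj_dSec {x : X} (hx : x ∈ e.baseSet) (v : E) :
    (mfderiv 𝓘(ℂ, 𝔭) 𝓘(ℂ, E) B.proj (sec e x) : 𝔭 →L[ℂ] E) (dSec e x v) = v := by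
  have hs : sec e x ∈ e.source := mem_source_of hx ⟨_, proj_sec hx⟩
  have h1 := mfderiv_comp (I := 𝓘(ℂ, E)) (I' := 𝓘(ℂ, 𝔭)) (I'' := 𝓘(ℂ, E)) (f := sec e)
    (g := B.proj) x
    (((contMDiffOn_proj he).contMDiffAt (e.open_source.mem_nhds hs)).mdifferentiableAt (by simp))
    (mdifferentiableAt_sec he hx)
  have h2 : B.proj ∘ sec e =ᶠ[𝓝 x] id := by
    filter_upwards [e.open_baseSet.mem_nhds hx] with y hy using proj_sec hy
  have h3 := h2.mfderiv_eq (I := 𝓘(ℂ, E)) (I' := 𝓘(ℂ, E))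
  rw [mfderiv_id] at h3
  exact (DFunLike.congr_fun h1 v).symm.trans (DFunLike.congr_fun h3 v)

/-- The transition function between two trivializations. -/
def transition (e e' : Bundle.Trivialization H B.proj) (x : X) : H := (e (sec e' x)).2

include he in
theorem sec_eq_act {x : X} (hx : x ∈ e.baseSet) (hx' : x ∈ e'.baseSet) :
    sec e' x = B.act (sec e x) (transition e e' x) :=
  act_sec he hx ⟨sec e' x, proj_sec hx'⟩

include he he' in
theorem contMDiffOn_transition : ContMDiffOn 𝓘(ℂ, E) 𝓘(ℂ, 𝔥) ω (transition e e')
    (e.baseSet ∩ e'.baseSet) :=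
  contMDiff_snd.comp_contMDiffOn (he.hol.comp ((contMDiffOn_sec he').mono Set.inter_subset_right)
    fun x hx => by
      change sec e' x ∈ e.source
      rw [e.mem_source, proj_sec hx.2]
      exact hx.1)

/-- The left logarithmic derivative `h⁻¹ dh` of the transition function. -/
def dTransition (e e' : Bundle.Trivialization H B.proj) (x : X) : E →L[ℂ] 𝔥 :=
  (mfderiv 𝓘(ℂ, E) 𝓘(ℂ, 𝔥) (fun y => (transition e e' x)⁻¹ * transition e e' y) x :)

variable (B) in
/-- The derivative of a right translation, between the model spaces. -/
def dActModel (h : H) (p : P) : 𝔭 →L[ℂ] 𝔭 := B.dAct h p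

variable (B) in
/-- The value of a fundamental vector field, in the model space. -/
def fundamentalModel (p : P) : 𝔥 →L[ℂ] 𝔭 := B.fundamental p

include he he' in
-- The product rule for the section `sec e'` = `sec e` · k, with k the transition function. Writing
-- k(y) = k(x) (k(x)⁻¹ k(y)) moves the derivative of k to the identity, where it acts as a
-- fundamental vector.
theorem dSec_change {x : X} (hx : x ∈ e.baseSet) (hx' : x ∈ e'.baseSet) (v : E) :
    dSec e' x v = B.dActModel (transition e e' x) (sec e x) (dSec e x v) +
      B.fundamentalModel (sec e' x) (dTransition e e' x v) := by
  set k := transition e e' x with hk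
  have hN : e.baseSet ∩ e'.baseSet ∈ 𝓝 x :=
    (e.open_baseSet.inter e'.open_baseSet).mem_nhds ⟨hx, hx'⟩
  have ht : MDifferentiableAt 𝓘(ℂ, E) 𝓘(ℂ, 𝔥) (transition e e') x :=
    ((contMDiffOn_transition he he').contMDiffAt hN).mdifferentiableAt (by simp)
  have hact : ∀ q : P × H, MDifferentiableAt (𝓘(ℂ, 𝔭).prod 𝓘(ℂ, 𝔥)) 𝓘(ℂ, 𝔭)
      (fun z : P × H => B.act z.1 z.2) q := fun q => B.act_hol.contMDiffAt.mdifferentiableAt (by simp)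
  have hf : MDifferentiableAt (𝓘(ℂ, E).prod 𝓘(ℂ, E)) 𝓘(ℂ, 𝔭)
      (fun z : X × X => B.act (sec e z.1) (transition e e' z.2)) (x, x) := by
    refine (hact _).comp (x, x) (f := fun z : X × X => (sec e z.1, transition e e' z.2)) ?_
    exact ((mdifferentiableAt_sec he hx).comp (x, x) mdifferentiableAt_fst).prodMk
      (ht.comp (x, x) mdifferentiableAt_snd)
  have h1 := mfderiv_diag hf
  have h2 : sec e' =ᶠ[𝓝 x] fun y => B.act (sec e y) (transition e e' y) := by
    filter_upwards [hN] with y hy using sec_eq_act he hy.1 hy.2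
  have h3 : dSec e' x = (mfderiv 𝓘(ℂ, E) 𝓘(ℂ, 𝔭)
    (fun y => B.act (sec e y) (transition e e' y)) x :) := h2.mfderiv_eq
  have h4 := mfderiv_comp (I := 𝓘(ℂ, E)) (I' := 𝓘(ℂ, 𝔭)) (I'' := 𝓘(ℂ, 𝔭)) (f := sec e)
    (g := fun q => B.act q k) x ((B.contMDiff_act_left k).contMDiffAt.mdifferentiableAt (by simp))
    (mdifferentiableAt_sec he hx)
  have h5 : (fun y => B.act (sec e x) (transition e e' y)) =
      (fun h => B.act (sec e' x) h) ∘ fun y => k⁻¹ * transition e e' y := by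
    ext y
    rw [Function.comp_apply, sec_eq_act he hx hx', ← B.act_mul, ← hk, mul_inv_cancel_left]
  have hm : MDifferentiableAt 𝓘(ℂ, E) 𝓘(ℂ, 𝔥) (fun y => k⁻¹ * transition e e' y) x :=
    (((contMDiff_mul_left (I := 𝓘(ℂ, 𝔥)) (n := ω) (a := k⁻¹)).contMDiffAt).comp x
      ((contMDiffOn_transition he he').contMDiffAt hN)).mdifferentiableAt (by simp)
  have h6 := mfderiv_comp (I := 𝓘(ℂ, E)) (I' := 𝓘(ℂ, 𝔥)) (I'' := 𝓘(ℂ, 𝔭))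
    (f := fun y => k⁻¹ * transition e e' y) (g := fun h => B.act (sec e' x) h) x
    ((B.contMDiff_act_right _).contMDiffAt.mdifferentiableAt (by simp)) hm
  rw [← h5] at h6
  have h7 := mfderiv_base_eq (E := 𝔥) (E' := 𝔭) (fun h => B.act (sec e' x) h)
    (show k⁻¹ * transition e e' x = 1 by rw [← hk, inv_mul_cancel])
  rw [h3]
  refine (DFunLike.congr_fun h1 v).trans ?_
  refine congrArg₂ (fun a b : 𝔭 => a + b) (DFunLike.congr_fun h4 v)
    ((DFunLike.congr_fun h6 v).trans ?_)
  exact DFunLike.congr_fun h7 (dTransition e e' x v)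

end PrincipalBundle

namespace BranchedCartanGeometry

open PrincipalBundle

variable {𝔤 G : Type*} [NormedAddCommGroup 𝔤] [NormedSpace ℂ 𝔤] [TopologicalSpace G]
  [ChartedSpace 𝔤 G] [Group G] [LieGroup 𝓘(ℂ, 𝔤) ω G]
  {ι : LieSubgroup 𝔤 G 𝔥 H} (Θ : BranchedCartanGeometry ι B)
  {e e' : Bundle.Trivialization H B.proj} (he : IsHolTrivialization E 𝔥 𝔭 B.act e)
  (he' : IsHolTrivialization E 𝔥 𝔭 B.act e')

/-- The `𝔤`-valued `1`-form on `X` defined by a branched Cartan geometry and a trivialization. -/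
def connForm (e : Bundle.Trivialization H B.proj) (x : X) : E →ₗ[ℂ] 𝔤 :=
  Θ.conn (sec e x) ∘ₗ (dSec e x : E →ₗ[ℂ] 𝔭)

include he he' in
-- The gauge law A' = Ad(k⁻¹) A + k⁻¹ dk: the first term comes from equivariance of `conn`, the
-- second from its values on fundamental vectors.
theorem connForm_change {x : X} (hx : x ∈ e.baseSet) (hx' : x ∈ e'.baseSet) (v : E) :
    Θ.connForm e' x v = Ad 𝔤 (ι.incl (transition e e' x))⁻¹ (Θ.connForm e x v) +
      ι.lie (dTransition e e' x v) := by
  have h1 : Θ.connForm e' x v = Θ.conn (sec e' x) (dSec e' x v) := rfl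
  rw [h1, dSec_change he he' hx hx' v, map_add]
  refine congrArg₂ (fun a b : 𝔤 => a + b) ?_ (Θ.conn_fundamental _ _)
  rw [sec_eq_act he hx hx']
  exact Θ.conn_dAct _ _ _

theorem exists_at_apply {x : X} (p : P) (hp : B.proj p = x) (w : 𝔭) :
    ∃ v : B.At x, (v.1 ⟨p, hp⟩ : 𝔭) = w := by
  subst hp
  exact ⟨B.invariantLift p w, B.invariantLift_apply_self p w⟩

include he in
/-- The form `connForm` is holomorphic. -/
theorem contDiffAt_connForm {c : OpenPartialHomeomorph X E} (hc : c ∈ atlas E X) {y : E}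
    (hy : y ∈ c.target) (hx : c.symm y ∈ e.baseSet) (v : E) :
    ContDiffAt ℂ ω (fun z => Θ.connForm e (c.symm z)
      ((mfderiv 𝓘(ℂ, E) 𝓘(ℂ, E) c.symm z : E →L[ℂ] E) v)) y := by
  classical
  have hcs : ContMDiffOn 𝓘(ℂ, E) 𝓘(ℂ, E) ω c.symm c.target :=
    contMDiffOn_symm_of_mem_maximalAtlas (IsManifold.subset_maximalAtlas hc)
  have hcc : ContMDiffOn 𝓘(ℂ, E) 𝓘(ℂ, E) ω c c.source :=
    contMDiffOn_of_mem_maximalAtlas (IsManifold.subset_maximalAtlas hc)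
  set O : Set E := c.target ∩ c.symm ⁻¹' e.baseSet with hOdef
  have hO : IsOpen O := c.isOpen_inter_preimage_symm e.open_baseSet
  set U : Set X := c.source ∩ e.baseSet with hUdef
  have hU : IsOpen U := c.open_source.inter e.open_baseSet
  have hs : ContMDiffOn 𝓘(ℂ, E) 𝓘(ℂ, 𝔭) ω (fun t => sec e (c.symm t)) O :=
    (contMDiffOn_sec he).comp (hcs.mono Set.inter_subset_left) fun t ht => ht.2
  have hsd : ∀ t ∈ O, MDifferentiableAt 𝓘(ℂ, E) 𝓘(ℂ, 𝔭) (fun t => sec e (c.symm t)) t :=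
    fun t ht => (hs.contMDiffAt (hO.mem_nhds ht)).mdifferentiableAt (by simp)
  let D : E → 𝔭 := fun t => (mfderiv 𝓘(ℂ, E) 𝓘(ℂ, 𝔭) (fun t => sec e (c.symm t)) t : E →L[ℂ] 𝔭) v
  -- Holomorphicity of Θ concerns sections of At(E_H), so the coordinate field v is lifted to the
  -- invariant field that is tangent to the local section.
  let σ : ∀ x, B.At x := fun x => if hx : x ∈ e.baseSet then
    (exists_at_apply (sec e x) (proj_sec hx) (D (c x))).choose else 0
  have hσ : ∀ x (hx : x ∈ e.baseSet), ((σ x).1 ⟨sec e x, proj_sec hx⟩ : 𝔭) = D (c x) := by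
    intro x hx
    have h1 : σ x = (exists_at_apply (sec e x) (proj_sec hx) (D (c x))).choose := dif_pos hx
    rw [h1]
    exact (exists_at_apply (sec e x) (proj_sec hx) (D (c x))).choose_spec
  -- Translating the local section by H sweeps out the part of E_H in question, and σ is the
  -- push-forward under ψ of the constant field v.
  let ψ : E × H → P := fun z => B.act (sec e (c.symm z.1)) z.2
  have hψ : ContMDiffOn (𝓘(ℂ, E).prod 𝓘(ℂ, 𝔥)) 𝓘(ℂ, 𝔭) ω ψ (O ×ˢ Set.univ) :=
    B.act_hol.comp_contMDiffOn ((hs.comp contMDiff_fst.contMDiffOn fun z hz => hz.1).prodMk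
      contMDiff_snd.contMDiffOn)
  have hUs : B.proj ⁻¹' U ⊆ e.source := fun p hp => e.mem_source.2 hp.2
  have hhol : B.IsHolAt U σ := by
    refine (contMDiffOn_partial_derivative hO hψ v (a := fun p => c (B.proj p))
      (b := fun p => (e p).2) (U := B.proj ⁻¹' U)
      (hcc.comp ((contMDiffOn_proj he).mono hUs) fun p hp => hp.1)
      (contMDiff_snd.comp_contMDiffOn (he.hol.mono hUs)) ?_ ?_).congr ?_
    · intro p hp
      refine ⟨c.map_source hp.1, ?_⟩
      change c.symm (c (B.proj p)) ∈ e.baseSet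
      rw [c.left_inv hp.1]
      exact hp.2
    · intro p hp
      change B.act (sec e (c.symm (c (B.proj p)))) (e p).2 = p
      rw [c.left_inv hp.1]
      exact (act_sec he hp.2 ⟨p, rfl⟩).symm
    · intro p hp
      refine tangentBundle_mk_eq rfl ?_
      have hcO : c (B.proj p) ∈ O := by
        refine ⟨c.map_source hp.1, ?_⟩
        change c.symm (c (B.proj p)) ∈ e.baseSet
        rw [c.left_inv hp.1]
        exact hp.2
      have h4 := mfderiv_comp (I := 𝓘(ℂ, E)) (I' := 𝓘(ℂ, 𝔭)) (I'' := 𝓘(ℂ, 𝔭))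
        (f := fun t => sec e (c.symm t)) (g := fun q => B.act q (e p).2) (c (B.proj p))
        ((B.contMDiff_act_left _).contMDiffAt.mdifferentiableAt (by simp)) (hsd _ hcO)
      refine Eq.trans ?_ (DFunLike.congr_fun h4 v).symm
      have h5 : ∀ (q : P) (hq : B.proj q = B.proj p), q = B.act (sec e (B.proj p)) (e p).2 →
          ((σ (B.proj p)).1 ⟨q, hq⟩ : 𝔭) =
            B.dAct (e p).2 (sec e (B.proj p)) ((σ (B.proj p)).1 ⟨sec e (B.proj p), proj_sec hp.2⟩) := by
        rintro q hq rfl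
        exact (σ (B.proj p)).2 ⟨sec e (B.proj p), proj_sec hp.2⟩ (e p).2
      refine (h5 p rfl (act_sec he hp.2 ⟨p, rfl⟩)).trans ?_
      have h6 := mfderiv_base_eq (E := 𝔭) (E' := 𝔭) (fun q => B.act q (e p).2)
        (show sec e (B.proj p) = sec e (c.symm (c (B.proj p))) by rw [c.left_inv hp.1])
      refine (DFunLike.congr_fun h6 _).trans ?_
      exact congrArg (mfderiv 𝓘(ℂ, 𝔭) 𝓘(ℂ, 𝔭) (fun q => B.act q (e p).2)
        (sec e (c.symm (c (B.proj p)))) : 𝔭 →L[ℂ] 𝔭) (hσ _ hp.2)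
  have h1 := Θ.holomorphic U σ hU hhol
  have h2 : ContMDiffOn 𝓘(ℂ, E) 𝓘(ℂ, 𝔤) ω (fun t => (Θ.θ (B.proj (sec e (c.symm t)))
      (σ (B.proj (sec e (c.symm t))))).1 ⟨B.toExt ι (sec e (c.symm t)) 1, rfl⟩) O := by
    refine h1.comp (f := fun t => (sec e (c.symm t), (1 : G))) (hs.prodMk contMDiffOn_const) ?_
    intro t ht
    change B.proj (sec e (c.symm t)) ∈ U
    rw [proj_sec ht.2]
    exact ⟨c.map_target ht.1, ht.2⟩
  have hyO : y ∈ O := ⟨hy, hx⟩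
  refine ((h2.contMDiffAt (hO.mem_nhds hyO)).contDiffAt).congr_of_eventuallyEq ?_
  filter_upwards [hO.mem_nhds hyO] with t ht
  have h3 : ∀ (x : X) (hq : B.proj (sec e (c.symm t)) = x),
      (Θ.θ (B.proj (sec e (c.symm t)))
      (σ (B.proj (sec e (c.symm t))))).1 ⟨B.toExt ι (sec e (c.symm t)) 1, rfl⟩ =
      Θ.conn (sec e (c.symm t)) ((σ x).1 ⟨sec e (c.symm t), hq⟩) := by
    rintro x rfl
    exact (Θ.conn_apply _ _ rfl).symm
  rw [h3 _ (proj_sec ht.2)]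
  refine congrArg (Θ.conn (sec e (c.symm t))) ?_
  refine Eq.trans ?_ (hσ _ ht.2).symm
  rw [c.right_inv ht.1]
  have h4 := mfderiv_comp (I := 𝓘(ℂ, E)) (I' := 𝓘(ℂ, E)) (I'' := 𝓘(ℂ, 𝔭))
    (f := c.symm) (g := sec e) t (mdifferentiableAt_sec he ht.2)
    ((hcs.contMDiffAt (c.open_target.mem_nhds ht.1)).mdifferentiableAt (by simp))
  exact (DFunLike.congr_fun h4 v).symm

end BranchedCartanGeometry

end Sections

/-! ### Determinants in exact sequences and in top exterior powers. -/

section LinearAlgebra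

/-- The determinant is multiplicative in short exact sequences. -/
theorem det_eq_mul_of_exact {V W Q : Type*} [AddCommGroup V] [Module ℂ V] [FiniteDimensional ℂ V]
    [AddCommGroup W] [Module ℂ W] [AddCommGroup Q] [Module ℂ Q] {i : W →ₗ[ℂ] V} {p : V →ₗ[ℂ] Q}
    (hi : Function.Injective i) (hp : Function.Surjective p)
    (hip : LinearMap.ker p = LinearMap.range i) {a : W →ₗ[ℂ] W} {f : V →ₗ[ℂ] V} {c : Q →ₗ[ℂ] Q}
    (h1 : f ∘ₗ i = i ∘ₗ a) (h2 : p ∘ₗ f = c ∘ₗ p) :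
    LinearMap.det f = LinearMap.det a * LinearMap.det c := by
  have hle : LinearMap.ker p ≤ (LinearMap.ker p).comap f := by
    intro v hv
    rw [Submodule.mem_comap, LinearMap.mem_ker]
    refine (DFunLike.congr_fun h2 v).trans ?_
    rw [LinearMap.comp_apply, LinearMap.mem_ker.1 hv, map_zero]
  rw [LinearMap.det_eq_det_mul_det (LinearMap.ker p) f hle]
  let i' : W ≃ₗ[ℂ] LinearMap.ker p :=
    (LinearEquiv.ofInjective i hi).trans (LinearEquiv.ofEq _ _ hip.symm)
  let p' : (V ⧸ LinearMap.ker p) ≃ₗ[ℂ] Q := p.quotKerEquivOfSurjective hp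
  congr 1
  · rw [← LinearMap.det_conj a i']
    congr 1
    ext w
    obtain ⟨w, rfl⟩ := i'.surjective w
    simp only [LinearMap.comp_apply, LinearEquiv.coe_coe, LinearEquiv.symm_apply_apply]
    exact DFunLike.congr_fun h1 w
  · rw [← LinearMap.det_conj _ p']
    congr 1
    ext q
    obtain ⟨v, rfl⟩ := hp q
    have h3 : p'.symm (p v) = Submodule.Quotient.mk v := p'.symm_apply_eq.2 rfl
    simp only [LinearMap.comp_apply, LinearEquiv.coe_coe, h3]
    exact DFunLike.congr_fun h2 v

/-- With as many arguments as the dimension, an alternating map is its value on a basis times the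
determinant. -/
theorem alternating_map_basis {V W ι : Type*} [Fintype ι] [DecidableEq ι] [AddCommGroup V]
    [Module ℂ V] [AddCommGroup W] [Module ℂ W] (g : V [⋀^ι]→ₗ[ℂ] W) (b : Module.Basis ι ℂ V)
    (f : V →ₗ[ℂ] V) : g (fun i => f (b i)) = LinearMap.det f • g b := by
  have h1 : g = (LinearMap.toSpanSingleton ℂ W (g b)).compAlternatingMap b.det := by
    refine Module.Basis.ext_alternating b fun v hv => ?_
    let σ := Equiv.ofBijective v (Finite.injective_iff_bijective.1 hv)
    have h2 : (fun i => b (v i)) = b ∘ σ := rfl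
    rw [h2, g.map_perm, AlternatingMap.map_perm]
    simp [b.det_self]
  have h3 := DFunLike.congr_fun h1 fun i => f (b i)
  rw [h3]
  simp only [LinearMap.compAlternatingMap_apply, LinearMap.toSpanSingleton_apply]
  rw [show (fun i => f (b i)) = f ∘ b from rfl, b.det_comp, b.det_self, mul_one]

end LinearAlgebra

/-! ### Determinants of coordinate changes of the cotangent bundle. -/

section CoordDet

variable {E : Type*} [NormedAddCommGroup E] [NormedSpace ℂ E]
  {X : Type*} [TopologicalSpace X] [ChartedSpace E X]
  {F : Type*} [NormedAddCommGroup F] [NormedSpace ℂ F]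
  {V : X → Type*} [TopologicalSpace (Bundle.TotalSpace F V)] [∀ x, AddCommGroup (V x)]
  [∀ x, Module ℂ (V x)] [∀ x, TopologicalSpace (V x)] [FiberBundle F V] [VectorBundle ℂ F V]

theorem symm_eq_symm_coordChangeL
    (e e' : Bundle.Trivialization F (Bundle.TotalSpace.proj : Bundle.TotalSpace F V → X))
    [MemTrivializationAtlas e] [MemTrivializationAtlas e'] {x : X} (hx : x ∈ e.baseSet)
    (hx' : x ∈ e'.baseSet) (v : F) : e.symm x v = e'.symm x (e.coordChangeL ℂ e' x v) := by
  have h2 : e'.linearEquivAt ℂ x hx' (e.symm x v) = e.coordChangeL ℂ e' x v := by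
    rw [e.coordChangeL_apply e' ⟨hx, hx'⟩]
    rfl
  rw [← h2]
  exact ((e'.linearEquivAt ℂ x hx').symm_apply_apply _).symm

variable [FiniteDimensional ℂ E] [IsManifold 𝓘(ℂ, E) ω X]

/-- The coordinate change of the dual bundle is the transpose of that of TX in the opposite
direction. -/
theorem coordDet_cotangent {x₀ x₁ x : X}
    (hx : x ∈ (trivializationAt E (TangentSpace 𝓘(ℂ, E)) x₀).baseSet)
    (hx' : x ∈ (trivializationAt E (TangentSpace 𝓘(ℂ, E)) x₁).baseSet) :
    coordDet (trivializationAt (E →L[ℂ] ℂ) (Cotangent E X) x₀)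
      (trivializationAt (E →L[ℂ] ℂ) (Cotangent E X) x₁) x =
    coordDet (trivializationAt E (TangentSpace 𝓘(ℂ, E)) x₁)
      (trivializationAt E (TangentSpace 𝓘(ℂ, E)) x₀) x := by
  set t := trivializationAt E (TangentSpace 𝓘(ℂ, E)) x₀
  set t' := trivializationAt E (TangentSpace 𝓘(ℂ, E)) x₁
  set T := trivializationAt (E →L[ℂ] ℂ) (Cotangent E X) x₀
  set T' := trivializationAt (E →L[ℂ] ℂ) (Cotangent E X) x₁
  have hT : x ∈ T.baseSet := ⟨hx, trivial⟩
  have hT' : x ∈ T'.baseSet := ⟨hx', trivial⟩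
  let a : E →L[ℂ] E := t'.coordChangeL ℂ t x
  have key : ∀ (φ : E →L[ℂ] ℂ) (v : E), T.coordChangeL ℂ T' x φ v = φ (a v) := by
    intro φ v
    have hT1 : ∀ (ψ : Cotangent E X x) (u : E), (T ⟨x, ψ⟩).2 u = ψ (t.symm x u) := fun ψ u => by
      rw [← t.symmL_apply (R := ℂ) hx]
      exact DFunLike.congr_fun (Bundle.Trivial.continuousLinearMapAt_trivialization ℂ X ℂ x) _
    have hT2 : ∀ (ψ : Cotangent E X x) (u : E), (T' ⟨x, ψ⟩).2 u = ψ (t'.symm x u) := fun ψ u => by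
      rw [← t'.symmL_apply (R := ℂ) hx']
      exact DFunLike.congr_fun (Bundle.Trivial.continuousLinearMapAt_trivialization ℂ X ℂ x) _
    rw [T.coordChangeL_apply T' ⟨hT, hT'⟩, hT2, symm_eq_symm_coordChangeL t' t hx' hx, ← hT1]
    have h3 := T.apply_mk_symm hT φ
    rw [h3]
    rfl
  let D : (E →L[ℂ] ℂ) ≃ₗ[ℂ] Module.Dual ℂ E := (LinearMap.toContinuousLinearMap (𝕜 := ℂ)).symm
  change _ = LinearMap.det (a : E →ₗ[ℂ] E)
  rw [coordDet, ← LinearMap.det_dualMap (a : E →ₗ[ℂ] E), ← LinearMap.det_conj _ D]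
  congr 1
  ext φ v
  obtain ⟨φ, rfl⟩ := D.surjective φ
  simp only [LinearMap.comp_apply, LinearEquiv.coe_coe, LinearEquiv.symm_apply_apply]
  exact key φ v

end CoordDet

/-! ### The character det Ad and its derivative. -/

section Character

variable (𝔤 : Type*) [NormedAddCommGroup 𝔤] [NormedSpace ℂ 𝔤]
  {G : Type*} [TopologicalSpace G] [ChartedSpace 𝔤 G] [Group G]

/-- The character `det ∘ Ad` of a complex Lie group. -/
def adDet (g : G) : ℂ := LinearMap.det (Ad 𝔤 g : 𝔤 →ₗ[ℂ] 𝔤)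

variable [LieGroup 𝓘(ℂ, 𝔤) ω G]

theorem adDet_one : adDet 𝔤 (1 : G) = 1 := by
  rw [adDet, Ad_one]
  exact LinearMap.det_id

theorem adDet_mul (g h : G) : adDet 𝔤 (g * h) = adDet 𝔤 g * adDet 𝔤 h := by
  rw [adDet, Ad_mul]
  exact LinearMap.det_comp _ _

theorem adDet_ne_zero (g : G) : adDet 𝔤 g ≠ 0 := fun h => by
  have h1 := adDet_mul 𝔤 g g⁻¹
  rw [mul_inv_cancel, adDet_one, h, zero_mul] at h1
  exact one_ne_zero h1

theorem adDet_inv (g : G) : adDet 𝔤 g⁻¹ = (adDet 𝔤 g)⁻¹ := by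
  have h1 := adDet_mul 𝔤 g⁻¹ g
  rw [inv_mul_cancel, adDet_one] at h1
  exact eq_inv_of_mul_eq_one_left h1.symm

variable [FiniteDimensional ℂ 𝔤]

theorem contMDiff_adDet : ContMDiff 𝓘(ℂ, 𝔤) 𝓘(ℂ, ℂ) ω (adDet 𝔤 : G → ℂ) :=
  contDiff_det.contMDiff.comp (contMDiff_Ad 𝔤)

variable (G) in
/-- The derivative of the character `det ∘ Ad` at the identity. -/
def adTrace : 𝔤 →L[ℂ] ℂ := (mfderiv 𝓘(ℂ, 𝔤) 𝓘(ℂ, ℂ) (adDet 𝔤 : G → ℂ) 1 :)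

/-- A character is invariant under conjugation, hence so is its derivative at 1. Therefore the
factor Ad(k⁻¹) in the gauge law disappears under `adTrace`. -/
theorem adTrace_Ad (g : G) (v : 𝔤) : adTrace 𝔤 G (Ad 𝔤 g v) = adTrace 𝔤 G v := by
  have h0 : (adDet 𝔤 : G → ℂ) ∘ (fun y => g * y * g⁻¹) = adDet 𝔤 := by
    ext y
    rw [Function.comp_apply, adDet_mul, adDet_mul, adDet_inv, mul_right_comm,
      mul_inv_cancel₀ (adDet_ne_zero 𝔤 g), one_mul]
  have h1 := mfderiv_comp (I := 𝓘(ℂ, 𝔤)) (I' := 𝓘(ℂ, 𝔤)) (I'' := 𝓘(ℂ, ℂ)) (1 : G)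
    ((contMDiff_adDet 𝔤).contMDiffAt.mdifferentiableAt (by simp))
    ((contMDiff_conj 𝔤 g).contMDiffAt.mdifferentiableAt (by simp))
  rw [h0] at h1
  have h2 := mfderiv_base_eq (E := 𝔤) (E' := ℂ) (adDet 𝔤 : G → ℂ)
    (show g * 1 * g⁻¹ = 1 by simp)
  exact (DFunLike.congr_fun h2 (Ad 𝔤 g v)).symm.trans (DFunLike.congr_fun h1 v).symm

end Character

/-! ### Transition determinants of ad(E_H). -/

section AdBundle

open PrincipalBundle

variable {E X 𝔥 H 𝔭 P : Type*} [NormedAddCommGroup E] [NormedSpace ℂ E] [TopologicalSpace X]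
  [ChartedSpace E X] [NormedAddCommGroup 𝔥] [NormedSpace ℂ 𝔥] [TopologicalSpace H]
  [ChartedSpace 𝔥 H] [Group H] [NormedAddCommGroup 𝔭] [NormedSpace ℂ 𝔭] [TopologicalSpace P]
  [ChartedSpace 𝔭 P] [LieGroup 𝓘(ℂ, 𝔥) ω H]
  (B : PrincipalBundle E X 𝔥 H 𝔭 P)

/-- The trivialization of `E_H` around `x` from which the preferred trivialization of `ad(E_H)` is
constructed. -/
def PrincipalBundle.trivAt (x : X) : Bundle.Trivialization H B.proj := (B.locally_trivial x).choose

theorem PrincipalBundle.mem_trivAt (x : X) : x ∈ (B.trivAt x).baseSet :=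
  (B.locally_trivial x).choose_spec.1

theorem PrincipalBundle.isHol_trivAt (x : X) : IsHolTrivialization E 𝔥 𝔭 B.act (B.trivAt x) :=
  (B.locally_trivial x).choose_spec.2

/-- If the local sections of E_H are related by k, the coordinates in ad(E_H) are related by
Ad(k⁻¹), whence the inverse. -/
theorem coordDet_adH {x₀ x₁ x : X} (hx : x ∈ (B.trivAt x₀).baseSet)
    (hx' : x ∈ (B.trivAt x₁).baseSet) :
    coordDet (trivializationAt 𝔥 B.AdH x₀) (trivializationAt 𝔥 B.AdH x₁) x =
      (adDet 𝔥 (transition (B.trivAt x₀) (B.trivAt x₁) x))⁻¹ := by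
  rw [← adDet_inv, coordDet, adDet]
  congr 1
  ext v
  rw [ContinuousLinearMap.coe_coe, ContinuousLinearMap.coe_coe, ContinuousLinearEquiv.coe_coe,
    (trivializationAt 𝔥 B.AdH x₀).coordChangeL_apply (trivializationAt 𝔥 B.AdH x₁) ⟨hx, hx'⟩]
  exact (adPretriv_coord (B.isHol_trivAt x₀) (B.isHol_trivAt x₁) ⟨hx, hx'⟩ v).symm

end AdBundle

/-! ### Transition functions of the line bundle of a divisor. -/

section DivisorBundle

variable {E X : Type*} [NormedAddCommGroup E] [NormedSpace ℂ E] [TopologicalSpace X]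
  [ChartedSpace E X] (D : EffectiveDivisor E X)

instance (i : D.LocalEquation) : MemTrivializationAtlas (D.lineBundleCore.localTriv i) :=
  ⟨⟨i, rfl⟩⟩

theorem coordDet_lineBundle (i j : D.LocalEquation) {x : X} (hx : x ∈ i.1.1) (hx' : x ∈ j.1.1) :
    coordDet (D.lineBundleCore.localTriv i) (D.lineBundleCore.localTriv j) x = D.ratio i j x := by
  have h : (((D.lineBundleCore.localTriv i).coordChangeL ℂ (D.lineBundleCore.localTriv j) x :
      ℂ →L[ℂ] ℂ) : ℂ →ₗ[ℂ] ℂ) = D.ratio i j x • LinearMap.id := by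
    ext
    exact D.lineBundleCore.localTriv_coordChange_eq (i := i) (j := j) ⟨hx, hx'⟩ 1
  rw [coordDet, h, LinearMap.det_smul]
  simp

end DivisorBundle

/-! ### The trace form of a geometry and a linear model of 𝔤/𝔥. -/

section Branching

open PrincipalBundle

variable {E X 𝔥 H 𝔭 P : Type*} [NormedAddCommGroup E] [NormedSpace ℂ E] [TopologicalSpace X]
  [ChartedSpace E X] [NormedAddCommGroup 𝔥] [NormedSpace ℂ 𝔥] [TopologicalSpace H]
  [ChartedSpace 𝔥 H] [Group H] [NormedAddCommGroup 𝔭] [NormedSpace ℂ 𝔭] [TopologicalSpace P]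
  [ChartedSpace 𝔭 P] [LieGroup 𝓘(ℂ, 𝔥) ω H]
  [IsManifold 𝓘(ℂ, E) ω X] [IsManifold 𝓘(ℂ, 𝔭) ω P]
  {𝔤 G : Type*} [NormedAddCommGroup 𝔤] [NormedSpace ℂ 𝔤] [TopologicalSpace G]
  [ChartedSpace 𝔤 G] [Group G] [LieGroup 𝓘(ℂ, 𝔤) ω G] [FiniteDimensional ℂ 𝔤]
  {ι : LieSubgroup 𝔤 G 𝔥 H} {B : PrincipalBundle E X 𝔥 H 𝔭 P} (Θ : BranchedCartanGeometry ι B)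
  [FiniteDimensional ℂ E]
  {e e' : Bundle.Trivialization H B.proj} (he : IsHolTrivialization E 𝔥 𝔭 B.act e)
  (he' : IsHolTrivialization E 𝔥 𝔭 B.act e')

variable (E) in
/-- The derivative of a function on `X`, on the model space. -/
def modelDeriv (g : X → ℂ) (x : X) : E →L[ℂ] ℂ := (mfderiv 𝓘(ℂ, E) 𝓘(ℂ, ℂ) g x :)

/-- With χ = det Ad, multiplicativity gives χ(k(x)⁻¹ k(y)) = χ(k(x))⁻¹ χ(k(y)). Differentiating at y
= x identifies the derivative of χ on k⁻¹ dk with the logarithmic derivative of χ(k). -/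
theorem adTrace_lie_dTransition (he : IsHolTrivialization E 𝔥 𝔭 B.act e)
    (he' : IsHolTrivialization E 𝔥 𝔭 B.act e') {x : X} (hx : x ∈ e.baseSet) (hx' : x ∈ e'.baseSet)
    (v : E) : adTrace 𝔤 G (ι.lie (dTransition e e' x v)) =
      (adDet 𝔤 (ι.incl (transition e e' x)))⁻¹ *
        modelDeriv E (fun y => adDet 𝔤 (ι.incl (transition e e' y))) x v := by
  set k := transition e e' x with hk
  have hN : e.baseSet ∩ e'.baseSet ∈ 𝓝 x :=
    (e.open_baseSet.inter e'.open_baseSet).mem_nhds ⟨hx, hx'⟩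
  have ht := (contMDiffOn_transition he he').contMDiffAt hN
  have hm : MDifferentiableAt 𝓘(ℂ, E) 𝓘(ℂ, 𝔥) (fun y => k⁻¹ * transition e e' y) x :=
    (((contMDiff_mul_left (I := 𝓘(ℂ, 𝔥)) (n := ω) (a := k⁻¹)).contMDiffAt).comp x
      ht).mdifferentiableAt (by simp)
  have hχ : ContMDiff 𝓘(ℂ, 𝔥) 𝓘(ℂ, ℂ) ω (fun h : H => adDet 𝔤 (ι.incl h)) :=
    (contMDiff_adDet 𝔤).comp ι.holomorphic
  have h1 := mfderiv_comp (I := 𝓘(ℂ, E)) (I' := 𝓘(ℂ, 𝔥)) (I'' := 𝓘(ℂ, ℂ))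
    (f := fun y => k⁻¹ * transition e e' y) (g := fun h : H => adDet 𝔤 (ι.incl h)) x
    (hχ.contMDiffAt.mdifferentiableAt (by simp)) hm
  have hk1 : k⁻¹ * transition e e' x = 1 := by rw [← hk, inv_mul_cancel]
  have h2 := mfderiv_base_eq (E := 𝔥) (E' := ℂ) (fun h : H => adDet 𝔤 (ι.incl h)) hk1
  have h3 := mfderiv_comp (I := 𝓘(ℂ, 𝔥)) (I' := 𝓘(ℂ, 𝔤)) (I'' := 𝓘(ℂ, ℂ))
    (f := ι.incl) (g := (adDet 𝔤 : G → ℂ)) 1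
    ((contMDiff_adDet 𝔤).contMDiffAt.mdifferentiableAt (by simp))
    (ι.holomorphic.contMDiffAt.mdifferentiableAt (by simp))
  have h4 := mfderiv_base_eq (E := 𝔤) (E' := ℂ) (adDet 𝔤 : G → ℂ) (map_one ι.incl)
  have h5 : (fun h : H => adDet 𝔤 (ι.incl h)) ∘ (fun y => k⁻¹ * transition e e' y) =
      (adDet 𝔤 (ι.incl k))⁻¹ • fun y => adDet 𝔤 (ι.incl (transition e e' y)) := by
    ext y
    simp only [Function.comp_apply, map_mul, map_inv, adDet_mul, adDet_inv, Pi.smul_apply,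
      smul_eq_mul]
  rw [h5] at h1
  have h6 : MDifferentiableAt 𝓘(ℂ, E) 𝓘(ℂ, ℂ) (fun y => adDet 𝔤 (ι.incl (transition e e' y))) x :=
    (hχ.contMDiffAt.comp x ht).mdifferentiableAt (by simp)
  have h7 := const_smul_mfderiv h6 (adDet 𝔤 (ι.incl k))⁻¹
  have h8 := (DFunLike.congr_fun h7 v).symm.trans (DFunLike.congr_fun h1 v)
  refine Eq.trans ?_ h8.symm
  refine Eq.trans ?_ (DFunLike.congr_fun h2 (dTransition e e' x v)).symm
  refine Eq.trans ?_ (DFunLike.congr_fun h3 (dTransition e e' x v)).symm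
  exact (DFunLike.congr_fun h4 (ι.lie (dTransition e e' x v))).symm

namespace BranchedCartanGeometry

/-- The holomorphic `1`-form on `X` obtained from the connection form by the derivative of the
character `det ∘ Ad`. -/
def traceForm (e : Bundle.Trivialization H B.proj) (x : X) : E →L[ℂ] ℂ :=
  LinearMap.toContinuousLinearMap ((adTrace 𝔤 G : 𝔤 →ₗ[ℂ] ℂ) ∘ₗ Θ.connForm e x)

/-- The derivative of χ applied to the gauge law: the trace form changes like a connection form on a
line bundle. -/
theorem traceForm_change (he : IsHolTrivialization E 𝔥 𝔭 B.act e)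
    (he' : IsHolTrivialization E 𝔥 𝔭 B.act e') {x : X} (hx : x ∈ e.baseSet) (hx' : x ∈ e'.baseSet)
    (v : E) : Θ.traceForm e' x v = Θ.traceForm e x v + (adDet 𝔤 (ι.incl (transition e e' x)))⁻¹ *
        modelDeriv E (fun y => adDet 𝔤 (ι.incl (transition e e' y))) x v := by
  have h1 : Θ.traceForm e' x v = adTrace 𝔤 G (Θ.connForm e' x v) := rfl
  have h2 : Θ.traceForm e x v = adTrace 𝔤 G (Θ.connForm e x v) := rfl
  rw [h1, h2, Θ.connForm_change he he' hx hx', map_add, adTrace_Ad,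
    adTrace_lie_dTransition he he' hx hx']

theorem contDiffAt_traceForm (he : IsHolTrivialization E 𝔥 𝔭 B.act e)
    {c : OpenPartialHomeomorph X E} (hc : c ∈ atlas E X) {y : E}
    (hy : y ∈ c.target) (hx : c.symm y ∈ e.baseSet) :
    ContDiffAt ℂ ω (holFormInChart (fun x => Θ.traceForm e x) c) y := by
  have hO := c.isOpen_inter_preimage_symm e.open_baseSet
  refine ContDiffOn.contDiffAt (s := c.target ∩ c.symm ⁻¹' e.baseSet) ?_ (hO.mem_nhds ⟨hy, hx⟩)
  rw [contDiffOn_clm_apply]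
  intro v z hz
  exact ((adTrace 𝔤 G).contDiff.contDiffAt.comp z
    (Θ.contDiffAt_connForm he hc hz.1 hz.2 v)).contDiffWithinAt

end BranchedCartanGeometry

/-- There is a linear model of the projection of `𝔤` to the tangent space of `G/H`. -/
theorem BranchedCartanGeometry.exists_projection [FiniteDimensional ℂ 𝔥]
    (Θ : BranchedCartanGeometry ι B) :
    ∃ ϖ : 𝔤 →ₗ[ℂ] E, Function.Surjective ϖ ∧ LinearMap.ker ϖ = LinearMap.range (ι.lie : 𝔥 →ₗ[ℂ] 𝔤) := by
  obtain ⟨p, hp⟩ := Θ.exists_conn_bijective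
  obtain ⟨e, hpe, he⟩ := B.locally_trivial (B.proj p)
  have hps : p ∈ e.source := e.mem_source.2 hpe
  have h1 : MDifferentiableAt 𝓘(ℂ, 𝔭) (𝓘(ℂ, E).prod 𝓘(ℂ, 𝔥)) e p :=
    (he.hol.contMDiffAt (e.open_source.mem_nhds hps)).mdifferentiableAt (by simp)
  have h2 : MDifferentiableAt (𝓘(ℂ, E).prod 𝓘(ℂ, 𝔥)) 𝓘(ℂ, 𝔭) e.toOpenPartialHomeomorph.symm (e p) :=
    (he.hol_symm.contMDiffAt (e.open_target.mem_nhds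
      (e.toOpenPartialHomeomorph.map_source hps))).mdifferentiableAt (by simp)
  have h2' : MDifferentiableAt (𝓘(ℂ, E).prod 𝓘(ℂ, 𝔥)) 𝓘(ℂ, 𝔭) e.toOpenPartialHomeomorph.symm (e p) := h2
  have h3 := mfderiv_comp p h2 h1
  have h4 : e.toOpenPartialHomeomorph.symm ∘ e =ᶠ[𝓝 p] id := by
    filter_upwards [e.open_source.mem_nhds hps] with q hq
    exact e.toOpenPartialHomeomorph.left_inv hq
  rw [h4.mfderiv_eq, mfderiv_id] at h3
  have h5 : MDifferentiableAt 𝓘(ℂ, 𝔭) (𝓘(ℂ, E).prod 𝓘(ℂ, 𝔥)) e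
      (e.toOpenPartialHomeomorph.symm (e p)) := by
    have : e.toOpenPartialHomeomorph.symm (e p) = p := e.toOpenPartialHomeomorph.left_inv hps
    rw [this]; exact h1
  have h6 := mfderiv_comp (e p) h5 h2
  have h7 : e ∘ e.toOpenPartialHomeomorph.symm =ᶠ[𝓝 (e p)] id := by
    filter_upwards [e.open_target.mem_nhds (e.toOpenPartialHomeomorph.map_source hps)] with q hq
    exact e.toOpenPartialHomeomorph.right_inv hq
  rw [h7.mfderiv_eq, mfderiv_id] at h6
  let D1 : 𝔭 →L[ℂ] E × 𝔥 := (mfderiv 𝓘(ℂ, 𝔭) (𝓘(ℂ, E).prod 𝓘(ℂ, 𝔥)) e p :)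
  let D2 : E × 𝔥 →L[ℂ] 𝔭 :=
    (mfderiv (𝓘(ℂ, E).prod 𝓘(ℂ, 𝔥)) 𝓘(ℂ, 𝔭) e.toOpenPartialHomeomorph.symm (e p) :)
  have i1 : Function.LeftInverse D2 D1 := fun v => (DFunLike.congr_fun h3 v).symm
  have i2 : Function.Surjective D1 := fun v => ⟨D2 v, by
    refine Eq.trans ?_ (DFunLike.congr_fun h6 v).symm
    have h8 : ∀ q, q = p → ∀ w : 𝔭, D1 w =
        (mfderiv 𝓘(ℂ, 𝔭) (𝓘(ℂ, E).prod 𝓘(ℂ, 𝔥)) e q : 𝔭 →L[ℂ] E × 𝔥) w := by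
      rintro q rfl w; rfl
    exact h8 _ (e.toOpenPartialHomeomorph.left_inv hps) _⟩
  -- A trivialization of E_H splits the tangent space of P as E × 𝔥, so that dim 𝔤 = dim E + dim 𝔥.
  let L1 : 𝔭 ≃ₗ[ℂ] E × 𝔥 := LinearEquiv.ofBijective (D1 : 𝔭 →ₗ[ℂ] E × 𝔥) ⟨i1.injective, i2⟩
  let L2 : 𝔭 ≃ₗ[ℂ] 𝔤 := LinearEquiv.ofBijective (Θ.conn p) hp
  have d1 : Module.finrank ℂ 𝔤 = Module.finrank ℂ E + Module.finrank ℂ 𝔥 := by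
    rw [← L2.finrank_eq, L1.finrank_eq, Module.finrank_prod]
  have d2 : Module.finrank ℂ (LinearMap.range (ι.lie : 𝔥 →ₗ[ℂ] 𝔤)) = Module.finrank ℂ 𝔥 :=
    LinearMap.finrank_range_of_inj ι.immersion
  have d3 := Submodule.finrank_quotient_add_finrank (LinearMap.range (ι.lie : 𝔥 →ₗ[ℂ] 𝔤))
  -- Any isomorphism will do, since ϖ only serves as a choice of coordinates on 𝔤/𝔥.
  let L : (𝔤 ⧸ LinearMap.range (ι.lie : 𝔥 →ₗ[ℂ] 𝔤)) ≃ₗ[ℂ] E :=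
    LinearEquiv.ofFinrankEq _ _ (by omega)
  refine ⟨L ∘ₗ (LinearMap.range (ι.lie : 𝔥 →ₗ[ℂ] 𝔤)).mkQ,
    L.surjective.comp (Submodule.mkQ_surjective _), ?_⟩
  rw [LinearMap.ker_comp, LinearEquiv.ker, ← LinearMap.ker]
  exact Submodule.ker_mkQ _

end Branching

/-! ### Local equations of the branching divisor. -/

open PrincipalBundle

variable {E X 𝔥 H 𝔭 P : Type*} [NormedAddCommGroup E] [NormedSpace ℂ E] [TopologicalSpace X]
  [ChartedSpace E X] [NormedAddCommGroup 𝔥] [NormedSpace ℂ 𝔥] [TopologicalSpace H]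
  [ChartedSpace 𝔥 H] [Group H] [NormedAddCommGroup 𝔭] [NormedSpace ℂ 𝔭] [TopologicalSpace P]
  [ChartedSpace 𝔭 P] [LieGroup 𝓘(ℂ, 𝔥) ω H]
  [IsManifold 𝓘(ℂ, E) ω X] [IsManifold 𝓘(ℂ, 𝔭) ω P]
  {𝔤 G : Type*} [NormedAddCommGroup 𝔤] [NormedSpace ℂ 𝔤] [TopologicalSpace G]
  [ChartedSpace 𝔤 G] [Group G] [LieGroup 𝓘(ℂ, 𝔤) ω G] [FiniteDimensional ℂ 𝔤]
  {ι : LieSubgroup 𝔤 G 𝔥 H} {B : PrincipalBundle E X 𝔥 H 𝔭 P} (Θ : BranchedCartanGeometry ι B)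
  [FiniteDimensional ℂ E]

/-- A trivialization of the tangent bundle. -/
abbrev TangentTriv (E X : Type*) [NormedAddCommGroup E] [NormedSpace ℂ E] [TopologicalSpace X]
  [ChartedSpace E X] [IsManifold 𝓘(ℂ, E) ω X] : Type _ :=
  Bundle.Trivialization E (Bundle.TotalSpace.proj :
    Bundle.TotalSpace E (TangentSpace 𝓘(ℂ, E) : X → Type _) → X)

/-- The frame of `T_x X` given by a trivialization, as a linear map between model spaces. -/
def tangentFrame (t : TangentTriv E X) [MemTrivializationAtlas t] (x : X) : E →ₗ[ℂ] E :=
  t.symmₗ ℂ x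

theorem tangentFrame_change (t t' : TangentTriv E X) [MemTrivializationAtlas t]
    [MemTrivializationAtlas t'] {x : X} (hx : x ∈ t.baseSet) (hx' : x ∈ t'.baseSet) :
    tangentFrame t' x = tangentFrame t x ∘ₗ ((t'.coordChangeL ℂ t x : E →L[ℂ] E) : E →ₗ[ℂ] E) := by
  ext v
  have h1 := symm_eq_symm_coordChangeL t' t hx' hx v
  rw [← t'.coe_symmₗ (R := ℂ) hx', ← t.coe_symmₗ (R := ℂ) hx] at h1
  exact h1

theorem isTangentFrame_symm (t : TangentTriv E X) [MemTrivializationAtlas t] {U : Set X}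
    (hU : U ⊆ t.baseSet) (b : Module.Basis (Fin (Module.finrank ℂ E)) ℂ E) :
    IsTangentFrame (E := E) U fun k x => t.symmₗ ℂ x (b k) := by
  have hb : ∀ x ∈ U, ∀ k, t.symmₗ ℂ x (b k) = t.localFrame b k x := by
    intro x hx k
    rw [t.localFrame_apply_of_mem_baseSet b (hU hx), t.coe_symmₗ (R := ℂ) (hU hx)]
    rfl
  refine ⟨fun k => ?_, fun x hx => ?_⟩
  · refine ((t.contMDiffOn_localFrame_baseSet ω b k).mono hU).congr fun x hx => ?_
    exact congrArg (Bundle.TotalSpace.mk x) (hb x hx k)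
  · have h := t.isLocalFrameOn_localFrame_baseSet 𝓘(ℂ, E) ω b
    have h1 : (fun k => t.symmₗ ℂ x (b k)) = fun k => t.localFrame b k x := funext (hb x hx)
    rw [h1]
    exact ⟨h.linearIndependent (hU hx), top_le_iff.1 (h.generating (hU hx))⟩

/-- Precomposed with L, the wedge of d vectors becomes an alternating map of top degree on V, which
the endomorphism M multiplies by its determinant. -/
theorem exteriorPower_map_eq {T V Q : Type*} [AddCommGroup T] [Module ℂ T] [AddCommGroup V]
    [Module ℂ V] [AddCommGroup Q] [Module ℂ Q] {d : ℕ} (φ : T →ₗ[ℂ] Q)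
    (b : Module.Basis (Fin d) ℂ V) (L : V ≃ₗ[ℂ] Q) (M : V →ₗ[ℂ] V) (u : Fin d → T)
    (h : ∀ k, φ (u k) = L (M (b k))) :
    exteriorPower.map d φ (exteriorPower.ιMulti ℂ d u) =
      LinearMap.det M • exteriorPower.ιMulti ℂ d fun k => L (b k) := by
  have h4 := alternating_map_basis ((exteriorPower.ιMulti ℂ d).compLinearMap (L : V →ₗ[ℂ] Q)) b M
  rw [exteriorPower.map_apply_ιMulti]
  exact (congrArg (exteriorPower.ιMulti ℂ d) (funext h)).trans h4

namespace BranchedCartanGeometry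

/-- The determinant of the soldering form in the frames given by trivializations. -/
def branchFun (ϖ : 𝔤 →ₗ[ℂ] E) (e : Bundle.Trivialization H B.proj) (t : TangentTriv E X)
    [MemTrivializationAtlas t] (x : X) : ℂ :=
  LinearMap.det (ϖ ∘ₗ Θ.connForm e x ∘ₗ tangentFrame t x)

variable {ϖ : 𝔤 →ₗ[ℂ] E} (hϖ : Function.Surjective ϖ)
  (hker : LinearMap.ker ϖ = LinearMap.range (ι.lie : 𝔥 →ₗ[ℂ] 𝔤))
  {e e' : Bundle.Trivialization H B.proj} (he : IsHolTrivialization E 𝔥 𝔭 B.act e)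
  (he' : IsHolTrivialization E 𝔥 𝔭 B.act e')

include hϖ hker in
omit [LieGroup 𝓘(ℂ, 𝔤) ω G] in
-- Ad of an element of H preserves 𝔥 and so descends to 𝔤/𝔥, modelled on E by ϖ. Determinants
-- multiply along 0 → 𝔥 → 𝔤 → 𝔤/𝔥 → 0.
theorem exists_quotient_ad [LieGroup 𝓘(ℂ, 𝔤) ω G] (h : H) :
    ∃ c : E →ₗ[ℂ] E, ϖ ∘ₗ (Ad 𝔤 (ι.incl h) : 𝔤 →ₗ[ℂ] 𝔤) = c ∘ₗ ϖ ∧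
      adDet 𝔤 (ι.incl h) = adDet 𝔥 h * LinearMap.det c := by
  have h1 : ((Ad 𝔤 (ι.incl h) : 𝔤 →L[ℂ] 𝔤) : 𝔤 →ₗ[ℂ] 𝔤) ∘ₗ (ι.lie : 𝔥 →ₗ[ℂ] 𝔤) =
      (ι.lie : 𝔥 →ₗ[ℂ] 𝔤) ∘ₗ (Ad 𝔥 h : 𝔥 →ₗ[ℂ] 𝔥) := by
    ext v
    exact (ι.lie_Ad h v).symm
  have hle : LinearMap.ker ϖ ≤ LinearMap.ker (ϖ ∘ₗ (Ad 𝔤 (ι.incl h) : 𝔤 →ₗ[ℂ] 𝔤)) := by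
    intro v hv
    rw [hker] at hv
    obtain ⟨u, rfl⟩ := hv
    rw [LinearMap.mem_ker]
    have h2 : (ι.lie (Ad 𝔥 h u) : 𝔤) ∈ LinearMap.ker ϖ := by
      rw [hker]; exact ⟨_, rfl⟩
    rw [ι.lie_Ad] at h2
    exact h2
  refine ⟨(LinearMap.ker ϖ).liftQ _ hle ∘ₗ (ϖ.quotKerEquivOfSurjective hϖ).symm, ?_, ?_⟩
  · ext v
    have h3 : (ϖ.quotKerEquivOfSurjective hϖ).symm (ϖ v) = Submodule.Quotient.mk v :=
      (ϖ.quotKerEquivOfSurjective hϖ).symm_apply_eq.2 rfl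
    simp only [LinearMap.comp_apply, LinearEquiv.coe_coe, h3]
    rfl
  · refine det_eq_mul_of_exact (i := (ι.lie : 𝔥 →ₗ[ℂ] 𝔤)) ι.immersion hϖ hker h1 ?_
    ext v
    have h3 : (ϖ.quotKerEquivOfSurjective hϖ).symm (ϖ v) = Submodule.Quotient.mk v :=
      (ϖ.quotKerEquivOfSurjective hϖ).symm_apply_eq.2 rfl
    simp only [LinearMap.comp_apply, LinearEquiv.coe_coe, h3]
    rfl

include hϖ hker he he' in
-- Modulo 𝔥 the inhomogeneous term of the gauge law vanishes. What remains is linear, and the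
-- determinant picks up that of Ad(k⁻¹) on 𝔤/𝔥 and that of the change of tangent frame.
theorem branchFun_change (t t' : TangentTriv E X) [MemTrivializationAtlas t]
    [MemTrivializationAtlas t'] {x : X} (hx : x ∈ e.baseSet) (hx' : x ∈ e'.baseSet)
    (ht : x ∈ t.baseSet) (ht' : x ∈ t'.baseSet) :
    Θ.branchFun ϖ e' t' x = (adDet 𝔤 (ι.incl (transition e e' x)))⁻¹ *
      adDet 𝔥 (transition e e' x) * coordDet t' t x * Θ.branchFun ϖ e t x := by
  set k := transition e e' x
  obtain ⟨c, hc, hdet⟩ := exists_quotient_ad hϖ hker k⁻¹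
  have h1 : ϖ ∘ₗ Θ.connForm e' x ∘ₗ tangentFrame t' x =
      c ∘ₗ (ϖ ∘ₗ Θ.connForm e x ∘ₗ tangentFrame t x) ∘ₗ
        ((t'.coordChangeL ℂ t x : E →L[ℂ] E) : E →ₗ[ℂ] E) := by
    rw [tangentFrame_change t t' ht ht']
    refine LinearMap.ext fun v => ?_
    simp only [LinearMap.comp_apply]
    rw [Θ.connForm_change he he' hx hx', map_add]
    have h2 : ∀ u : 𝔥, ϖ (ι.lie u) = 0 := fun u => by
      have : (ι.lie u : 𝔤) ∈ LinearMap.ker ϖ := by rw [hker]; exact ⟨_, rfl⟩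
      exact this
    rw [h2, add_zero, ← map_inv]
    exact DFunLike.congr_fun hc _
  rw [branchFun, h1, LinearMap.det_comp, LinearMap.det_comp, coordDet, branchFun]
  rw [map_inv, adDet_inv, adDet_inv] at hdet
  have h3 : LinearMap.det c = (adDet 𝔤 (ι.incl k))⁻¹ * adDet 𝔥 k := by
    rw [hdet]
    field_simp [adDet_ne_zero 𝔥 k]
  rw [h3]
  ring

include hϖ hker he in
omit [IsManifold 𝓘(ℂ, E) ω X] [IsManifold 𝓘(ℂ, 𝔭) ω P] [FiniteDimensional ℂ 𝔤]
  [FiniteDimensional ℂ E] in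
/-- The fibres of `ad(E_G)/ad(E_H)` are identified with the model space by a trivialization. -/
theorem exists_adQuot_equiv {x : X} (hx : x ∈ e.baseSet) : ∃ L : B.AdQuot ι x ≃ₗ[ℂ] E,
    ∀ a : B.AdG ι x, L ((LinearMap.range (B.iota₁ ι x)).mkQ a) =
      ϖ (a.1 ⟨B.toExt ι (sec e x) 1, proj_sec hx⟩) := by
  let ev : B.AdG ι x →ₗ[ℂ] 𝔤 :=
    { toFun := fun a => a.1 ⟨B.toExt ι (sec e x) 1, proj_sec hx⟩
      map_add' := fun _ _ => rfl
      map_smul' := fun _ _ => rfl }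
  have hev : Function.Surjective ev := fun w => ⟨adGConst ι he w x, adGConst_apply_sec he w hx⟩
  have hinj : Function.Injective ev := fun a a' h => B.adG_ext ι (sec e x) (proj_sec hx) h
  have hi : ∀ a : B.AdH x, ev (B.iota₁ ι x a) = ι.lie (a.1 ⟨sec e x, proj_sec hx⟩) := fun a => by
    refine (B.iota₁Fun_toExt ι a (sec e x) (proj_sec hx) 1).trans ?_
    rw [inv_one, Ad_one]
    rfl
  have hk : LinearMap.ker (ϖ ∘ₗ ev) = LinearMap.range (B.iota₁ ι x) := by
    ext a
    rw [LinearMap.mem_ker, LinearMap.comp_apply, ← LinearMap.mem_ker, hker]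
    constructor
    · rintro ⟨u, hu⟩
      refine ⟨adOf he hx u, hinj ?_⟩
      rw [hi, adOf_sec]
      exact hu
    · rintro ⟨a, rfl⟩
      exact ⟨_, (hi a).symm⟩
  exact ⟨(Submodule.quotEquivOfEq _ _ hk.symm).trans
    ((ϖ ∘ₗ ev).quotKerEquivOfSurjective (hϖ.comp hev)), fun a => rfl⟩

include he in
/-- The homomorphism `TX → ad(E_G)/ad(E_H)` in terms of the connection form. -/
theorem isInduced_eq {φ : ∀ x : X, TangentSpace 𝓘(ℂ, E) x →ₗ[ℂ] B.AdQuot ι x}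
    (hφ : Θ.IsInduced φ) {x : X} (hx : x ∈ e.baseSet) {L : B.AdQuot ι x ≃ₗ[ℂ] E}
    (hL : ∀ a : B.AdG ι x, L ((LinearMap.range (B.iota₁ ι x)).mkQ a) =
      ϖ (a.1 ⟨B.toExt ι (sec e x) 1, proj_sec hx⟩)) (u : E) :
    φ x u = L.symm (ϖ (Θ.connForm e x u)) := by
  obtain ⟨v, hv⟩ := exists_at_apply (B := B) (sec e x) (proj_sec hx) (dSec e x u)
  have h3 : ∀ (y : X) (hy : B.proj (sec e x) = y) (v : B.At y), φ y
      ((mfderiv 𝓘(ℂ, 𝔭) 𝓘(ℂ, E) B.proj (sec e x) : 𝔭 →L[ℂ] E) (v.1 ⟨sec e x, hy⟩)) =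
      (LinearMap.range (B.iota₁ ι y)).mkQ (Θ.θ y v) := by
    rintro y rfl v
    exact hφ (sec e x) v
  have h5 : (mfderiv 𝓘(ℂ, 𝔭) 𝓘(ℂ, E) B.proj (sec e x) : 𝔭 →L[ℂ] E)
      (v.1 ⟨sec e x, proj_sec hx⟩) = u :=
    (congrArg (mfderiv 𝓘(ℂ, 𝔭) 𝓘(ℂ, E) B.proj (sec e x) : 𝔭 →L[ℂ] E) hv).trans
      (mfderiv_proj_dSec he hx u)
  have h6 : φ x u = (LinearMap.range (B.iota₁ ι x)).mkQ (Θ.θ x v) :=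
    (congrArg (φ x) h5).symm.trans (h3 x (proj_sec hx) v)
  have h7 : (Θ.θ x v).1 ⟨B.toExt ι (sec e x) 1, proj_sec hx⟩ = Θ.connForm e x u :=
    (Θ.conn_apply v (sec e x) (proj_sec hx)).symm.trans (congrArg (Θ.conn (sec e x)) hv)
  refine h6.trans ((LinearEquiv.eq_symm_apply L).2 ?_)
  exact (hL _).trans (congrArg ϖ h7)

include hϖ hker he in
-- The function is the coefficient of ⋀ᵈφ in explicit frames: the tangent frame of t, and the
-- sections of ad(E_G) with constant coordinates in e that lift a basis of E through ϖ. The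
-- definition of the branching divisor then applies.
theorem localEq_branchFun {D : EffectiveDivisor E X} (hD : Θ.IsBranchingDivisor D)
    (t : TangentTriv E X) [MemTrivializationAtlas t] :
    D.localEq (e.baseSet ∩ t.baseSet) (Θ.branchFun ϖ e t) := by
  obtain ⟨φ, hφ, hloc⟩ := hD
  let b := Module.finBasis ℂ E
  choose w hw using fun k => hϖ (b k)
  have hq : ∀ x (hx : x ∈ e.baseSet), ∃ L : B.AdQuot ι x ≃ₗ[ℂ] E,
      (∀ k, (LinearMap.range (B.iota₁ ι x)).mkQ (adGConst ι he (w k) x) = L.symm (b k)) ∧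
      ∀ u : E, φ x u = L.symm (ϖ (Θ.connForm e x u)) := by
    intro x hx
    obtain ⟨L, hL⟩ := exists_adQuot_equiv hϖ hker he hx
    refine ⟨L, fun k => ?_, Θ.isInduced_eq he hφ hx hL⟩
    rw [LinearEquiv.eq_symm_apply, hL, adGConst_apply_sec he _ hx, hw]
  refine hloc (e.baseSet ∩ t.baseSet) (fun k x => t.symmₗ ℂ x (b k))
    (fun k x => adGConst ι he (w k) x) _ (e.open_baseSet.inter t.open_baseSet)
    (isTangentFrame_symm t Set.inter_subset_right b)
    ⟨fun k => isHolAdG_adGConst he (w k) Set.inter_subset_left, fun x hx => ?_⟩ fun x hx => ?_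
  · obtain ⟨L, h1, -⟩ := hq x hx.1
    rw [show (fun k => (LinearMap.range (B.iota₁ ι x)).mkQ (adGConst ι he (w k) x)) =
      b.map L.symm from funext h1]
    exact ⟨(b.map L.symm).linearIndependent, (b.map L.symm).span_eq⟩
  · obtain ⟨L, h1, h2⟩ := hq x hx.1
    have h3 := exteriorPower_map_eq (T := TangentSpace 𝓘(ℂ, E) x) (φ x) b L.symm (ϖ ∘ₗ Θ.connForm e x ∘ₗ tangentFrame t x)
      (fun k => t.symmₗ ℂ x (b k)) fun k => h2 _
    have h4 : (fun k => (LinearMap.range (B.iota₁ ι x)).mkQ (adGConst ι he (w k) x)) =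
      fun k => L.symm (b k) := funext h1
    exact h3.trans (congrArg (fun z => Θ.branchFun ϖ e t x •
      exteriorPower.ιMulti ℂ (Module.finrank ℂ E) z) h4.symm)

end BranchedCartanGeometry

/-! ### The relation between the degrees. -/

section Degrees

variable {E : Type*} [NormedAddCommGroup E] [NormedSpace ℂ E] [FiniteDimensional ℂ E]
  {X : Type*} [TopologicalSpace X] [ChartedSpace E X] [IsManifold 𝓘(ℂ, E) ω X]
  [CompactSpace X] [T2Space X]

theorem IsContForm.smul {τ : ∀ x : X, (TangentSpace 𝓘(ℂ, E) x) [⋀^Fin 2]→L[ℝ] ℝ}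
    (h : IsContForm τ) (a : ℝ) : IsContForm fun x => a • τ x := fun c =>
  ContinuousOn.congr (f := a • twoFormInChart τ (chartAt E c)) ((h c).const_smul a) fun _ _ => rfl

theorem IsContForm.add {τ τ' : ∀ x : X, (TangentSpace 𝓘(ℂ, E) x) [⋀^Fin 2]→L[ℝ] ℝ}
    (h : IsContForm τ) (h' : IsContForm τ') : IsContForm fun x => τ x + τ' x := fun c =>
  ContinuousOn.congr (f := twoFormInChart τ (chartAt E c) + twoFormInChart τ' (chartAt E c))
    ((h c).add (h' c)) fun _ _ => rfl

variable {𝔥 H 𝔭 P : Type*} [NormedAddCommGroup 𝔥] [NormedSpace ℂ 𝔥] [FiniteDimensional ℂ 𝔥]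
  [TopologicalSpace H] [ChartedSpace 𝔥 H] [Group H] [LieGroup 𝓘(ℂ, 𝔥) ω H]
  [NormedAddCommGroup 𝔭] [NormedSpace ℂ 𝔭] [TopologicalSpace P] [ChartedSpace 𝔭 P]
  [IsManifold 𝓘(ℂ, 𝔭) ω P]
  {𝔤 G : Type*} [NormedAddCommGroup 𝔤] [NormedSpace ℂ 𝔤] [TopologicalSpace G]
  [ChartedSpace 𝔤 G] [Group G] [LieGroup 𝓘(ℂ, 𝔤) ω G] [FiniteDimensional ℂ 𝔤]
  {ι : LieSubgroup 𝔤 G 𝔥 H} {B : PrincipalBundle E X 𝔥 H 𝔭 P}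

open PrincipalBundle

variable (B) in
/-- The set around `x` on which the trivializations of `E_H` and `TX` around `x` are defined. -/
def frameDomain (x : X) : Set X :=
  (B.trivAt x).baseSet ∩ (trivializationAt E (TangentSpace 𝓘(ℂ, E)) x).baseSet

theorem isOpen_frameDomain (x : X) : IsOpen (frameDomain B x) :=
  (B.trivAt x).open_baseSet.inter (trivializationAt E (TangentSpace 𝓘(ℂ, E)) x).open_baseSet

theorem mem_frameDomain (x : X) : x ∈ frameDomain B x :=
  ⟨B.mem_trivAt x, FiberBundle.mem_baseSet_trivializationAt E (TangentSpace 𝓘(ℂ, E)) x⟩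

variable (ι B) in
/-- The value of the character `det ∘ Ad` of `G` on the transition functions of `E_H`. -/
def charTransition (x₀ x₁ x : X) : ℂ :=
  adDet 𝔤 (ι.incl (transition (B.trivAt x₀) (B.trivAt x₁) x))

theorem contMDiffOn_charTransition (x₀ x₁ : X) : ContMDiffOn 𝓘(ℂ, E) 𝓘(ℂ, ℂ) ω
    (charTransition ι B x₀ x₁) ((B.trivAt x₀).baseSet ∩ (B.trivAt x₁).baseSet) :=
  ((contMDiff_adDet 𝔤).comp ι.holomorphic).comp_contMDiffOn
    (contMDiffOn_transition (B.isHol_trivAt x₀) (B.isHol_trivAt x₁))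

theorem charTransition_ne_zero (x₀ x₁ x : X) : charTransition ι B x₀ x₁ x ≠ 0 := adDet_ne_zero 𝔤 _

variable (Θ : BranchedCartanGeometry ι B)

/-- The local equations of the branching divisor given by trivializations. -/
def branchEq {D : EffectiveDivisor E X} {ϖ : 𝔤 →ₗ[ℂ] E} (hϖ : Function.Surjective ϖ)
    (hker : LinearMap.ker ϖ = LinearMap.range (ι.lie : 𝔥 →ₗ[ℂ] 𝔤)) (hD : Θ.IsBranchingDivisor D)
    (x : X) : D.LocalEquation :=
  ⟨(frameDomain B x, Θ.branchFun ϖ (B.trivAt x) (trivializationAt E (TangentSpace 𝓘(ℂ, E)) x)),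
    Θ.localEq_branchFun hϖ hker (B.isHol_trivAt x) hD _⟩

/-- By `branchFun_change` both sides agree after multiplication by a local equation. It may vanish
at points but on no nonempty open set, so continuity permits cancelling it. -/
theorem ratio_branchEq {D : EffectiveDivisor E X} {ϖ : 𝔤 →ₗ[ℂ] E} (hϖ : Function.Surjective ϖ)
    (hker : LinearMap.ker ϖ = LinearMap.range (ι.lie : 𝔥 →ₗ[ℂ] 𝔤)) (hD : Θ.IsBranchingDivisor D)
    {x₀ x₁ x : X} (hx : x ∈ frameDomain B x₀) (hx' : x ∈ frameDomain B x₁) :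
    D.ratio (branchEq Θ hϖ hker hD x₀) (branchEq Θ hϖ hker hD x₁) x =
      (charTransition ι B x₀ x₁ x)⁻¹ *
        adDet 𝔥 (transition (B.trivAt x₀) (B.trivAt x₁) x) *
        coordDet (trivializationAt E (TangentSpace 𝓘(ℂ, E)) x₁)
          (trivializationAt E (TangentSpace 𝓘(ℂ, E)) x₀) x := by
  set i := branchEq Θ hϖ hker hD x₀
  set j := branchEq Θ hϖ hker hD x₁
  refine D.eq_of_mul_eq i (W := frameDomain B x₀ ∩ frameDomain B x₁)
    ((isOpen_frameDomain x₀).inter (isOpen_frameDomain x₁)) Set.inter_subset_left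
    (u := D.ratio i j) (v := fun x => (charTransition ι B x₀ x₁ x)⁻¹ *
        adDet 𝔥 (transition (B.trivAt x₀) (B.trivAt x₁) x) *
        coordDet (trivializationAt E (TangentSpace 𝓘(ℂ, E)) x₁)
          (trivializationAt E (TangentSpace 𝓘(ℂ, E)) x₀) x)
    (ContMDiffOn.continuousOn (D.ratio_unit i j).1) ?_ (fun y hy => ?_) ⟨hx, hx'⟩
  · have c1 : ContinuousOn (charTransition ι B x₀ x₁) (frameDomain B x₀ ∩ frameDomain B x₁) :=
      (contMDiffOn_charTransition x₀ x₁).continuousOn.mono fun y hy => ⟨hy.1.1, hy.2.1⟩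
    have c2 : ContinuousOn (fun x => adDet 𝔥 (transition (B.trivAt x₀) (B.trivAt x₁) x))
        (frameDomain B x₀ ∩ frameDomain B x₁) :=
      ((contMDiff_adDet 𝔥).comp_contMDiffOn (contMDiffOn_transition (B.isHol_trivAt x₀)
        (B.isHol_trivAt x₁))).continuousOn.mono fun y hy => ⟨hy.1.1, hy.2.1⟩
    have c3 : ContinuousOn (coordDet (trivializationAt E (TangentSpace 𝓘(ℂ, E)) x₁)
          (trivializationAt E (TangentSpace 𝓘(ℂ, E)) x₀)) (frameDomain B x₀ ∩ frameDomain B x₁) :=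
      (contMDiffOn_coordDet (E := E) _ _).continuousOn.mono fun y hy => ⟨hy.2.2, hy.1.2⟩
    exact ((c1.inv₀ fun y _ => charTransition_ne_zero x₀ x₁ y).mul c2).mul c3
  · rw [← D.ratio_mul i j hy]
    exact Θ.branchFun_change hϖ hker (B.isHol_trivAt x₀) (B.isHol_trivAt x₁) _ _ hy.1.1 hy.2.1
      hy.1.2 hy.2.2

/-- The relation between the degrees for a branched Cartan geometry. -/
theorem degree_eq_of_isBranchingDivisor (hd : 0 < Module.finrank ℂ E) (κ : KaehlerForm E X)
    {D : EffectiveDivisor E X} (hD : Θ.IsBranchingDivisor D) :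
    degree κ (E →L[ℂ] ℂ) (Cotangent E X) - D.degree κ = degree κ 𝔥 B.AdH := by
  obtain ⟨ϖ, hϖ, hker⟩ := Θ.exists_projection
  let h₁ := Classical.choice (HermitianMetric.nonempty E (E →L[ℂ] ℂ) (Cotangent E X))
  let h₂ := Classical.choice (HermitianMetric.nonempty E ℂ D.lineBundleCore.Fiber)
  let h₃ := Classical.choice (HermitianMetric.nonempty E 𝔥 B.AdH)
  let i := branchEq Θ hϖ hker hD
  let e₁ := fun x₀ : X => trivializationAt (E →L[ℂ] ℂ) (Cotangent E X) x₀
  let e₂ := fun x₀ : X => D.lineBundleCore.localTriv (i x₀)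
  let e₃ := fun x₀ : X => trivializationAt 𝔥 B.AdH x₀
  have m₁ : ∀ {x₀ x : X}, x ∈ frameDomain B x₀ → x ∈ (e₁ x₀).baseSet := fun h => ⟨h.2, trivial⟩
  have m₂ : ∀ {x₀ x : X}, x ∈ frameDomain B x₀ → x ∈ (e₂ x₀).baseSet := fun h => h
  have m₃ : ∀ {x₀ x : X}, x ∈ frameDomain B x₀ → x ∈ (e₃ x₀).baseSet := fun h => h.1
  -- The potential of the induced metric on Ω^d ⊗ O(-D) ⊗ det ad(E_H)⁻¹, that is, on the dual of det
  -- ad(E_G).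
  let Φ : X → X → ℝ := fun x₀ x => h₁.logDetIn (e₁ x₀) x - h₂.logDetIn (e₂ x₀) x -
    h₃.logDetIn (e₃ x₀) x
  have hmem : ∀ {c y}, y ∈ (chartAt E c).target → chartAt E c ∈ atlas E X := fun _ =>
    chart_mem_atlas E _
  have s₁ : ∀ x₀ c : X, ∀ y ∈ (chartAt E c).target, (chartAt E c).symm y ∈ frameDomain B x₀ →
      ContDiffAt ℝ ∞ (h₁.logDetIn (e₁ x₀) ∘ (chartAt E c).symm) y := fun x₀ c y hy hyU =>
    h₁.contDiffAt_logDetIn (e₁ x₀) (chart_mem_atlas E c) hy (m₁ hyU)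
  have s₂ : ∀ x₀ c : X, ∀ y ∈ (chartAt E c).target, (chartAt E c).symm y ∈ frameDomain B x₀ →
      ContDiffAt ℝ ∞ (h₂.logDetIn (e₂ x₀) ∘ (chartAt E c).symm) y := fun x₀ c y hy hyU =>
    h₂.contDiffAt_logDetIn (e₂ x₀) (chart_mem_atlas E c) hy (m₂ hyU)
  have s₃ : ∀ x₀ c : X, ∀ y ∈ (chartAt E c).target, (chartAt E c).symm y ∈ frameDomain B x₀ →
      ContDiffAt ℝ ∞ (h₃.logDetIn (e₃ x₀) ∘ (chartAt E c).symm) y := fun x₀ c y hy hyU =>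
    h₃.contDiffAt_logDetIn (e₃ x₀) (chart_mem_atlas E c) hy (m₃ hyU)
  have hΦs : ∀ x₀ c : X, ∀ y ∈ (chartAt E c).target, (chartAt E c).symm y ∈ frameDomain B x₀ →
      ContDiffAt ℝ ∞ (Φ x₀ ∘ (chartAt E c).symm) y := fun x₀ c y hy hyU =>
    ((s₁ x₀ c y hy hyU).sub (s₂ x₀ c y hy hyU)).sub (s₃ x₀ c y hy hyU)
  -- The determinants of the changes of frame of TX and of ad(E_H) cancel, and only the character of
  -- G survives.
  have hchange : ∀ x₀ x₁ x : X, x ∈ frameDomain B x₀ → x ∈ frameDomain B x₁ →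
      Φ x₁ x = Φ x₀ x - Real.log (Complex.normSq (charTransition ι B x₀ x₁ x)) := by
    intro x₀ x₁ x hx hx'
    have d₁ := h₁.logDetIn_change (e₁ x₀) (e₁ x₁) (m₁ hx) (m₁ hx')
    have d₂ := h₂.logDetIn_change (e₂ x₀) (e₂ x₁) (m₂ hx) (m₂ hx')
    have d₃ := h₃.logDetIn_change (e₃ x₀) (e₃ x₁) (m₃ hx) (m₃ hx')
    rw [coordDet_cotangent hx.2 hx'.2] at d₁
    rw [coordDet_lineBundle D (i x₀) (i x₁) hx hx', ratio_branchEq Θ hϖ hker hD hx hx'] at d₂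
    rw [coordDet_adH B hx.1 hx'.1] at d₃
    have n₁ := Complex.normSq_pos.2 (coordDet_ne_zero
      (trivializationAt E (TangentSpace 𝓘(ℂ, E)) x₁)
      (trivializationAt E (TangentSpace 𝓘(ℂ, E)) x₀) x)
    have n₂ := Complex.normSq_pos.2 (charTransition_ne_zero (ι := ι) (B := B) x₀ x₁ x)
    have n₃ := Complex.normSq_pos.2 (adDet_ne_zero 𝔥 (transition (B.trivAt x₀) (B.trivAt x₁) x))
    rw [map_mul, map_mul, map_inv₀, Real.log_mul (by positivity) n₁.ne',
      Real.log_mul (by positivity) n₃.ne', Real.log_inv] at d₂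
    rw [map_inv₀, Real.log_inv] at d₃
    change _ - _ - _ = _ - _ - _ - _
    linarith
  have hzero : integralPow (fun x => (h₁.chernForm x + (-1 : ℝ) • h₂.chernForm x) +
      (-1 : ℝ) • h₃.chernForm x) κ.form = 0 := by
    refine integralPow_eq_zero_of_potentials hd κ Φ (frameDomain B)
      (fun x₀ x => Θ.traceForm (B.trivAt x₀) x) (-(1 / (2 * Real.pi)))
      isOpen_frameDomain mem_frameDomain hΦs (fun x₀ c y hy hyU => ?_)
      (fun x₀ c y hy hyU => Θ.contDiffAt_traceForm (B.isHol_trivAt x₀) (chart_mem_atlas E c) hy hyU.1)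
      fun x₀ x₁ c y hy hy₀ hy₁ v => ?_
    · have t₁ := h₁.twoFormInChart_chernForm (e₁ x₀) (chart_mem_atlas E c) hy (m₁ hyU)
      have t₂ := h₂.twoFormInChart_chernForm (e₂ x₀) (chart_mem_atlas E c) hy (m₂ hyU)
      have t₃ := h₃.twoFormInChart_chernForm (e₃ x₀) (chart_mem_atlas E c) hy (m₃ hyU)
      have u₁ := (s₁ x₀ c y hy hyU).of_le two_le_infty
      have u₂ := (s₂ x₀ c y hy hyU).of_le two_le_infty
      have u₃ := (s₃ x₀ c y hy hyU).of_le two_le_infty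
      have hI : iddbar (Φ x₀ ∘ (chartAt E c).symm) y = iddbar (h₁.logDetIn (e₁ x₀) ∘ (chartAt E c).symm) y -
          iddbar (h₂.logDetIn (e₂ x₀) ∘ (chartAt E c).symm) y -
          iddbar (h₃.logDetIn (e₃ x₀) ∘ (chartAt E c).symm) y :=
        (iddbar_sub (u₁.sub u₂) u₃).trans (congrArg (fun z => z - _) (iddbar_sub u₁ u₂))
      have hsum : twoFormInChart (fun x => (h₁.chernForm x + (-1 : ℝ) • h₂.chernForm x) +
          (-1 : ℝ) • h₃.chernForm x) (chartAt E c) y =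
          (twoFormInChart h₁.chernForm (chartAt E c) y +
            (-1 : ℝ) • twoFormInChart h₂.chernForm (chartAt E c) y) +
          (-1 : ℝ) • twoFormInChart h₃.chernForm (chartAt E c) y := rfl
      rw [hsum, t₁, t₂, t₃, hI]
      ext w
      simp only [ContinuousAlternatingMap.add_apply, ContinuousAlternatingMap.smul_apply,
        ContinuousAlternatingMap.sub_apply, smul_eq_mul]
      ring
    -- In passing from x₀ to x₁, dΦ loses 2 Re(g⁻¹ dg) while the trace form gains g⁻¹ dg, so dΦ + 2
    -- Re A is unchanged.
    · set g : E → ℂ := charTransition ι B x₀ x₁ ∘ (chartAt E c).symm with hg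
      have hcm : ContMDiffAt 𝓘(ℂ, E) 𝓘(ℂ, ℂ) ω (charTransition ι B x₀ x₁) ((chartAt E c).symm y) :=
        (contMDiffOn_charTransition x₀ x₁).contMDiffAt
          (((B.trivAt x₀).open_baseSet.inter (B.trivAt x₁).open_baseSet).mem_nhds ⟨hy₀.1, hy₁.1⟩)
      have hgd : DifferentiableAt ℂ g y :=
        (contDiffAt_comp_symm_complex (chart_mem_atlas E c) hy hcm).differentiableAt (by simp)
      have hg0 : g y ≠ 0 := charTransition_ne_zero x₀ x₁ _
      have hev : Φ x₁ ∘ (chartAt E c).symm =ᶠ[𝓝 y] fun z =>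
          (Φ x₀ ∘ (chartAt E c).symm) z - Real.log (Complex.normSq (g z)) := by
        filter_upwards [eventually_symm_mem hy ((isOpen_frameDomain x₀).inter (isOpen_frameDomain x₁))
          ⟨hy₀, hy₁⟩] with z hz
        exact hchange x₀ x₁ _ hz.2.1 hz.2.2
      have hd₁ : fderiv ℝ (Φ x₁ ∘ (chartAt E c).symm) y v =
          fderiv ℝ (Φ x₀ ∘ (chartAt E c).symm) y v - ((2 * (g y)⁻¹) * fderiv ℂ g y v).re := by
        have hln := contDiffAt_log_normSq (contDiffAt_real
          (contDiffAt_comp_symm_complex (chart_mem_atlas E c) hy hcm)) hg0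
        rw [hev.fderiv_eq, fderiv_fun_sub ((hΦs x₀ c y hy hy₀).differentiableAt (by simp))
          (hln.differentiableAt (by simp)), fderiv_log_normSq hgd hg0]
        rfl
      have hA : holFormInChart (fun x => Θ.traceForm (B.trivAt x₁) x) (chartAt E c) y v =
          holFormInChart (fun x => Θ.traceForm (B.trivAt x₀) x) (chartAt E c) y v +
            (g y)⁻¹ * fderiv ℂ g y v := by
        refine (Θ.traceForm_change (B.isHol_trivAt x₀) (B.isHol_trivAt x₁) hy₀.1 hy₁.1 _).trans ?_
        refine congrArg (fun z => _ + (g y)⁻¹ * z) ?_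
        have h5 := mfderiv_comp (I := 𝓘(ℂ, E)) (I' := 𝓘(ℂ, E)) (I'' := 𝓘(ℂ, ℂ))
          (f := (chartAt E c).symm) (g := charTransition ι B x₀ x₁) y
          (hcm.mdifferentiableAt (by simp))
          (((contMDiffOn_symm_of_mem_maximalAtlas (IsManifold.subset_maximalAtlas
            (chart_mem_atlas E c))).contMDiffAt
            ((chartAt E c).open_target.mem_nhds hy)).mdifferentiableAt (n := ω) (by simp))
        rw [mfderiv_eq_fderiv] at h5
        exact (DFunLike.congr_fun h5 v).symm
      rw [hd₁, hA, Complex.add_re, mul_assoc, Complex.mul_re]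
      simp only [Complex.re_ofNat, Complex.im_ofNat]
      ring
  have hκ := κ.isContForm
  have k₁ : IsContForm h₁.chernForm := h₁.isContForm_chernForm
  have k₂ : IsContForm h₂.chernForm := h₂.isContForm_chernForm
  have k₃ : IsContForm h₃.chernForm := h₃.isContForm_chernForm
  rw [integralPow_add hd (k₁.add (k₂.smul _)) (k₃.smul _) hκ, integralPow_add hd k₁ (k₂.smul _) hκ,
    integralPow_smul hd, integralPow_smul hd] at hzero
  have r₁ : degree κ (E →L[ℂ] ℂ) (Cotangent E X) = integralPow h₁.chernForm κ.form := rfl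
  have r₂ : D.degree κ = integralPow h₂.chernForm κ.form := rfl
  have r₃ : degree κ 𝔥 B.AdH = integralPow h₃.chernForm κ.form := rfl
  rw [r₁, r₂, r₃]
  linarith

end Degrees

/-! ### Dirichlet energy on discs, and integration over parallel slices. -/

section Slices

open MeasureTheory Set

/-- The Dirichlet energy of a radial function with a given increase. -/
theorem ofReal_sq_div_log_le_lintegral {h h' : ℝ → ℝ} {a R A B : ℝ} (ha : 0 < a) (haR : a < R)
    (hd : ∀ s ∈ Icc a R, HasDerivAt h (h' s) s) (hc : ContinuousOn h' (Icc a R))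
    (hAB : A ≤ B) (hA : h a ≤ A) (hB : B ≤ h R) :
    ENNReal.ofReal ((B - A) ^ 2 / Real.log (R / a)) ≤
      ∫⁻ s in Ioo a R, ENNReal.ofReal (s * h' s ^ 2) := by
  have hlog : 0 < Real.log (R / a) := Real.log_pos ((one_lt_div ha).2 haR)
  -- The minimizer of ∫ s h'(s)² ds with increase B - A has h' = l / s. The bound comes from s (h' -
  -- l / s)² ≥ 0.
  set l := (B - A) / Real.log (R / a) with hl
  have hl0 : 0 ≤ l := div_nonneg (sub_nonneg.2 hAB) hlog.le
  have hu : uIcc a R = Icc a R := uIcc_of_le haR.le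
  have hinv : ContinuousOn (fun s : ℝ => s⁻¹) (Icc a R) :=
    continuousOn_inv₀.mono fun s hs => (ha.trans_le hs.1).ne'
  have i1 : IntervalIntegrable h' volume a R := (hu ▸ hc).intervalIntegrable
  have i2 : IntervalIntegrable (fun s : ℝ => s⁻¹) volume a R := (hu ▸ hinv).intervalIntegrable
  have hc3 : ContinuousOn (fun s => s * h' s ^ 2) (Icc a R) := continuousOn_id.mul (hc.pow 2)
  have i3 : IntervalIntegrable (fun s => s * h' s ^ 2) volume a R := (hu ▸ hc3).intervalIntegrable
  have hft : ∫ s in a..R, h' s = h R - h a :=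
    intervalIntegral.integral_eq_sub_of_hasDerivAt (fun s hs => hd s (hu ▸ hs)) i1
  have hli : ∫ s in a..R, s⁻¹ = Real.log (R / a) := integral_inv_of_pos ha (ha.trans haR)
  have hmono : ∫ s in a..R, (2 * l * h' s - l ^ 2 * s⁻¹) ≤ ∫ s in a..R, s * h' s ^ 2 := by
    refine intervalIntegral.integral_mono_on haR.le ((i1.const_mul _).sub (i2.const_mul _)) i3
      fun s hs => ?_
    have hs0 : 0 < s := ha.trans_le hs.1
    have h1 : s * h' s ^ 2 - (2 * l * h' s - l ^ 2 * s⁻¹) = s * (h' s - l * s⁻¹) ^ 2 := by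
      field_simp; ring
    have h2 : 0 ≤ s * (h' s - l * s⁻¹) ^ 2 := by positivity
    linarith
  rw [intervalIntegral.integral_sub (i1.const_mul _) (i2.const_mul _),
    intervalIntegral.integral_const_mul, intervalIntegral.integral_const_mul, hft, hli] at hmono
  have hge : (B - A) ^ 2 / Real.log (R / a) ≤ ∫ s in a..R, s * h' s ^ 2 := by
    refine le_trans ?_ hmono
    have h1 : 2 * l * (B - A) - l ^ 2 * Real.log (R / a) = (B - A) ^ 2 / Real.log (R / a) := by
      rw [hl]; field_simp; ring
    rw [← h1]
    have : l * (B - A) ≤ l * (h R - h a) := mul_le_mul_of_nonneg_left (by linarith) hl0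
    linarith
  refine (ENNReal.ofReal_le_ofReal hge).trans_eq ?_
  rw [intervalIntegral.integral_of_le haR.le, ofReal_integral_eq_lintegral_ofReal,
    restrict_Ioo_eq_restrict_Ioc]
  · exact (intervalIntegrable_iff_integrableOn_Ioc_of_le haR.le).1 i3
  · refine (ae_restrict_iff' measurableSet_Ioc).2 (Filter.Eventually.of_forall fun s hs => ?_)
    exact mul_nonneg (ha.trans hs.1).le (sq_nonneg _)

/-- The Dirichlet energy of a function on a disc which is small on a smaller concentric circle and
large on the boundary. -/
theorem ofReal_sq_div_log_le_lintegral_ball {u : ℂ → ℝ} {U : Set ℂ} {c : ℂ} {a R A B : ℝ}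
    (hU : IsOpen U) (hu : ContDiffOn ℝ 1 u U) (hR : Metric.closedBall c R ⊆ U) (ha : 0 < a)
    (haR : a < R) (hAB : A ≤ B) (hA : ∀ z ∈ Metric.sphere c a, u z ≤ A)
    (hB : ∀ z ∈ Metric.sphere c R, B ≤ u z) :
    ENNReal.ofReal ((B - A) ^ 2 / Real.log (R / a)) * ENNReal.ofReal (2 * Real.pi) ≤
      ∫⁻ z in Metric.ball c R, ENNReal.ofReal (‖fderiv ℝ u z‖ ^ 2) := by
  set F : ℂ → ENNReal := (Metric.ball c R).indicator
    (fun z => ENNReal.ofReal (‖fderiv ℝ u z‖ ^ 2)) with hF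
  have hFm : Measurable F :=
    (((measurable_fderiv ℝ u).norm.pow_const 2).ennreal_ofReal).indicator measurableSet_ball
  have hcont : ContinuousOn (fderiv ℝ u) U := hu.continuousOn_fderiv_of_isOpen hU le_rfl
  have e1 : ∫⁻ z in Metric.ball c R, ENNReal.ofReal (‖fderiv ℝ u z‖ ^ 2) = ∫⁻ z, F (c + z) := by
    rw [lintegral_add_left_eq_self F c, hF, lintegral_indicator measurableSet_ball]
  rw [e1, ← Complex.lintegral_comp_polarCoord_symm]
  have hm : Measurable fun p : ℝ × ℝ =>
      ENNReal.ofReal p.1 • F (c + Complex.polarCoord.symm p) := by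
    have hp : Measurable fun p : ℝ × ℝ => Complex.polarCoord.symm p := by
      simp only [Complex.polarCoord_symm_apply]
      fun_prop
    exact (measurable_fst.ennreal_ofReal).smul (hFm.comp (measurable_const.add hp))
  rw [show polarCoord.target = Ioi (0 : ℝ) ×ˢ Ioo (-Real.pi) Real.pi from rfl,
    Measure.volume_eq_prod, ← Measure.prod_restrict, lintegral_prod_symm _ hm.aemeasurable]
  have hπ : volume (Ioo (-Real.pi) Real.pi) = ENNReal.ofReal (2 * Real.pi) := by
    rw [Real.volume_Ioo]; congr 1; ring
  rw [← hπ, ← setLIntegral_const]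
  -- On each ray the radial derivative is bounded by the norm of the differential, and the
  -- one-dimensional estimate applies.
  refine lintegral_mono fun θ => ?_
  set w : ℂ := Real.cos θ + Real.sin θ * Complex.I with hw
  have hwn : ‖w‖ = 1 := by
    rw [hw, Complex.norm_def, Complex.normSq_apply]
    simp only [Complex.add_re, Complex.add_im, Complex.mul_re, Complex.mul_im, Complex.ofReal_re,
      Complex.ofReal_im, Complex.I_re, Complex.I_im]
    rw [show (Real.cos θ + (Real.sin θ * 0 - 0 * 1)) * (Real.cos θ + (Real.sin θ * 0 - 0 * 1)) +
      (0 + (Real.sin θ * 1 + 0 * 0)) * (0 + (Real.sin θ * 1 + 0 * 0)) = 1 by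
        nlinarith [Real.sin_sq_add_cos_sq θ], Real.sqrt_one]
  have hnorm : ∀ s : ℝ, 0 ≤ s → ‖(s : ℂ) * w‖ = s := fun s hs => by
    rw [norm_mul, hwn, mul_one, Complex.norm_real, Real.norm_of_nonneg hs]
  have hmem : ∀ s ∈ Icc a R, c + s * w ∈ U := fun s hs => hR (by
    rw [Metric.mem_closedBall, dist_eq_norm, add_sub_cancel_left, hnorm s (ha.le.trans hs.1)]
    exact hs.2)
  have hline : ∀ s : ℝ, HasDerivAt (fun s : ℝ => c + s * w) w s := fun s => by
    simpa using ((Complex.ofRealCLM.hasDerivAt (x := s)).mul_const w).const_add c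
  have h1 := ofReal_sq_div_log_le_lintegral (h := fun s : ℝ => u (c + s * w))
    (h' := fun s : ℝ => fderiv ℝ u (c + s * w) w) ha haR
    (fun s hs => (((hu.contDiffAt (hU.mem_nhds (hmem s hs))).differentiableAt
      (by simp)).hasFDerivAt).comp_hasDerivAt s (hline s))
    ((hcont.comp (by fun_prop) hmem).clm_apply continuousOn_const) hAB
    (hA _ (by rw [mem_sphere_iff_norm, add_sub_cancel_left, hnorm a ha.le]))
    (hB _ (by rw [mem_sphere_iff_norm, add_sub_cancel_left, hnorm R (ha.trans haR).le]))
  refine h1.trans ?_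
  refine (lintegral_mono_set (s := Ioo a R) (t := Ioi (0 : ℝ))
    (f := fun s => ENNReal.ofReal s • F (c + Complex.polarCoord.symm (s, θ)))
    fun s hs => ha.trans hs.1).trans' ?_
  refine setLIntegral_mono' measurableSet_Ioo fun s hs => ?_
  have hs0 : 0 < s := ha.trans hs.1
  have hin : c + Complex.polarCoord.symm (s, θ) ∈ Metric.ball c R := by
    rw [Complex.polarCoord_symm_apply, mem_ball_iff_norm, add_sub_cancel_left, hnorm s hs0.le]
    exact hs.2
  rw [hF, indicator_of_mem hin, smul_eq_mul, ← ENNReal.ofReal_mul hs0.le,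
    Complex.polarCoord_symm_apply]
  refine ENNReal.ofReal_le_ofReal (mul_le_mul_of_nonneg_left ?_ hs0.le)
  have h2 := (fderiv ℝ u (c + s * w)).le_opNorm w
  rw [hwn, mul_one] at h2
  rw [← sq_abs]
  exact pow_le_pow_left₀ (abs_nonneg _) h2 2

variable {W : Type*} [NormedAddCommGroup W] [NormedSpace ℝ W] [FiniteDimensional ℝ W]
  [MeasurableSpace W] [BorelSpace W] {μ : Measure W} [μ.IsAddHaarMeasure]

theorem lintegral_slices_swap {T : ℂ → W} (hT : Continuous T) {F : W → ENNReal}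
    (hF : Measurable F) (B : Set W) (D : Set ℂ) :
    ∫⁻ w in B, (∫⁻ z in D, F (w + T z)) ∂μ = ∫⁻ z in D, ∫⁻ w in B, F (w + T z) ∂μ :=
  lintegral_lintegral_swap (hF.comp (measurable_fst.add (hT.measurable.comp measurable_snd))).aemeasurable

/-- The integral of a function over a set bounds the integrals over parallel slices. -/
theorem lintegral_slices_le {T : ℂ → W} (hT : Continuous T) {F : W → ENNReal}
    (hF : Measurable F) {B S : Set W} {D : Set ℂ} (hB : MeasurableSet B) (hS : MeasurableSet S)
    (hD : MeasurableSet D) (h : ∀ w ∈ B, ∀ z ∈ D, w + T z ∈ S) :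
    ∫⁻ w in B, (∫⁻ z in D, F (w + T z)) ∂μ ≤ (∫⁻ w in S, F w ∂μ) * volume D := by
  rw [lintegral_slices_swap hT hF, ← setLIntegral_const]
  refine setLIntegral_mono' hD fun z hz => ?_
  rw [← lintegral_indicator hB, ← lintegral_indicator hS,
    ← lintegral_add_right_eq_self (S.indicator F) (T z)]
  refine lintegral_mono fun w => ?_
  by_cases hw : w ∈ B
  · rw [indicator_of_mem hw, indicator_of_mem (h w hw z hz)]
  · rw [indicator_of_notMem hw]; exact zero_le

/-- A set whose parallel slices are null is null. -/
theorem exists_nhds_null_of_slices {T : ℂ → W} (hT : Continuous T) (hT0 : T 0 = 0) {Z : Set W}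
    (hZ : MeasurableSet Z) {w₀ : W} {B : Set W} (hB : B ∈ 𝓝 w₀) {D : Set ℂ} (hD : D ∈ 𝓝 (0 : ℂ))
    (h : ∀ w ∈ B, volume {z ∈ D | w + T z ∈ Z} = 0) : ∃ O ∈ 𝓝 w₀, μ (Z ∩ O) = 0 := by
  obtain ⟨b, hb, hbB⟩ := Metric.mem_nhds_iff.1 hB
  obtain ⟨r, hr, hrD⟩ := Metric.mem_nhds_iff.1 hD
  have hF : Measurable (Z.indicator (fun _ : W => (1 : ENNReal))) := measurable_const.indicator hZ
  have h1 : ∫⁻ w in Metric.ball w₀ b, (∫⁻ z in Metric.ball 0 r,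
      Z.indicator (fun _ => (1 : ENNReal)) (w + T z)) ∂μ = 0 := by
    refine (setLIntegral_congr_fun (g := fun _ => 0) measurableSet_ball fun w hw => ?_).trans (by simp)
    have hm : MeasurableSet {z : ℂ | w + T z ∈ Z} := (measurable_const.add hT.measurable) hZ
    have : ∀ z, Z.indicator (fun _ => (1 : ENNReal)) (w + T z) =
        {z : ℂ | w + T z ∈ Z}.indicator (fun _ => 1) z := fun z => rfl
    simp only [this]
    rw [lintegral_indicator_const hm, one_mul, Measure.restrict_apply hm]
    refine measure_mono_null ?_ (h w (hbB hw))
    exact fun z hz => ⟨hrD hz.2, hz.1⟩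
  rw [lintegral_slices_swap hT hF] at h1
  have hme : Measurable fun z => ∫⁻ w in Metric.ball w₀ b,
      Z.indicator (fun _ => (1 : ENNReal)) (w + T z) ∂μ :=
    (hF.comp (measurable_snd.add (hT.measurable.comp measurable_fst))).lintegral_prod_right'
      (f := fun p : ℂ × W => Z.indicator (fun _ => (1 : ENNReal)) (p.2 + T p.1))
  have h2 := (ae_restrict_iff' measurableSet_ball).1 ((lintegral_eq_zero_iff hme).1 h1)
  obtain ⟨q, hq, hqT⟩ := Metric.mem_nhds_iff.1
    (hT.continuousAt.preimage_mem_nhds (Metric.ball_mem_nhds (T 0) (half_pos hb)))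
  have hpos : volume (Metric.ball (0 : ℂ) (min q r)) ≠ 0 :=
    (Metric.measure_ball_pos _ _ (lt_min hq hr)).ne'
  -- By Fubini almost every z in the disc gives a null translate of Z within the ball, so some z
  -- close to 0 does. Translating by T z proves nullity near w₀.
  obtain ⟨z, hz, hz0⟩ : ∃ z ∈ Metric.ball (0 : ℂ) (min q r), ∫⁻ w in Metric.ball w₀ b,
      Z.indicator (fun _ => (1 : ENNReal)) (w + T z) ∂μ = 0 := by
    by_contra! hne
    refine hpos (measure_mono_null (fun z hz => ?_) h2)
    exact fun h3 => hne z hz (h3 (Metric.ball_subset_ball (min_le_right _ _) hz))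
  refine ⟨Metric.ball w₀ (b / 2), Metric.ball_mem_nhds _ (half_pos hb), ?_⟩
  have hm : MeasurableSet {w : W | w + T z ∈ Z} := (measurable_id.add_const _) hZ
  have h4 : μ ({w | w + T z ∈ Z} ∩ Metric.ball w₀ b) = 0 := by
    have : ∀ w, Z.indicator (fun _ => (1 : ENNReal)) (w + T z) =
        {w : W | w + T z ∈ Z}.indicator (fun _ => 1) w := fun w => rfl
    simp only [this] at hz0
    rwa [lintegral_indicator_const hm, one_mul, Measure.restrict_apply hm] at hz0
  rw [← measure_preimage_add_right μ (T z) (Z ∩ Metric.ball w₀ (b / 2))]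
  refine measure_mono_null (t := {w | w + T z ∈ Z} ∩ Metric.ball w₀ b) ?_ h4
  rintro w ⟨hw, hw'⟩
  refine ⟨hw, ?_⟩
  have h5 : ‖T z‖ < b / 2 := by
    have := hqT (Metric.ball_subset_ball (min_le_left _ _) hz)
    rwa [hT0, mem_preimage, mem_ball_zero_iff] at this
  have h6 : ‖w + T z - w₀‖ < b / 2 := mem_ball_iff_norm.1 hw'
  rw [mem_ball_iff_norm]
  calc ‖w - w₀‖ = ‖(w + T z - w₀) - T z‖ := by congr 1; abel
    _ ≤ ‖w + T z - w₀‖ + ‖T z‖ := norm_sub_le _ _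
    _ < b := by linarith

end Slices

/-! ### Zeros of holomorphic functions along complex lines. -/

section Zeros

open MeasureTheory Set Metric

variable {E : Type*} [NormedAddCommGroup E] [NormedSpace ℂ E]

/-- Near a zero of a holomorphic function which does not vanish identically, there is a direction in
which all slices have a zero and are bounded below on an annulus. -/
theorem exists_slices_through_zeros {f : E → ℂ} {Ω V : Set E} (hΩ : IsOpen Ω)
    (hf : AnalyticOnNhd ℂ f Ω) {y₀ : E} (hy₀ : y₀ ∈ Ω) (h0 : f y₀ = 0)
    (hne : ∃ᶠ y in 𝓝 y₀, f y ≠ 0) (hV : V ∈ 𝓝 y₀) :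
    ∃ (v : E) (r δ M b : ℝ), 0 < r ∧ 0 < δ ∧ 0 ≤ M ∧ 0 < b ∧
      (∀ y ∈ ball y₀ b, ∀ z : ℂ, ‖z‖ ≤ 3 * r → y + z • v ∈ V ∩ Ω) ∧
      ∀ y ∈ ball y₀ b, (∀ z : ℂ, r ≤ ‖z‖ → ‖z‖ ≤ 3 * r → δ ≤ ‖f (y + z • v)‖) ∧
        ∃ a : ℂ, ‖a‖ ≤ r ∧ ∀ z : ℂ, ‖z‖ ≤ 3 * r → ‖f (y + z • v)‖ ≤ M * ‖z - a‖ := by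
  obtain ⟨K, t, ht, hK⟩ := ((hf y₀ hy₀).contDiffAt (n := 1)).exists_lipschitzOnWith
  obtain ⟨b₀, hb₀, hsub⟩ := Metric.mem_nhds_iff.1
    (Filter.inter_mem (Filter.inter_mem hV (hΩ.mem_nhds hy₀)) ht)
  -- A nearby point where f ≠ 0 determines the direction. On the line through it f is not
  -- identically zero, so its zero at y₀ is isolated there.
  obtain ⟨y₁, hy₁, hy₁b⟩ := (hne.and_eventually (ball_mem_nhds y₀ hb₀)).exists
  set v := y₁ - y₀ with hv
  have hv0 : 0 < ‖v‖ := norm_pos_iff.2 fun h => hy₁ (by rw [← h0, sub_eq_zero.1 h])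
  have hvb : ‖v‖ < b₀ := mem_ball_iff_norm.1 hy₁b
  have hga : ∀ y : E, ∀ z : ℂ, y + z • v ∈ Ω → AnalyticAt ℂ (fun z : ℂ => f (y + z • v)) z :=
    fun y z hz => AnalyticAt.fun_comp (g := f) (f := fun z : ℂ => y + z • v) (hf _ hz) (by fun_prop)
  have hball : ∀ z : ℂ, ‖z‖ < b₀ / ‖v‖ → y₀ + z • v ∈ ball y₀ b₀ := fun z hz => by
    rw [mem_ball_iff_norm, add_sub_cancel_left, norm_smul]
    exact (lt_div_iff₀ hv0).1 hz
  obtain ⟨r₀, hr₀, hr₀f⟩ : ∃ r₀ > 0, ∀ z : ℂ, ‖z‖ < r₀ → z ≠ 0 → f (y₀ + z • v) ≠ 0 := by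
    have hΩ0 : y₀ + (0 : ℂ) • v ∈ Ω := by simpa using hy₀
    rcases (hga y₀ 0 hΩ0).eventually_eq_zero_or_eventually_ne_zero with h | h
    · exfalso
      have hS : AnalyticOnNhd ℂ (fun z : ℂ => f (y₀ + z • v)) (ball 0 (b₀ / ‖v‖)) := fun z hz =>
        hga y₀ z (hsub (hball z (mem_ball_zero_iff.1 hz))).1.2
      have h1 := hS.eqOn_zero_of_preconnected_of_eventuallyEq_zero
        (convex_ball _ _).isPreconnected (mem_ball_self (by positivity)) h
        (show (1 : ℂ) ∈ ball (0 : ℂ) (b₀ / ‖v‖) by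
          rw [mem_ball_zero_iff, norm_one]; exact (one_lt_div hv0).2 hvb)
      refine hy₁ ?_
      simpa [hv] using h1
    · obtain ⟨r₀, hr₀, h2⟩ := Metric.eventually_nhds_iff.1 (eventually_nhdsWithin_iff.1 h)
      exact ⟨r₀, hr₀, fun z hz hz0 => h2 (by simpa using hz) hz0⟩
  -- The factor 8 keeps the disc of radius 3r within the one where the zero is isolated, and leaves
  -- room to move the base point by b₀ / 2.
  set r := min r₀ (b₀ / ‖v‖) / 8 with hr
  have hrpos : 0 < r := by positivity
  have hr1 : 8 * r ≤ r₀ := by rw [hr, mul_div_cancel₀ _ (by norm_num)]; exact min_le_left _ _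
  have hr2 : 8 * r * ‖v‖ ≤ b₀ := by
    rw [hr, mul_div_cancel₀ _ (by norm_num)]
    exact (le_div_iff₀ hv0).1 (min_le_right _ _)
  have hmem : ∀ y ∈ ball y₀ (b₀ / 2), ∀ z : ℂ, ‖z‖ ≤ 3 * r → y + z • v ∈ ball y₀ b₀ := by
    intro y hy z hz
    rw [mem_ball_iff_norm] at hy ⊢
    have h1 : ‖z • v‖ ≤ 3 * r * ‖v‖ := by
      rw [norm_smul]; exact mul_le_mul_of_nonneg_right hz hv0.le
    have h2 : y + z • v - y₀ = (y - y₀) + z • v := by abel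
    have h3 : 0 ≤ r * ‖v‖ := by positivity
    rw [h2]
    linarith [norm_add_le (y - y₀) (z • v)]
  have hy₀b : y₀ ∈ ball y₀ (b₀ / 2) := mem_ball_self (half_pos hb₀)
  have hcpt : IsCompact {z : ℂ | r ≤ ‖z‖ ∧ ‖z‖ ≤ 3 * r} := by
    refine (isCompact_closedBall (0 : ℂ) (3 * r)).of_isClosed_subset
      ((isClosed_le continuous_const continuous_norm).inter
        (isClosed_le continuous_norm continuous_const)) fun z hz => mem_closedBall_zero_iff.2 hz.2
  obtain ⟨δ, hδ, hδf⟩ := hcpt.exists_forall_le' (f := fun z => ‖f (y₀ + z • v)‖) (a := 0)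
    (ContinuousOn.norm fun z hz => (hga y₀ z
      (hsub (hmem y₀ hy₀b z hz.2)).1.2).continuousAt.continuousWithinAt)
    (fun z hz => norm_pos_iff.2 (hr₀f z (by linarith [hz.2]) fun h => by
      have := hz.1; rw [h, norm_zero] at this; linarith))
  have hLip : ∀ y ∈ ball y₀ b₀, ∀ y' ∈ ball y₀ b₀, ‖f y - f y'‖ ≤ K * ‖y - y'‖ := fun y hy y' hy' => by
    have := hK.dist_le_mul y (hsub hy).2 y' (hsub hy').2
    rwa [dist_eq_norm, dist_eq_norm] at this
  have hK0 : (0 : ℝ) ≤ K := K.2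
  -- The radius δ / (4 (K + 1)) ensures that moving the slice changes f by less than δ / 4, where K
  -- is the Lipschitz constant of f. The same constant bounds f by the distance to a zero along the
  -- slice.
  refine ⟨v, r, δ / 2, K * ‖v‖, min (b₀ / 2) (δ / (4 * (K + 1))), hrpos, half_pos hδ, by positivity,
    by positivity, fun y hy z hz => (hsub (hmem y (ball_subset_ball (min_le_left _ _) hy) z hz)).1,
    fun y hy => ?_⟩
  have hyb := ball_subset_ball (min_le_left _ _) hy
  have hyd : K * ‖y - y₀‖ < δ / 4 := by
    have h1 : ‖y - y₀‖ < δ / (4 * (K + 1)) := (mem_ball_iff_norm.1 hy).trans_le (min_le_right _ _)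
    rw [lt_div_iff₀ (by positivity)] at h1
    nlinarith [norm_nonneg (y - y₀)]
  have hclose : ∀ z : ℂ, ‖z‖ ≤ 3 * r → ‖f (y + z • v) - f (y₀ + z • v)‖ < δ / 4 := fun z hz => by
    have h1 := hLip _ (hmem y hyb z hz) _ (hmem y₀ hy₀b z hz)
    rw [show y + z • v - (y₀ + z • v) = y - y₀ by abel] at h1
    linarith
  have hlow : ∀ z : ℂ, r ≤ ‖z‖ → ‖z‖ ≤ 3 * r → δ * (3 / 4) ≤ ‖f (y + z • v)‖ := fun z h1 h2 => by
    have h3 := hδf z ⟨h1, h2⟩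
    have h4 := norm_sub_norm_le (f (y₀ + z • v)) (f (y + z • v))
    rw [norm_sub_rev] at h4
    linarith [hclose z h2]
  have hy0 : ‖f y‖ < δ / 4 := by
    simpa [h0] using hclose 0 (by simpa using hrpos.le)
  refine ⟨fun z h1 h2 => by linarith [hlow z h1 h2], ?_⟩
  set g : ℂ → ℂ := fun z => f (y + z • v) with hg
  have hg0 : g 0 = f y := by simp [hg]
  have hgan : AnalyticOnNhd ℂ g (closedBall 0 (3 * r)) := fun z hz =>
    hga y z (hsub (hmem y hyb z (mem_closedBall_zero_iff.1 hz))).1.2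
  have hsph : ∀ z ∈ sphere (0 : ℂ) r, δ / 2 ≤ ‖g z - g 0‖ := fun z hz => by
    have hz' : ‖z‖ = r := mem_sphere_zero_iff_norm.1 hz
    have h1 := hlow z hz'.ge (by linarith)
    have h2 := norm_sub_norm_le (g z) (g 0)
    rw [hg0] at h2 ⊢
    change δ * (3 / 4) ≤ ‖g z‖ at h1
    linarith
  have hfr : ∃ᶠ z in 𝓝 (0 : ℂ), g z ≠ g 0 := fun h => by
    have h1 : g =ᶠ[𝓝 0] fun _ => g 0 := by filter_upwards [h] with z hz using not_not.1 hz
    have h2 := hgan.eqOn_of_preconnected_of_eventuallyEq (fun z _ => analyticAt_const)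
      (convex_closedBall _ _).isPreconnected (mem_closedBall_self (by positivity)) h1
      (show (r : ℂ) ∈ closedBall (0 : ℂ) (3 * r) by
        rw [mem_closedBall_zero_iff, Complex.norm_real, Real.norm_of_nonneg hrpos.le]; linarith)
    have h3 := hsph r (by
      rw [mem_sphere_zero_iff_norm, Complex.norm_real, Real.norm_of_nonneg hrpos.le])
    simp only at h2
    rw [h2, sub_self, norm_zero] at h3
    linarith
  have hdc : DiffContOnCl ℂ g (ball 0 r) := by
    refine DifferentiableOn.diffContOnCl fun z hz => ?_
    rw [closure_ball _ hrpos.ne'] at hz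
    exact (hgan z (closedBall_subset_closedBall (by linarith) hz)).differentiableAt.differentiableWithinAt
  -- Quantitative open mapping: since |g - g 0| ≥ δ / 2 on the circle, g covers the ball of radius δ
  -- / 4 about g 0, and this ball contains 0. So nearby slices meet the zero set as well.
  obtain ⟨a, ha, ha0⟩ := hdc.ball_subset_image_closedBall hrpos hsph hfr
    (show (0 : ℂ) ∈ ball (g 0) (δ / 2 / 2) by
      rw [mem_ball_iff_norm, zero_sub, norm_neg, hg0]; linarith)
  have ha' : ‖a‖ ≤ r := mem_closedBall_zero_iff.1 ha
  refine ⟨a, ha', fun z hz => ?_⟩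
  have h1 := hLip _ (hmem y hyb z hz) _ (hmem y hyb a (by linarith))
  change g a = 0 at ha0
  change ‖g z - g a‖ ≤ _ at h1
  rw [ha0, sub_zero, show y + z • v - (y + a • v) = (z - a) • v by rw [sub_smul]; abel, norm_smul] at h1
  change ‖g z‖ ≤ _
  linarith

variable [FiniteDimensional ℂ E]

/-- The zero set of a holomorphic function which does not vanish identically is locally null. -/
theorem exists_nhds_null_zeros {f : E → ℂ} {Ω : Set E} (hΩ : IsOpen Ω)
    (hf : AnalyticOnNhd ℂ f Ω) {y₀ : E} (hy₀ : y₀ ∈ Ω) (hne : ∃ᶠ y in 𝓝 y₀, f y ≠ 0) :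
    ∃ O ∈ 𝓝 ((realCoordCLE E).symm y₀), volume ({t | realCoord E t ∈ Ω ∧ f (realCoord E t) = 0} ∩ O) = 0 := by
  by_cases h0 : f y₀ = 0
  · obtain ⟨v, r, δ, M, b, hr, hδ, -, hb, hmem, hsl⟩ :=
      exists_slices_through_zeros hΩ hf hy₀ h0 hne Filter.univ_mem
    let T : ℂ → (Fin (Module.finrank ℂ E) × Fin 2 → ℝ) := fun z => (realCoordCLE E).symm (z • v)
    have hT : Continuous T := (realCoordCLE E).symm.continuous.comp (by fun_prop)
    have hadd : ∀ t z, realCoord E (t + T z) = realCoord E t + z • v := fun t z => by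
      rw [← realCoordCLE_apply, ← realCoordCLE_apply, map_add]
      exact congrArg _ ((realCoordCLE E).apply_symm_apply _)
    have hZ : MeasurableSet {t | realCoord E t ∈ Ω ∧ f (realCoord E t) = 0} := by
      have h1 : IsOpen (Ω ∩ f ⁻¹' {0}ᶜ) :=
        hf.continuousOn.isOpen_inter_preimage hΩ isOpen_compl_singleton
      have h2 : {t | realCoord E t ∈ Ω ∧ f (realCoord E t) = 0} =
          (realCoord E ⁻¹' Ω) \ (realCoord E ⁻¹' (Ω ∩ f ⁻¹' {0}ᶜ)) := by
        ext t
        constructor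
        · rintro ⟨h3, h4⟩
          exact ⟨h3, fun h5 => h5.2 h4⟩
        · rintro ⟨h3, h4⟩
          exact ⟨h3, not_not.1 fun h5 => h4 ⟨h3, h5⟩⟩
      rw [h2]
      exact (isOpen_realCoord_preimage E hΩ).measurableSet.diff
        (isOpen_realCoord_preimage E h1).measurableSet
    refine exists_nhds_null_of_slices (B := realCoord E ⁻¹' ball y₀ b) (D := ball 0 (3 * r)) hT
      (by simp [T]) hZ ?_ (ball_mem_nhds _ (by positivity)) fun t ht => ?_
    · refine (isOpen_realCoord_preimage E isOpen_ball).mem_nhds ?_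
      rw [mem_preimage, ← realCoordCLE_apply, ContinuousLinearEquiv.apply_symm_apply]
      exact mem_ball_self hb
    · have hga : AnalyticOnNhd ℂ (fun z : ℂ => f (realCoord E t + z • v)) (ball 0 (3 * r)) :=
        fun z hz => AnalyticAt.fun_comp (g := f) (f := fun z : ℂ => realCoord E t + z • v)
          (hf _ (hmem _ ht z (mem_ball_zero_iff.1 hz).le).2) (by fun_prop)
      have hrn : ‖(r : ℂ)‖ = r := by rw [Complex.norm_real, Real.norm_of_nonneg hr.le]
      -- On the slice f does not vanish on the annulus, so its zeros are discrete and hence null.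
      rcases hga.eqOn_zero_or_eventually_ne_zero_of_preconnected (convex_ball _ _).isPreconnected
        with h | h
      · exfalso
        have h1 := h (show (r : ℂ) ∈ ball (0 : ℂ) (3 * r) by rw [mem_ball_zero_iff, hrn]; linarith)
        have h2 := (hsl _ ht).1 r hrn.ge (by linarith)
        rw [show f (realCoord E t + (r : ℂ) • v) = 0 from h1, norm_zero] at h2
        linarith
      · have h1 := (ae_restrict_iff' measurableSet_ball).1
          (ae_restrict_le_codiscreteWithin (μ := volume) measurableSet_ball h)
        refine measure_mono_null (fun z hz => ?_) h1
        intro h2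
        refine h2 hz.1 ?_
        have h3 := hz.2.2
        rwa [hadd] at h3
  · refine ⟨realCoord E ⁻¹' (Ω ∩ f ⁻¹' {0}ᶜ), ?_, ?_⟩
    · refine (isOpen_realCoord_preimage E
        (hf.continuousOn.isOpen_inter_preimage hΩ isOpen_compl_singleton)).mem_nhds ?_
      rw [mem_preimage, ← realCoordCLE_apply, ContinuousLinearEquiv.apply_symm_apply]
      exact ⟨hy₀, h0⟩
    · refine measure_mono_null ?_ measure_empty
      rintro t ⟨h1, h2⟩
      exact h2.2 h1.2

/-- Put N = |f|² e^φ and L = -log ε. On each slice log(N + ε) climbs from about log ε, on a circle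
of radius √ε around a zero, to a bounded value on the circle of radius 2r. A climb of about L across
an annulus whose logarithmic width is about L / 2 costs energy of order L, and integrating over the
slices gives the bound. -/
theorem exists_energy_lower_bound {f : E → ℂ} {φ : E → ℝ} {Ω V : Set E} (hΩ : IsOpen Ω)
    (hf : AnalyticOnNhd ℂ f Ω) (hφ : ContDiffOn ℝ 1 φ Ω) {y₀ : E} (hy₀ : y₀ ∈ Ω) (h0 : f y₀ = 0)
    (hne : ∃ᶠ y in 𝓝 y₀, f y ≠ 0) (hV : IsOpen V) (hyV : y₀ ∈ V) :
    ∃ c > 0, ∀ᶠ ε in 𝓝[>] (0 : ℝ), ENNReal.ofReal (c * -Real.log ε) ≤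
      ∫⁻ t in realCoord E ⁻¹' V, ENNReal.ofReal (‖fderiv ℝ (fun y =>
        Real.log (Complex.normSq (f y) * Real.exp (φ y) + ε)) (realCoord E t)‖ ^ 2) := by
  have hV' : V ∩ {y | y ∈ Ω ∧ |φ y - φ y₀| < 1} ∈ 𝓝 y₀ := by
    refine Filter.inter_mem (hV.mem_nhds hyV) ?_
    have h1 := Metric.tendsto_nhds.1 (hφ.continuousOn.continuousAt (hΩ.mem_nhds hy₀)) 1 one_pos
    filter_upwards [hΩ.mem_nhds hy₀, h1] with y h2 h3
    exact ⟨h2, h3⟩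
  obtain ⟨v, r, δ, M, b, hr, hδ, hM, hb, hmem, hsl⟩ :=
    exists_slices_through_zeros hΩ hf hy₀ h0 hne hV'
  let T : ℂ → (Fin (Module.finrank ℂ E) × Fin 2 → ℝ) := fun z => (realCoordCLE E).symm (z • v)
  have hT : Continuous T := (realCoordCLE E).symm.continuous.comp (by fun_prop)
  have hadd : ∀ t z, realCoord E (t + T z) = realCoord E t + z • v := fun t z => by
    rw [← realCoordCLE_apply, ← realCoordCLE_apply, map_add]
    exact congrArg _ ((realCoordCLE E).apply_symm_apply _)
  -- The base points of the slices. The unit ball only serves to make the volume finite.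
  set B : Set (Fin (Module.finrank ℂ E) × Fin 2 → ℝ) :=
    ball ((realCoordCLE E).symm y₀) 1 ∩ realCoord E ⁻¹' ball y₀ b with hBdef
  have hBo : IsOpen B := isOpen_ball.inter (isOpen_realCoord_preimage E isOpen_ball)
  have hBne : B.Nonempty := ⟨(realCoordCLE E).symm y₀, mem_ball_self one_pos, by
    rw [mem_preimage, ← realCoordCLE_apply, ContinuousLinearEquiv.apply_symm_apply]
    exact mem_ball_self hb⟩
  have hBfin : volume B ≠ ⊤ :=
    ((measure_mono inter_subset_left).trans_lt measure_ball_lt_top).ne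
  have hBpos : 0 < volume B := hBo.measure_pos volume hBne
  set D : Set ℂ := ball 0 (3 * r) with hD
  have hDfin : volume D ≠ ⊤ := measure_ball_lt_top.ne
  set m := (volume B).toReal with hm
  have hm0 : 0 < m := ENNReal.toReal_pos hBpos.ne' hBfin
  set q := (volume D).toReal with hq
  have hq0 : 0 ≤ q := ENNReal.toReal_nonneg
  -- On the inner circle N + ε ≤ κ₁ ε, and on the outer one N ≥ κ₂.
  set κ₁ := M ^ 2 * Real.exp (φ y₀ + 1) + 1 with hκ₁
  have hκ₁0 : 0 < κ₁ := by positivity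
  set κ₂ := δ ^ 2 * Real.exp (φ y₀ - 1) with hκ₂
  have hκ₂0 : 0 < κ₂ := by positivity
  set c₁ := Real.log κ₂ - Real.log κ₁ with hc₁
  -- Energy (π / 2) L on each slice, times the volume m of base points, divided by the stretching
  -- ‖v‖² of the slices and the area q of the discs. The added units keep the denominators positive.
  refine ⟨Real.pi / 2 * m / ((‖v‖ ^ 2 + 1) * (q + 1)), by positivity, ?_⟩
  have hL : Filter.Tendsto (fun ε => -Real.log ε) (𝓝[>] (0 : ℝ)) Filter.atTop :=
    Filter.tendsto_neg_atBot_atTop.comp Real.tendsto_log_nhdsGT_zero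
  filter_upwards [hL.eventually_ge_atTop 1, hL.eventually_ge_atTop (2 * |c₁|),
    hL.eventually_ge_atTop (2 * Real.log (2 * r)),
    hL.eventually_gt_atTop (-(2 * Real.log (2 * r))), self_mem_nhdsWithin] with ε e1 e2 e3 e4 hε
  have hε0 : 0 < ε := hε
  set L := -Real.log ε with hLdef
  set ℓ : E → ℝ := fun y => Real.log (Complex.normSq (f y) * Real.exp (φ y) + ε) with hℓ
  have hpos : ∀ y, 0 < Complex.normSq (f y) * Real.exp (φ y) + ε := fun y =>
    add_pos_of_nonneg_of_pos (mul_nonneg (Complex.normSq_nonneg _) (Real.exp_pos _).le) hε0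
  have hℓs : ContDiffOn ℝ 1 ℓ Ω := by
    have h1 : ContDiffOn ℝ 1 f Ω := fun y hy =>
      ((hf y hy).contDiffAt.restrict_scalars ℝ).contDiffWithinAt
    have h2 : ContDiffOn ℝ 1 (fun y => Complex.normSq (f y)) Ω := by
      simp only [Complex.normSq_apply]
      have hre : ContDiffOn ℝ 1 (fun y => (f y).re) Ω := Complex.reCLM.contDiff.comp_contDiffOn h1
      have him : ContDiffOn ℝ 1 (fun y => (f y).im) Ω := Complex.imCLM.contDiff.comp_contDiffOn h1
      exact (hre.mul hre).add (him.mul him)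
    exact ((h2.mul hφ.exp).add contDiffOn_const).log fun y _ => (hpos y).ne'
  have hlog : Real.log (√ε) = -(L / 2) := by
    rw [Real.log_sqrt hε0.le, hLdef]; ring
  have hsq0 : 0 < √ε := Real.sqrt_pos.2 hε0
  have hsqr : √ε < 2 * r := by
    rw [← Real.log_lt_log_iff hsq0 (by positivity), hlog]; linarith
  have hlogdiv : Real.log (2 * r / √ε) = Real.log (2 * r) + L / 2 := by
    rw [Real.log_div (by positivity) hsq0.ne', hlog]; ring
  have hslice : ∀ t ∈ B, ENNReal.ofReal (Real.pi / 2 * L) ≤ ENNReal.ofReal (‖v‖ ^ 2 + 1) *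
      ∫⁻ z in D, ENNReal.ofReal (‖fderiv ℝ ℓ (realCoord E (t + T z))‖ ^ 2) := by
    intro t ht
    set y := realCoord E t with hy
    obtain ⟨hann, a, ha, hle⟩ := hsl y ht.2
    set u : ℂ → ℝ := fun z => ℓ (y + z • v) with hu
    have hin : ∀ z : ℂ, ‖z - a‖ ≤ 2 * r → ‖z‖ ≤ 3 * r := fun z hz => by
      have := norm_add_le (z - a) a
      rw [sub_add_cancel] at this
      linarith
    set A : ℂ →L[ℝ] E := (ContinuousLinearMap.smulRight (1 : ℂ →L[ℂ] ℂ) v).restrictScalars ℝ with hA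
    have hAle : ‖A‖ ≤ ‖v‖ := ContinuousLinearMap.opNorm_le_bound _ (norm_nonneg _) fun z => by
      change ‖z • v‖ ≤ _
      rw [norm_smul, mul_comm]
    have haff : ∀ z, HasFDerivAt (fun z : ℂ => y + z • v) A z := fun z =>
      A.hasFDerivAt.const_add y
    set U : Set ℂ := (fun z : ℂ => y + z • v) ⁻¹' Ω with hU
    have hUo : IsOpen U := hΩ.preimage (by fun_prop)
    have hus : ContDiffOn ℝ 1 u U := by
      refine hℓs.comp (f := fun z : ℂ => y + z • v) ?_ fun z hz => hz
      exact (contDiff_const.add A.contDiff).contDiffOn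
    have hφb : ∀ z : ℂ, ‖z‖ ≤ 3 * r → |φ (y + z • v) - φ y₀| < 1 := fun z hz =>
      (hmem y ht.2 z hz).1.2.2
    have hΩm : ∀ z : ℂ, ‖z‖ ≤ 3 * r → z ∈ U := fun z hz => (hmem y ht.2 z hz).2
    have h1 := ofReal_sq_div_log_le_lintegral_ball (A := Real.log (κ₁ * ε)) (B := Real.log κ₂) hUo hus
      (c := a) (R := 2 * r) (fun z hz => hΩm z (hin z (mem_closedBall_iff_norm.1 hz))) hsq0 hsqr ?_ ?_ ?_
    · have hAB : Real.log κ₂ - Real.log (κ₁ * ε) = L + c₁ := by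
        rw [Real.log_mul hκ₁0.ne' hε0.ne', hLdef, hc₁]; ring
      have h2 : ENNReal.ofReal (Real.pi / 2 * L) ≤ ENNReal.ofReal ((Real.log κ₂ -
          Real.log (κ₁ * ε)) ^ 2 / Real.log (2 * r / √ε)) * ENNReal.ofReal (2 * Real.pi) := by
        rw [← ENNReal.ofReal_mul' (by positivity)]
        refine ENNReal.ofReal_le_ofReal ?_
        rw [hAB, hlogdiv]
        -- For small ε the constant c₁ costs at most half of L in the numerator, and the denominator
        -- is at most L.
        have h3 : L / 4 ≤ (L + c₁) ^ 2 / (Real.log (2 * r) + L / 2) := by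
          rw [le_div_iff₀ (by linarith)]
          have h4 : L / 2 ≤ L + c₁ := by linarith [neg_abs_le c₁]
          nlinarith
        nlinarith [Real.pi_pos]
      refine h2.trans (h1.trans ?_)
      rw [← lintegral_const_mul' _ _ ENNReal.ofReal_ne_top]
      have hsub : ball a (2 * r) ⊆ D := fun z hz => by
        rw [hD, mem_ball_zero_iff]
        have h5 := norm_add_le (z - a) a
        rw [sub_add_cancel] at h5
        linarith [mem_ball_iff_norm.1 hz]
      refine (lintegral_mono_set hsub).trans' (setLIntegral_mono' measurableSet_ball fun z hz => ?_)
      rw [← ENNReal.ofReal_mul (by positivity), hadd]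
      refine ENNReal.ofReal_le_ofReal ?_
      have hzU := hΩm z (hin z (mem_ball_iff_norm.1 hz).le)
      have h6 : fderiv ℝ u z = (fderiv ℝ ℓ (y + z • v)).comp A :=
        (HasFDerivAt.comp (g := ℓ) (f := fun z : ℂ => y + z • v) z
          ((hℓs.contDiffAt (hΩ.mem_nhds hzU)).differentiableAt (by simp)).hasFDerivAt (haff z)).fderiv
      have h7 : ‖fderiv ℝ u z‖ ≤ ‖fderiv ℝ ℓ (y + z • v)‖ * ‖v‖ := by
        rw [h6]
        exact (ContinuousLinearMap.opNorm_comp_le _ _).trans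
          (mul_le_mul_of_nonneg_left hAle (norm_nonneg _))
      calc ‖fderiv ℝ u z‖ ^ 2 ≤ (‖fderiv ℝ ℓ (y + z • v)‖ * ‖v‖) ^ 2 :=
            pow_le_pow_left₀ (norm_nonneg _) h7 2
        _ ≤ (‖v‖ ^ 2 + 1) * ‖fderiv ℝ ℓ (y + z • v)‖ ^ 2 := by
            nlinarith [sq_nonneg ‖fderiv ℝ ℓ (y + z • v)‖]
    · have h3 : Real.log (κ₁ * ε) = Real.log κ₂ - (L + c₁) := by
        rw [Real.log_mul hκ₁0.ne' hε0.ne', hLdef, hc₁]; ring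
      rw [h3]
      linarith [neg_abs_le c₁, abs_nonneg c₁]
    · intro z hz
      have hz' : ‖z - a‖ = √ε := mem_sphere_iff_norm.1 hz
      have h3 := hin z (by linarith)
      refine Real.log_le_log (hpos _) ?_
      have h4 : Complex.normSq (f (y + z • v)) ≤ M ^ 2 * ε := by
        rw [Complex.normSq_eq_norm_sq]
        have h5 := pow_le_pow_left₀ (norm_nonneg _) (hle z h3) 2
        rwa [mul_pow, hz', Real.sq_sqrt hε0.le] at h5
      have h5 : Real.exp (φ (y + z • v)) ≤ Real.exp (φ y₀ + 1) :=
        Real.exp_le_exp.2 (by linarith [(abs_lt.1 (hφb z h3)).2])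
      have h6 := mul_le_mul h4 h5 (Real.exp_pos _).le (by positivity)
      rw [hκ₁]
      linarith
    · intro z hz
      have hz' : ‖z - a‖ = 2 * r := mem_sphere_iff_norm.1 hz
      have h3 := hin z hz'.le
      refine Real.log_le_log hκ₂0 ?_
      have hr' : r ≤ ‖z‖ := by
        have := norm_sub_le z a
        linarith
      have h4 : δ ^ 2 ≤ Complex.normSq (f (y + z • v)) := by
        rw [Complex.normSq_eq_norm_sq]
        exact pow_le_pow_left₀ hδ.le (hann z hr' h3) 2
      have h5 : Real.exp (φ y₀ - 1) ≤ Real.exp (φ (y + z • v)) :=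
        Real.exp_le_exp.2 (by linarith [(abs_lt.1 (hφb z h3)).1])
      have h6 := mul_le_mul h4 h5 (Real.exp_pos _).le (Complex.normSq_nonneg _)
      rw [hκ₂]
      linarith
  have hF : Measurable fun t : Fin (Module.finrank ℂ E) × Fin 2 → ℝ =>
      ENNReal.ofReal (‖fderiv ℝ ℓ (realCoord E t)‖ ^ 2) := by
    borelize E
    rw [realCoord_eq]
    exact (((measurable_fderiv ℝ ℓ).comp (realCoordCLE E).continuous.measurable).norm.pow_const
      2).ennreal_ofReal
  have hSm := (isOpen_realCoord_preimage E hV).measurableSet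
  have h1 := lintegral_slices_le (μ := volume) hT hF hBo.measurableSet hSm
    (measurableSet_ball : MeasurableSet D) fun t ht z hz => by
      rw [mem_preimage, hadd]
      exact (hmem _ ht.2 z (mem_ball_zero_iff.1 hz).le).1.1
  have h2 : ENNReal.ofReal (Real.pi / 2 * L) * volume B ≤ ENNReal.ofReal (‖v‖ ^ 2 + 1) *
      ∫⁻ t in B, (∫⁻ z in D, ENNReal.ofReal (‖fderiv ℝ ℓ (realCoord E (t + T z))‖ ^ 2)) := by
    rw [← setLIntegral_const, ← lintegral_const_mul' _ _ ENNReal.ofReal_ne_top]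
    exact setLIntegral_mono' hBo.measurableSet hslice
  have hBr : volume B = ENNReal.ofReal m := (ENNReal.ofReal_toReal hBfin).symm
  have hDr : volume D ≤ ENNReal.ofReal (q + 1) := by
    rw [← ENNReal.ofReal_toReal hDfin]
    exact ENNReal.ofReal_le_ofReal (by linarith)
  set I := ∫⁻ t in realCoord E ⁻¹' V, ENNReal.ofReal (‖fderiv ℝ ℓ (realCoord E t)‖ ^ 2) with hI
  have h3 : ENNReal.ofReal (Real.pi / 2 * L * m) ≤ I * ENNReal.ofReal ((‖v‖ ^ 2 + 1) * (q + 1)) := by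
    rw [ENNReal.ofReal_mul (p := Real.pi / 2 * L) (by positivity), ← hBr,
      ENNReal.ofReal_mul (p := ‖v‖ ^ 2 + 1) (by positivity)]
    refine h2.trans ((mul_le_mul_right (h1.trans (mul_le_mul_right hDr I)) _).trans_eq ?_)
    ring
  have h4 : ENNReal.ofReal (Real.pi / 2 * m / ((‖v‖ ^ 2 + 1) * (q + 1)) * L) *
      ENNReal.ofReal ((‖v‖ ^ 2 + 1) * (q + 1)) ≤ I * ENNReal.ofReal ((‖v‖ ^ 2 + 1) * (q + 1)) := by
    refine le_trans (le_of_eq ?_) h3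
    rw [← ENNReal.ofReal_mul (by positivity)]
    congr 1
    field_simp
  exact (ENNReal.mul_le_mul_iff_left (ENNReal.ofReal_pos.2 (by positivity)).ne'
    ENNReal.ofReal_ne_top).1 h4

end Zeros

/-! ### The regularized potential and its derivatives. -/

section Regularization

variable {E : Type*} [NormedAddCommGroup E] [NormedSpace ℂ E]

/-- A regularization of `log N + (log N)² / (2 L)`, where `L = - log ε`. -/
def regPotential (ε N : ℝ) : ℝ :=
  Real.log (N + ε) + Real.log (N + ε) ^ 2 / (2 * -Real.log ε)

/-- The derivative of the regularized potential with respect to `log N`. -/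
def regWeight (ε N : ℝ) : ℝ :=
  (1 + Real.log (N + ε) / -Real.log ε) * (N / (N + ε))

/-- With L = -log ε the first factor is (log(N + ε) - log ε) / L, and N + ε ≥ ε. -/
theorem regWeight_nonneg {ε N : ℝ} (hε : 0 < ε) (hε1 : ε < 1) (hN : 0 ≤ N) : 0 ≤ regWeight ε N := by
  have hL : 0 < -Real.log ε := neg_pos.2 (Real.log_neg hε hε1)
  have h1 : Real.log ε ≤ Real.log (N + ε) := Real.log_le_log hε (by linarith)
  refine mul_nonneg ?_ (by positivity)
  have : 1 + Real.log (N + ε) / -Real.log ε = (Real.log (N + ε) - Real.log ε) / -Real.log ε := by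
    have hne : Real.log ε ≠ 0 := (neg_pos.1 hL).ne
    field_simp
    ring
  rw [this]
  exact div_nonneg (by linarith) hL.le

/-- The bound does not depend on ε, so it provides the dominating function for the limit ε → 0. -/
theorem regWeight_le {ε N C : ℝ} (hε : 0 < ε) (hε1 : 1 ≤ -Real.log ε) (hN : 0 ≤ N) (hNC : N ≤ C) :
    regWeight ε N ≤ 1 + |Real.log (C + 1)| := by
  have hL : 0 < -Real.log ε := by linarith
  have hεlt : ε < 1 := by
    by_contra! h
    linarith [Real.log_nonneg h]
  have h1 : Real.log (N + ε) ≤ Real.log (C + 1) := Real.log_le_log (by linarith) (by linarith)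
  have h2 : N / (N + ε) ≤ 1 := (div_le_one (by linarith)).2 (by linarith)
  have h3 : Real.log (N + ε) / -Real.log ε ≤ |Real.log (C + 1)| := by
    rw [div_le_iff₀ hL]
    nlinarith [le_abs_self (Real.log (C + 1)), abs_nonneg (Real.log (C + 1))]
  have h4 : 0 ≤ N / (N + ε) := by positivity
  have h5 : 0 ≤ |Real.log (C + 1)| := abs_nonneg _
  unfold regWeight
  nlinarith

theorem tendsto_regWeight {N : ℝ} (hN : 0 < N) :
    Filter.Tendsto (fun ε => regWeight ε N) (𝓝[>] (0 : ℝ)) (𝓝 1) := by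
  have h0 : Filter.Tendsto (fun ε : ℝ => N + ε) (𝓝[>] (0 : ℝ)) (𝓝 N) := by
    have : Filter.Tendsto (fun ε : ℝ => N + ε) (𝓝 0) (𝓝 (N + 0)) :=
      (continuous_const.add continuous_id).tendsto 0
    rw [add_zero] at this
    exact this.mono_left nhdsWithin_le_nhds
  have hL : Filter.Tendsto (fun ε => -Real.log ε) (𝓝[>] (0 : ℝ)) Filter.atTop :=
    Filter.tendsto_neg_atBot_atTop.comp Real.tendsto_log_nhdsGT_zero
  have h1 := ((h0.log hN.ne').div_atTop hL).const_add 1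
  have h2 : Filter.Tendsto (fun ε : ℝ => N / (N + ε)) (𝓝[>] (0 : ℝ)) (𝓝 (N / N)) :=
    Filter.Tendsto.div tendsto_const_nhds h0 hN.ne'
  rw [div_self hN.ne'] at h2
  simpa [regWeight] using h1.mul h2

theorem hasDerivAt_regPotential_exp {ε : ℝ} (hε : 0 < ε) (hε1 : ε < 1) (t : ℝ) :
    HasDerivAt (fun t => regPotential ε (Real.exp t)) (regWeight ε (Real.exp t)) t := by
  have hpos : 0 < Real.exp t + ε := add_pos (Real.exp_pos t) hε
  have hL : Real.log ε ≠ 0 := (Real.log_neg hε hε1).ne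
  have h1 : HasDerivAt (fun t => Real.log (Real.exp t + ε)) (Real.exp t / (Real.exp t + ε)) t :=
    ((Real.hasDerivAt_exp t).add_const ε).log hpos.ne'
  refine (h1.add ((h1.pow 2).div_const (2 * -Real.log ε))).congr_deriv ?_
  unfold regWeight
  field_simp
  ring

/-- The first summand is the contribution of the quadratic term of the potential: 1/L times the
square of the slope of log(N + ε), which produces the energy. The second is nonnegative and may be
dropped. -/
theorem hasDerivAt_regWeight_exp {ε : ℝ} (hε : 0 < ε) (hε1 : ε < 1) (t : ℝ) :
    HasDerivAt (fun t => regWeight ε (Real.exp t))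
      ((1 / -Real.log ε) * (Real.exp t / (Real.exp t + ε)) ^ 2 +
        regWeight ε (Real.exp t) * (ε / (Real.exp t + ε))) t := by
  have hpos : 0 < Real.exp t + ε := add_pos (Real.exp_pos t) hε
  have hL : Real.log ε ≠ 0 := (Real.log_neg hε hε1).ne
  have h1 : HasDerivAt (fun t => Real.log (Real.exp t + ε)) (Real.exp t / (Real.exp t + ε)) t :=
    ((Real.hasDerivAt_exp t).add_const ε).log hpos.ne'
  have h2 : HasDerivAt (fun t => Real.exp t / (Real.exp t + ε))
      ((Real.exp t * (Real.exp t + ε) - Real.exp t * Real.exp t) / (Real.exp t + ε) ^ 2) t :=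
    (Real.hasDerivAt_exp t).div ((Real.hasDerivAt_exp t).add_const ε) hpos.ne'
  refine (((h1.div_const (-Real.log ε)).const_add 1).mul h2).congr_deriv ?_
  unfold regWeight
  field_simp
  ring

/-- The potential of a Hermitian metric, regularized at the zeros of a section. -/
theorem iddbar_regPotential {f : E → ℂ} {φ : E → ℝ} {y : E} {ε : ℝ} (hε : 0 < ε) (hε1 : ε < 1)
    (hf : ContDiffAt ℂ 2 f y) (hφ : ContDiffAt ℝ 2 φ y) (h0 : f y ≠ 0) :
    ∃ s : ℝ, 0 ≤ s ∧ iddbar (fun z => regPotential ε (Complex.normSq (f z) * Real.exp (φ z))) y =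
      regWeight ε (Complex.normSq (f y) * Real.exp (φ y)) • iddbar φ y +
        (1 / -Real.log ε) • rankOne (fderiv ℝ (fun z =>
          Real.log (Complex.normSq (f z) * Real.exp (φ z) + ε)) y) +
        s • rankOne (fderiv ℝ (fun z => Real.log (Complex.normSq (f z)) + φ z) y) := by
  set w : E → ℝ := fun z => Real.log (Complex.normSq (f z)) + φ z with hw
  have hl : ContDiffAt ℝ 2 (fun z => Real.log (Complex.normSq (f z))) y :=
    contDiffAt_log_normSq (contDiffAt_real hf) h0
  have hwd : ContDiffAt ℝ 2 w y := hl.add hφ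
  have hexp : ∀ z, f z ≠ 0 → Complex.normSq (f z) * Real.exp (φ z) = Real.exp (w z) := fun z hz => by
    rw [hw, Real.exp_add, Real.exp_log (Complex.normSq_pos.2 hz)]
  have hne : ∀ᶠ z in 𝓝 y, f z ≠ 0 := hf.continuousAt.eventually_ne h0
  set N := Real.exp (w y) with hN
  have hNpos : 0 < N := Real.exp_pos _
  have h1 : iddbar (fun z => regPotential ε (Complex.normSq (f z) * Real.exp (φ z))) y =
      iddbar (fun z => regPotential ε (Real.exp (w z))) y := by
    refine iddbar_congr ?_
    filter_upwards [hne] with z hz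
    rw [hexp z hz]
  have h2 := iddbar_comp_real (χ := fun t => regPotential ε (Real.exp t))
    (χ' := fun t => regWeight ε (Real.exp t)) hwd
    (Filter.Eventually.of_forall fun t => hasDerivAt_regPotential_exp hε hε1 t)
    (hasDerivAt_regWeight_exp hε hε1 (w y))
  -- Off its zeros a holomorphic f makes log |f|² pluriharmonic.
  have h3 : iddbar w y = iddbar φ y := by
    rw [hw, iddbar_add hl hφ, iddbar_log_normSq hf h0, zero_add]
  have h4 : fderiv ℝ (fun z => Real.log (Complex.normSq (f z) * Real.exp (φ z) + ε)) y =
      (N / (N + ε)) • fderiv ℝ w y := by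
    have h5 : (fun z => Real.log (Complex.normSq (f z) * Real.exp (φ z) + ε)) =ᶠ[𝓝 y]
        fun z => Real.log (Real.exp (w z) + ε) := by
      filter_upwards [hne] with z hz
      rw [hexp z hz]
    have h6 : HasDerivAt (fun t => Real.log (Real.exp t + ε)) (N / (N + ε)) (w y) :=
      ((Real.hasDerivAt_exp _).add_const ε).log (add_pos hNpos hε).ne'
    rw [h5.fderiv_eq]
    exact (h6.comp_hasFDerivAt y (hwd.differentiableAt (by simp)).hasFDerivAt).fderiv
  refine ⟨regWeight ε N * (ε / (N + ε)), mul_nonneg (regWeight_nonneg hε hε1 hNpos.le)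
    (by positivity), ?_⟩
  rw [h1, h2, h3, h4, rankOne_smul, hexp y h0, ← hN]
  ext v
  simp only [ContinuousAlternatingMap.add_apply, ContinuousAlternatingMap.smul_apply, smul_eq_mul]
  ring

end Regularization

/-! ### Positivity of the Kähler form in charts. -/

section Positivity

variable {E : Type*} [NormedAddCommGroup E] [NormedSpace ℂ E] [FiniteDimensional ℂ E]
  {X : Type*} [TopologicalSpace X] [ChartedSpace E X] [IsManifold 𝓘(ℂ, E) ω X]

/-- The transition from the preferred chart provides a right inverse, so this endomorphism of a
finite dimensional space is surjective, hence injective. -/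
theorem chartSymmDeriv_injective {e : OpenPartialHomeomorph X E} (he : e ∈ atlas E X) {y : E}
    (hy : y ∈ e.target) : Function.Injective (chartSymmDeriv e y : E →L[ℝ] E) := by
  set x := e.symm y with hx
  have hs : (chartAt E x).symm (chartAt E x x) = x := (chartAt E x).left_inv (mem_chart_source E x)
  have hxe : x ∈ e.source := e.map_target hy
  have h1 := chartSymmDeriv_transition (chart_mem_atlas E x) he (mem_chart_target E x)
    (by rw [hs]; exact hxe)
  rw [chartSymmDeriv_chartAt, hs, hx, e.right_inv hy] at h1
  let A : E →L[ℝ] E := chartSymmDeriv e y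
  have hsurj : Function.Surjective (A : E →ₗ[ℝ] E) := fun v => ⟨_, (DFunLike.congr_fun h1 v).symm⟩
  exact LinearMap.injective_iff_surjective.2 hsurj

theorem KaehlerForm.twoFormInChart_type (κ : KaehlerForm E X) (e : OpenPartialHomeomorph X E)
    (y v w : E) : twoFormInChart κ.form e y ![Complex.I • v, Complex.I • w] =
      twoFormInChart κ.form e y ![v, w] := by
  let A : E →L[ℂ] E := (mfderiv 𝓘(ℂ, E) 𝓘(ℂ, E) e.symm y :)
  have h : ∀ a b : E, twoFormInChart κ.form e y ![a, b] = κ.form (e.symm y) ![A a, A b] := fun a b => by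
    refine congrArg (κ.form (e.symm y)) ?_
    funext i
    fin_cases i <;> rfl
  rw [h, h, A.map_smul, A.map_smul]
  exact κ.type_one_one _ _ _

theorem KaehlerForm.twoFormInChart_pos (κ : KaehlerForm E X) {e : OpenPartialHomeomorph X E}
    (he : e ∈ atlas E X) {y : E} (hy : y ∈ e.target) (v : E) (hv : v ≠ 0) :
    0 < twoFormInChart κ.form e y ![v, Complex.I • v] := by
  let A : E →L[ℂ] E := (mfderiv 𝓘(ℂ, E) 𝓘(ℂ, E) e.symm y :)
  have h : ∀ a b : E, twoFormInChart κ.form e y ![a, b] = κ.form (e.symm y) ![A a, A b] := fun a b => by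
    refine congrArg (κ.form (e.symm y)) ?_
    funext i
    fin_cases i <;> rfl
  rw [h, A.map_smul]
  refine κ.positive _ (A v) fun h0 => hv ?_
  refine chartSymmDeriv_injective he hy (?_ : A v = A 0)
  rw [A.map_zero]; exact h0

theorem KaehlerForm.wedgePow_rankOne_nonneg (κ : KaehlerForm E X) {e : OpenPartialHomeomorph X E}
    (he : e ∈ atlas E X) {y : E} (hy : y ∈ e.target) (p : E →L[ℝ] ℝ) :
    0 ≤ wedgePow (Module.finrank ℂ E) (rankOne p) (twoFormInChart κ.form e y) (realFrame E) :=
  (wedgePow_rankOne rfl _ (κ.twoFormInChart_type e y) (κ.twoFormInChart_pos he hy) p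
    (Module.finBasis ℂ E)).1

/-- The square norm of `p` is locally bounded by the density of `i ∂ℓ ∧ ∂̄ℓ ∧ κ^{d-1}`, `p = dℓ`. -/
theorem KaehlerForm.exists_wedgePow_rankOne_ge (hd : 0 < Module.finrank ℂ E) (κ : KaehlerForm E X)
    (c : X) {y₀ : E} (hy₀ : y₀ ∈ (chartAt E c).target) :
    ∃ a > 0, ∀ᶠ y in 𝓝 y₀, ∀ p : E →L[ℝ] ℝ, a * ‖p‖ ^ 2 ≤
      wedgePow (Module.finrank ℂ E) (rankOne p) (twoFormInChart κ.form (chartAt E c) y)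
        (realFrame E) := by
  have hp : ProperSpace E := FiniteDimensional.proper ℂ E
  have hp' : ProperSpace (E →L[ℝ] ℝ) := FiniteDimensional.proper ℝ _
  obtain ⟨r, hr, hrsub⟩ := Metric.nhds_basis_closedBall.mem_iff.1
    ((chartAt E c).open_target.mem_nhds hy₀)
  -- Q is homogeneous of degree 2 in the covector, so it suffices to bound it below on the unit
  -- sphere, where strict positivity and compactness give a positive constant.
  set Q : (E →L[ℝ] ℝ) × E → ℝ := fun z => wedgePow (Module.finrank ℂ E) (rankOne z.1)
    (twoFormInChart κ.form (chartAt E c) z.2) (realFrame E) with hQ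
  have hcpt : IsCompact (Metric.sphere (0 : E →L[ℝ] ℝ) 1 ×ˢ Metric.closedBall y₀ r) :=
    (isCompact_sphere _ _).prod (isCompact_closedBall _ _)
  have hcont : ContinuousOn Q (Metric.sphere (0 : E →L[ℝ] ℝ) 1 ×ˢ Metric.closedBall y₀ r) := by
    simp only [hQ, wedgePow_apply hd, rankOne_apply]
    refine continuousOn_const.mul (continuousOn_finsetSum _ fun σ _ => continuousOn_const.mul
      (ContinuousOn.mul ?_ (continuousOn_finsetProd _ fun i _ => ?_)))
    · have hev : ∀ v : E, Continuous fun z : (E →L[ℝ] ℝ) × E => z.1 v := fun v =>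
        (ContinuousLinearMap.apply ℝ ℝ v).continuous.comp continuous_fst
      exact (continuous_const.mul (((hev _).mul (hev _)).sub ((hev _).mul (hev _)))).continuousOn
    · have h1 := (ContinuousAlternatingMap.apply ℝ E ℝ ![realFrame E (σ (i, 0)),
        realFrame E (σ (i, 1))]).continuous.comp_continuousOn (κ.smooth _ (chart_mem_atlas E c)).continuousOn
      exact h1.comp continuousOn_snd fun z hz => hrsub hz.2
  obtain ⟨a, ha, haQ⟩ := hcpt.exists_forall_le' hcont (a := 0) fun z hz => by
    have hz0 : z.1 ≠ 0 := fun h => by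
      have := mem_sphere_zero_iff_norm.1 hz.1
      rw [h, norm_zero] at this
      exact zero_ne_one this
    exact (wedgePow_rankOne rfl _ (κ.twoFormInChart_type _ _)
      (κ.twoFormInChart_pos (chart_mem_atlas E c) (hrsub hz.2)) z.1 (Module.finBasis ℂ E)).2 hz0
  refine ⟨a, ha, ?_⟩
  filter_upwards [Metric.closedBall_mem_nhds y₀ hr] with y hy p
  by_cases hp0 : p = 0
  · rw [hp0, norm_zero]
    simpa using κ.wedgePow_rankOne_nonneg (chart_mem_atlas E c) (hrsub hy) (0 : E →L[ℝ] ℝ)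
  · have hn : 0 < ‖p‖ := norm_pos_iff.2 hp0
    have h1 := haQ (‖p‖⁻¹ • p, y) ⟨by
      rw [mem_sphere_zero_iff_norm, norm_smul, norm_inv, norm_norm, inv_mul_cancel₀ hn.ne'], hy⟩
    have h2 : wedgePow (Module.finrank ℂ E) (rankOne p) (twoFormInChart κ.form (chartAt E c) y)
        (realFrame E) = ‖p‖ ^ 2 * Q (‖p‖⁻¹ • p, y) := by
      simp only [hQ]
      rw [rankOne_smul, wedgePow_smul hd, AlternatingMap.smul_apply, smul_eq_mul]
      field_simp
    rw [h2, mul_comm]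
    exact mul_le_mul_of_nonneg_left h1 (sq_nonneg _)

end Positivity

/-! ### The canonical section of O(D) and its regularized potential. -/

section PositiveDegree

open MeasureTheory

variable {E : Type*} [NormedAddCommGroup E] [NormedSpace ℂ E] [FiniteDimensional ℂ E]
  {X : Type*} [TopologicalSpace X] [ChartedSpace E X] [IsManifold 𝓘(ℂ, E) ω X]

/-- The form `i ∂∂̄ u` on `X`. -/
def iddbarForm (u : X → ℝ) (x : X) : (TangentSpace 𝓘(ℂ, E) x) [⋀^Fin 2]→L[ℝ] ℝ :=
  iddbar (E := E) (u ∘ (chartAt E x).symm) (chartAt E x x)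

theorem twoFormInChart_iddbarForm {u : X → ℝ}
    (hu : ∀ c : X, ∀ y ∈ (chartAt E c).target, ContDiffAt ℝ ∞ (u ∘ (chartAt E c).symm) y) (c : X)
    {y : E} (hy : y ∈ (chartAt E c).target) :
    twoFormInChart (iddbarForm u) (chartAt E c) y = iddbar (u ∘ (chartAt E c).symm) y := by
  set x := (chartAt E c).symm y with hx
  have hs : (chartAt E c).symm y ∈ (chartAt E x).source := mem_chart_source E x
  rw [iddbar_transition (chart_mem_atlas E c) (chart_mem_atlas E x) hy hs
    ((hu x _ ((chartAt E x).map_source hs)).of_le two_le_infty)]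
  exact congrArg (fun L : E →L[ℝ] E => (iddbar (u ∘ (chartAt E x).symm)
    (chartAt E x x)).compContinuousLinearMap L) (chartSymmDeriv_eq (chart_mem_atlas E c) hy)

theorem isContForm_iddbarForm {u : X → ℝ}
    (hu : ∀ c : X, ∀ y ∈ (chartAt E c).target, ContDiffAt ℝ ∞ (u ∘ (chartAt E c).symm) y)
    [CompactSpace X] [T2Space X] :
    IsContForm (E := E) (iddbarForm u) := by
  intro c y hy
  refine ((continuousAt_iddbar (hu c y hy)).congr ?_).continuousWithinAt
  filter_upwards [(chartAt E c).open_target.mem_nhds hy] with z hz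
  exact (twoFormInChart_iddbarForm hu c hz).symm

/-- The case of a single global potential and zero connection form. -/
theorem integralPow_iddbarForm [CompactSpace X] [T2Space X] (hd : 0 < Module.finrank ℂ E)
    (κ : KaehlerForm E X) {u : X → ℝ}
    (hu : ∀ c : X, ∀ y ∈ (chartAt E c).target, ContDiffAt ℝ ∞ (u ∘ (chartAt E c).symm) y) :
    integralPow (iddbarForm u) κ.form = 0 := by
  have h0 : ∀ (c : X) (y : E), holFormInChart (X := X) (fun _ => (0 : E →L[ℂ] ℂ)) (chartAt E c) y = 0 :=
    fun c y => rfl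
  refine integralPow_eq_zero_of_potentials hd κ (fun _ => u) (fun _ => Set.univ)
    (fun _ _ => (0 : E →L[ℂ] ℂ)) 1 (fun _ => isOpen_univ) (fun _ => Set.mem_univ _)
    (fun _ c y hy _ => hu c y hy) (fun _ c y hy _ => ?_) (fun _ c y _ _ => ?_)
    fun _ _ c y _ _ _ v => rfl
  · rw [one_smul]; exact twoFormInChart_iddbarForm hu c hy
  · exact contDiffAt_const (c := (0 : E →L[ℂ] ℂ))

namespace EffectiveDivisor

variable {D : EffectiveDivisor E X}

/-- If no local equation vanished anywhere, all of them would be units, and by maximality every unit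
would be one of them; this describes the zero divisor. -/
theorem exists_localEquation_eq_zero (hD : D ≠ 0) :
    ∃ (j : D.LocalEquation) (x : X), x ∈ j.1.1 ∧ j.1.2 x = 0 := by
  by_contra! hne
  refine hD ?_
  have h : D.localEq = (0 : EffectiveDivisor E X).localEq := by
    funext U f
    refine propext ⟨fun hf => ?_, fun hf => ?_⟩
    · exact ⟨D.isOpen U f hf, D.hol U f hf, fun x hx => hne ⟨(U, f), hf⟩ x hx⟩
    · refine D.maximal U f hf.1 hf.2.1 fun U' f' hf' => ?_
      have hu : UnitOn E U' f' := ⟨D.hol U' f' hf', fun x hx => hne ⟨(U', f'), hf'⟩ x hx⟩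
      exact ⟨fun x => f x / f' x, (hf.2.mono Set.inter_subset_right).div
        (hu.mono Set.inter_subset_left), fun x hx => (div_mul_cancel₀ _ (hu.2 x hx.1)).symm⟩
  cases D
  cases h
  rfl

variable (h : HermitianMetric E ℂ D.lineBundleCore.Fiber)

/-- The square norm of the canonical section of `O_X(D)`. -/
def sectionNormSq (x : X) : ℝ :=
  Complex.normSq ((D.lineBundleCore.indexAt x).1.2 x) *
    Real.exp (h.logDetIn (D.lineBundleCore.localTriv (D.lineBundleCore.indexAt x)) x)

/-- The canonical section has coordinate f_j in the trivialization belonging to f_j. Replacing f_i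
by f_j multiplies the coordinate by the transition unit, which the change of `logDetIn` compensates.
-/
theorem sectionNormSq_eq (j : D.LocalEquation) {x : X} (hx : x ∈ j.1.1) :
    sectionNormSq h x =
      Complex.normSq (j.1.2 x) * Real.exp (h.logDetIn (D.lineBundleCore.localTriv j) x) := by
  set i := D.lineBundleCore.indexAt x with hi
  have hxi : x ∈ i.1.1 := D.lineBundleCore.mem_baseSet_at x
  have hr := D.ratio_mul i j ⟨hxi, hx⟩
  have hc := h.logDetIn_change (D.lineBundleCore.localTriv i) (D.lineBundleCore.localTriv j) hxi hx
  rw [coordDet_lineBundle D i j hxi hx] at hc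
  rw [sectionNormSq, ← hi, hc, hr, map_mul, Real.exp_add,
    Real.exp_log (Complex.normSq_pos.2 ((D.ratio_unit i j).2 x ⟨hxi, hx⟩))]
  ring

theorem sectionNormSq_nonneg (x : X) : 0 ≤ sectionNormSq h x :=
  mul_nonneg (Complex.normSq_nonneg _) (Real.exp_pos _).le

theorem contDiffAt_localEquation (j : D.LocalEquation) (c : X) {y : E}
    (hy : y ∈ (chartAt E c).target) (hyj : (chartAt E c).symm y ∈ j.1.1) :
    ContDiffAt ℂ ω (j.1.2 ∘ (chartAt E c).symm) y :=
  contDiffAt_comp_symm_complex (chart_mem_atlas E c) hy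
    (ContMDiffOn.contMDiffAt (D.hol _ _ j.2) ((D.isOpen _ _ j.2).mem_nhds hyj))

theorem contDiffAt_potential (j : D.LocalEquation) (c : X) {y : E}
    (hy : y ∈ (chartAt E c).target) (hyj : (chartAt E c).symm y ∈ j.1.1) :
    ContDiffAt ℝ ∞ (h.logDetIn (D.lineBundleCore.localTriv j) ∘ (chartAt E c).symm) y :=
  h.contDiffAt_logDetIn (D.lineBundleCore.localTriv j) (chart_mem_atlas E c) hy hyj

theorem sectionNormSq_eventuallyEq (j : D.LocalEquation) (c : X) {y : E}
    (hy : y ∈ (chartAt E c).target) (hyj : (chartAt E c).symm y ∈ j.1.1) :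
    sectionNormSq h ∘ (chartAt E c).symm =ᶠ[𝓝 y] fun z =>
      Complex.normSq ((j.1.2 ∘ (chartAt E c).symm) z) *
        Real.exp ((h.logDetIn (D.lineBundleCore.localTriv j) ∘ (chartAt E c).symm) z) := by
  filter_upwards [eventually_symm_mem hy (D.isOpen _ _ j.2) hyj] with z hz
  exact sectionNormSq_eq h j hz.2

theorem contDiffAt_sectionNormSq (c : X) {y : E} (hy : y ∈ (chartAt E c).target) :
    ContDiffAt ℝ ∞ (sectionNormSq h ∘ (chartAt E c).symm) y := by
  set j := D.lineBundleCore.indexAt ((chartAt E c).symm y)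
  have hyj : (chartAt E c).symm y ∈ j.1.1 := D.lineBundleCore.mem_baseSet_at _
  have hf : ContDiffAt ℝ ∞ (j.1.2 ∘ (chartAt E c).symm) y :=
    contDiffAt_real ((contDiffAt_localEquation j c hy hyj).of_le le_top)
  have hre := Complex.reCLM.contDiff.contDiffAt.comp y hf
  have him := Complex.imCLM.contDiff.contDiffAt.comp y hf
  refine ContDiffAt.congr_of_eventuallyEq ?_ (sectionNormSq_eventuallyEq h j c hy hyj)
  exact ((hre.mul hre).add (him.mul him)).mul (contDiffAt_potential h j c hy hyj).exp

theorem continuous_sectionNormSq : Continuous (sectionNormSq h) := by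
  refine continuous_iff_continuousAt.2 fun x => ?_
  have h1 := (contDiffAt_sectionNormSq h x (mem_chart_target E x)).continuousAt
  have h2 : ContinuousAt ((sectionNormSq h ∘ (chartAt E x).symm) ∘ chartAt E x) x :=
    h1.comp ((chartAt E x).continuousAt (mem_chart_source E x))
  refine h2.congr ?_
  filter_upwards [(chartAt E x).open_source.mem_nhds (mem_chart_source E x)] with z hz
  simp [(chartAt E x).left_inv hz]

theorem contDiffAt_log_sectionNormSq_add {ε : ℝ} (hε : 0 < ε) (c : X) {y : E}
    (hy : y ∈ (chartAt E c).target) :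
    ContDiffAt ℝ ∞ (fun z => Real.log (sectionNormSq h ((chartAt E c).symm z) + ε)) y :=
  ((contDiffAt_sectionNormSq h c hy).add contDiffAt_const).log
    (add_pos_of_nonneg_of_pos (sectionNormSq_nonneg h _) hε).ne'

theorem contDiffAt_regPotential_sectionNormSq {ε : ℝ} (hε : 0 < ε) (c : X) (y : E)
    (hy : y ∈ (chartAt E c).target) :
    ContDiffAt ℝ ∞ ((fun x => regPotential ε (sectionNormSq h x)) ∘ (chartAt E c).symm) y := by
  have h1 := contDiffAt_log_sectionNormSq_add h hε c hy
  exact h1.add ((h1.pow 2).div_const _)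

/-- The form `χ' c₁`, where `χ'` is the regularized weight. -/
def weightedChernForm (ε : ℝ) (x : X) : (TangentSpace 𝓘(ℂ, E) x) [⋀^Fin 2]→L[ℝ] ℝ :=
  regWeight ε (sectionNormSq h x) • h.chernForm x

theorem continuous_regWeight_sectionNormSq {ε : ℝ} (hε : 0 < ε) :
    Continuous fun x => regWeight ε (sectionNormSq h x) := by
  have h1 : Continuous fun x => sectionNormSq h x + ε :=
    (continuous_sectionNormSq h).add continuous_const
  have h2 : ∀ x, sectionNormSq h x + ε ≠ 0 := fun x =>
    (add_pos_of_nonneg_of_pos (sectionNormSq_nonneg h x) hε).ne'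
  exact (continuous_const.add ((h1.log h2).div_const _)).mul ((continuous_sectionNormSq h).div h1 h2)

theorem isContForm_weightedChernForm [CompactSpace X] [T2Space X] {ε : ℝ} (hε : 0 < ε) :
    IsContForm (weightedChernForm h ε) := fun c =>
  (((continuous_regWeight_sectionNormSq h hε).comp_continuousOn
    (chartAt E c).continuousOn_symm).smul (h.isContForm_chernForm c) :)

/-- Off the divisor, the density of `i ∂∂̄ G + 2 π χ' c₁` is bounded below by an energy density. -/
theorem chartDensity_regularized_ge (hd : 0 < Module.finrank ℂ E) (κ : KaehlerForm E X) {ε : ℝ}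
    (hε : 0 < ε) (hε1 : ε < 1) (c : X) {y : E} (hy : y ∈ (chartAt E c).target)
    (h0 : sectionNormSq h ((chartAt E c).symm y) ≠ 0) :
    (1 / -Real.log ε) * wedgePow (Module.finrank ℂ E) (rankOne (fderiv ℝ (fun z =>
        Real.log (sectionNormSq h ((chartAt E c).symm z) + ε)) y))
        (twoFormInChart κ.form (chartAt E c) y) (realFrame E) ≤
      chartDensity (fun x => iddbarForm (fun x => regPotential ε (sectionNormSq h x)) x +
        (2 * Real.pi) • weightedChernForm h ε x) κ.form (chartAt E c) y := by
  set j := D.lineBundleCore.indexAt ((chartAt E c).symm y)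
  have hyj : (chartAt E c).symm y ∈ j.1.1 := D.lineBundleCore.mem_baseSet_at _
  have hev := sectionNormSq_eventuallyEq h j c hy hyj
  have hf0 : (j.1.2 ∘ (chartAt E c).symm) y ≠ 0 := fun h1 => h0 (by
    have h2 := hev.eq_of_nhds
    simp only [h1, map_zero, zero_mul] at h2
    exact h2)
  obtain ⟨s, hs, hI⟩ := iddbar_regPotential hε hε1
    ((contDiffAt_localEquation j c hy hyj).of_le le_top)
    ((contDiffAt_potential h j c hy hyj).of_le two_le_infty) hf0
  set w := fun z => Real.log (Complex.normSq ((j.1.2 ∘ (chartAt E c).symm) z)) +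
    (h.logDetIn (D.lineBundleCore.localTriv j) ∘ (chartAt E c).symm) z
  have h1 : iddbar ((fun x => regPotential ε (sectionNormSq h x)) ∘ (chartAt E c).symm) y =
      iddbar (fun z => regPotential ε (Complex.normSq ((j.1.2 ∘ (chartAt E c).symm) z) *
        Real.exp ((h.logDetIn (D.lineBundleCore.localTriv j) ∘ (chartAt E c).symm) z))) y :=
    iddbar_congr (hev.fun_comp (regPotential ε))
  have h2 : fderiv ℝ (fun z => Real.log (sectionNormSq h ((chartAt E c).symm z) + ε)) y =
      fderiv ℝ (fun z => Real.log (Complex.normSq ((j.1.2 ∘ (chartAt E c).symm) z) *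
        Real.exp ((h.logDetIn (D.lineBundleCore.localTriv j) ∘ (chartAt E c).symm) z) + ε)) y :=
    (hev.fun_comp fun t => Real.log (t + ε)).fderiv_eq
  have h3 : regWeight ε (sectionNormSq h ((chartAt E c).symm y)) =
      regWeight ε (Complex.normSq ((j.1.2 ∘ (chartAt E c).symm) y) *
        Real.exp ((h.logDetIn (D.lineBundleCore.localTriv j) ∘ (chartAt E c).symm) y)) :=
    congrArg (regWeight ε) hev.eq_of_nhds
  -- The Chern form is -1/(2π) times i∂∂̄ of the potential, so 2π χ' c₁ cancels the term χ' i∂∂̄φ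
  -- and only rank one forms remain.
  have h4 : twoFormInChart (fun x => iddbarForm (fun x => regPotential ε (sectionNormSq h x)) x +
        (2 * Real.pi) • weightedChernForm h ε x) (chartAt E c) y =
      (1 / -Real.log ε) • rankOne (fderiv ℝ (fun z =>
        Real.log (sectionNormSq h ((chartAt E c).symm z) + ε)) y) + s • rankOne (fderiv ℝ w y) := by
    have e1 : twoFormInChart (fun x => iddbarForm (fun x => regPotential ε (sectionNormSq h x)) x +
        (2 * Real.pi) • weightedChernForm h ε x) (chartAt E c) y =
      twoFormInChart (iddbarForm (fun x => regPotential ε (sectionNormSq h x))) (chartAt E c) y +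
        (2 * Real.pi) • regWeight ε (sectionNormSq h ((chartAt E c).symm y)) •
          twoFormInChart h.chernForm (chartAt E c) y := rfl
    rw [e1, twoFormInChart_iddbarForm
      (fun c y hy => contDiffAt_regPotential_sectionNormSq h hε c y hy) c hy, h1, hI, h2, h3,
      h.twoFormInChart_chernForm (D.lineBundleCore.localTriv j) (chart_mem_atlas E c) hy hyj]
    ext v
    simp only [ContinuousAlternatingMap.add_apply, ContinuousAlternatingMap.smul_apply, smul_eq_mul]
    field_simp
    ring
  rw [chartDensity, h4, wedgePow_add hd, wedgePow_smul hd, wedgePow_smul hd]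
  have h5 := κ.wedgePow_rankOne_nonneg (chart_mem_atlas E c) hy (fderiv ℝ w y)
  simp only [AlternatingMap.add_apply, AlternatingMap.smul_apply, smul_eq_mul]
  nlinarith [mul_nonneg hs h5]

/-- The domain of a local equation in a chart. -/
def chartDomain (j : D.LocalEquation) (c : X) : Set E :=
  (chartAt E c).target ∩ (chartAt E c).symm ⁻¹' j.1.1

theorem isOpen_chartDomain (j : D.LocalEquation) (c : X) : IsOpen (chartDomain j c) :=
  (chartAt E c).isOpen_inter_preimage_symm (D.isOpen _ _ j.2)

theorem analyticOnNhd_localEquation (j : D.LocalEquation) (c : X) :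
    AnalyticOnNhd ℂ (j.1.2 ∘ (chartAt E c).symm) (chartDomain j c) := fun _ hy =>
  (contDiffAt_localEquation j c hy.1 hy.2).analyticAt

/-- A local equation vanishes identically on no nonempty open subset of X, and the chart carries
small open sets of E back to X. -/
theorem frequently_localEquation_ne_zero (j : D.LocalEquation) (c : X) {y : E}
    (hy : y ∈ chartDomain j c) : ∃ᶠ z in 𝓝 y, (j.1.2 ∘ (chartAt E c).symm) z ≠ 0 := by
  intro hev
  obtain ⟨O, hO, hOo, hyO⟩ := mem_nhds_iff.1
    (Filter.inter_mem hev ((isOpen_chartDomain j c).mem_nhds hy))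
  have hW := (chartAt E c).isOpen_inter_preimage hOo
  have hWj : (chartAt E c).source ∩ chartAt E c ⁻¹' O ⊆ j.1.1 := fun x hx => by
    have h1 := (hO hx.2).2.2
    rwa [Set.mem_preimage, (chartAt E c).left_inv hx.1] at h1
  obtain ⟨x, hx, hx0⟩ := D.nonzero _ _ j.2 _ hWj hW
    ⟨(chartAt E c).symm y, (chartAt E c).map_target hy.1, by
      rw [Set.mem_preimage, (chartAt E c).right_inv hy.1]; exact hyO⟩
  refine (hO hx.2).1 (?_ : j.1.2 ((chartAt E c).symm (chartAt E c x)) ≠ 0)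
  rwa [(chartAt E c).left_inv hx.1]

/-- The support of a divisor is null in every chart. -/
theorem null_sectionNormSq_eq_zero (c : X) :
    volume {t | realCoord E t ∈ (chartAt E c).target ∧
      sectionNormSq h ((chartAt E c).symm (realCoord E t)) = 0} = 0 := by
  refine measure_null_of_locally_null _ fun t ht => ?_
  set y := realCoord E t with hyt
  have hy : y ∈ (chartAt E c).target := ht.1
  set j := D.lineBundleCore.indexAt ((chartAt E c).symm y)
  have hyj : y ∈ chartDomain j c := ⟨hy, D.lineBundleCore.mem_baseSet_at _⟩
  obtain ⟨O, hO, hO0⟩ := exists_nhds_null_zeros (isOpen_chartDomain j c)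
    (analyticOnNhd_localEquation j c) hyj (frequently_localEquation_ne_zero j c hyj)
  have ht' : (realCoordCLE E).symm y = t := by
    rw [hyt, ← realCoordCLE_apply, ContinuousLinearEquiv.symm_apply_apply]
  rw [ht'] at hO
  refine ⟨_, ?_, hO0⟩
  filter_upwards [self_mem_nhdsWithin, mem_nhdsWithin_of_mem_nhds hO, mem_nhdsWithin_of_mem_nhds
    ((isOpen_realCoord_preimage E (isOpen_chartDomain j c)).mem_nhds hyj)] with s h1 h2 h3
  refine ⟨⟨h3, ?_⟩, h2⟩
  have h4 := h1.2
  rw [sectionNormSq_eq h j h3.2] at h4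
  exact Complex.normSq_eq_zero.1 ((mul_eq_zero.1 h4).resolve_right (Real.exp_pos _).ne')

end EffectiveDivisor

end PositiveDegree

/-! ### Nonzero effective divisors have positive degree. -/

section DegreePositivity

open MeasureTheory

variable {E : Type*} [NormedAddCommGroup E] [NormedSpace ℂ E] [FiniteDimensional ℂ E]
  {X : Type*} [TopologicalSpace X] [ChartedSpace E X] [IsManifold 𝓘(ℂ, E) ω X]
  [CompactSpace X] [T2Space X]

namespace EffectiveDivisor

variable {D : EffectiveDivisor E X} (h : HermitianMetric E ℂ D.lineBundleCore.Fiber)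

theorem ae_sectionNormSq_ne_zero (c : X) :
    ∀ᵐ t ∂volume.restrict (realCoord E ⁻¹' (chartAt E c).target),
      realCoord E t ∈ (chartAt E c).target ∧
        sectionNormSq h ((chartAt E c).symm (realCoord E t)) ≠ 0 := by
  refine (ae_restrict_iff' (isOpen_realCoord_preimage E (chartAt E c).open_target).measurableSet).2 ?_
  refine measure_mono_null (fun t ht => ?_) (null_sectionNormSq_eq_zero h c)
  by_contra hne
  exact ht fun h1 => ⟨h1, fun h2 => hne ⟨h1, h2⟩⟩

theorem chartDensity_weightedChernForm (hd : 0 < Module.finrank ℂ E) (κ : KaehlerForm E X) (ε : ℝ)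
    (c : X) (y : E) : chartDensity (weightedChernForm h ε) κ.form (chartAt E c) y =
      regWeight ε (sectionNormSq h ((chartAt E c).symm y)) *
        chartDensity h.chernForm κ.form (chartAt E c) y :=
  DFunLike.congr_fun (wedgePow_smul hd (regWeight ε (sectionNormSq h ((chartAt E c).symm y)))
    (twoFormInChart h.chernForm (chartAt E c) y) (twoFormInChart κ.form (chartAt E c) y)) (realFrame E)

/-- Dominated convergence: for small ε the weights are uniformly bounded, and they tend to 1 off the
divisor, whose support is null. -/
theorem tendsto_integralPow_weightedChernForm (hd : 0 < Module.finrank ℂ E) (κ : KaehlerForm E X) :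
    Filter.Tendsto (fun ε => integralPow (weightedChernForm h ε) κ.form) (𝓝[>] (0 : ℝ))
      (𝓝 (integralPow h.chernForm κ.form)) := by
  obtain ⟨C, hC⟩ := (isCompact_range (continuous_sectionNormSq h)).bddAbove
  have hL : Filter.Tendsto (fun ε => -Real.log ε) (𝓝[>] (0 : ℝ)) Filter.atTop :=
    Filter.tendsto_neg_atBot_atTop.comp Real.tendsto_log_nhdsGT_zero
  simp only [integralPow_eq_sum]
  refine tendsto_finsetSum _ fun c _ => ?_
  have hi := integrableOn_partition_mul c (continuousOn_chartDensity
    h.isContForm_chernForm κ.isContForm c)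
  refine tendsto_integral_filter_of_dominated_convergence (fun t =>
    (1 + |Real.log (C + 1)|) * ‖chartPartition E X c ((chartAt E c).symm (realCoord E t)) *
      chartDensity h.chernForm κ.form (chartAt E c) (realCoord E t)‖) ?_ ?_ (hi.norm.const_mul _) ?_
  · filter_upwards [self_mem_nhdsWithin] with ε hε
    exact (integrableOn_partition_mul c (continuousOn_chartDensity
      (isContForm_weightedChernForm h hε) κ.isContForm c)).aestronglyMeasurable
  · filter_upwards [self_mem_nhdsWithin, hL.eventually_ge_atTop 1] with ε hε hε1
    have hε0 : 0 < ε := hε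
    have hεlt : ε < 1 := by
      by_contra! h1
      linarith [Real.log_nonneg h1]
    refine Filter.Eventually.of_forall fun t => ?_
    have hN := sectionNormSq_nonneg h ((chartAt E c).symm (realCoord E t))
    have h1 := regWeight_nonneg hε0 hεlt hN
    have h2 := regWeight_le hε0 hε1 hN (hC ⟨_, rfl⟩)
    rw [chartDensity_weightedChernForm h hd, mul_left_comm, norm_mul, Real.norm_of_nonneg h1]
    exact mul_le_mul_of_nonneg_right h2 (norm_nonneg _)
  · filter_upwards [ae_sectionNormSq_ne_zero h c] with t ht
    have hN := (sectionNormSq_nonneg h ((chartAt E c).symm (realCoord E t))).lt_of_ne' ht.2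
    have h1 := ((tendsto_regWeight hN).mul_const
      (chartDensity h.chernForm κ.form (chartAt E c) (realCoord E t))).const_mul
      (chartPartition E X c ((chartAt E c).symm (realCoord E t)))
    rw [one_mul] at h1
    simpa only [chartDensity_weightedChernForm h hd] using h1

/-- The term i∂∂̄G integrates to zero, so the right side is the integral of a form that is at least
1/L times an energy density. Near a zero of the section the energy is at least a multiple of L; the
powers of L cancel, and the bound is independent of ε. -/
theorem exists_integralPow_weightedChernForm_ge (hD : D ≠ 0) (hd : 0 < Module.finrank ℂ E)
    (κ : KaehlerForm E X) : ∃ b > 0, ∀ᶠ ε in 𝓝[>] (0 : ℝ),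
      b ≤ 2 * Real.pi * integralPow (weightedChernForm h ε) κ.form := by
  obtain ⟨j, x₀, hxj, hx0⟩ := exists_localEquation_eq_zero hD
  -- One chart whose partition function is positive at the zero suffices, because the other terms of
  -- the sum are nonnegative.
  obtain ⟨c, hc, hcx⟩ : ∃ c ∈ chartIndices E X, chartPartition E X c x₀ ≠ 0 := by
    by_contra! hne
    have := sum_chartPartition (E := E) x₀
    rw [Finset.sum_eq_zero hne] at this
    exact zero_ne_one this
  set r₀ := chartPartition E X c x₀ with hr₀
  have hr₀pos : 0 < r₀ := ((chartPartition E X).nonneg c x₀).lt_of_ne' hcx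
  have hxc : x₀ ∈ (chartAt E c).source := chartPartition_subordinate E X c (subset_tsupport _ hcx)
  set y₀ := chartAt E c x₀ with hy₀d
  have hy₀ : y₀ ∈ (chartAt E c).target := (chartAt E c).map_source hxc
  have hsx : (chartAt E c).symm y₀ = x₀ := (chartAt E c).left_inv hxc
  have hy₀j : y₀ ∈ chartDomain j c := ⟨hy₀, by rw [Set.mem_preimage, hsx]; exact hxj⟩
  obtain ⟨a, ha, haE⟩ := κ.exists_wedgePow_rankOne_ge hd c hy₀
  have hρ : ∀ᶠ y in 𝓝 y₀, r₀ / 2 < chartPartition E X c ((chartAt E c).symm y) := by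
    have h1 := (contDiffOn_chartPartition c (chart_mem_atlas E c)).continuousOn.continuousAt
      ((chartAt E c).open_target.mem_nhds hy₀)
    refine h1.eventually (lt_mem_nhds ?_)
    change r₀ / 2 < chartPartition E X c ((chartAt E c).symm y₀)
    rw [hsx]
    linarith
  obtain ⟨V, hV, hVo, hyV⟩ := mem_nhds_iff.1
    ((haE.and hρ).and ((isOpen_chartDomain j c).mem_nhds hy₀j))
  obtain ⟨b, hb, hbE⟩ := exists_energy_lower_bound (isOpen_chartDomain j c)
    (analyticOnNhd_localEquation j c)
    (φ := h.logDetIn (D.lineBundleCore.localTriv j) ∘ (chartAt E c).symm)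
    (fun y hy => ((contDiffAt_potential h j c hy.1 hy.2).of_le (by
      exact_mod_cast le_top)).contDiffWithinAt) hy₀j
    (show j.1.2 ((chartAt E c).symm y₀) = 0 by rw [hsx]; exact hx0)
    (frequently_localEquation_ne_zero j c hy₀j) hVo hyV
  -- Here r₀ / 2 bounds the partition function on V, a compares the Kähler density with the norm of
  -- the differential, and b is the energy constant.
  refine ⟨r₀ / 2 * a * b, by positivity, ?_⟩
  filter_upwards [hbE, self_mem_nhdsWithin, Ioo_mem_nhdsGT (one_pos : (0 : ℝ) < 1)]
    with ε hεb hε hε1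
  have hε0 : 0 < ε := hε
  have hεlt : ε < 1 := hε1.2
  have hL : 0 < -Real.log ε := neg_pos.2 (Real.log_neg hε0 hεlt)
  set τ : ∀ x : X, (TangentSpace 𝓘(ℂ, E) x) [⋀^Fin 2]→L[ℝ] ℝ := fun x =>
    iddbarForm (fun x => regPotential ε (sectionNormSq h x)) x +
      (2 * Real.pi) • weightedChernForm h ε x with hτ
  have hG := fun c y hy => contDiffAt_regPotential_sectionNormSq h hε0 c y hy
  have hG' : IsContForm (iddbarForm (E := E) (fun x => regPotential ε (sectionNormSq h x))) :=
    isContForm_iddbarForm hG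
  have hw := isContForm_weightedChernForm h hε0
  have hτc : IsContForm τ := hG'.add (hw.smul _)
  have hint : integralPow τ κ.form = 2 * Real.pi * integralPow (weightedChernForm h ε) κ.form := by
    rw [hτ, integralPow_add hd hG' (hw.smul _) κ.isContForm, integralPow_smul hd,
      integralPow_iddbarForm hd κ hG, zero_add]
  rw [← hint, integralPow_eq_sum]
  have hi := fun b : X => integrableOn_partition_mul b
    (continuousOn_chartDensity hτc κ.isContForm b)
  have hnn : ∀ b : X, ∀ᵐ t ∂volume.restrict (realCoord E ⁻¹' (chartAt E b).target),
      0 ≤ chartPartition E X b ((chartAt E b).symm (realCoord E t)) *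
        chartDensity τ κ.form (chartAt E b) (realCoord E t) := fun b => by
    filter_upwards [ae_sectionNormSq_ne_zero h b] with t ht
    refine mul_nonneg ((chartPartition E X).nonneg b _) ?_
    refine le_trans ?_ (chartDensity_regularized_ge h hd κ hε0 hεlt b ht.1 ht.2)
    exact mul_nonneg (by positivity) (κ.wedgePow_rankOne_nonneg (chart_mem_atlas E b) ht.1 _)
  refine le_trans ?_ (Finset.single_le_sum (f := fun b => ∫ t in realCoord E ⁻¹' (chartAt E b).target,
    chartPartition E X b ((chartAt E b).symm (realCoord E t)) *
      chartDensity τ κ.form (chartAt E b) (realCoord E t))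
    (fun b _ => setIntegral_nonneg_of_ae_restrict (hnn b)) hc)
  have hsub : realCoord E ⁻¹' V ⊆ realCoord E ⁻¹' (chartAt E c).target := fun t ht => (hV ht).2.1
  refine le_trans ?_ (setIntegral_mono_set (hi c) (hnn c) hsub.eventuallyLE)
  have hnnV := ae_restrict_of_ae_restrict_of_subset hsub (hnn c)
  have hiV := (hi c).mono_set hsub
  -- The energy bound is an estimate of a `lintegral`, so the comparison is made in the extended
  -- nonnegative reals.
  rw [← ENNReal.ofReal_le_ofReal_iff (setIntegral_nonneg_of_ae_restrict hnnV),
    ofReal_integral_eq_lintegral_ofReal hiV hnnV]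
  have hVm := (isOpen_realCoord_preimage E hVo).measurableSet
  have e1 : ENNReal.ofReal (r₀ / 2 * a * b) = ENNReal.ofReal (r₀ / 2 * a * (1 / -Real.log ε)) *
      ENNReal.ofReal (b * -Real.log ε) := by
    rw [← ENNReal.ofReal_mul (by positivity)]
    congr 1
    have hne : Real.log ε ≠ 0 := (neg_pos.1 hL).ne
    field_simp
  rw [e1]
  refine (mul_le_mul_right hεb _).trans ?_
  rw [← lintegral_const_mul' _ _ ENNReal.ofReal_ne_top]
  refine lintegral_mono_ae ?_
  filter_upwards [ae_restrict_of_ae_restrict_of_subset hsub (ae_sectionNormSq_ne_zero h c),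
    ae_restrict_mem hVm] with t ht htV
  rw [← ENNReal.ofReal_mul (by positivity)]
  refine ENNReal.ofReal_le_ofReal ?_
  set y := realCoord E t with hy
  obtain ⟨⟨h1, h2⟩, h3⟩ := hV htV
  have h4 : fderiv ℝ (fun y => Real.log (Complex.normSq ((j.1.2 ∘ (chartAt E c).symm) y) *
      Real.exp ((h.logDetIn (D.lineBundleCore.localTriv j) ∘ (chartAt E c).symm) y) + ε)) y =
      fderiv ℝ (fun z => Real.log (sectionNormSq h ((chartAt E c).symm z) + ε)) y :=
    ((sectionNormSq_eventuallyEq h j c h3.1 h3.2).fun_comp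
      fun t => Real.log (t + ε)).fderiv_eq.symm
  have h5 := chartDensity_regularized_ge h hd κ hε0 hεlt c ht.1 ht.2
  have h6 := h1 (fderiv ℝ (fun z => Real.log (sectionNormSq h ((chartAt E c).symm z) + ε)) y)
  rw [h4]
  set p := ‖fderiv ℝ (fun z => Real.log (sectionNormSq h ((chartAt E c).symm z) + ε)) y‖ ^ 2
  have h7 : (1 / -Real.log ε) * (a * p) ≤ chartDensity τ κ.form (chartAt E c) y :=
    (mul_le_mul_of_nonneg_left h6 (by positivity)).trans h5
  calc r₀ / 2 * a * (1 / -Real.log ε) * p = r₀ / 2 * ((1 / -Real.log ε) * (a * p)) := by ring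
    _ ≤ chartPartition E X c ((chartAt E c).symm y) * chartDensity τ κ.form (chartAt E c) y :=
      mul_le_mul h2.le h7 (by positivity) ((chartPartition E X).nonneg c _)

/-- A nonzero effective divisor on a compact Kähler manifold has positive degree. -/
theorem degree_pos (hd : 0 < Module.finrank ℂ E) (κ : KaehlerForm E X) (hD : D ≠ 0) :
    0 < D.degree κ := by
  let h := Classical.choice (HermitianMetric.nonempty E ℂ D.lineBundleCore.Fiber)
  obtain ⟨b, hb, hbE⟩ := exists_integralPow_weightedChernForm_ge h hD hd κ
  -- The constant b does not depend on ε, so the bound survives the limit.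
  have h1 := ge_of_tendsto ((tendsto_integralPow_weightedChernForm h hd κ).const_mul (2 * Real.pi)) hbE
  have h2 : D.degree κ = integralPow h.chernForm κ.form := rfl
  rw [h2]
  exact pos_of_mul_pos_right (hb.trans_le h1) (by positivity)

end EffectiveDivisor

end DegreePositivity

end BranchedCartan
end

/-! ### The nonexistence statements. -/

theorem proposition4p1
    -- a compact connected Kähler manifold `X` of positive dimension with Kähler form `κ`
    {E : Type*} [NormedAddCommGroup E] [NormedSpace ℂ E] [FiniteDimensional ℂ E]
    (hd : 0 < Module.finrank ℂ E)
    {X : Type*} [TopologicalSpace X] [ChartedSpace E X] [IsManifold 𝓘(ℂ, E) ω X]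
    [CompactSpace X] [ConnectedSpace X] [T2Space X] (κ : BranchedCartan.KaehlerForm E X)
    -- a connected complex Lie group `G` and a connected complex Lie subgroup `H`
    {𝔤 : Type*} [NormedAddCommGroup 𝔤] [NormedSpace ℂ 𝔤] [FiniteDimensional ℂ 𝔤]
    {G : Type*} [TopologicalSpace G] [ChartedSpace 𝔤 G] [Group G] [LieGroup 𝓘(ℂ, 𝔤) ω G]
    [ConnectedSpace G]
    {𝔥 : Type*} [NormedAddCommGroup 𝔥] [NormedSpace ℂ 𝔥] [FiniteDimensional ℂ 𝔥]
    {H : Type*} [TopologicalSpace H] [ChartedSpace 𝔥 H] [Group H] [LieGroup 𝓘(ℂ, 𝔥) ω H]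
    [ConnectedSpace H] (ι : BranchedCartan.LieSubgroup 𝔤 G 𝔥 H)
    -- a holomorphic principal `H`-bundle `B` on `X`, with total space `P`
    {𝔭 : Type*} [NormedAddCommGroup 𝔭] [NormedSpace ℂ 𝔭]
    {P : Type*} [TopologicalSpace P] [ChartedSpace 𝔭 P] [IsManifold 𝓘(ℂ, 𝔭) ω P]
    (B : BranchedCartan.PrincipalBundle E X 𝔥 H 𝔭 P)
    -- an effective divisor `D` on `X`
    (D : BranchedCartan.EffectiveDivisor E X) :
    (BranchedCartan.degree κ (E →L[ℂ] ℂ) (BranchedCartan.Cotangent E X) - D.degree κ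
        ≠ BranchedCartan.degree κ 𝔥 B.AdH →
      ¬ ∃ Θ : BranchedCartan.BranchedCartanGeometry ι B, Θ.IsBranchingDivisor D) ∧
    (D ≠ 0 →
      BranchedCartan.degree κ (E →L[ℂ] ℂ) (BranchedCartan.Cotangent E X)
        ≤ BranchedCartan.degree κ 𝔥 B.AdH →
      ¬ ∃ Θ : BranchedCartan.BranchedCartanGeometry ι B, Θ.IsBranchingDivisor D) := by
  refine ⟨fun hne => ?_, fun hD hle => ?_⟩
  · rintro ⟨Θ, hΘ⟩
    exact hne (BranchedCartan.degree_eq_of_isBranchingDivisor Θ hd κ hΘ)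
  · rintro ⟨Θ, hΘ⟩
    have h1 := BranchedCartan.degree_eq_of_isBranchingDivisor Θ hd κ hΘ
    have h2 := BranchedCartan.EffectiveDivisor.degree_pos hd κ hD
    -- With degree(D) > 0 the relation makes degree(Ω¹) strictly larger than degree(ad(E_H)),
    -- contrary to the hypothesis.
    linarith
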